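/- **Setting.** Let $M$ be an oriented connected 3-manifold that is the interior of a compact 3-manifold with non-empty boundary $\partial M$ a union of $r$ tori, and let $\mathcal T$ be an (oriented) ideal triangulation of $M$ with tetrahedra $T_1,\dots,T_N$, hence with $N$ edges. Each tetrahedron $T_j$ has three normal quadrilateral types $q_j\to q_j'\to q_j''\to q_j$ (cyclically ordered by the orientation), each facing a pair of opposite edges. Let $\bar a_{ij},\bar b_{ij},\bar c_{ij}$ be the number of edges of $T_j$ facing $q_j,q_j',q_j''$, respectively, that are equal to the $i$-th edge of $\mathcal T$. A *generalised angle structure* is a function $\alpha:\{\text{quadrilateral types}\}\to\mathbb R$ with $\alpha(q_j)+\alpha(q_j')+\alpha(q_j'')=\pi$ for all $j$ and $\sum_j(\bar a_{ij}\alpha(q_j)+\bar b_{ij}\alpha(q'_j)+\bar c_{ij}\alpha(q''_j))=2\pi$ for all $i$. An *index structure* on $\mathcal T$ is a family of generalised angle structures $\alpha_Q$, one for each choice $Q=(Q_1,\dots,Q_N)$ of a quadrilateral type in each tetrahedron, with $\alpha_Q(Q_j)>0$ for all $j$. The *tetrahedron index* is $$I_\Delta(m,e)=\sum_{n\ge\max(0,-e)}(-1)^n\frac{q^{\frac12n(n+1)-(n+\frac12e)m}}{(q)_n(q)_{n+e}}\in\mathbb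 Z((q^{1/2})),\qquad (q)_n=\prod_{i=1}^n(1-q^i).$$ Let $\varpi$ be an oriented multi-curve on $\partial M$ (a disjoint union of oriented simple closed curves) in normal position with respect to the induced triangulation of $\partial M$, no component of which is null-homologous in $\partial M$. Let $\bar a_{\varpi,j},\bar b_{\varpi,j},\bar c_{\varpi,j}$ be the signed number of times that $\varpi$ turns anticlockwise around those corners of the four triangular ends of the truncated tetrahedron $T_j$ that lie on edges facing $q_j,q'_j,q''_j$, respectively. Choose for each $j$ which quadrilateral type is called $q_j'$ (respecting the cyclic order), and put $a_{ij}=\bar a_{ij}-\bar b_{ij}$, $b_{ij}=\bar c_{ij}-\bar b_{ij}$, $\nu_i=2-\sum_j\bar b_{ij}$, and likewise $a_{\varpi,j}=\bar a_{\varpi,j}-\bar b_{\varpi,j}$, $b_{\varpi,j}=\bar c_{\varpi,j}-\bar b_{\varpi,j}$, $\nu_\varpi=-\sum_j\bar b_{\varpi,j}$. Choose a set $\mathcal B$ of edges of $\mathcal T$ such that the rows of the matrix $((a_{ij})\mid(b_{ij}))$ indexed by $\mathcal B$ form a $\mathbb Z$-basis of the $\mathbb Z$-span of all its rows. The *index*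 of $\mathcal T$ at $[\varpi]\in H_1(\partial M;\mathbb Z)$ is $$I_{\mathcal T}([\varpi])=\sum_{k\in\mathbb Z^{\mathcal B}}(-q^{1/2})^{\sum_i k_i\nu_i+\nu_\varpi}\prod_{j=1}^N I_\Delta\Big(-b_{\varpi,j}-\sum_i k_ib_{ij},\;a_{\varpi,j}+\sum_i k_ia_{ij}\Big)\in\mathbb Z((q^{1/2})),$$ provided that this sum converges $q$-adically. **Theorem.** Let $\mathcal T$ and $\widetilde{\mathcal T}$ be ideal triangulations of $M$ related by a 2–3 move (two distinct tetrahedra of $\mathcal T$ sharing a face are replaced by three tetrahedra around a new edge joining the two vertices opposite that face), and suppose that both admit an index structure. Then both indices converge, and $$I_{\mathcal T}([\varpi])=I_{\widetilde{\mathcal T}}([\varpi])\qquad\text{for all }[\varpi]\in H_1(\partial M;\mathbb Z).$$ This holds for all choices made in the definition: the two sides may be computed with any oriented multi-curves as above, normal with respect to $\mathcal T$ and $\widetilde{\mathcal T}$ respectively, that represent the same class in $H_1(\partial M;\mathbb Z)$, with any sets of basic edges, and with any choices of the types called $q'_j$. -/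

import Mathlib

/-! ## Formal series in `q^{1/2}`

The ring `ℤ((q^{1/2}))` is `LaurentSeries ℤ`, the variable `X` being `q^{1/2}`. -/

/-- The integer power `(-q^{1/2})^m`. -/
noncomputable def negSqrtQPow (m : ℤ) : LaurentSeries ℤ :=
  HahnSeries.single m ((m.negOnePow : ℤˣ) : ℤ)

/-- `(q)_n = ∏_{i=1}^n (1 - q^i)`, written in the variable `X = q^{1/2}`. -/
noncomputable def qPoch (n : ℕ) : PowerSeries ℤ :=
  ∏ i ∈ Finset.range n, (1 - PowerSeries.X ^ (2 * (i + 1)))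

/-- `1 / (q)_n`, with the convention that it vanishes for `n < 0`. -/
noncomputable def qPochInv (n : ℤ) : PowerSeries ℤ :=
  if n < 0 then 0 else PowerSeries.invOfUnit (qPoch n.toNat) 1

theorem qPoch_mul_inv (n : ℕ) : qPoch n * qPochInv n = 1 := by
  unfold qPochInv
  rw [if_neg (by omega), Int.toNat_natCast]
  apply PowerSeries.mul_invOfUnit
  simp [qPoch, map_prod]

/-- The family `f` of Laurent series in `q^{1/2}` can be summed formally (`q`-adically): the
exponents that occur are bounded below and each exponent occurs in only finitely many terms. -/
def FormallySummable {κ : Type*} (f : κ → LaurentSeries ℤ) : Prop :=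
  ∃ F : HahnSeries.SummableFamily ℤ ℤ κ, ∀ k, F k = f k

open Classical in
/-- The formal sum of a formally summable family (and `0` for any other family). -/
noncomputable def formalSum {κ : Type*} (f : κ → LaurentSeries ℤ) : LaurentSeries ℤ :=
  if h : FormallySummable f then h.choose.hsum else 0

theorem coeff_formalSum {κ : Type*} {f : κ → LaurentSeries ℤ} (h : FormallySummable f) (d : ℤ) :
    (formalSum f).coeff d = ∑ᶠ k, (f k).coeff d := by
  unfold formalSum
  rw [dif_pos h, HahnSeries.SummableFamily.coeff_hsum]
  exact finsum_congr fun k => by rw [h.choose_spec k]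

/-- The `n`-th term of the tetrahedron index,
`(-1)^n q^{n(n+1)/2 - (n+e/2)m} / ((q)_n (q)_{n+e})`; it vanishes for `n < -e`. -/
noncomputable def tetIndexTerm (m e : ℤ) (n : ℕ) : LaurentSeries ℤ :=
  HahnSeries.single ((n : ℤ) * (n + 1) - (2 * n + e) * m) ((-1 : ℤ) ^ n) *
    HahnSeries.ofPowerSeries ℤ ℤ (qPochInv n * qPochInv (n + e))

/-- The tetrahedron index `I_Δ(m,e)`. -/
noncomputable def tetIndex (m e : ℤ) : LaurentSeries ℤ :=
  formalSum (tetIndexTerm m e)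

theorem coeff_tetIndexTerm_eq_zero (m e : ℤ) (n : ℕ) (d : ℤ) (h : d < n - m ^ 2 - e * m) :
    (tetIndexTerm m e n).coeff d = 0 := by
  unfold tetIndexTerm
  rw [HahnSeries.coeff_single_mul, HahnSeries.ofPowerSeries_apply,
    HahnSeries.embDomain_of_notMem_range, mul_zero]
  rintro ⟨j, hj⟩
  have hj' : (j : ℤ) = d - ((n : ℤ) * (n + 1) - (2 * n + e) * m) := hj
  nlinarith [sq_nonneg ((n : ℤ) - m), Int.natCast_nonneg j]

/-- The series defining `I_Δ(m,e)` always converges formally. -/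
theorem formallySummable_tetIndexTerm (m e : ℤ) : FormallySummable (tetIndexTerm m e) := by
  refine ⟨⟨tetIndexTerm m e, ?_, ?_⟩, fun k => rfl⟩
  · refine Set.IsWF.isPWO (BddBelow.isWF ?_)
    refine ⟨- m ^ 2 - e * m, ?_⟩
    intro d hd
    obtain ⟨n, hn⟩ := Set.mem_iUnion.1 hd
    by_contra hlt
    exact hn (coeff_tetIndexTerm_eq_zero m e n d (by push Not at hlt; have := Int.natCast_nonneg n; linarith))
  · intro d
    refine (Set.finite_Iic (d + m ^ 2 + e * m).toNat).subset fun n hn => ?_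
    by_contra hlt
    have hlt' : (d + m ^ 2 + e * m).toNat < n := by simpa using hlt
    refine hn (coeff_tetIndexTerm_eq_zero m e n d ?_)
    have := (Int.toNat_lt' (by omega)).1 hlt'
    linarith

/-! ## Oriented ideal triangulations

The vertices of every tetrahedron are numbered by `Fin 4`, compatibly with the orientation: seen
from vertex `0`, from outside, the vertices `1, 2, 3` appear anticlockwise. Face `f` is opposite
vertex `f`. The truncated end of tetrahedron `t` at vertex `v` is the triangle `(t, v)` of the
induced triangulation of the boundary. For `w ≠ v`, it has a corner `(t, v, w)`, lying on the edge
`vw` of `t`, and for `f ≠ v` a side `(t, v, f)`, lying in face `f` of `t` and opposite the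
corner `(t, v, f)`. -/

/-- Seen from outside vertex `v`, the vertex following `w` in anticlockwise order
(junk value for `w = v`). -/
def ccw (v w : Fin 4) : Fin 4 :=
  ![![0, 2, 3, 1], ![3, 1, 0, 2], ![1, 3, 2, 0], ![2, 0, 1, 3]] v w

/-- The normal quadrilateral type facing the edge `vw` of a tetrahedron: type `0` faces the edges
`01, 23`, type `1` faces `02, 13` and type `2` faces `03, 12`. The cyclic order
`0 → 1 → 2 → 0` is the anticlockwise one at each vertex. (Junk value for `v = w`.) -/
def quadType (v w : Fin 4) : Fin 3 :=
  ![![0, 0, 1, 2], ![0, 0, 2, 1], ![1, 2, 0, 0], ![2, 1, 0, 0]] v w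

/-- `(v, w, ccw v w, ccw v (ccw v w))` is an even ordering of the four vertices. -/
theorem ccw_spec : ∀ v w : Fin 4, v ≠ w →
    ∃ p : Equiv.Perm (Fin 4), Equiv.Perm.sign p = 1 ∧
      p 0 = v ∧ p 1 = w ∧ p 2 = ccw v w ∧ p 3 = ccw v (ccw v w) := by
  decide

theorem quadType_ccw : ∀ v w : Fin 4, v ≠ w → quadType v (ccw v w) = quadType v w + 1 := by
  decide

/-- Orientation-reversing pairing of the faces of oriented tetrahedra indexed by `τ`: face `f` of
`t` is glued to a face of `adj t f`; vertex `v ≠ f` is sent to `glue t f v`, and the face in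
question is the one opposite `glue t f f`. -/
structure FacePairing (τ : Type*) where
  adj : τ → Fin 4 → τ
  glue : τ → Fin 4 → Equiv.Perm (Fin 4)
  adj_adj : ∀ t f, adj (adj t f) (glue t f f) = t
  glue_glue : ∀ t f, glue (adj t f) (glue t f f) = (glue t f)⁻¹
  not_self : ∀ t f, (adj t f, glue t f f) ≠ (t, f)
  odd : ∀ t f, Equiv.Perm.sign (glue t f) = -1

/-- Corners (or sides) of the boundary triangles, as triples `(t, v, w)` with `v ≠ w`. -/
abbrev Corner (τ : Type*) := {c : τ × Fin 4 × Fin 4 // c.2.1 ≠ c.2.2}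

namespace FacePairing

variable {τ : Type*} (T : FacePairing τ)

/-- The effect of the gluing along face `f` of `t` on the triple `(t, v, f)`: the side
`(t, v, f)` of a boundary triangle is glued to the side `T.flip (t, v, f)`. -/
def flip (s : τ × Fin 4 × Fin 4) : τ × Fin 4 × Fin 4 :=
  (T.adj s.1 s.2.2, T.glue s.1 s.2.2 s.2.1, T.glue s.1 s.2.2 s.2.2)

/-- Two corners are glued along a face containing the edge on which they lie. -/
def CornerRel (c d : Corner τ) : Prop :=
  ∃ f, f ≠ c.1.2.1 ∧ f ≠ c.1.2.2 ∧
    d.1 = (T.adj c.1.1 f, T.glue c.1.1 f c.1.2.1, T.glue c.1.1 f c.1.2.2)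

/-- Vertices of the triangulated boundary, i.e. ends of edges of the triangulation. -/
def LinkVertex := Quot T.CornerRel

/-- Edges of the triangulated boundary: sides of triangles, glued in pairs. -/
def LinkEdge := Quot fun c d : Corner τ => d.1 = T.flip c.1

/-- Edges of the triangulation: corners up to gluing, `(t, v, w)` being identified
with `(t, w, v)`. -/
def Edge := Quot fun c d : Corner τ => T.CornerRel c d ∨ d.1 = (c.1.1, c.1.2.2, c.1.2.1)

/-- Cusps, i.e. ideal vertices or boundary components: vertices of tetrahedra up to gluing. -/
def Cusp := Quot fun a b : τ × Fin 4 =>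
  ∃ f, f ≠ a.2 ∧ b = (T.adj a.1 f, T.glue a.1 f a.2)

variable {T} in
/-- The boundary vertex at a corner. -/
def linkVertex (c : Corner τ) : T.LinkVertex := Quot.mk _ c

variable {T} in
/-- The boundary edge containing a side. -/
def linkEdge (c : Corner τ) : T.LinkEdge := Quot.mk _ c

variable {T} in
/-- The edge `vw` of tetrahedron `t`. -/
def edge (c : Corner τ) : T.Edge := Quot.mk _ c

variable {T} in
/-- The cusp at vertex `v` of tetrahedron `t`. -/
def cusp (a : τ × Fin 4) : T.Cusp := Quot.mk _ a

/-- Euler characteristic `V - E + F` of the boundary component at the cusp `C`. -/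
noncomputable def linkEuler (C : T.Cusp) : ℤ :=
  (Set.ncard {x : T.LinkVertex | ∃ c : Corner τ, linkVertex c = x ∧ cusp (c.1.1, c.1.2.1) = C} : ℤ)
  - (Set.ncard {x : T.LinkEdge | ∃ c : Corner τ, linkEdge c = x ∧ cusp (c.1.1, c.1.2.1) = C} : ℤ)
  + (Set.ncard {a : τ × Fin 4 | cusp (T := T) a = C} : ℤ)

end FacePairing

/-- An oriented ideal triangulation, with tetrahedra indexed by the finite type `τ`, of a connected
3-manifold which is the interior of a compact 3-manifold with torus boundary components. As the
tetrahedra are oriented, the vertex links are closed connected oriented surfaces, and the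
complement of the vertices in the quotient is a 3-manifold; the condition on the boundary is that
each vertex link be a torus, i.e. have Euler characteristic `0`. -/
structure IdealTriangulation (τ : Type*) extends FacePairing τ where
  connected : ∀ s t, Relation.ReflTransGen (fun a b => ∃ f, adj a f = b) s t
  torus : ∀ C : toFacePairing.Cusp, toFacePairing.linkEuler C = 0

namespace FacePairing

variable {τ : Type*} (T : FacePairing τ)

/-! ## Angle structures, index structures and Neumann-Zagier matrices -/

/-- The entry of the matrix of angle equations in the row of the edge `E` and the column of the
quadrilateral type `x` of tetrahedron `t`: how many of the two edges of `t` facing this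
quadrilateral type are equal to `E` in the triangulation. For `x = 0, 1, 2` these are the entries
of the three Neumann-Zagier matrices. -/
noncomputable def edgeCoeff (E : T.Edge) (t : τ) (x : Fin 3) : ℕ :=
  Nat.card {c : Corner τ // c.1.1 = t ∧ c.1.2.1 < c.1.2.2 ∧ quadType c.1.2.1 c.1.2.2 = x ∧
    edge c = E}

/-- Generalised angle structures. -/
structure IsGeneralisedAngleStructure [Fintype τ] (α : τ → Fin 3 → ℝ) : Prop where
  tet : ∀ t, ∑ x, α t x = Real.pi
  edge : ∀ E : T.Edge, ∑ t, ∑ x, T.edgeCoeff E t x * α t x = 2 * Real.pi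

/-- `T` admits an index structure: for each choice `Q` of a quadrilateral type in each tetrahedron,
there is a generalised angle structure which is positive on the chosen quadrilateral types. -/
def HasIndexStructure [Fintype τ] : Prop :=
  ∀ Q : τ → Fin 3, ∃ α : τ → Fin 3 → ℝ, T.IsGeneralisedAngleStructure α ∧ ∀ t, 0 < α t (Q t)

end FacePairing

/-- From a vector of coefficients of the angle variables `Z, Z', Z''` of the tetrahedra, eliminate
in each tetrahedron `t` the variable of the quadrilateral type `Q t`, using `Z + Z' + Z'' = π`. If
the eliminated variable is called `Z'` (cyclically ordering the three as `Z → Z' → Z''`), this is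
the new coefficient of `Z`. -/
def elimA {τ : Type*} (Q : τ → Fin 3) (x : τ → Fin 3 → ℤ) (t : τ) : ℤ := x t (Q t + 2) - x t (Q t)

/-- In the situation of `elimA`, the new coefficient of `Z''`. -/
def elimB {τ : Type*} (Q : τ → Fin 3) (x : τ → Fin 3 → ℤ) (t : τ) : ℤ := x t (Q t + 1) - x t (Q t)

namespace FacePairing

variable {τ : Type*} (T : FacePairing τ)

/-- The coefficients of the angle equation of the edge `E`. -/
noncomputable def edgeVec (E : T.Edge) (t : τ) (x : Fin 3) : ℤ := T.edgeCoeff E t x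

/-- The row of the Neumann-Zagier matrix `(A | B)` belonging to the edge `E`. -/
noncomputable def row (Q : τ → Fin 3) (E : T.Edge) : τ → ℤ × ℤ :=
  fun t => (elimA Q (T.edgeVec E) t, elimB Q (T.edgeVec E) t)

/-- The constant `ν_E` in the equation `A Z + B Z'' = π ν` obtained by elimination. -/
noncomputable def nu [Fintype τ] (Q : τ → Fin 3) (E : T.Edge) : ℤ := 2 - ∑ t, T.edgeVec E t (Q t)

/-- `B` is a set of basic edges: the corresponding rows of the Neumann-Zagier matrix form an
integer basis of its integer row space. -/
def IsBasic (Q : τ → Fin 3) (B : Finset T.Edge) : Prop :=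
  LinearIndependent ℤ (fun E : B => T.row Q E) ∧
    Submodule.span ℤ (T.row Q '' (B : Set T.Edge)) = Submodule.span ℤ (Set.range (T.row Q))

end FacePairing

/-! ## Peripheral curves -/

theorem ne_ccw : ∀ v w : Fin 4, v ≠ w → v ≠ ccw v w := by
  decide

/-- The next corner, anticlockwise, of the same boundary triangle (or the next side). -/
def Corner.next {τ : Type*} (c : Corner τ) : Corner τ :=
  ⟨(c.1.1, c.1.2.1, ccw c.1.2.1 c.1.2.2), ne_ccw _ _ c.2⟩

namespace FacePairing

variable {τ : Type*} (T : FacePairing τ)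

/-- A 1-chain of the dual cell decomposition of the triangulated boundary is recorded by its
intersection numbers `z (t, v, f)` with the sides of the triangles, counted positively when
entering the triangle `(t, v)`. The boundary of the 2-cell dual to a vertex is a small
anticlockwise loop around the vertex; where it turns about a corner `c` of a triangle it enters
through the side opposite `c.next.next` and leaves through the side opposite `c.next`. Hence this
is the intersection number with the side `s` of the boundary of the 2-chain with coefficients
`h`. -/
def loops (h : T.LinkVertex → ℤ) (s : Corner τ) : ℤ :=
  h (linkVertex s.next) - h (linkVertex s.next.next)

/-- A 1-cycle is a boundary. -/
def NullHomologous (z : τ × Fin 4 × Fin 4 → ℤ) : Prop :=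
  ∃ h : T.LinkVertex → ℤ, ∀ s : Corner τ, z s.1 = T.loops h s

/-- An unoriented normal multi-curve on the triangulated boundary (a disjoint union of simple
closed normal curves), given up to normal isotopy by its normal coordinates: `count t v w` is the
number of its arcs in the triangle `(t, v)` which cut off the corner `(t, v, w)`. The matching
condition says that the numbers of endpoints agree on sides which are glued; the arcs are then
joined in the only way that makes the curves disjoint. -/
structure NormalCurve where
  count : τ → Fin 4 → Fin 4 → ℕ
  count_diag : ∀ t v, count t v v = 0
  matching : ∀ t v f, v ≠ f →
    ∑ w with w ≠ v ∧ w ≠ f, count t v w =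
      ∑ w with w ≠ v ∧ w ≠ f, count (T.adj t f) (T.glue t f v) (T.glue t f w)

namespace NormalCurve

variable {T} (γ : T.NormalCurve)

/-- The arcs of a normal multi-curve: arc `i` at the corner `(t, v, w)` is the `i`-th one, starting
from the corner. -/
abbrev Arc := Σ c : τ × Fin 4 × Fin 4, Fin (γ.count c.1 c.2.1 c.2.2)

variable {γ}

/-- Tetrahedron containing an arc. -/
def Arc.tet (a : γ.Arc) : τ := a.1.1

/-- Vertex of the tetrahedron at which an arc lies. -/
def Arc.vert (a : γ.Arc) : Fin 4 := a.1.2.1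

/-- The corner of the boundary triangle cut off by an arc. -/
def Arc.corner (a : γ.Arc) : Fin 4 := a.1.2.2

/-- Position of an endpoint of the arc `a` on a side of its triangle, counted from the end `w` of
that side: both `w` and `a.corner` are ends of the side. From the corner `a.corner`, the points on
the side are first those of the arcs at this corner and then, in reverse order, those of the arcs
at the other end. -/
def Arc.pos (a : γ.Arc) (w : Fin 4) : ℕ :=
  if a.corner = w then a.2
  else γ.count a.tet a.vert w + γ.count a.tet a.vert a.corner - 1 - a.2

/-- The arc `a` meets the side in face `f` of its triangle, at a point where it continues as the
arc `b` of the triangle on the other side. -/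
def Joined (a : γ.Arc) (f : Fin 4) (b : γ.Arc) : Prop :=
  f ≠ a.vert ∧ f ≠ a.corner ∧ b.tet = T.adj a.tet f ∧ b.vert = T.glue a.tet f a.vert ∧
    b.corner ≠ T.glue a.tet f f ∧
    ∀ w, w ≠ a.vert → w ≠ f → a.pos w = b.pos (T.glue a.tet f w)

/-- Two arcs belong to the same component. -/
def SameComponent (a b : γ.Arc) : Prop :=
  Relation.EqvGen (fun a b : γ.Arc => ∃ f, Joined a f b) a b

/-- The sign with which the arc `a`, oriented anticlockwise about its corner, crosses the side in
face `f`: it enters the triangle through the side opposite the corner preceding `a.corner` in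
anticlockwise order, and leaves it through the side opposite the corner following it. -/
def Arc.enters (a : γ.Arc) (f : Fin 4) : ℤ :=
  if f = ccw a.vert (ccw a.vert a.corner) then 1 else -1

open Classical in
/-- The 1-chain (intersection numbers with the sides, positive when entering the triangle) of the
union `K` of some of the arcs, an arc being oriented anticlockwise about its corner if its sign is
`1` and clockwise if its sign is `-1`. -/
noncomputable def chain [Fintype τ] (sgn : γ.Arc → ℤˣ) (K : Set γ.Arc) (s : τ × Fin 4 × Fin 4) : ℤ :=
  ∑ a : γ.Arc, if a ∈ K ∧ a.tet = s.1 ∧ a.vert = s.2.1 ∧ a.corner ≠ s.2.2 then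
    (sgn a : ℤ) * a.enters s.2.2 else 0

end NormalCurve

/-- An oriented multi-curve in normal position on the boundary, that is, a disjoint union of
oriented simple closed normal curves, no component of which is null-homologous in the boundary.
`sgn a` is `1` if the arc `a` turns anticlockwise about its corner, and `-1` otherwise. -/
structure MultiCurve [Fintype τ] extends NormalCurve T where
  sgn : toNormalCurve.Arc → ℤˣ
  coherent : ∀ a f b, NormalCurve.Joined a f b →
    (sgn a : ℤ) * a.enters f = - ((sgn b : ℤ) * b.enters (T.glue a.tet f f))
  essential : ∀ a : toNormalCurve.Arc,
    ¬ T.NullHomologous (NormalCurve.chain sgn {b | NormalCurve.SameComponent a b})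

namespace MultiCurve

variable {T} [Fintype τ] (ϖ : T.MultiCurve)

/-- The 1-cycle defined by an oriented multi-curve. -/
noncomputable def cycle : τ × Fin 4 × Fin 4 → ℤ := NormalCurve.chain ϖ.sgn Set.univ

/-- Turning numbers: `turn t x` is the signed number of arcs turning anticlockwise around those
corners of the four truncated ends of the tetrahedron `t` that lie on an edge facing the
quadrilateral type `x`. -/
noncomputable def turn (t : τ) (x : Fin 3) : ℤ :=
  ∑ v, ∑ w with w ≠ v ∧ quadType v w = x, ∑ i, (ϖ.sgn ⟨(t, v, w), i⟩ : ℤ)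

/-- The scalar `ν_ϖ` obtained by elimination. -/
noncomputable def nu (Q : τ → Fin 3) : ℤ := - ∑ t, ϖ.turn t (Q t)

end MultiCurve

/-! ## The index -/

variable [Fintype τ]

/-- The term with summation index `k` in the sum defining the index of `T` at the oriented
multi-curve `ϖ`, for the quad-choice `Q` and the set `B` of basic edges. -/
noncomputable def indexTerm (Q : τ → Fin 3) (B : Finset T.Edge) (ϖ : T.MultiCurve) (k : B → ℤ) :
    LaurentSeries ℤ :=
  negSqrtQPow (∑ E : B, k E * T.nu Q E + ϖ.nu Q) *
    ∏ t, tetIndex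
      (-(elimB Q ϖ.turn t) - ∑ E : B, k E * elimB Q (T.edgeVec E) t)
      (elimA Q ϖ.turn t + ∑ E : B, k E * elimA Q (T.edgeVec E) t)

/-- The index of `T` at the oriented multi-curve `ϖ`, computed with the quad-choice `Q` and the set
`B` of basic edges. -/
noncomputable def index (Q : τ → Fin 3) (B : Finset T.Edge) (ϖ : T.MultiCurve) :
    LaurentSeries ℤ :=
  formalSum (T.indexTerm Q B ϖ)

end FacePairing

/-! ## The 2-3 move

A bipyramid has poles `0, 4` and equatorial vertices `1, 2, 3`. It is the union of the tetrahedra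
`0123` and `1234`, and also of the three tetrahedra `0234`, `0314`, `0124` around the edge `04`;
these orderings of the vertices are all positive for one orientation of the bipyramid. For
`i : Fin 3`, the `i`-th of the latter three omits the equatorial vertex with label `i + 1`; its
vertices are, in order, `0`, the two equatorial vertices following cyclically, and `4`. Addition
on `i` is modulo `3`, so the label of the equatorial vertex number `i` is `i.succ : Fin 4`. -/

/-- The tetrahedra of two triangulations and the labelling of their vertices for a 2-3 move. -/
structure BipyramidData (τ τ' : Type*) where
  /-- the tetrahedron `0123`; its vertex `northLabel j` carries the label `j` -/
  north : τ
  northLabel : Equiv.Perm (Fin 4)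
  /-- the tetrahedron `1234`; its vertex `southLabel j` carries the label `j + 1` -/
  south : τ
  southLabel : Equiv.Perm (Fin 4)
  /-- the tetrahedra `0234`, `0314`, `0124`; vertex `midLabel i j` carries the `j`-th label -/
  mid : Fin 3 → τ'
  midLabel : Fin 3 → Equiv.Perm (Fin 4)
  /-- the identification of the tetrahedra outside the bipyramid -/
  rest : {t : τ // t ≠ north ∧ t ≠ south} ≃ {t' : τ' // ∀ i, t' ≠ mid i}
  restLabel : {t : τ // t ≠ north ∧ t ≠ south} → Equiv.Perm (Fin 4)

/-- The identification of the vertices `(t, v, f)` (vertex `v` of face `f` of `t`) of the faces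
not in the interior of the bipyramid. Equivalently, the identification of the sides of boundary
triangles that lie in these faces. -/
inductive BipyramidData.Corr {τ τ' : Type*} (m : BipyramidData τ τ') :
    τ × Fin 4 × Fin 4 → τ' × Fin 4 × Fin 4 → Prop
  | rest (t) (v f : Fin 4) (h : v ≠ f) :
      m.Corr (t.1, v, f) ((m.rest t).1, m.restLabel t v, m.restLabel t f)
  | north_pole (i : Fin 3) :
      m.Corr (m.north, m.northLabel 0, m.northLabel i.succ) (m.mid i, m.midLabel i 0, m.midLabel i 3)
  | north_one (i : Fin 3) :
      m.Corr (m.north, m.northLabel (i + 1).succ, m.northLabel i.succ)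
        (m.mid i, m.midLabel i 1, m.midLabel i 3)
  | north_two (i : Fin 3) :
      m.Corr (m.north, m.northLabel (i + 2).succ, m.northLabel i.succ)
        (m.mid i, m.midLabel i 2, m.midLabel i 3)
  | south_pole (i : Fin 3) :
      m.Corr (m.south, m.southLabel 3, m.southLabel i.castSucc)
        (m.mid i, m.midLabel i 3, m.midLabel i 0)
  | south_one (i : Fin 3) :
      m.Corr (m.south, m.southLabel (i + 1).castSucc, m.southLabel i.castSucc)
        (m.mid i, m.midLabel i 1, m.midLabel i 0)
  | south_two (i : Fin 3) :
      m.Corr (m.south, m.southLabel (i + 2).castSucc, m.southLabel i.castSucc)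
        (m.mid i, m.midLabel i 2, m.midLabel i 0)

/-- `T'` is obtained from `T` by a 2-3 move: two distinct tetrahedra `north`, `south` of `T` sharing
the face `123` are replaced by three tetrahedra around a new edge `04`, all other tetrahedra and
gluings of faces being unchanged, up to an orientation-preserving renumbering. -/
structure TwoThreeMove {τ τ' : Type*} (T : FacePairing τ) (T' : FacePairing τ') extends
    BipyramidData τ τ' where
  north_ne_south : north ≠ south
  mid_injective : Function.Injective mid
  north_even : Equiv.Perm.sign northLabel = 1
  south_even : Equiv.Perm.sign southLabel = 1
  mid_even : ∀ i, Equiv.Perm.sign (midLabel i) = 1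
  rest_even : ∀ t, Equiv.Perm.sign (restLabel t) = 1
  /-- in `T`, the face `123` of `north` is glued to that of `south` -/
  shared : ∀ i : Fin 3, T.flip (north, northLabel i.succ, northLabel 0) =
    (south, southLabel i.castSucc, southLabel 3)
  /-- in `T'`, the face of `mid i` containing the edge `04` and the equatorial vertex number `i + 2`
  is glued to the face of `mid (i + 1)` with the same labels -/
  inner_zero : ∀ i, T'.flip (mid i, midLabel i 0, midLabel i 1) =
    (mid (i + 1), midLabel (i + 1) 0, midLabel (i + 1) 2)
  inner_equator : ∀ i, T'.flip (mid i, midLabel i 2, midLabel i 1) =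
    (mid (i + 1), midLabel (i + 1) 1, midLabel (i + 1) 2)
  inner_four : ∀ i, T'.flip (mid i, midLabel i 3, midLabel i 1) =
    (mid (i + 1), midLabel (i + 1) 3, midLabel (i + 1) 2)
  /-- all other gluings agree -/
  outer : ∀ s s', toBipyramidData.Corr s s' → toBipyramidData.Corr (T.flip s) (T'.flip s')

/-- The multi-curves `ϖ` and `ϖ'`, in normal position with respect to the boundary triangulations
of `T` and `T'`, represent the same class in `H_1(∂M; ℤ)`. The two boundary triangulations are
subdivisions of one cell decomposition of `∂M`, in which each of the five truncated ends of the
bipyramid is a single (triangular or quadrilateral) cell. Its edges are the sides related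
by `Corr`, and its vertices are those of the boundary triangulation of `T`. The cycles of `ϖ` and
`ϖ'` in the dual cell decomposition have to differ by a boundary. -/
def TwoThreeMove.SameClass {τ τ' : Type*} [Fintype τ] [Fintype τ'] {T : FacePairing τ}
    {T' : FacePairing τ'} (m : TwoThreeMove T T') (ϖ : T.MultiCurve) (ϖ' : T'.MultiCurve) : Prop :=
  ∃ h : T.LinkVertex → ℤ, ∀ (s : Corner τ) (s' : τ' × Fin 4 × Fin 4), m.Corr s.1 s' →
    ϖ.cycle s.1 - ϖ'.cycle s' = T.loops h s

/-! In the symmetric form J_Δ(a,b,c) = (-q^{1/2})^{-b} I_Δ(b-c, a-b) (`tetJ`), the tetrahedron index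
is invariant under all permutations of its entries, and adding s to all three entries multiplies it
by (-q^{1/2})^{-s}. A summand of the index then becomes q^{∑u} times a product of J_Δ's, one per
tetrahedron, evaluated at the coefficients of the three angles. This is a function `term` of an
integer vector u on all edges, in which the types called q'_j no longer occur (`indexTerm_eq`). Call
u flat if the corresponding combination of rows of (A|B) vanishes. Pairing with an angle structure
shows that `term` does not change under flat vectors (`term_add_of_isFlat`), and a basic set of
edges represents every class modulo flat vectors exactly once. So the index is a sum over a quotient
lattice that does not depend on the choices.

Convergence: the degree of J_Δ, plus the pairing of its entries with the angles, is bounded below by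
the angle of the largest entry times the spread of the entries, up to a constant (`degJ_ge`). An
angle structure positive on the types with the largest entries therefore bounds all spreads in terms
of the degree. Which types these are depends on u, so one angle structure for every quad choice is
needed (`exists_bound`).

The 2–3 move: the new triangulation has one more edge, the axis of the bipyramid. With the values on
the other edges fixed, the sum over the value on the axis is the pentagon identity
(`tetJ_pentagon`), which follows from two q-Vandermonde sums.

The curves are the delicate part. Let κ(c) be the signed number of arcs at a corner c of the
boundary triangulation. For homologous curves one can write κ = K + e + h and κ' = K' + e', where K
and K' agree outside the bipyramid and on its boundary, e and e' are constant on triangles and h is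
a function of the boundary vertices. A loop around a boundary vertex acts like an edge equation, so
h is absorbed by translating u; the constants e and e' only change the power of -q^{1/2}. What
remains to be shown is ∑e + 2∑h = ∑e' (`exists_rotation`): essential simple curves on tori have a
total rotation number that depends only on the homology class. A small loop around a vertex violates
this, so it is here that the components must be essential.

To prove it, the surface is cut along the curve. Crossing the curve changes a multivalued height by
one, which becomes single-valued on an infinite cyclic cover. Consider a region of the cover bounded
below by level curves of height zero and above by the level set of another function. If all its
components reach negative height, essentiality of the level curves implies that its Euler
characteristic is at most zero (`HeightMap.Truncation.sum_card_le`). The upper function is taken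
from a harmonic function on the cell decomposition common to both triangulations; the minimum
principle supplies the condition on components (`good_of_potential`). This bounds ∑e + 2∑h above by
a number computed on the common cells. The reversed curve gives a second bound, and since the total
variation around a cell is at least twice the oscillation, the two bounds together force equality
(`Frame.rotation_eq`). The common value is the same for both curves. -/

/-! ## Formal sums -/

/-- The family `f` is formally summable, with sum `s`. -/
def HasFormalSum {κ : Type*} (f : κ → LaurentSeries ℤ) (s : LaurentSeries ℤ) : Prop :=
  ∃ F : HahnSeries.SummableFamily ℤ ℤ κ, (∀ k, F k = f k) ∧ F.hsum = s

section FormalSums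

variable {κ ι : Type*} {f g : κ → LaurentSeries ℤ} {s t : LaurentSeries ℤ}

theorem HasFormalSum.summable (h : HasFormalSum f s) : FormallySummable f :=
  let ⟨F, hF, _⟩ := h
  ⟨F, hF⟩

theorem HasFormalSum.coeff (h : HasFormalSum f s) (d : ℤ) :
    s.coeff d = ∑ᶠ k, (f k).coeff d := by
  obtain ⟨F, hF, rfl⟩ := h
  rw [HahnSeries.SummableFamily.coeff_hsum]
  exact finsum_congr fun k => by rw [hF]

theorem HasFormalSum.unique (h : HasFormalSum f s) (h' : HasFormalSum f t) : s = t := by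
  ext d
  rw [h.coeff, h'.coeff]

theorem FormallySummable.hasFormalSum (h : FormallySummable f) : HasFormalSum f (formalSum f) := by
  obtain ⟨F, hF⟩ := h
  refine ⟨F, hF, ?_⟩
  ext d
  rw [coeff_formalSum ⟨F, hF⟩, HahnSeries.SummableFamily.coeff_hsum]
  exact finsum_congr fun k => by rw [hF]

theorem HasFormalSum.formalSum_eq (h : HasFormalSum f s) : formalSum f = s :=
  h.summable.hasFormalSum.unique h

theorem Set.IsPWO.bddBelow_int {S : Set ℤ} (hS : S.IsPWO) : BddBelow S := by
  rcases S.eq_empty_or_nonempty with rfl | hne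
  · exact bddBelow_empty
  · exact ⟨hS.isWF.min hne, fun x hx => hS.isWF.min_le hne hx⟩

/-- The exponents are bounded below, so only finitely many of them are at most `d`, and each occurs
in finitely many terms. With the converse below, summability becomes a finiteness statement about
the indices. -/
theorem FormallySummable.finite (h : FormallySummable f) (d : ℤ) :
    {k | ∃ e ≤ d, (f k).coeff e ≠ 0}.Finite := by
  obtain ⟨F, hF⟩ := h
  have hb : BddBelow (⋃ k, (F k).support) := F.isPWO_iUnion_support.bddBelow_int
  obtain ⟨b, hb⟩ := hb
  refine ((Set.finite_Icc b d).biUnion fun e _ => F.finite_co_support e).subset ?_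
  rintro k ⟨e, hed, he⟩
  rw [← hF] at he
  exact Set.mem_biUnion (show e ∈ Set.Icc b d from ⟨hb (Set.mem_iUnion.2 ⟨k, he⟩), hed⟩) he

theorem formallySummable_of_finite (h : ∀ d : ℤ, {k | ∃ e ≤ d, (f k).coeff e ≠ 0}.Finite) :
    FormallySummable f := by
  refine ⟨⟨f, ?_, fun d => (h d).subset fun k hk => ⟨d, le_rfl, hk⟩⟩, fun _ => rfl⟩
  refine Set.IsWF.isPWO (BddBelow.isWF ?_)
  -- Only finitely many terms have an exponent that is at most 0, and these have a common lower
  -- bound; every other exponent is positive.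
  have hfin : (⋃ k ∈ (h 0).toFinset, (f k).support).IsPWO :=
    (Finset.isPWO_bUnion _).2 fun k _ => (f k).isPWO_support
  obtain ⟨b, hb⟩ := hfin.bddBelow_int
  refine ⟨min b 0, ?_⟩
  rintro e he
  obtain ⟨k, hk⟩ := Set.mem_iUnion.1 he
  by_cases h0 : e ≤ 0
  · exact (min_le_left _ _).trans (hb (Set.mem_biUnion ((h 0).mem_toFinset.2 ⟨e, h0, hk⟩) hk))
  · exact (min_le_right _ _).trans (by omega)

theorem HasFormalSum.congr (h : HasFormalSum f s) (hfg : ∀ k, g k = f k) : HasFormalSum g s := by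
  have : g = f := funext hfg
  rwa [this]

theorem HasFormalSum.add (h : HasFormalSum f s) (h' : HasFormalSum g t) :
    HasFormalSum (fun k => f k + g k) (s + t) := by
  obtain ⟨F, hF, rfl⟩ := h
  obtain ⟨G, hG, rfl⟩ := h'
  exact ⟨F + G, fun k => by simp [hF, hG], HahnSeries.SummableFamily.hsum_add⟩

theorem HasFormalSum.sub (h : HasFormalSum f s) (h' : HasFormalSum g t) :
    HasFormalSum (fun k => f k - g k) (s - t) := by
  obtain ⟨F, hF, rfl⟩ := h
  obtain ⟨G, hG, rfl⟩ := h'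
  exact ⟨F - G, fun k => by simp [hF, hG], HahnSeries.SummableFamily.hsum_sub⟩

theorem HasFormalSum.mul_left (h : HasFormalSum f s) (x : LaurentSeries ℤ) :
    HasFormalSum (fun k => x * f k) (x * s) := by
  obtain ⟨F, hF, rfl⟩ := h
  exact ⟨x • F, fun k => by rw [HahnSeries.SummableFamily.smul_apply, hF]; rfl, HahnSeries.SummableFamily.hsum_smul⟩

theorem HasFormalSum.mul {g : ι → LaurentSeries ℤ} (h : HasFormalSum f s) (h' : HasFormalSum g t) :
    HasFormalSum (fun p : κ × ι => f p.1 * g p.2) (s * t) := by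
  obtain ⟨F, hF, rfl⟩ := h
  obtain ⟨G, hG, rfl⟩ := h'
  exact ⟨F.mul G, fun k => by simp [hF, hG], HahnSeries.SummableFamily.hsum_mul F G⟩

theorem HasFormalSum.equiv {g : ι → LaurentSeries ℤ} (h : HasFormalSum f s) (e : ι ≃ κ)
    (hg : ∀ i, g i = f (e i)) : HasFormalSum g s := by
  obtain ⟨F, hF, rfl⟩ := h
  refine ⟨HahnSeries.SummableFamily.Equiv e.symm F, fun k => ?_,
    HahnSeries.SummableFamily.hsum_equiv _ _⟩
  rw [hg, ← hF]
  rfl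

/-- A family may be extended by zero. -/
theorem HasFormalSum.extend {g : ι → LaurentSeries ℤ} (h : HasFormalSum f s) (e : κ → ι)
    (he : Function.Injective e) (hg : ∀ k, g (e k) = f k) (h0 : ∀ i, i ∉ Set.range e → g i = 0) :
    HasFormalSum g s := by
  obtain ⟨F, hF, rfl⟩ := h
  refine ⟨F.embDomain ⟨e, he⟩, fun i => ?_, HahnSeries.SummableFamily.hsum_embDomain _ _⟩
  by_cases hi : i ∈ Set.range e
  · obtain ⟨k, rfl⟩ := hi
    rw [hg, ← hF]
    exact HahnSeries.SummableFamily.embDomain_image F ⟨e, he⟩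
  · rw [h0 i hi]
    exact HahnSeries.SummableFamily.embDomain_of_notMem_range _ _ hi

theorem hasFormalSum_zero : HasFormalSum (fun _ : κ => 0) 0 :=
  ⟨0, fun _ => rfl, HahnSeries.SummableFamily.hsum_zero⟩

theorem hasFormalSum_single [DecidableEq κ] (k : κ) (h0 : ∀ j, j ≠ k → f j = 0) :
    HasFormalSum f (f k) := by
  refine ⟨HahnSeries.SummableFamily.single k (f k), fun j => ?_, HahnSeries.SummableFamily.hsum_single _ _⟩
  by_cases hj : j = k
  · subst hj; simp [HahnSeries.SummableFamily.single]
  · rw [h0 j hj]; simp [HahnSeries.SummableFamily.single, hj]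

/-- Iterated summation. -/
theorem HasFormalSum.prod_fiberwise {f : κ × ι → LaurentSeries ℤ} {g : κ → LaurentSeries ℤ}
    (h : HasFormalSum f s) (hg : ∀ k, HasFormalSum (fun i => f (k, i)) (g k)) :
    HasFormalSum g s := by
  -- If the fibre sum over `k` has a nonzero coefficient at `e`, then so does some term of that
  -- fibre.
  have hsum : FormallySummable g := by
    refine formallySummable_of_finite fun d => ((h.summable.finite d).image Prod.fst).subset ?_
    rintro k ⟨e, hed, he⟩
    rw [(hg k).coeff] at he
    obtain ⟨i, hi⟩ : ∃ i, (f (k, i)).coeff e ≠ 0 := by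
      by_contra! h0
      exact he (finsum_eq_zero_of_forall_eq_zero h0)
    exact ⟨(k, i), ⟨e, hed, hi⟩, rfl⟩
  have h1 := hsum.hasFormalSum
  suffices formalSum g = s by rwa [this] at h1
  ext d
  rw [h1.coeff, h.coeff, finsum_curry _ ((h.summable.finite d).subset fun p hp => ⟨d, le_rfl, hp⟩)]
  exact finsum_congr fun k => (hg k).coeff d

end FormalSums

/-! ## Monomials -/

theorem negSqrtQPow_add (a b : ℤ) : negSqrtQPow (a + b) = negSqrtQPow a * negSqrtQPow b := by
  simp [negSqrtQPow, HahnSeries.single_mul_single, Int.negOnePow_add]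

theorem negSqrtQPow_zero : negSqrtQPow 0 = 1 := by
  simp [negSqrtQPow]

theorem negSqrtQPow_sum {ι : Type*} (s : Finset ι) (f : ι → ℤ) :
    negSqrtQPow (∑ i ∈ s, f i) = ∏ i ∈ s, negSqrtQPow (f i) := by
  classical
  induction s using Finset.induction_on with
  | empty => simp [negSqrtQPow_zero]
  | insert a s ha ih => rw [Finset.sum_insert ha, Finset.prod_insert ha, negSqrtQPow_add, ih]

/-- The monomial `X^m`, where `X = q^{1/2}`. -/
noncomputable def sqrtQPow (m : ℤ) : LaurentSeries ℤ := HahnSeries.single m 1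

theorem sqrtQPow_add (a b : ℤ) : sqrtQPow (a + b) = sqrtQPow a * sqrtQPow b := by
  simp [sqrtQPow, HahnSeries.single_mul_single]

theorem sqrtQPow_zero : sqrtQPow 0 = 1 := rfl

theorem negSqrtQPow_two_mul (m : ℤ) : negSqrtQPow (2 * m) = sqrtQPow (2 * m) := by
  simp [negSqrtQPow, sqrtQPow, Int.negOnePow_even]

theorem coeff_sqrtQPow_mul (m : ℤ) (x : LaurentSeries ℤ) (d : ℤ) :
    (sqrtQPow m * x).coeff d = x.coeff (d - m) := by
  simp [sqrtQPow, HahnSeries.coeff_single_mul]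

theorem coeff_negSqrtQPow_mul (m : ℤ) (x : LaurentSeries ℤ) (d : ℤ) :
    (negSqrtQPow m * x).coeff d = (m.negOnePow : ℤˣ) * x.coeff (d - m) := by
  simp [negSqrtQPow, HahnSeries.coeff_single_mul]

theorem coeff_mul_eq_zero_of_lt {x y : LaurentSeries ℤ} {a b : ℤ} (hx : ∀ d < a, x.coeff d = 0)
    (hy : ∀ d < b, y.coeff d = 0) : ∀ d < a + b, (x * y).coeff d = 0 := by
  intro d hd
  rw [HahnSeries.coeff_mul]
  refine Finset.sum_eq_zero fun p hp => ?_
  have hp' := (Finset.mem_antidiagonal.1 hp).2.2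
  by_cases h1 : p.1 < a
  · rw [hx _ h1, zero_mul]
  · rw [hy p.2 (by omega), mul_zero]

theorem coeff_prod_eq_zero_of_lt {ι : Type*} (s : Finset ι) (x : ι → LaurentSeries ℤ) (a : ι → ℤ)
    (hx : ∀ i, ∀ d < a i, (x i).coeff d = 0) : ∀ d < ∑ i ∈ s, a i, (∏ i ∈ s, x i).coeff d = 0 := by
  classical
  induction s using Finset.induction_on with
  | empty =>
    intro d hd
    simp only [Finset.sum_empty] at hd
    simp only [Finset.prod_empty, HahnSeries.coeff_one, if_neg hd.ne]
  | insert i s hi ih =>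
    rw [Finset.sum_insert hi, Finset.prod_insert hi]
    exact coeff_mul_eq_zero_of_lt (hx i) ih

/-! ## The tetrahedron index -/

/-- `1 / (q)_n` as a Laurent series; it vanishes for `n < 0`. -/
noncomputable def qInv (n : ℤ) : LaurentSeries ℤ := HahnSeries.ofPowerSeries ℤ ℤ (qPochInv n)

theorem qInv_of_neg {n : ℤ} (h : n < 0) : qInv n = 0 := by
  simp [qInv, qPochInv, h]

theorem coeff_qInv_of_neg (n : ℤ) {d : ℤ} (h : d < 0) : (qInv n).coeff d = 0 := by
  unfold qInv
  rw [HahnSeries.ofPowerSeries_apply, HahnSeries.embDomain_of_notMem_range]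
  rintro ⟨j, hj⟩
  have hj' : (j : ℤ) = d := hj
  omega

theorem qInv_zero : qInv 0 = 1 := by
  have h := qPoch_mul_inv 0
  simp only [qPoch, Finset.range_zero, Finset.prod_empty, one_mul] at h
  rw [qInv, show ((0 : ℤ)) = ((0 : ℕ) : ℤ) from rfl, h, map_one]

/-- Valid for all integers because `1/(q)_n` is zero for negative `n`; at `n = 0` the factor `1 -
q^0` kills the left side. Sums can therefore run over all of ℤ and be shifted without boundary
terms. -/
theorem one_sub_sqrtQPow_mul_qInv (n : ℤ) : (1 - sqrtQPow (2 * n)) * qInv n = qInv (n - 1) := by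
  rcases lt_trichotomy n 0 with h | rfl | h
  · rw [qInv_of_neg h, qInv_of_neg (by omega), mul_zero]
  · rw [qInv_of_neg (by omega : (0 : ℤ) - 1 < 0), mul_zero, sqrtQPow_zero, sub_self, zero_mul]
  · obtain ⟨k, rfl⟩ : ∃ k : ℕ, n = k + 1 := ⟨(n - 1).toNat, by omega⟩
    have h1 : qPoch (k + 1) * qPochInv ((k : ℤ) + 1) = 1 := by exact_mod_cast qPoch_mul_inv (k + 1)
    have h0 := qPoch_mul_inv k
    have hs : qPoch (k + 1) = qPoch k * (1 - PowerSeries.X ^ (2 * (k + 1))) := by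
      simp [qPoch, Finset.prod_range_succ]
    have h2 : (1 - PowerSeries.X ^ (2 * (k + 1))) * qPochInv ((k : ℤ) + 1) = qPochInv k := by
      calc (1 - PowerSeries.X ^ (2 * (k + 1))) * qPochInv ((k : ℤ) + 1)
          = (qPoch k * qPochInv k) *
            ((1 - PowerSeries.X ^ (2 * (k + 1))) * qPochInv ((k : ℤ) + 1)) := by rw [h0, one_mul]
        _ = qPochInv k * (qPoch k * (1 - PowerSeries.X ^ (2 * (k + 1))) *
            qPochInv ((k : ℤ) + 1)) := by ring
        _ = qPochInv k := by rw [← hs, h1, mul_one]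
    rw [show (k : ℤ) + 1 - 1 = k by ring, qInv, qInv, ← h2, map_mul, map_sub, map_one, map_pow,
      HahnSeries.ofPowerSeries_X, HahnSeries.single_pow, sqrtQPow]
    simp

theorem one_sub_sqrtQPow_ne_zero {n : ℤ} (h : n ≠ 0) : (1 - sqrtQPow n : LaurentSeries ℤ) ≠ 0 := by
  intro h0
  have := congrArg (fun x : LaurentSeries ℤ => x.coeff 0) h0
  simp [sqrtQPow, HahnSeries.coeff_one, h.symm] at this

theorem single_eq_sqrtQPow (a : ℤ) (n : ℤ) :
    (HahnSeries.single a ((n.negOnePow : ℤˣ) : ℤ) : LaurentSeries ℤ) =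
      negSqrtQPow n * sqrtQPow (a - n) := by
  simp [negSqrtQPow, sqrtQPow, HahnSeries.single_mul_single]

/-- The terms of the tetrahedron index, indexed by all integers. -/
noncomputable def tetTerm (m e : ℤ) (n : ℤ) : LaurentSeries ℤ :=
  negSqrtQPow n * sqrtQPow (n ^ 2 - (2 * n + e) * m) * (qInv n * qInv (n + e))

theorem tetTerm_natCast (m e : ℤ) (n : ℕ) : tetTerm m e n = tetIndexTerm m e n := by
  unfold tetTerm tetIndexTerm
  have h1 : ((-1 : ℤ) ^ n) = (((n : ℤ).negOnePow : ℤˣ) : ℤ) := by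
    simp [Int.negOnePow_def]
  rw [h1, single_eq_sqrtQPow, map_mul]
  unfold qInv
  congr 3
  ring

theorem hasFormalSum_tetIndex (m e : ℤ) : HasFormalSum (tetTerm m e) (tetIndex m e) := by
  refine (formallySummable_tetIndexTerm m e).hasFormalSum.extend (fun n : ℕ => (n : ℤ))
    Nat.cast_injective (fun n => tetTerm_natCast m e n) fun n hn => ?_
  have : n < 0 := by
    by_contra h
    exact hn ⟨n.toNat, by simp; omega⟩
  simp [tetTerm, qInv_of_neg this]

/-- Term by term the left side carries a factor `1 - q^n`, which turns `1/(q)_n` into `1/(q)_{n-1}`;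
a shift of the summation index by one then gives the right side. -/
theorem tetIndex_recurrence_left (m e : ℤ) :
    tetIndex m e - sqrtQPow (-e) * tetIndex (m - 1) e =
      negSqrtQPow 1 * (sqrtQPow (-m - e) * tetIndex (m - 1) (e + 1)) := by
  have h1 := (hasFormalSum_tetIndex m e).sub
    ((hasFormalSum_tetIndex (m - 1) e).mul_left (sqrtQPow (-e)))
  have h2 := ((hasFormalSum_tetIndex (m - 1) (e + 1)).mul_left
    (sqrtQPow (-m - e))).mul_left (negSqrtQPow 1)
  refine h1.unique (h2.equiv (Equiv.subRight (1 : ℤ)) fun n => ?_)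
  have h3 := one_sub_sqrtQPow_mul_qInv n
  simp only [Equiv.subRight_apply]
  unfold tetTerm
  rw [← h3, show n - 1 + (e + 1) = n + e by ring]
  have e1 : sqrtQPow ((n : ℤ) ^ 2 - (2 * n + e) * (m - 1)) =
      sqrtQPow (n ^ 2 - (2 * n + e) * m) * sqrtQPow (2 * n) * sqrtQPow e := by
    rw [← sqrtQPow_add, ← sqrtQPow_add]; congr 1; ring
  have e2 : sqrtQPow (-m - e) * sqrtQPow ((n - 1) ^ 2 - (2 * (n - 1) + (e + 1)) * (m - 1)) =
      sqrtQPow (n ^ 2 - (2 * n + e) * m) := by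
    rw [← sqrtQPow_add]; congr 1; ring
  have e3 : negSqrtQPow 1 * negSqrtQPow (n - 1) = negSqrtQPow n := by
    rw [← negSqrtQPow_add]; congr 1; ring
  have e4 : sqrtQPow (-e) * sqrtQPow e = 1 := by rw [← sqrtQPow_add, neg_add_cancel, sqrtQPow_zero]
  rw [e1, ← e2, ← e3]
  linear_combination (-(negSqrtQPow 1 * negSqrtQPow (n - 1)) * (sqrtQPow (-m - e) * sqrtQPow ((n - 1) ^ 2 - (2 * (n - 1) + (e + 1)) * (m - 1))) * sqrtQPow (2 * n) * (qInv n * qInv (n + e))) * e4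

/-- Here the factor is `1 - q^{n+e}` and acts on `1/(q)_{n+e}`, so no shift is needed. -/
theorem tetIndex_recurrence_right (m e : ℤ) :
    tetIndex m e - sqrtQPow e * tetIndex (m - 1) e = sqrtQPow (-m) * tetIndex m (e - 1) := by
  have h1 := (hasFormalSum_tetIndex m e).sub
    ((hasFormalSum_tetIndex (m - 1) e).mul_left (sqrtQPow e))
  have h2 := (hasFormalSum_tetIndex m (e - 1)).mul_left (sqrtQPow (-m))
  refine h1.unique (h2.congr fun n => ?_)
  have h3 := one_sub_sqrtQPow_mul_qInv (n + e)
  unfold tetTerm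
  rw [show n + (e - 1) = n + e - 1 by ring, ← h3]
  have e1 : sqrtQPow e * sqrtQPow ((n : ℤ) ^ 2 - (2 * n + e) * (m - 1)) =
      sqrtQPow (n ^ 2 - (2 * n + e) * m) * sqrtQPow (2 * (n + e)) := by
    rw [← sqrtQPow_add, ← sqrtQPow_add]; congr 1; ring
  have e2 : sqrtQPow (-m) * sqrtQPow (n ^ 2 - (2 * n + (e - 1)) * m) =
      sqrtQPow (n ^ 2 - (2 * n + e) * m) := by
    rw [← sqrtQPow_add]; congr 1; ring
  linear_combination (-negSqrtQPow n * (qInv n * qInv (n + e))) * e1 -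
    (negSqrtQPow n * (qInv n * ((1 - sqrtQPow (2 * (n + e))) * qInv (n + e)))) * e2

/-- The symmetric form `J_Δ(a,b,c) = (-q^{1/2})^{-b} I_Δ(b-c, a-b)` of the tetrahedron index. -/
noncomputable def tetJ (a b c : ℤ) : LaurentSeries ℤ := negSqrtQPow (-b) * tetIndex (b - c) (a - b)

theorem tetIndex_eq_tetJ (a b c : ℤ) : tetIndex (b - c) (a - b) = negSqrtQPow b * tetJ a b c := by
  rw [tetJ, ← mul_assoc, ← negSqrtQPow_add, add_neg_cancel, negSqrtQPow_zero, one_mul]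

/-- `tetIndex` sees only differences of the entries, so only the prefactor changes. This is how
constants on a tetrahedron are traded for powers of `-q^{1/2}`. -/
theorem tetJ_add (a b c s : ℤ) : tetJ (a + s) (b + s) (c + s) = negSqrtQPow (-s) * tetJ a b c := by
  unfold tetJ
  rw [← mul_assoc, ← negSqrtQPow_add]
  congr 2 <;> ring

/-- This and the next two recurrences express J_Δ by one value with an entry raised and one with an
entry lowered. Comparing two of them yields the symmetries. -/
theorem tetJ_recurrence_left (a b c : ℤ) : tetJ a b c =
    sqrtQPow (b - a) * tetJ a b (c + 1) + sqrtQPow (c - a) * tetJ a (b - 1) c := by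
  have h := tetIndex_recurrence_left (b - c) (a - b)
  unfold tetJ
  rw [show b - (c + 1) = b - c - 1 by ring, show b - 1 - c = b - c - 1 by ring,
    show a - (b - 1) = a - b + 1 by ring, show -(b - 1) = -b + 1 by ring, negSqrtQPow_add,
    show b - a = -(a - b) by ring, show c - a = -(b - c) - (a - b) by ring]
  linear_combination negSqrtQPow (-b) * h

theorem tetJ_recurrence_right (a b c : ℤ) : tetJ a b c =
    sqrtQPow (a - b) * tetJ a b (c + 1) + sqrtQPow (c - b) * tetJ (a - 1) b c := by
  have h := tetIndex_recurrence_right (b - c) (a - b)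
  unfold tetJ
  rw [show b - (c + 1) = b - c - 1 by ring, show a - 1 - b = a - b - 1 by ring,
    show c - b = -(b - c) by ring]
  linear_combination negSqrtQPow (-b) * h

theorem tetJ_recurrence_outer (a b c : ℤ) : tetJ a b c =
    sqrtQPow (b - c) * tetJ (a + 1) b c + sqrtQPow (a - c) * tetJ a (b - 1) c := by
  have h := tetJ_recurrence_right (a + 1) b c
  have h1 := tetJ_add a (b - 1) c 1
  rw [sub_add_cancel] at h1
  rw [h1, add_sub_cancel_right] at h
  have e1 : sqrtQPow (b - c) * sqrtQPow (c - b) = 1 := by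
    rw [← sqrtQPow_add, ← sqrtQPow_zero]; congr 1; ring
  have e2 : sqrtQPow (b - c) * (sqrtQPow (a + 1 - b) * negSqrtQPow (-1)) =
      -sqrtQPow (a - c) := by
    simp only [sqrtQPow, negSqrtQPow, HahnSeries.single_mul_single]
    simp [Int.negOnePow_neg]
    ring_nf
  rw [h]
  linear_combination (-tetJ a b c) * e1 - tetJ a (b - 1) c * e2

theorem sqrtQPow_mul_cancel {a : ℤ} {x y : LaurentSeries ℤ} (h : sqrtQPow a * x = sqrtQPow a * y) :
    x = y := by
  have e : sqrtQPow (-a) * sqrtQPow a = 1 := by rw [← sqrtQPow_add, neg_add_cancel, sqrtQPow_zero]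
  rw [← one_mul x, ← one_mul y, ← e, mul_assoc, h, mul_assoc]

/-- Induction on |a - b|. The left recurrence at (a, a-k, c) and the right recurrence at (a-k, a, c)
have the same coefficients; by induction two of the three pairs of terms agree, hence so does the
third, which has difference k + 1. -/
theorem tetJ_swap_left (a b c : ℤ) : tetJ a b c = tetJ b a c := by
  suffices H : ∀ k : ℕ, ∀ a c, tetJ a (a - k) c = tetJ (a - k) a c by
    rcases le_total b a with h | h
    · have := H (a - b).toNat a c
      rwa [show a - ((a - b).toNat : ℤ) = b by omega] at this
    · have := H (b - a).toNat b c
      rw [show b - ((b - a).toNat : ℤ) = a by omega] at this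
      exact this.symm
  intro k
  induction k with
  | zero => intro a c; simp
  | succ k ih =>
    intro a c
    have h1 := tetJ_recurrence_left a (a - k) c
    have h2 := tetJ_recurrence_right (a - k) a c
    rw [ih, ih] at h1
    have h3 := h1.symm.trans h2
    rw [show a - ((k + 1 : ℕ) : ℤ) = a - k - 1 by push_cast; ring]
    exact sqrtQPow_mul_cancel (add_left_cancel h3)

/-- The same induction on |a - c|, now comparing the left and the outer recurrence. -/
theorem tetJ_swap_outer (a b c : ℤ) : tetJ a b c = tetJ c b a := by
  suffices H : ∀ k : ℕ, ∀ a b, tetJ a b (a + k) = tetJ (a + k) b a by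
    rcases le_total a c with h | h
    · have := H (c - a).toNat a b
      rwa [show a + ((c - a).toNat : ℤ) = c by omega] at this
    · have := H (a - c).toNat c b
      rw [show c + ((a - c).toNat : ℤ) = a by omega] at this
      exact this.symm
  intro k
  induction k with
  | zero => intro a c; simp
  | succ k ih =>
    intro a b
    have h1 := tetJ_recurrence_left a b (a + k)
    have h2 := tetJ_recurrence_outer (a + k) b a
    rw [ih, ih] at h1
    have h3 := h1.symm.trans h2
    rw [show a + ((k + 1 : ℕ) : ℤ) = a + k + 1 by push_cast; ring]
    exact sqrtQPow_mul_cancel (add_right_cancel h3)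

theorem tetJ_swap_right (a b c : ℤ) : tetJ a b c = tetJ a c b := by
  rw [tetJ_swap_left, tetJ_swap_outer, tetJ_swap_left]

/-- A lower bound for the degree of `J_Δ`, in powers of `q^{1/2}`. -/
def degJ (a b c : ℤ) : ℤ :=
  -min a (min b c) + (a - min a (min b c)) * (b - min a (min b c)) +
    (b - min a (min b c)) * (c - min a (min b c)) + (c - min a (min b c)) * (a - min a (min b c))

/-- By symmetry the middle entry may be assumed minimal. Then `tetIndex m e` is used with `m ≤ 0 ≤
e`, the lowest exponents of its terms increase with `n`, and the bound is the exponent at `n = 0`.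
-/
theorem coeff_tetJ_eq_zero (a b c d : ℤ) (h : d < degJ a b c) : (tetJ a b c).coeff d = 0 := by
  have key : ∀ a b c, b ≤ a → b ≤ c → d < -b + (a - b) * (c - b) → (tetJ a b c).coeff d = 0 := by
    intro a b c hab hbc h
    rw [tetJ, coeff_negSqrtQPow_mul, (hasFormalSum_tetIndex _ _).coeff,
      finsum_eq_zero_of_forall_eq_zero, mul_zero]
    intro n
    by_cases hn : n < 0
    · simp [tetTerm, qInv_of_neg hn]
    · rw [tetTerm, negSqrtQPow, sqrtQPow, HahnSeries.single_mul_single, HahnSeries.coeff_single_mul,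
        coeff_mul_eq_zero_of_lt (fun d hd => coeff_qInv_of_neg n hd)
          (fun d hd => coeff_qInv_of_neg (n + (a - b)) hd), mul_zero]
      nlinarith [mul_nonneg (not_lt.1 hn) (sub_nonneg.2 hbc)]
  rcases le_total a b with hab | hab <;> rcases le_total b c with hbc | hbc <;>
    rcases le_total a c with hac | hac <;>
    simp only [degJ, min_eq_left, min_eq_right, hab, hbc, hac] at h <;>
    first
    | exact key a b c (by omega) (by omega) (by linarith)
    | (rw [tetJ_swap_left]; exact key b a c (by omega) (by omega) (by linarith))
    | (rw [tetJ_swap_right]; exact key a c b (by omega) (by omega) (by linarith))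

/-! ## The pentagon identity -/

theorem sqrtQPow_neg_mul_self (a : ℤ) : sqrtQPow (-a) * sqrtQPow a = 1 := by
  rw [← sqrtQPow_add, neg_add_cancel, sqrtQPow_zero]

theorem qInv_mul_cancel {n : ℤ} (h : 0 < n) {x y : LaurentSeries ℤ}
    (hxy : (1 - sqrtQPow (2 * n)) * x = (1 - sqrtQPow (2 * n)) * y) : x = y :=
  mul_left_cancel₀ (one_sub_sqrtQPow_ne_zero (by omega)) hxy

/-- The summand of the first `q`-Vandermonde identity. -/
noncomputable def vanderTerm (a b n : ℤ) : LaurentSeries ℤ :=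
  negSqrtQPow n * sqrtQPow (n ^ 2 - 2 * n) * (qInv n * qInv (a - n) * qInv (b - n))

theorem hasFormalSum_of_support {f : ℤ → LaurentSeries ℤ} (a : ℤ)
    (h0 : ∀ n, n < 0 → f n = 0) (h1 : ∀ n, a < n → f n = 0) : FormallySummable f :=
  formallySummable_of_finite fun d => (Set.finite_Icc 0 a).subset fun n ⟨e, _, he⟩ => by
    by_contra hn
    rw [Set.mem_Icc, not_and_or, not_le, not_le] at hn
    rcases hn with hn | hn
    · exact he (by rw [h0 n hn, HahnSeries.coeff_zero])
    · exact he (by rw [h1 n hn, HahnSeries.coeff_zero])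

theorem summable_vanderTerm (a b : ℤ) : FormallySummable (vanderTerm a b) :=
  hasFormalSum_of_support a (fun n hn => by simp [vanderTerm, qInv_of_neg hn])
    (fun n hn => by simp [vanderTerm, qInv_of_neg (by omega : a - n < 0)])

/-- In q-notation the summand is (-1)^n q^{n(n-1)/2} / ((q)_n (q)_{a-n} (q)_{b-n}) and the sum
q^{ab} / ((q)_a (q)_b). Induction on `a`, after multiplication by the non-zero-divisor 1 - q^a; for
negative `a` everything vanishes. -/
theorem hasFormalSum_vanderTerm (a b : ℤ) :
    HasFormalSum (vanderTerm a b) (sqrtQPow (2 * a * b) * (qInv a * qInv b)) := by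
  by_cases ha : a < 0
  · rw [qInv_of_neg ha, zero_mul, mul_zero]
    refine hasFormalSum_zero.congr fun n => ?_
    by_cases hn : n < 0
    · simp [vanderTerm, qInv_of_neg hn]
    · simp [vanderTerm, qInv_of_neg (by omega : a - n < 0)]
  obtain ⟨k, rfl⟩ : ∃ k : ℕ, a = k := ⟨a.toNat, by omega⟩
  induction k with
  | zero =>
    have h := hasFormalSum_single (f := vanderTerm (0 : ℕ) b) 0 fun n hn => by
      rcases lt_or_gt_of_ne hn with hn | hn
      · simp [vanderTerm, qInv_of_neg hn]
      · simp [vanderTerm, qInv_of_neg (by omega : -n < 0)]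
    simpa [vanderTerm, qInv_zero, sqrtQPow_zero, negSqrtQPow_zero] using h
  | succ k ih =>
    have ih := ih (by omega)
    have hs := (summable_vanderTerm (k + 1 : ℕ) b).hasFormalSum
    suffices H : formalSum (vanderTerm (k + 1 : ℕ) b) =
        sqrtQPow (2 * ((k + 1 : ℕ) : ℤ) * b) * (qInv ((k + 1 : ℕ) : ℤ) * qInv b) by rwa [H] at hs
    refine qInv_mul_cancel (n := ((k + 1 : ℕ) : ℤ)) (by omega) ?_
    -- split `1 - q^a = (1 - q^n) + q^n (1 - q^{a-n})` and shift `n` in the first part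
    let u : ℤ → LaurentSeries ℤ := fun n => negSqrtQPow n * sqrtQPow (n ^ 2 - 2 * n) *
      ((1 - sqrtQPow (2 * n)) * qInv n * qInv ((k + 1 : ℕ) - n) * qInv (b - n))
    have hu : HasFormalSum u (formalSum u) :=
      (hasFormalSum_of_support (k + 1 : ℕ) (fun n hn => by simp [u, qInv_of_neg hn])
        (fun n hn => by simp only [u]; rw [qInv_of_neg (by omega : ((k + 1 : ℕ) : ℤ) - n < 0)]; simp)
        ).hasFormalSum
    have h1 := (hs.mul_left (1 - sqrtQPow (2 * ((k + 1 : ℕ) : ℤ)))).sub hu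
    have h2 := hu.equiv (Equiv.addRight (1 : ℤ)) (g := fun n => u (n + 1)) fun n => rfl
    have h3 := (h1.add h2)
    rw [sub_add_cancel] at h3
    refine h3.unique (((ih.mul_left (sqrtQPow (2 * b)))).congr fun n => ?_) |>.trans ?_
    · simp only [u, vanderTerm]
      have e1 := one_sub_sqrtQPow_mul_qInv (n + 1)
      have e2 := one_sub_sqrtQPow_mul_qInv (((k + 1 : ℕ) : ℤ) - n)
      have e3 := one_sub_sqrtQPow_mul_qInv (b - n)
      rw [add_sub_cancel_right] at e1
      rw [show ((k + 1 : ℕ) : ℤ) - n - 1 = k - n by push_cast; ring] at e2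
      rw [show ((k + 1 : ℕ) : ℤ) - (n + 1) = k - n by push_cast; ring,
        show b - (n + 1) = b - n - 1 by ring, e1, ← e2, ← e3,
        show (n + 1) ^ 2 - 2 * (n + 1) = (n ^ 2 - 2 * n) + 2 * n - 1 by ring, sub_eq_add_neg _ (1 : ℤ),
        sqrtQPow_add, sqrtQPow_add, negSqrtQPow_add,
        show 2 * ((k + 1 : ℕ) : ℤ) = 2 * n + 2 * (((k + 1 : ℕ) : ℤ) - n) by ring, sqrtQPow_add,
        show 2 * b = 2 * n + 2 * (b - n) by ring, sqrtQPow_add]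
      have e4 : negSqrtQPow 1 * sqrtQPow (-1) = -1 := by
        simp [negSqrtQPow, sqrtQPow, HahnSeries.single_mul_single]
      linear_combination (negSqrtQPow n * sqrtQPow (n ^ 2 - 2 * n) * sqrtQPow (2 * n) * qInv n *
        ((1 - sqrtQPow (2 * (((k + 1 : ℕ) : ℤ) - n))) * qInv (((k + 1 : ℕ) : ℤ) - n)) *
        ((1 - sqrtQPow (2 * (b - n))) * qInv (b - n))) * e4
    · have e2 := one_sub_sqrtQPow_mul_qInv (((k + 1 : ℕ) : ℤ))
      rw [show ((k + 1 : ℕ) : ℤ) - 1 = k by push_cast; ring] at e2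
      rw [← e2, show 2 * ((k + 1 : ℕ) : ℤ) * b = 2 * b + 2 * k * b by push_cast; ring,
        sqrtQPow_add]
      ring

/-- The summand of the second `q`-Vandermonde identity. -/
noncomputable def durfeeTerm (a b n : ℤ) : LaurentSeries ℤ :=
  sqrtQPow (2 * (a - n) * (b - n)) * (qInv n * qInv (a - n) * qInv (b - n))

theorem summable_durfeeTerm (a b : ℤ) : FormallySummable (durfeeTerm a b) :=
  hasFormalSum_of_support a (fun n hn => by simp [durfeeTerm, qInv_of_neg hn])
    (fun n hn => by simp [durfeeTerm, qInv_of_neg (by omega : a - n < 0)])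

/-- In q-notation the summand is q^{(a-n)(b-n)} / ((q)_n (q)_{a-n} (q)_{b-n}). The induction is the
previous one with the splitting 1 - q^a = (1 - q^{a-n}) + q^{a-n}(1 - q^n), in which the second part
is shifted. -/
theorem hasFormalSum_durfeeTerm (a b : ℤ) :
    HasFormalSum (durfeeTerm a b) (qInv a * qInv b) := by
  by_cases ha : a < 0
  · rw [qInv_of_neg ha, zero_mul]
    refine hasFormalSum_zero.congr fun n => ?_
    by_cases hn : n < 0
    · simp [durfeeTerm, qInv_of_neg hn]
    · simp [durfeeTerm, qInv_of_neg (by omega : a - n < 0)]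
  obtain ⟨k, rfl⟩ : ∃ k : ℕ, a = k := ⟨a.toNat, by omega⟩
  induction k with
  | zero =>
    have h := hasFormalSum_single (f := durfeeTerm (0 : ℕ) b) 0 fun n hn => by
      rcases lt_or_gt_of_ne hn with hn | hn
      · simp [durfeeTerm, qInv_of_neg hn]
      · simp [durfeeTerm, qInv_of_neg (by omega : -n < 0)]
    simpa [durfeeTerm, qInv_zero, sqrtQPow_zero] using h
  | succ k ih =>
    have ih := ih (by omega)
    have hs := (summable_durfeeTerm (k + 1 : ℕ) b).hasFormalSum
    suffices H : formalSum (durfeeTerm (k + 1 : ℕ) b) =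
        qInv ((k + 1 : ℕ) : ℤ) * qInv b by rwa [H] at hs
    refine qInv_mul_cancel (n := ((k + 1 : ℕ) : ℤ)) (by omega) ?_
    let u : ℤ → LaurentSeries ℤ := fun n => sqrtQPow (2 * ((k + 1 : ℕ) - n) * (b - n)) *
      sqrtQPow (2 * ((k + 1 : ℕ) - n)) *
      ((1 - sqrtQPow (2 * n)) * qInv n * qInv ((k + 1 : ℕ) - n) * qInv (b - n))
    have hu : HasFormalSum u (formalSum u) :=
      (hasFormalSum_of_support (k + 1 : ℕ) (fun n hn => by simp [u, qInv_of_neg hn])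
        (fun n hn => by simp only [u]; rw [qInv_of_neg (by omega : ((k + 1 : ℕ) : ℤ) - n < 0)]; simp)
        ).hasFormalSum
    have h1 := (hs.mul_left (1 - sqrtQPow (2 * ((k + 1 : ℕ) : ℤ)))).sub hu
    have h2 := hu.equiv (Equiv.addRight (1 : ℤ)) (g := fun n => u (n + 1)) fun n => rfl
    have h3 := (h1.add h2)
    rw [sub_add_cancel] at h3
    refine h3.unique (ih.congr fun n => ?_) |>.trans ?_
    · simp only [u, durfeeTerm]
      have e1 := one_sub_sqrtQPow_mul_qInv (n + 1)
      have e2 := one_sub_sqrtQPow_mul_qInv (((k + 1 : ℕ) : ℤ) - n)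
      have e3 := one_sub_sqrtQPow_mul_qInv (b - n)
      rw [add_sub_cancel_right] at e1
      rw [show ((k + 1 : ℕ) : ℤ) - n - 1 = k - n by push_cast; ring] at e2
      rw [show ((k + 1 : ℕ) : ℤ) - (n + 1) = k - n by push_cast; ring,
        show b - (n + 1) = b - n - 1 by ring, e1, ← e2, ← e3,
        show 2 * (k - n) * (b - n - 1) = 2 * (k - n) * (b - n) + -(2 * (k - n)) by ring,
        sqrtQPow_add _ (-(2 * (k - n))),
        show 2 * ((k + 1 : ℕ) : ℤ) = 2 * n + 2 * (((k + 1 : ℕ) : ℤ) - n) by ring, sqrtQPow_add (2 * n),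
        show 2 * (((k + 1 : ℕ) : ℤ) - n) * (b - n) = 2 * (k - n) * (b - n) + 2 * (b - n) by
          push_cast; ring, sqrtQPow_add _ (2 * (b - n))]
      have e4 := sqrtQPow_neg_mul_self (2 * (k - n))
      linear_combination (sqrtQPow (2 * (k - n) * (b - n)) * qInv n *
        ((1 - sqrtQPow (2 * (((k + 1 : ℕ) : ℤ) - n))) * qInv (((k + 1 : ℕ) : ℤ) - n)) *
        ((1 - sqrtQPow (2 * (b - n))) * qInv (b - n))) * e4
    · have e2 := one_sub_sqrtQPow_mul_qInv (((k + 1 : ℕ) : ℤ))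
      rw [show ((k + 1 : ℕ) : ℤ) - 1 = k by push_cast; ring] at e2
      rw [← e2]
      ring

/-- The summand of the fourfold sum behind the pentagon identity. -/
noncomputable def pentagonTerm (m₁ m₂ e₁ e₂ : ℤ) (p : ℤ × (ℤ × ℤ) × ℤ) : LaurentSeries ℤ :=
  sqrtQPow (2 * p.1) * (tetTerm m₁ (e₁ + p.1) p.2.1.1 * tetTerm m₂ (e₂ + p.1) p.2.1.2 *
    tetTerm (m₁ + m₂) p.1 p.2.2)

theorem tetTerm_eq_zero {m e n : ℤ} (h : n < 0 ∨ n + e < 0) : tetTerm m e n = 0 := by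
  rcases h with h | h <;> simp [tetTerm, qInv_of_neg h]

theorem coeff_tetTerm_eq_zero {m e n d : ℤ} (h : d < n + n ^ 2 - (2 * n + e) * m) :
    (tetTerm m e n).coeff d = 0 := by
  rw [tetTerm, mul_assoc, coeff_negSqrtQPow_mul, coeff_sqrtQPow_mul, coeff_mul_eq_zero_of_lt
    (fun d hd => coeff_qInv_of_neg n hd) (fun d hd => coeff_qInv_of_neg (n + e) hd), mul_zero]
  linarith

/-- On the support, the contributions to the exponents that contain `m₁`, `m₂` or their sum are
nonnegative because of the sign conditions. The remaining exponent 2k + a + a² + b + b² + c + c² is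
proper on the support, where k ≥ -c. -/
theorem summable_pentagonTerm {m₁ m₂ : ℤ} (e₁ e₂ : ℤ) (h₁ : m₁ ≤ 0) (h₂ : m₂ ≤ 0) :
    FormallySummable (pentagonTerm m₁ m₂ e₁ e₂) := by
  refine formallySummable_of_finite fun d => ?_
  have hI : (Set.Icc (-(|d| + 1)) (|d| + 1)).Finite := Set.finite_Icc _ _
  refine (hI.prod ((hI.prod hI).prod hI)).subset ?_
  rintro ⟨k, ⟨a, b⟩, c⟩ ⟨d', hd', hne⟩
  have hd : d' ≤ |d| := hd'.trans (le_abs_self d)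
  have hn : ∀ {m e n : ℤ}, tetTerm m e n ≠ 0 → 0 ≤ n ∧ 0 ≤ n + e := fun h => by
    by_contra hcon
    exact h (tetTerm_eq_zero (by omega))
  have hne' : pentagonTerm m₁ m₂ e₁ e₂ ⟨k, ⟨a, b⟩, c⟩ ≠ 0 := fun h => hne (by rw [h]; rfl)
  have hp := right_ne_zero_of_mul hne'
  obtain ⟨ha, ha'⟩ := hn (left_ne_zero_of_mul (left_ne_zero_of_mul hp))
  obtain ⟨hb, hb'⟩ := hn (right_ne_zero_of_mul (left_ne_zero_of_mul hp))
  obtain ⟨hc, hc'⟩ := hn (right_ne_zero_of_mul hp)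
  have hdeg : 2 * k + (a + a ^ 2 + (b + b ^ 2) + (c + c ^ 2)) ≤ d' := by
    by_contra hlt
    push Not at hlt
    refine hne ?_
    unfold pentagonTerm
    rw [coeff_sqrtQPow_mul]
    refine coeff_mul_eq_zero_of_lt (a := a + a ^ 2 + (b + b ^ 2)) (b := c + c ^ 2)
      (coeff_mul_eq_zero_of_lt (a := a + a ^ 2) (b := b + b ^ 2)
        (fun d hd => coeff_tetTerm_eq_zero ?_) (fun d hd => coeff_tetTerm_eq_zero ?_))
      (fun d hd => coeff_tetTerm_eq_zero ?_) _ (by simp only; linarith)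
    · simp only at *; nlinarith
    · simp only at *; nlinarith
    · simp only at *; nlinarith
  -- As `k ≥ -c`, the degree is at least `c ^ 2 - c` plus nonnegative terms, so this bounds `c`, and
  -- then the other indices.
  have hc2 : c ≤ c ^ 2 - c + 1 := by nlinarith [sq_nonneg (c - 1)]
  have := sq_nonneg a
  have := sq_nonneg b
  have := abs_nonneg d
  simp only [Set.mem_prod, Set.mem_Icc]
  have := sq_nonneg c
  refine ⟨⟨?_, ?_⟩, ⟨⟨?_, ?_⟩, ?_, ?_⟩, ?_, ?_⟩ <;> nlinarith

/-- The change of summation variables behind the pentagon identity. -/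
def pentagonEquiv : (ℤ × ℤ) × (ℤ × ℤ) ≃ ℤ × (ℤ × ℤ) × ℤ where
  toFun x := (x.2.1 - x.2.2, (x.1.1 - x.2.1, x.1.2 - x.2.1), x.2.2)
  invFun y := ((y.2.1.1 + (y.1 + y.2.2), y.2.1.2 + (y.1 + y.2.2)), (y.1 + y.2.2, y.2.2))
  left_inv x := by ext <;> simp
  right_inv y := by ext <;> simp

theorem pentagonTerm_pentagonEquiv (m₁ m₂ e₁ e₂ r₁ r₂ p n : ℤ) :
    pentagonTerm m₁ m₂ e₁ e₂ (pentagonEquiv ((r₁, r₂), (p, n))) =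
      negSqrtQPow (r₁ + r₂) *
        sqrtQPow ((r₁ - r₂) ^ 2 - (2 * r₁ + e₁) * m₁ - (2 * r₂ + e₂) * m₂) *
        (durfeeTerm r₁ r₂ p * vanderTerm (r₁ + e₁) (r₂ + e₂) n) := by
  simp only [pentagonTerm, pentagonEquiv, Equiv.coe_fn_mk, tetTerm, durfeeTerm, vanderTerm]
  rw [show r₁ - p + (e₁ + (p - n)) = r₁ + e₁ - n by ring,
    show r₂ - p + (e₂ + (p - n)) = r₂ + e₂ - n by ring, show n + (p - n) = p by ring]
  have key : sqrtQPow (2 * (p - n)) *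
      ((negSqrtQPow (r₁ - p) * sqrtQPow ((r₁ - p) ^ 2 - (2 * (r₁ - p) + (e₁ + (p - n))) * m₁)) *
      (negSqrtQPow (r₂ - p) * sqrtQPow ((r₂ - p) ^ 2 - (2 * (r₂ - p) + (e₂ + (p - n))) * m₂)) *
      (negSqrtQPow n * sqrtQPow (n ^ 2 - (2 * n + (p - n)) * (m₁ + m₂)))) =
      negSqrtQPow (r₁ + r₂) *
        sqrtQPow ((r₁ - r₂) ^ 2 - (2 * r₁ + e₁) * m₁ - (2 * r₂ + e₂) * m₂) *
        (sqrtQPow (2 * (r₁ - p) * (r₂ - p)) * (negSqrtQPow n * sqrtQPow (n ^ 2 - 2 * n))) := by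
    simp only [negSqrtQPow, sqrtQPow, HahnSeries.single_mul_single, one_mul, mul_one]
    have hp : (((r₁ - p).negOnePow : ℤˣ) : ℤ) * (((r₂ - p).negOnePow : ℤˣ) : ℤ) =
        (((r₁ + r₂).negOnePow : ℤˣ) : ℤ) := by
      rw [← Units.val_mul, ← Int.negOnePow_add, show r₁ - p + (r₂ - p) = r₁ + r₂ - 2 * p by ring,
        Int.negOnePow_sub, Int.negOnePow_even (2 * p) (even_two_mul p)]
      simp
    rw [hp]
    congr 1
    ring_nf
  linear_combination (qInv (r₁ - p) * qInv (r₁ + e₁ - n) * (qInv (r₂ - p) * qInv (r₂ + e₂ - n)) *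
    (qInv n * qInv p)) * key

/-- One fourfold family is summed in two ways. For fixed `k` the other three sums give three
tetrahedron indices. After the substitution `pentagonEquiv`, for fixed (r₁, r₂) the family factors
into a `durfeeTerm` in one variable and a `vanderTerm` in the other; their sums produce exactly the
four q-factorials of a product of two terms, and the factor q^{(r₁+e₁)(r₂+e₂)} accounts for the
shifts of `m₁` and `m₂`. -/
theorem tetIndex_pentagon {m₁ m₂ : ℤ} (e₁ e₂ : ℤ) (h₁ : m₁ ≤ 0) (h₂ : m₂ ≤ 0) :
    HasFormalSum (fun k : ℤ => sqrtQPow (2 * k) *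
      (tetIndex m₁ (e₁ + k) * tetIndex m₂ (e₂ + k) * tetIndex (m₁ + m₂) k))
      (tetIndex (m₁ - e₂) e₁ * tetIndex (m₂ - e₁) e₂) := by
  have hS := (summable_pentagonTerm e₁ e₂ h₁ h₂).hasFormalSum
  have hl := hS.prod_fiberwise (g := fun k : ℤ => sqrtQPow (2 * k) *
      (tetIndex m₁ (e₁ + k) * tetIndex m₂ (e₂ + k) * tetIndex (m₁ + m₂) k)) fun k =>
    (((hasFormalSum_tetIndex m₁ (e₁ + k)).mul (hasFormalSum_tetIndex m₂ (e₂ + k))).mul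
      (hasFormalSum_tetIndex (m₁ + m₂) k)).mul_left (sqrtQPow (2 * k))
  have hr := (hS.equiv pentagonEquiv (fun _ => rfl)).prod_fiberwise
    (g := fun r : ℤ × ℤ => tetTerm (m₁ - e₂) e₁ r.1 * tetTerm (m₂ - e₁) e₂ r.2) fun r => by
      obtain ⟨r₁, r₂⟩ := r
      have h := (((hasFormalSum_durfeeTerm r₁ r₂).mul (hasFormalSum_vanderTerm (r₁ + e₁) (r₂ + e₂))
        ).mul_left (negSqrtQPow (r₁ + r₂) *
        sqrtQPow ((r₁ - r₂) ^ 2 - (2 * r₁ + e₁) * m₁ - (2 * r₂ + e₂) * m₂))).congr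
        (fun k => pentagonTerm_pentagonEquiv m₁ m₂ e₁ e₂ r₁ r₂ k.1 k.2)
      convert h using 1
      have h4 : sqrtQPow (r₁ ^ 2 - (2 * r₁ + e₁) * (m₁ - e₂)) *
          sqrtQPow (r₂ ^ 2 - (2 * r₂ + e₂) * (m₂ - e₁)) =
          sqrtQPow ((r₁ - r₂) ^ 2 - (2 * r₁ + e₁) * m₁ - (2 * r₂ + e₂) * m₂) *
          sqrtQPow (2 * (r₁ + e₁) * (r₂ + e₂)) := by
        rw [← sqrtQPow_add, ← sqrtQPow_add]
        congr 1
        ring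
      simp only [tetTerm]
      rw [negSqrtQPow_add]
      linear_combination (negSqrtQPow r₁ * negSqrtQPow r₂ * (qInv r₁ * qInv (r₁ + e₁)) *
        (qInv r₂ * qInv (r₂ + e₂))) * h4
  have h := (hasFormalSum_tetIndex (m₁ - e₂) e₁).mul (hasFormalSum_tetIndex (m₂ - e₁) e₂)
  rwa [hr.unique h] at hl

/-- The summand of the symmetric form of the pentagon identity. -/
noncomputable def pentagonJ (n s : Fin 3 → ℤ) (k : ℤ) : LaurentSeries ℤ :=
  sqrtQPow (2 * k) * (tetJ k (n 1 + s 2) (n 2 + s 1) * tetJ k (n 2 + s 0) (n 0 + s 2) *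
    tetJ k (n 0 + s 1) (n 1 + s 0))

/-- The two hypotheses are the sign conditions on `m₁` and `m₂`. They merely order the differences
`n i - s i`, which is no loss since the identity is symmetric under simultaneous permutations of `n`
and `s`. -/
theorem tetJ_pentagon_aux (n s : Fin 3 → ℤ) (h₁ : n 1 - s 1 ≤ n 0 - s 0) (h₂ : n 2 - s 2 ≤ n 1 - s 1) :
    HasFormalSum (pentagonJ n s) (tetJ (n 0) (n 1) (n 2) * tetJ (s 0) (s 1) (s 2)) := by
  have h := tetIndex_pentagon (m₁ := n 2 - s 2 - (n 1 - s 1)) (m₂ := n 1 - s 1 - (n 0 - s 0))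
    (s 0 - s 1) (n 2 - n 1) (by omega) (by omega)
  have hl : tetIndex (n 2 - s 2 - (n 1 - s 1) - (n 2 - n 1)) (s 0 - s 1) *
      tetIndex (n 1 - s 1 - (n 0 - s 0) - (s 0 - s 1)) (n 2 - n 1) =
      negSqrtQPow (s 1 + n 1) * (tetJ (n 0) (n 1) (n 2) * tetJ (s 0) (s 1) (s 2)) := by
    have e1 := tetIndex_eq_tetJ (s 0) (s 1) (s 2)
    have e2 := tetIndex_eq_tetJ (n 2) (n 1) (n 0)
    rw [show n 2 - s 2 - (n 1 - s 1) - (n 2 - n 1) = s 1 - s 2 by ring,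
      show n 1 - s 1 - (n 0 - s 0) - (s 0 - s 1) = n 1 - n 0 by ring, e1, e2, negSqrtQPow_add,
      tetJ_swap_outer (n 2)]
    ring
  rw [hl] at h
  have h' := h.mul_left (negSqrtQPow (-(s 1 + n 1)))
  rw [← mul_assoc, ← negSqrtQPow_add, neg_add_cancel, negSqrtQPow_zero, one_mul] at h'
  -- The last index on the right of the unsymmetric identity has second argument `k`, whereas in the
  -- symmetric form it is `k - (n 2 + s 0)`.
  refine h'.equiv (Equiv.subRight (n 2 + s 0)) fun k => ?_
  simp only [Equiv.subRight_apply, pentagonJ]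
  have e1 := tetIndex_eq_tetJ k (n 2 + s 1) (n 1 + s 2)
  have e2 := tetIndex_eq_tetJ k (n 1 + s 0) (n 0 + s 1)
  have e3 := tetIndex_eq_tetJ k (n 2 + s 0) (n 0 + s 2)
  rw [show n 2 - s 2 - (n 1 - s 1) = n 2 + s 1 - (n 1 + s 2) by ring,
    show s 0 - s 1 + (k - (n 2 + s 0)) = k - (n 2 + s 1) by ring,
    show n 1 - s 1 - (n 0 - s 0) = n 1 + s 0 - (n 0 + s 1) by ring,
    show n 2 - n 1 + (k - (n 2 + s 0)) = k - (n 1 + s 0) by ring,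
    show n 2 + s 1 - (n 1 + s 2) + (n 1 + s 0 - (n 0 + s 1)) = n 2 + s 0 - (n 0 + s 2) by ring,
    e1, e2, e3, tetJ_swap_right k (n 1 + s 2), tetJ_swap_right k (n 0 + s 1)]
  have e4 : negSqrtQPow (-(s 1 + n 1)) * (sqrtQPow (2 * (k - (n 2 + s 0))) *
      (negSqrtQPow (n 2 + s 1) * negSqrtQPow (n 1 + s 0) * negSqrtQPow (n 2 + s 0))) =
      sqrtQPow (2 * k) := by
    rw [← negSqrtQPow_two_mul, ← negSqrtQPow_two_mul, ← negSqrtQPow_add, ← negSqrtQPow_add,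
      ← negSqrtQPow_add, ← negSqrtQPow_add]
    congr 1
    ring
  rw [← e4]
  ring

/-- The pentagon identity for `J_Δ`. -/
theorem tetJ_pentagon (n s : Fin 3 → ℤ) :
    HasFormalSum (pentagonJ n s) (tetJ (n 0) (n 1) (n 2) * tetJ (s 0) (s 1) (s 2)) := by
  -- The identity is transported along two adjacent transpositions, which generate all permutations;
  -- then the index with the smallest `n i - s i` is moved to the last place.
  have swap : ∀ n s : Fin 3 → ℤ,
      HasFormalSum (pentagonJ ![n 1, n 0, n 2] ![s 1, s 0, s 2])
        (tetJ (n 1) (n 0) (n 2) * tetJ (s 1) (s 0) (s 2)) →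
      HasFormalSum (pentagonJ n s) (tetJ (n 0) (n 1) (n 2) * tetJ (s 0) (s 1) (s 2)) := by
    intro n s h
    rw [tetJ_swap_left (n 0), tetJ_swap_left (s 0)]
    refine h.congr fun k => ?_
    simp only [pentagonJ, Matrix.cons_val_zero, Matrix.cons_val_one, Matrix.cons_val]
    rw [tetJ_swap_right k (n 0 + s 2), tetJ_swap_right k (n 2 + s 1), tetJ_swap_right k (n 1 + s 0)]
    ring
  have swap' : ∀ n s : Fin 3 → ℤ,
      HasFormalSum (pentagonJ ![n 0, n 2, n 1] ![s 0, s 2, s 1])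
        (tetJ (n 0) (n 2) (n 1) * tetJ (s 0) (s 2) (s 1)) →
      HasFormalSum (pentagonJ n s) (tetJ (n 0) (n 1) (n 2) * tetJ (s 0) (s 1) (s 2)) := by
    intro n s h
    rw [tetJ_swap_right (n 0), tetJ_swap_right (s 0)]
    refine h.congr fun k => ?_
    simp only [pentagonJ, Matrix.cons_val_zero, Matrix.cons_val_one, Matrix.cons_val]
    rw [tetJ_swap_right k (n 2 + s 1), tetJ_swap_right k (n 1 + s 0), tetJ_swap_right k (n 0 + s 2)]
    ring
  have two : ∀ n s : Fin 3 → ℤ, n 2 - s 2 ≤ n 1 - s 1 → n 2 - s 2 ≤ n 0 - s 0 →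
      HasFormalSum (pentagonJ n s) (tetJ (n 0) (n 1) (n 2) * tetJ (s 0) (s 1) (s 2)) := by
    intro n s h h'
    rcases le_total (n 1 - s 1) (n 0 - s 0) with h1 | h1
    · exact tetJ_pentagon_aux n s h1 h
    · exact swap n s (tetJ_pentagon_aux ![n 1, n 0, n 2] ![s 1, s 0, s 2] (by simpa using h1)
        (by simpa using h'))
  by_cases h : n 2 - s 2 ≤ n 1 - s 1 ∧ n 2 - s 2 ≤ n 0 - s 0
  · exact two n s h.1 h.2
  by_cases h' : n 1 - s 1 ≤ n 2 - s 2 ∧ n 1 - s 1 ≤ n 0 - s 0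
  · exact swap' n s (two ![n 0, n 2, n 1] ![s 0, s 2, s 1] (by simpa using h'.1) (by simpa using h'.2))
  · refine swap n s (swap' ![n 1, n 0, n 2] ![s 1, s 0, s 2] ?_)
    exact two ![n 1, n 2, n 0] ![s 1, s 2, s 0]
      (by simp only [Matrix.cons_val_one, Matrix.cons_val]; omega)
      (by simp only [Matrix.cons_val_zero, Matrix.cons_val]; omega)

/-! ## Polygonal surfaces with a height function -/

/-- A closed surface glued from polygons, with a multivalued integer height function on the
polygons. The darts are the sides of the polygons, `nxt` is the anticlockwise order around a
polygon, `fl` is the gluing and `tail` the initial vertex of a dart. Crossing the dart `d`, the height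
increases by `jump d`. The height of an edge is the smaller one of its two polygons, and vertices have heights too:
`tl d` is the height of the tail of `d` relative to the polygon of `d`. -/
structure HeightMap (D F Z : Type*) where
  nxt : D → D
  prv : D → D
  fl : D → D
  face : D → F
  tail : D → Z
  jump : D → ℤ
  tl : D → ℤ
  prv_nxt : ∀ d, prv (nxt d) = d
  nxt_prv : ∀ d, nxt (prv d) = d
  fl_fl : ∀ d, fl (fl d) = d
  fl_ne : ∀ d, fl d ≠ d
  face_nxt : ∀ d, face (nxt d) = face d
  tail_fl : ∀ d, tail (fl d) = tail (nxt d)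
  jump_fl : ∀ d, jump (fl d) = -jump d
  tl_fl : ∀ d, jump d + tl (fl d) = tl (nxt d)
  tl_le : ∀ d, tl d ≤ min 0 (jump d)
  tail_orbit : ∀ d d', tail d = tail d' → Relation.EqvGen (fun a b => b = nxt (fl a)) d d'
  -- From here on the axioms describe level curves: with `jump_fl` the height changes by at most
  -- one, neighbouring sides of a polygon are not both crossed by a change, and a descending side
  -- next to a level side continues as a descending side of the adjacent polygon.
  neg_one_le_jump : ∀ d, -1 ≤ jump d
  jump_nxt : ∀ d, jump d ≠ 0 → jump (nxt d) = 0
  jump_prv : ∀ d, jump d ≠ 0 → jump (prv d) = 0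
  jump_iff : ∀ d, jump d = 0 → (jump (nxt d) = -1 ↔ jump (prv (fl d)) = -1)

namespace HeightMap

variable {D F Z : Type*} (W : HeightMap D F Z)

theorem face_prv (d : D) : W.face (W.prv d) = W.face d := by
  rw [← W.face_nxt, W.nxt_prv]

theorem tl_nxt_le (d : D) : W.tl (W.nxt d) ≤ min 0 (W.jump d) := by
  have h := W.tl_le (W.fl d)
  rw [W.jump_fl] at h
  rw [← W.tl_fl]
  omega

open Classical in
/-- The dual cochain of the curves parallel to the sides in `K`, drawn inside the polygons. -/
noncomputable def pushed (K : Set D) (d : D) : ℚ :=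
  (if W.nxt d ∈ K then 1 else 0) - (if W.prv d ∈ K then 1 else 0)

/-- Descending sides are consecutive on a level curve. -/
def Consecutive (a b : D) : Prop :=
  ∃ d, W.jump d = 0 ∧ a = W.nxt d ∧ b = W.prv (W.fl d) ∧ W.jump a = -1 ∧ W.jump b = -1

/-- No level curve is the boundary of a 2-chain. -/
def Essential : Prop :=
  ∀ b, W.jump b = -1 → ¬ ∃ h : Z → ℚ, ∀ d, W.jump d = 0 →
    h (W.tail (W.nxt d)) - h (W.tail d) = W.pushed {b' | Relation.EqvGen W.Consecutive b b'} d

/-- Adjacency of polygons of the infinite cyclic cover with nonnegative height. -/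
def Adj (x y : F × ℤ) : Prop :=
  ∃ d, x.1 = W.face d ∧ y = (W.face (W.fl d), x.2 + W.jump d) ∧ 0 ≤ x.2 ∧ 0 ≤ y.2

/-- Connected components of the region of nonnegative height. -/
abbrev Comp := Quot W.Adj

end HeightMap

/-- Cells over the same or neighbouring cells have different ranges of levels; rewriting their sums
as sums over all of ℤ makes them comparable. -/
theorem sum_fin_eq_finsum {n : ℕ} (a : ℤ) (y : ℤ → ℚ) (h : ∀ i, y i ≠ 0 → a ≤ i ∧ i < a + n) :
    ∑ k : Fin n, y (k + a) = ∑ᶠ i, y i := by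
  rw [finsum_eq_sum_of_support_subset (s := Finset.Ico a (a + n)) y
    (fun i hi => by simpa using h i hi), Fin.sum_univ_eq_sum_range (fun k => y (k + a))]
  refine Finset.sum_nbij' (fun k => k + a) (fun i => (i - a).toNat) ?_ ?_ ?_ ?_ ?_
  · intro k hk; simp at hk ⊢; omega
  · intro i hi; simp at hi ⊢; omega
  · intro k _; simp
  · intro i hi; simp at hi; simp; omega
  · intro k _; rfl

/-- Extension by zero of a function on the cells of bounded nonnegative height. -/
noncomputable def extendLevel {α : Type*} {r : α → ℕ} (x : (Σ a, Fin (r a)) → ℚ) (a : α) (i : ℤ) : ℚ :=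
  if h : 0 ≤ i ∧ i < r a then x ⟨a, ⟨i.toNat, by omega⟩⟩ else 0

section extendLevel

variable {α : Type*} {r : α → ℕ}

theorem extendLevel_of_not (x : (Σ a, Fin (r a)) → ℚ) {a : α} {i : ℤ} (h : ¬ (0 ≤ i ∧ i < r a)) :
    extendLevel x a i = 0 := by
  simp only [extendLevel, dif_neg h]

theorem extendLevel_coe (x : (Σ a, Fin (r a)) → ℚ) (a : α) (k : Fin (r a)) :
    extendLevel x a (k : ℕ) = x ⟨a, k⟩ := by
  simp [extendLevel]

theorem extendLevel_add (x y : (Σ a, Fin (r a)) → ℚ) (a : α) (i : ℤ) :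
    extendLevel (x + y) a i = extendLevel x a i + extendLevel y a i := by
  unfold extendLevel; split_ifs <;> simp

theorem extendLevel_smul (c : ℚ) (x : (Σ a, Fin (r a)) → ℚ) (a : α) (i : ℤ) :
    extendLevel (c • x) a i = c * extendLevel x a i := by
  unfold extendLevel; split_ifs <;> simp

theorem extendLevel_injective {x : (Σ a, Fin (r a)) → ℚ} (h : ∀ a i, extendLevel x a i = 0) :
    x = 0 := by
  funext ⟨a, k⟩
  have := extendLevel_coe x a k
  rw [h] at this
  exact this.symm

end extendLevel

/-! ### Euler characteristic of regions of the infinite cyclic cover. -/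

namespace HeightMap

variable {D F Z : Type*} (W : HeightMap D F Z)

/-- A closed subcomplex of the infinite cyclic cover, recorded by the numbers of its polygons, edges and
vertices above a given one with nonnegative height. -/
structure Truncation where
  rF : F → ℕ
  rD : D → ℕ
  rZ : Z → ℕ
  rD_fl : ∀ d, rD (W.fl d) = rD d
  closed_face : ∀ d, rF (W.face d) + min 0 (W.jump d) ≤ rD d
  /-- every component of the 1-skeleton reaches negative height -/
  vertices_connected : ∀ h : Z → ℤ → ℚ, (∀ z (i : ℤ), ¬ (0 ≤ i ∧ i < rZ z) → h z i = 0) →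
    (∀ d i, 0 ≤ i + min 0 (W.jump d) → i + min 0 (W.jump d) < rD d →
      h (W.tail (W.nxt d)) (i + W.tl (W.nxt d)) = h (W.tail d) (i + W.tl d)) → ∀ z i, h z i = 0
  /-- every component of the surface reaches negative height -/
  faces_connected : ∀ S : Set (F × ℤ), (∀ x ∈ S, 0 ≤ x.2 ∧ x.2 < rF x.1) →
    (∀ d i, (W.face d, i) ∈ S → (W.face (W.fl d), i + W.jump d) ∈ S) → S = ∅

variable {W}

theorem pushed_fl {S : Set D} {d : D} (h : W.nxt d ∈ S ↔ W.prv (W.fl d) ∈ S)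
    (h' : W.nxt (W.fl d) ∈ S ↔ W.prv d ∈ S) : W.pushed S (W.fl d) = -W.pushed S d := by
  classical
  by_cases h1 : W.nxt d ∈ S <;> by_cases h2 : W.prv d ∈ S <;>
    simp [pushed, h1, h2, ← h, h']

namespace Truncation

variable (X : W.Truncation)

/-- The coboundary of a vertex function. -/
noncomputable def d0 (h : (Σ z, Fin (X.rZ z)) → ℚ) (d : D) (i : ℤ) : ℚ :=
  extendLevel h (W.tail (W.nxt d)) (i + W.tl (W.nxt d)) - extendLevel h (W.tail d) (i + W.tl d)

/-- The boundary of a 2-chain. -/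
noncomputable def bd (p : (Σ f, Fin (X.rF f)) → ℚ) (d : D) (i : ℤ) : ℚ :=
  extendLevel p (W.face d) i - extendLevel p (W.face (W.fl d)) (i + W.jump d)

open Classical in
/-- The product of a 2-chain with the pushed curves at level zero. -/
noncomputable def cup (S : Set D) (p : (Σ f, Fin (X.rF f)) → ℚ) (d : D) (i : ℤ) : ℚ :=
  if i = 0 then extendLevel p (W.face d) i * W.pushed S d else 0

theorem d0_add (h h') (d : D) (i : ℤ) : X.d0 (h + h') d i = X.d0 h d i + X.d0 h' d i := by
  simp only [d0, extendLevel_add]; ring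

theorem d0_smul (c : ℚ) (h) (d : D) (i : ℤ) : X.d0 (c • h) d i = c * X.d0 h d i := by
  simp only [d0, extendLevel_smul]; ring

theorem bd_add (p p') (d : D) (i : ℤ) : X.bd (p + p') d i = X.bd p d i + X.bd p' d i := by
  simp only [bd, extendLevel_add]; ring

theorem bd_smul (c : ℚ) (p) (d : D) (i : ℤ) : X.bd (c • p) d i = c * X.bd p d i := by
  simp only [bd, extendLevel_smul]; ring

theorem cup_add (S : Set D) (p p') (d : D) (i : ℤ) :
    X.cup S (p + p') d i = X.cup S p d i + X.cup S p' d i := by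
  simp only [cup, extendLevel_add]; split_ifs <;> ring

theorem cup_smul (S : Set D) (c : ℚ) (p) (d : D) (i : ℤ) : X.cup S (c • p) d i = c * X.cup S p d i := by
  simp only [cup, extendLevel_smul]; split_ifs <;> ring

theorem d0_fl (h) (d : D) (i : ℤ) : X.d0 h (W.fl d) (i + W.jump d) = - X.d0 h d i := by
  have h1 := W.tail_fl (W.fl d)
  have h2 := W.tl_fl (W.fl d)
  rw [W.fl_fl] at h1 h2
  rw [W.jump_fl] at h2
  simp only [d0, ← h1, ← h2, W.tail_fl, ← W.tl_fl d]
  rw [show i + W.jump d + (-W.jump d + W.tl d) = i + W.tl d by ring,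
    show i + W.jump d + W.tl (W.fl d) = i + (W.jump d + W.tl (W.fl d)) by ring]
  ring

theorem bd_fl (p) (d : D) (i : ℤ) : X.bd p (W.fl d) (i + W.jump d) = - X.bd p d i := by
  simp only [bd, W.fl_fl, W.jump_fl]
  rw [show i + W.jump d + -W.jump d = i by ring]
  ring

/-- Pairing a boundary with a cocycle. -/
theorem sum_bd_mul [Fintype D] [Fintype F] [DecidableEq F] {pos : D → Prop} [DecidablePred pos]
    (hpos : ∀ d, pos (W.fl d) ↔ ¬ pos d) (p : (Σ f, Fin (X.rF f)) → ℚ)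
    (x : D → ℤ → ℚ) (hx : ∀ d i, 0 ≤ i + min 0 (W.jump d) → x (W.fl d) (i + W.jump d) = - x d i)
    (hx0 : ∀ d i, i + min 0 (W.jump d) < 0 → 0 ≤ i → x d i = 0)
    (hc : ∀ f i, ∑ d with W.face d = f, x d i = 0) :
    ∑ d : {d // pos d}, ∑ k : Fin (X.rD d), X.bd p d (k - min 0 (W.jump d)) *
      x d (k - min 0 (W.jump d)) = 0 := by
  classical
  -- Each value of the boundary is a difference of two values of `p`, and `x` is antisymmetric, so
  -- the pairing is a sum of `y` over all darts. Grouped by polygons, each group contains the sum of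
  -- `x` around a polygon, which is zero.
  let y : D → ℤ → ℚ := fun d i => extendLevel p (W.face d) i * x d i
  -- Closedness of the subcomplex: the sides of a polygon that occurs also occur, so restricting to
  -- the range of the sides loses nothing.
  have hy : ∀ d i, y d i ≠ 0 → -min 0 (W.jump d) ≤ i ∧ i < -min 0 (W.jump d) + X.rD d ∧
      0 ≤ i ∧ i < X.rF (W.face d) := by
    intro d i h
    have h1 : 0 ≤ i ∧ i < X.rF (W.face d) := by
      by_contra h1
      exact h (by simp [y, extendLevel_of_not p h1])
    have h2 : ¬ i + min 0 (W.jump d) < 0 := fun h2 => h (by simp [y, hx0 d i h2 h1.1])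
    have := X.closed_face d
    omega
  have hD : ∀ d, ∑ k : Fin (X.rD d), y d (k - min 0 (W.jump d)) = ∑ᶠ i, y d i := fun d => by
    simpa only [sub_eq_add_neg] using sum_fin_eq_finsum (n := X.rD d) (-min 0 (W.jump d)) (y d)
      fun i hi => ⟨(hy d i hi).1, (hy d i hi).2.1⟩
  have hF : ∀ d, ∑ k : Fin (X.rF (W.face d)), y d k = ∑ᶠ i, y d i := fun d => by
    simpa using sum_fin_eq_finsum (n := X.rF (W.face d)) 0 (y d)
      fun i hi => by have := (hy d i hi).2.2; omega
  have h1 : ∀ d, ∑ k : Fin (X.rD d), X.bd p d (k - min 0 (W.jump d)) * x d (k - min 0 (W.jump d)) =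
      ∑ᶠ i, y d i + ∑ᶠ i, y (W.fl d) i := by
    intro d
    rw [← hD, ← hD, ← Fin.sum_congr' (fun k => y (W.fl d) (k - min 0 (W.jump (W.fl d)))) (X.rD_fl d).symm,
      ← Finset.sum_add_distrib]
    refine Finset.sum_congr rfl fun k _ => ?_
    have e : ((Fin.cast (X.rD_fl d).symm k : ℕ) : ℤ) - min 0 (W.jump (W.fl d)) =
        k - min 0 (W.jump d) + W.jump d := by
      rw [W.jump_fl, Fin.val_cast]; omega
    simp only [y, bd]
    rw [e, hx d _ (by omega)]
    ring
  rw [Finset.sum_congr rfl fun (d : {d // pos d}) _ => h1 d.1, Finset.sum_add_distrib]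
  have h2 : ∑ d : {d // pos d}, ∑ᶠ i, y (W.fl d) i = ∑ d : {d // ¬ pos d}, ∑ᶠ i, y d i :=
    Fintype.sum_equiv (⟨fun d => ⟨W.fl d, by rw [hpos]; exact not_not.2 d.2⟩,
      fun d => ⟨W.fl d, by rw [hpos]; exact d.2⟩, fun d => Subtype.ext (W.fl_fl _),
      fun d => Subtype.ext (W.fl_fl _)⟩ : {d // pos d} ≃ {d // ¬ pos d}) _ _ fun d => rfl
  rw [h2, Fintype.sum_subtype_add_sum_subtype pos (fun d => ∑ᶠ i, y d i)]
  rw [Finset.sum_congr rfl fun d _ => (hF d).symm, ← Finset.sum_fiberwise Finset.univ W.face]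
  refine Finset.sum_eq_zero fun f _ => ?_
  have h3 : ∀ d ∈ Finset.univ.filter (fun d => W.face d = f),
      ∑ k : Fin (X.rF (W.face d)), y d k = ∑ k : Fin (X.rF f), extendLevel p f k * x d k := by
    intro d hd
    obtain rfl := (Finset.mem_filter.1 hd).2
    rfl
  rw [Finset.sum_congr rfl h3, Finset.sum_comm]
  refine Finset.sum_eq_zero fun k _ => ?_
  rw [← Finset.mul_sum, hc, mul_zero]

theorem sum_face_sub [Fintype D] [DecidableEq F] (g : D → ℚ) (f : F) :
    ∑ d with W.face d = f, (g (W.nxt d) - g d) = 0 := by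
  rw [Finset.sum_sub_distrib, sub_eq_zero]
  refine Finset.sum_nbij' W.nxt W.prv ?_ ?_ ?_ ?_ ?_
  · intro d hd; simpa [W.face_nxt] using hd
  · intro d hd; simpa [W.face_prv] using hd
  · intro d _; exact W.prv_nxt d
  · intro d _; exact W.nxt_prv d
  · intro d _; rfl

/-- A parallel curve enters a polygon as often as it leaves it. Formally, the difference between the
next and the previous side is a sum of two telescoping differences. -/
theorem sum_face_pushed [Fintype D] [DecidableEq F] (S : Set D) (f : F) :
    ∑ d with W.face d = f, W.pushed S d = 0 := by
  classical
  have h1 := sum_face_sub (W := W) (fun d => if d ∈ S then (1 : ℚ) else 0) f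
  have h2 := sum_face_sub (W := W) (fun d => if W.prv d ∈ S then (1 : ℚ) else 0) f
  simp only [W.prv_nxt] at h2
  have h3 : ∀ d, W.pushed S d = ((if W.nxt d ∈ S then (1 : ℚ) else 0) - if d ∈ S then 1 else 0) +
      ((if d ∈ S then (1 : ℚ) else 0) - if W.prv d ∈ S then 1 else 0) := fun d => by
    unfold pushed
    ring
  rw [Finset.sum_congr rfl fun d _ => h3 d, Finset.sum_add_distrib, h1, h2, add_zero]

/-- The pushed curves meet only sides without height change, since neighbours of a side with a
change are level. Across such a side a curve in `S` continues in the adjacent polygon, where `p` has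
the same value. -/
theorem cup_fl {S : Set D} (hS : ∀ b ∈ S, W.jump b = -1)
    (hS' : ∀ a b, W.Consecutive a b → (a ∈ S ↔ b ∈ S)) (p : (Σ f, Fin (X.rF f)) → ℚ)
    (hp : ∀ d i, 0 ≤ i + min 0 (W.jump d) →
      extendLevel p (W.face d) i = extendLevel p (W.face (W.fl d)) (i + W.jump d)) (d : D) (i : ℤ)
    (hi : 0 ≤ i + min 0 (W.jump d)) :
    X.cup S p (W.fl d) (i + W.jump d) = - X.cup S p d i := by
  have hpush : ∀ d, W.jump d ≠ 0 → W.pushed S d = 0 := fun d hd => by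
    have h1 : W.nxt d ∉ S := fun h => by have := hS _ h; rw [W.jump_nxt d hd] at this; omega
    have h2 : W.prv d ∉ S := fun h => by have := hS _ h; rw [W.jump_prv d hd] at this; omega
    simp [pushed, h1, h2]
  have key : ∀ d, W.jump d = 0 → (W.nxt d ∈ S ↔ W.prv (W.fl d) ∈ S) := fun d hd => by
    have hj := W.jump_iff d hd
    constructor
    · exact fun h => (hS' _ _ ⟨d, hd, rfl, rfl, hS _ h, hj.1 (hS _ h)⟩).1 h
    · exact fun h => (hS' _ _ ⟨d, hd, rfl, rfl, hj.2 (hS _ h), hS _ h⟩).2 h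
  unfold cup
  by_cases hd : W.jump d = 0
  · have hd' : W.jump (W.fl d) = 0 := by rw [W.jump_fl, hd, neg_zero]
    have h1 := hp d i hi
    have h2 := key _ hd'
    rw [W.fl_fl] at h2
    rw [pushed_fl (key d hd) h2, hd, add_zero]
    rw [hd, add_zero] at h1
    rw [h1]
    split_ifs <;> ring
  · rw [hpush d hd, hpush (W.fl d) (by rw [W.jump_fl]; omega)]
    simp

theorem cup_eq_zero {S : Set D} (hS : ∀ b ∈ S, W.jump b = -1) (p : (Σ f, Fin (X.rF f)) → ℚ) (d : D)
    (i : ℤ) (hi : i + min 0 (W.jump d) < 0) (hi' : 0 ≤ i) : X.cup S p d i = 0 := by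
  have hd : W.jump d ≠ 0 := by omega
  have h1 : W.nxt d ∉ S := fun h => by have := hS _ h; rw [W.jump_nxt d hd] at this; omega
  have h2 : W.prv d ∉ S := fun h => by have := hS _ h; rw [W.jump_prv d hd] at this; omega
  simp [cup, pushed, h1, h2]

theorem d0_eq_zero (h : (Σ z, Fin (X.rZ z)) → ℚ) (d : D) (i : ℤ) (hi : i + min 0 (W.jump d) < 0) :
    X.d0 h d i = 0 := by
  have h1 := W.tl_le d
  have h2 := W.tl_nxt_le d
  rw [d0, extendLevel_of_not _ (by omega), extendLevel_of_not _ (by omega), sub_zero]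

theorem sum_face_d0 [Fintype D] [DecidableEq F] (h : (Σ z, Fin (X.rZ z)) → ℚ) (f : F) (i : ℤ) :
    ∑ d with W.face d = f, X.d0 h d i = 0 :=
  sum_face_sub (W := W) (fun d => extendLevel h (W.tail d) (i + W.tl d)) f

theorem sum_face_cup [Fintype D] [DecidableEq F] (S : Set D) (p : (Σ f, Fin (X.rF f)) → ℚ) (f : F)
    (i : ℤ) : ∑ d with W.face d = f, X.cup S p d i = 0 := by
  have h : ∀ d ∈ Finset.univ.filter (fun d => W.face d = f),
      X.cup S p d i = (if i = 0 then extendLevel p f i else 0) * W.pushed S d := fun d hd => by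
    rw [cup, (Finset.mem_filter.1 hd).2]
    split_ifs <;> ring
  rw [Finset.sum_congr rfl h, ← Finset.mul_sum, sum_face_pushed, mul_zero]

/-- A 2-cycle relative to the region of negative height, if it multiplies the chosen level curves to a
coboundary, vanishes. -/
theorem eq_zero_of_cup (hW : W.Essential) {sel : W.Comp → Option D}
    (hsel : ∀ b, W.jump b = -1 → ∃ b₀, sel (Quot.mk _ (W.face b, 0)) = some b₀ ∧ W.jump b₀ = -1 ∧
      (Quot.mk _ (W.face b₀, 0) : W.Comp) = Quot.mk _ (W.face b, 0))
    (h : (Σ z, Fin (X.rZ z)) → ℚ) (p : (Σ f, Fin (X.rF f)) → ℚ)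
    (hp : ∀ d i, 0 ≤ i + min 0 (W.jump d) →
      extendLevel p (W.face d) i = extendLevel p (W.face (W.fl d)) (i + W.jump d))
    (hh : ∀ d i, 0 ≤ i + min 0 (W.jump d) → i + min 0 (W.jump d) < X.rD d →
      X.d0 h d i + X.cup {b | W.jump b = -1 ∧ ∃ b₀, sel (Quot.mk _ (W.face b, 0)) = some b₀ ∧
        Relation.EqvGen W.Consecutive b₀ b} p d i = 0) : p = 0 := by
  classical
  refine extendLevel_injective fun f₀ i₀ => ?_
  by_contra hl
  have hi₀ : 0 ≤ i₀ ∧ i₀ < X.rF f₀ := by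
    by_contra hi; exact hl (extendLevel_of_not _ hi)
  set l := extendLevel p f₀ i₀ with hl_def
  set κ : W.Comp := Quot.mk _ (f₀, i₀)
  -- A chain without boundary is constant on components. As its value `l` on `κ` is not zero, all of
  -- `κ` lies inside the truncation.
  have hconst : ∀ f i, 0 ≤ i → (Quot.mk _ (f, i) : W.Comp) = κ → extendLevel p f i = l := by
    intro f i _ he
    have := Quot.eqvGen_exact he
    have key : ∀ x y : F × ℤ, Relation.EqvGen W.Adj x y →
        extendLevel p x.1 x.2 = extendLevel p y.1 y.2 := by
      intro x y hxy
      induction hxy with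
      | rel x y h =>
        obtain ⟨d, h1, rfl, h2, h3⟩ := h
        rw [h1]
        exact hp d x.2 (by simp only at h3; omega)
      | refl x => rfl
      | symm x y _ ih => exact ih.symm
      | trans x y z _ _ ih1 ih2 => exact ih1.trans ih2
    exact key _ _ this
  have hX : ∀ f i, 0 ≤ i → (Quot.mk _ (f, i) : W.Comp) = κ → i < X.rF f := by
    intro f i hi he
    by_contra hlt
    exact hl ((hconst f i hi he).symm.trans (extendLevel_of_not _ (by omega)))
  -- If the height never dropped from 0 to -1 along `κ`, then `κ` would be closed under all gluings,
  -- which `faces_connected` excludes.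
  obtain ⟨b₁, hb₁, hb₁κ⟩ : ∃ b, W.jump b = -1 ∧ (Quot.mk _ (W.face b, 0) : W.Comp) = κ := by
    by_contra hno
    push Not at hno
    have := X.faces_connected {x | 0 ≤ x.2 ∧ (Quot.mk _ x : W.Comp) = κ}
      (fun x hx => ⟨hx.1, hX _ _ hx.1 hx.2⟩) (by
        rintro d i ⟨hi, he⟩
        have h1 : 0 ≤ i + W.jump d := by
          by_contra h1
          have h2 := W.neg_one_le_jump d
          simp only at hi
          obtain rfl : i = 0 := by omega
          exact hno d (by omega) he
        exact ⟨h1, he ▸ (Quot.sound ⟨d, rfl, rfl, hi, h1⟩ : (Quot.mk W.Adj (W.face d, i)) = _).symm⟩)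
    exact (Set.mem_empty_iff_false (f₀, i₀)).1 (this ▸ ⟨hi₀.1, rfl⟩)
  obtain ⟨b₀, hs₀, hb₀, hb₀κ⟩ := hsel b₁ hb₁
  rw [hb₁κ] at hs₀ hb₀κ
  -- The chosen level curve runs along polygons of `κ` at height 0 only.
  have hK : ∀ b, Relation.EqvGen W.Consecutive b₀ b →
      W.jump b = -1 ∧ (Quot.mk _ (W.face b, 0) : W.Comp) = κ := by
    have key : ∀ a b, Relation.EqvGen W.Consecutive a b →
        ((W.jump a = -1 ∧ (Quot.mk _ (W.face a, 0) : W.Comp) = κ) ↔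
          (W.jump b = -1 ∧ (Quot.mk _ (W.face b, 0) : W.Comp) = κ)) := by
      intro a b hab
      induction hab with
      | rel a b h =>
        obtain ⟨d, hd, rfl, rfl, h1, h2⟩ := h
        rw [W.face_nxt, W.face_prv]
        have : (Quot.mk W.Adj (W.face d, 0)) = Quot.mk W.Adj (W.face (W.fl d), 0) :=
          Quot.sound ⟨d, rfl, by simp [hd], le_rfl, le_rfl⟩
        rw [this]
        simp [h1, h2]
      | refl x => rfl
      | symm x y _ ih => exact ih.symm
      | trans x y z _ _ ih1 ih2 => exact ih1.trans ih2
    exact fun b hb => (key b₀ b hb).1 ⟨hb₀, hb₀κ⟩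
  -- lifts of vertices on the component
  let inZ (z : Z) (j : ℤ) : Prop := ∃ d, W.tail d = z ∧ (Quot.mk _ (W.face d, j - W.tl d) : W.Comp) = κ
  have hinZ : ∀ d j, 0 ≤ j →
      (inZ (W.tail d) j ↔ (Quot.mk _ (W.face d, j - W.tl d) : W.Comp) = κ) := by
    intro d j hj
    refine ⟨?_, fun h => ⟨d, rfl, h⟩⟩
    rintro ⟨d', hd', he⟩
    have key : ∀ a b, Relation.EqvGen (fun a b => b = W.nxt (W.fl a)) a b →
        (Quot.mk _ (W.face a, j - W.tl a) : W.Comp) = Quot.mk _ (W.face b, j - W.tl b) := by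
      intro a b hab
      induction hab with
      | rel a b h =>
        subst h
        have h1 := W.tl_fl (W.fl a)
        rw [W.fl_fl, W.jump_fl] at h1
        have h2 := W.tl_le a
        have h3 := W.tl_le (W.nxt (W.fl a))
        refine Quot.sound ⟨a, rfl, ?_, ?_, ?_⟩
        · rw [W.face_nxt]; ext
          · rfl
          · simp only; omega
        · simp only; omega
        · simp only; omega
      | refl x => rfl
      | symm x y _ ih => exact ih.symm
      | trans x y z _ _ ih1 ih2 => exact ih1.trans ih2
    rw [← key _ _ (W.tail_orbit _ _ hd')]
    exact he
  -- Summing `h` over the lifts of a vertex in `κ` pushes the relation down to the closed surface: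
  -- `-H / l` then exhibits the chosen level curve as null-homologous, against `Essential`.
  let H (z : Z) : ℚ := ∑ᶠ j, if inZ z j then extendLevel h z j else 0
  have hH : ∀ d, H (W.tail d) = ∑ᶠ i, if (Quot.mk _ (W.face d, i) : W.Comp) = κ then
      extendLevel h (W.tail d) (i + W.tl d) else 0 := by
    intro d
    refine (finsum_comp_equiv (Equiv.addRight (W.tl d))
      (f := fun j => if inZ (W.tail d) j then extendLevel h (W.tail d) j else 0)).symm.trans ?_
    refine finsum_congr fun i => ?_
    simp only [Equiv.coe_addRight]
    by_cases hj : 0 ≤ i + W.tl d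
    · have := hinZ d _ hj
      rw [add_sub_cancel_right] at this
      simp only [this]
    · simp only [extendLevel_of_not h (i := i + W.tl d) (a := W.tail d) (by omega), ite_self]
  have hfin : ∀ d, (Function.support fun i => if (Quot.mk _ (W.face d, i) : W.Comp) = κ then
      extendLevel h (W.tail d) (i + W.tl d) else 0).Finite := by
    intro d
    refine (Set.finite_Ico (-W.tl d) (X.rZ (W.tail d) - W.tl d)).subset fun i hi => ?_
    by_contra hni
    refine hi ?_
    simp only [Set.mem_Ico, not_and, not_lt] at hni
    simp only
    rw [extendLevel_of_not _ (by omega)]; simp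
  refine hW b₀ hb₀ ⟨fun z => -(H z / l), fun d hd => ?_⟩
  have h1 := hH (W.nxt d)
  have h1f := hfin (W.nxt d)
  rw [W.face_nxt] at h1 h1f
  have h2 : H (W.tail (W.nxt d)) - H (W.tail d) =
      -(l * W.pushed {b' | Relation.EqvGen W.Consecutive b₀ b'} d) := by
    rw [h1, hH, ← finsum_sub_distrib h1f (hfin d)]
    -- The pushed curve lives at level 0; at all other levels of `κ` the function `h` is constant
    -- along the side.
    rw [finsum_eq_single _ 0]
    · by_cases hκ : (Quot.mk _ (W.face d, 0) : W.Comp) = κ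
      · have h3 := hh d 0 (by omega) (by
          have := hX _ _ le_rfl hκ
          have := X.closed_face d
          omega)
        rw [if_pos hκ, if_pos hκ]
        have h4 : X.d0 h d 0 = _ := eq_neg_of_add_eq_zero_left h3
        rw [d0] at h4
        rw [h4, cup, if_pos rfl, hconst _ _ le_rfl hκ]
        congr 2
        have h5 : ∀ b, W.face b = W.face d → ((W.jump b = -1 ∧
            ∃ b₀, sel (Quot.mk _ (W.face b, 0)) = some b₀ ∧ Relation.EqvGen W.Consecutive b₀ b) ↔
              Relation.EqvGen W.Consecutive b₀ b) := by
          intro b hb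
          rw [hb, hκ, hs₀]
          constructor
          · rintro ⟨_, b', h, h'⟩
            obtain rfl := Option.some.inj h
            exact h'
          · exact fun h => ⟨(hK b h).1, b₀, rfl, h⟩
        simp only [pushed, Set.mem_ofPred_eq]
        simp only [h5 _ (W.face_nxt d), h5 _ (W.face_prv d)]
      · rw [if_neg hκ, if_neg hκ]
        have h6 : ∀ b, W.face b = W.face d → ¬ Relation.EqvGen W.Consecutive b₀ b := 
          fun b hb h => hκ (hb ▸ (hK b h).2)
        simp only [pushed, Set.mem_ofPred_eq]
        rw [if_neg (h6 _ (W.face_nxt d)), if_neg (h6 _ (W.face_prv d))]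
        simp
    · intro i hi
      by_cases hκ : (Quot.mk _ (W.face d, i) : W.Comp) = κ
      · rw [if_pos hκ, if_pos hκ]
        by_cases hi0 : 0 ≤ i
        · have h3 := hh d i (by omega) (by
            have := hX _ _ hi0 hκ
            have := X.closed_face d
            omega)
          rw [cup, if_neg hi, add_zero] at h3
          exact h3
        · exact X.d0_eq_zero h d i (by omega)
      · rw [if_neg hκ, if_neg hκ, sub_zero]
  have h3 : -(H (W.tail (W.nxt d)) / l) - -(H (W.tail d) / l) =
      -((H (W.tail (W.nxt d)) - H (W.tail d)) / l) := by ring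
  rw [h3, h2]
  field_simp

open Classical in
/-- The regions bounded by essential level curves have Euler characteristic at most zero. -/
theorem sum_card_le [Fintype D] [Fintype F] [Fintype Z] (hW : W.Essential) :
    2 * ∑ z, X.rZ z + 2 * ∑ f, X.rF f ≤ ∑ d, X.rD d := by
  -- Picks one of the two darts of every edge, so that edges can be counted once.
  let pos (d : D) : Prop := WellOrderingRel d (W.fl d)
  have hpos : ∀ d, pos (W.fl d) ↔ ¬ pos d := by
    intro d
    have ht := (WellOrderingRel.isWellOrder (α := D)).trichotomous d (W.fl d)
    have ha := fun h => asymm_of WellOrderingRel (a := d) (b := W.fl d) h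
    simp only [pos, W.fl_fl]
    have := W.fl_ne d
    constructor
    · exact fun h h' => ha h' h
    · intro h
      by_contra h'
      exact this (ht h h').symm
  -- one level curve in each component
  have hsel : ∃ sel : W.Comp → Option D, ∀ b, W.jump b = -1 →
      ∃ b₀, sel (Quot.mk _ (W.face b, 0)) = some b₀ ∧ W.jump b₀ = -1 ∧
      (Quot.mk _ (W.face b₀, 0) : W.Comp) = Quot.mk _ (W.face b, 0) := by
    refine ⟨fun q => if h : ∃ b, W.jump b = -1 ∧ (Quot.mk _ (W.face b, 0) : W.Comp) = q then
      some h.choose else none, fun b hb => ?_⟩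
    have h : ∃ b', W.jump b' = -1 ∧ (Quot.mk _ (W.face b', 0) : W.Comp) = Quot.mk _ (W.face b, 0) :=
      ⟨b, hb, rfl⟩
    exact ⟨h.choose, dif_pos h, h.choose_spec⟩
  obtain ⟨sel, hsel⟩ := hsel
  set S : Set D := {b | W.jump b = -1 ∧ ∃ b₀, sel (Quot.mk _ (W.face b, 0)) = some b₀ ∧
        Relation.EqvGen W.Consecutive b₀ b} with hS_def
  have hS : ∀ b ∈ S, W.jump b = -1 := fun b hb => hb.1
  have hS' : ∀ a b, W.Consecutive a b → (a ∈ S ↔ b ∈ S) := by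
    rintro _ _ ⟨d, hd, rfl, rfl, h1, h2⟩
    have h3 : (Quot.mk W.Adj (W.face d, 0)) = Quot.mk W.Adj (W.face (W.fl d), 0) :=
      Quot.sound ⟨d, rfl, by simp [hd], le_rfl, le_rfl⟩
    have h4 : W.Consecutive (W.nxt d) (W.prv (W.fl d)) := ⟨d, hd, rfl, rfl, h1, h2⟩
    simp only [hS_def, Set.mem_ofPred_eq, W.face_nxt, W.face_prv, h3, h1, h2, true_and]
    exact exists_congr fun b₀ => and_congr_right fun _ =>
      ⟨fun h => h.trans _ _ _ (.rel _ _ h4), fun h => h.trans _ _ _ (.symm _ _ (.rel _ _ h4))⟩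
  -- Lifts of an edge are numbered by the height of the lower adjacent polygon, whereas the cochains
  -- use the height of the polygon of the dart.
  let lvl (x : Σ d : {d // pos d}, Fin (X.rD d.1)) : ℤ := x.2 - min 0 (W.jump x.1)
  let B : ((Σ f, Fin (X.rF f)) → ℚ) →ₗ[ℚ] (Σ d : {d // pos d}, Fin (X.rD d.1)) → ℚ :=
    { toFun := fun p x => X.bd p x.1 (lvl x)
      map_add' := fun p p' => funext fun x => X.bd_add p p' _ _
      map_smul' := fun c p => funext fun x => X.bd_smul c p _ _ }
  let A : ((Σ z, Fin (X.rZ z)) → ℚ) →ₗ[ℚ] (Σ d : {d // pos d}, Fin (X.rD d.1)) → ℚ :=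
    { toFun := fun h x => X.d0 h x.1 (lvl x)
      map_add' := fun p p' => funext fun x => X.d0_add p p' _ _
      map_smul' := fun c p => funext fun x => X.d0_smul c p _ _ }
  let C : ((Σ f, Fin (X.rF f)) → ℚ) →ₗ[ℚ] (Σ d : {d // pos d}, Fin (X.rD d.1)) → ℚ :=
    { toFun := fun p x => X.cup S p x.1 (lvl x)
      map_add' := fun p p' => funext fun x => X.cup_add S p p' _ _
      map_smul' := fun c p => funext fun x => X.cup_smul S c p _ _ }
  obtain ⟨π, hπ⟩ := LinearMap.exists_leftInverse_of_injective (LinearMap.ker B).subtype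
    (Submodule.ker_subtype _)
  -- An antisymmetric cochain that vanishes on the chosen darts vanishes on all edges of the
  -- truncation.
  have hext : ∀ y : D → ℤ → ℚ, (∀ d i, 0 ≤ i + min 0 (W.jump d) →
      y (W.fl d) (i + W.jump d) = - y d i) → (∀ x : Σ d : {d // pos d}, Fin (X.rD d.1), y x.1 (lvl x) = 0) →
      ∀ d i, 0 ≤ i + min 0 (W.jump d) → i + min 0 (W.jump d) < X.rD d → y d i = 0 := by
    intro y hy hy0 d i h1 h2
    by_cases hd : pos d
    · have := hy0 ⟨⟨d, hd⟩, ⟨(i + min 0 (W.jump d)).toNat, by simp only; omega⟩⟩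
      simp only [lvl] at this
      rwa [Int.toNat_of_nonneg h1, add_sub_cancel_right] at this
    · have hd' := (hpos d).2 hd
      have h3 := hy d i h1
      have h5 := X.rD_fl d
      have h4 := hy0 ⟨⟨W.fl d, hd'⟩, ⟨(i + min 0 (W.jump d)).toNat, by simp only; omega⟩⟩
      simp only [lvl] at h4
      rw [Int.toNat_of_nonneg h1, W.jump_fl, show i + min 0 (W.jump d) - min 0 (-W.jump d) =
        i + W.jump d by omega, h3] at h4
      linarith
  have hker : ∀ p ∈ LinearMap.ker B, ∀ d i, 0 ≤ i + min 0 (W.jump d) →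
      extendLevel p (W.face d) i = extendLevel p (W.face (W.fl d)) (i + W.jump d) := by
    intro p hp d i hi
    by_cases h2 : i + min 0 (W.jump d) < X.rD d
    · have := hext (X.bd p) (fun d i _ => X.bd_fl p d i) (fun x => congrFun (LinearMap.mem_ker.1 hp) x)
        d i hi h2
      exact sub_eq_zero.1 this
    · have h3 := X.closed_face d
      have h4 := X.closed_face (W.fl d)
      rw [X.rD_fl, W.jump_fl] at h4
      rw [extendLevel_of_not _ (by omega), extendLevel_of_not _ (by omega)]
  -- An injective map from 0-cochains and 2-chains to 1-cochains proves the inequality by counting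
  -- dimensions. Coboundaries and boundaries alone do not suffice, since there may be relative
  -- 2-cycles; on these, the projection `π` onto the kernel allows one to add the class dual to a
  -- level curve of each component.
  let Ψ := A.coprod (B + C ∘ₗ (LinearMap.ker B).subtype ∘ₗ π)
  have hΨ : Function.Injective Ψ := by
    rw [← LinearMap.ker_eq_bot, LinearMap.ker_eq_bot']
    rintro ⟨h, p⟩ h0
    have h0' : ∀ x, X.d0 h x.1 (lvl x) + (X.bd p x.1 (lvl x) + X.cup S (π p : _) x.1 (lvl x)) = 0 := fun x =>
      congrFun h0 x
    have hπp := hker (π p : _) (π p).2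
    -- A boundary is orthogonal to the two cocycles in the relation. Pairing the relation with the
    -- boundary of `p` therefore leaves the sum of its squares, so `p` has no boundary.
    have e1 := sum_bd_mul X hpos p (X.d0 h) (fun d i _ => X.d0_fl h d i)
      (fun d i hi _ => X.d0_eq_zero h d i hi) (X.sum_face_d0 h)
    have e2 := sum_bd_mul X hpos p (X.cup S (π p : _)) (X.cup_fl hS hS' _ hπp)
      (X.cup_eq_zero hS _) (X.sum_face_cup S _)
    have e3 : ∑ d : {d // pos d}, ∑ k : Fin (X.rD d), (X.bd p d (k - min 0 (W.jump d))) ^ 2 = 0 := by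
      have e4 := congrArg₂ (fun a b : ℚ => -(a + b)) e1 e2
      simp only [add_zero, neg_zero] at e4
      rw [← e4, ← Finset.sum_add_distrib, ← Finset.sum_neg_distrib]
      refine Finset.sum_congr rfl fun d _ => ?_
      rw [← Finset.sum_add_distrib, ← Finset.sum_neg_distrib]
      refine Finset.sum_congr rfl fun k _ => ?_
      have := h0' ⟨d, k⟩
      simp only [lvl] at this
      linear_combination (X.bd p d (k - min 0 (W.jump d))) * this
    have hpk : p ∈ LinearMap.ker B := by
      rw [LinearMap.mem_ker]
      funext ⟨d, k⟩
      rw [Finset.sum_eq_zero_iff_of_nonneg fun d _ => Finset.sum_nonneg fun k _ => sq_nonneg _] at e3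
      have := (Finset.sum_eq_zero_iff_of_nonneg fun k _ => sq_nonneg _).1 (e3 d (Finset.mem_univ _)) k
        (Finset.mem_univ _)
      exact pow_eq_zero_iff two_ne_zero |>.1 this
    have hπe : ((π p : _) : (Σ f, Fin (X.rF f)) → ℚ) = p :=
      congrArg Subtype.val (LinearMap.congr_fun hπ ⟨p, hpk⟩)
    rw [hπe] at h0' hπp
    have hB0 : ∀ x, X.bd p x.1 (lvl x) = 0 := fun x => congrFun (LinearMap.mem_ker.1 hpk) x
    have hp0 : p = 0 := by
      refine X.eq_zero_of_cup hW hsel h p hπp fun d i h1 h2 => ?_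
      refine hext (fun d i => X.d0 h d i + X.cup S p d i) (fun d i hi => ?_) (fun x => ?_) d i h1 h2
      · rw [X.d0_fl, X.cup_fl hS hS' p hπp d i hi]; ring
      · have := h0' x; rw [hB0, zero_add] at this; exact this
    subst hp0
    have hcup0 : ∀ d i, X.cup S 0 d i = 0 := fun d i => by simp [cup, extendLevel]
    have hh0 : h = 0 := by
      refine extendLevel_injective (X.vertices_connected _ (fun z i hi => extendLevel_of_not _ hi)
        fun d i h1 h2 => ?_)
      have := hext (X.d0 h) (fun d i _ => X.d0_fl h d i) (fun x => by
        have := h0' x; rw [hB0, hcup0, zero_add, add_zero] at this; exact this) d i h1 h2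
      exact sub_eq_zero.1 this
    rw [hh0]; rfl
  have h1 := LinearMap.finrank_le_finrank_of_injective hΨ
  rw [Module.finrank_prod, Module.finrank_fintype_fun_eq_card, Module.finrank_fintype_fun_eq_card,
    Module.finrank_fintype_fun_eq_card] at h1
  simp only [Fintype.card_sigma, Fintype.card_fin] at h1
  have h2 : ∑ d, X.rD d = 2 * ∑ d : {d // pos d}, X.rD d.1 := by
    rw [← Fintype.sum_subtype_add_sum_subtype pos, two_mul]
    congr 1
    exact (Fintype.sum_equiv (⟨fun d => ⟨W.fl d, by rw [hpos]; exact not_not.2 d.2⟩,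
      fun d => ⟨W.fl d, by rw [hpos]; exact d.2⟩, fun d => Subtype.ext (W.fl_fl _),
      fun d => Subtype.ext (W.fl_fl _)⟩ : {d // pos d} ≃ {d // ¬ pos d}) _ _
        fun d => (X.rD_fl d.1).symm).symm
  omega

end Truncation

end HeightMap

/-! ## Triangulated surfaces and normal curves -/

/-- A closed oriented triangulated surface. Corners and sides of the triangles are indexed by `C`, a
side having the index of the opposite corner. `nx` is the anticlockwise order in a triangle, `fl` the
gluing of sides; `tri` is the triangle and `lv` the vertex at a corner. -/
structure TriSurface (C A V : Type*) where
  nx : C → C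
  fl : C → C
  tri : C → A
  lv : C → V
  nx_nx_nx : ∀ c, nx (nx (nx c)) = c
  nx_ne : ∀ c, nx c ≠ c
  tri_nx : ∀ c, tri (nx c) = tri c
  tri_eq : ∀ c d, tri c = tri d → d = c ∨ d = nx c ∨ d = nx (nx c)
  tri_surjective : Function.Surjective tri
  fl_fl : ∀ s, fl (fl s) = s
  fl_ne : ∀ s, fl s ≠ s
  lv_fl : ∀ s, lv (nx (fl s)) = lv (nx (nx s))
  lv_orbit : ∀ c d, lv c = lv d → Relation.EqvGen (fun a b => ∃ s, a = nx s ∧ b = nx (nx (fl s))) c d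

namespace TriSurface

variable {C A V : Type*} (S : TriSurface C A V)

/-- An oriented normal multi-curve without inessential components. `n c` is the number of arcs at the
corner `c`, and `sg c k` is `1` if the `k`-th of them, counted from the corner, turns anticlockwise
around the corner, and `-1` otherwise. -/
structure Curve where
  n : C → ℕ
  sg : C → ℕ → ℤ
  sg_eq : ∀ c k, sg c k = 1 ∨ sg c k = -1
  m : C → ℕ
  m_eq : ∀ s, m s = n (S.nx s) + n (S.nx (S.nx s))
  m_fl : ∀ s, m (S.fl s) = m s
  /-- the crossing number at the `j`-th point of a side -/
  cr : C → ℕ → ℤ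
  cr_eq : ∀ s j, cr s j =
    if j < n (S.nx s) then sg (S.nx s) j else -sg (S.nx (S.nx s)) (m s - 1 - j)
  cr_fl : ∀ s j, j < m s → cr (S.fl s) (m s - 1 - j) = -cr s j
  /-- the arc ending at the `j`-th point of a side -/
  arcAt : C → ℕ → C × ℕ
  arcAt_eq : ∀ s j, arcAt s j = if j < n (S.nx s) then (S.nx s, j) else (S.nx (S.nx s), m s - 1 - j)
  essential : ∀ c k, k < n c → ¬ ∃ h : V → ℤ, ∀ s, ∑ j ∈ Finset.range (m s),
    (open Classical in if Relation.EqvGen (fun a b => ∃ s j, j < m s ∧ a = arcAt s j ∧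
      b = arcAt (S.fl s) (m s - 1 - j)) (c, k) (arcAt s j) then cr s j else 0) =
        h (S.lv (S.nx s)) - h (S.lv (S.nx (S.nx s)))

namespace Curve

variable {S} (γ : S.Curve)

/-- Two arcs are joined at a point of a side. -/
def Joined (a b : C × ℕ) : Prop :=
  ∃ s j, j < γ.m s ∧ a = γ.arcAt s j ∧ b = γ.arcAt (S.fl s) (γ.m s - 1 - j)

theorem m_nx (c : C) : γ.m (S.nx c) = γ.n (S.nx (S.nx c)) + γ.n c := by
  rw [γ.m_eq, S.nx_nx_nx]

theorem m_nx_nx (c : C) : γ.m (S.nx (S.nx c)) = γ.n c + γ.n (S.nx c) := by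
  rw [γ.m_eq, S.nx_nx_nx]

/-- Sides of the pieces into which the triangles are cut by the curve: the segments of the sides
and both sides of the arcs, seen from the piece closer to the corner (`outer`) and from the other
one (`inner`). -/
inductive Dart
  | seg (s : C) (j : ℕ) (h : j ≤ γ.m s)
  | outer (c : C) (k : ℕ) (h : k < γ.n c)
  | inner (c : C) (k : ℕ) (h : k < γ.n c)

/-- Pieces into which the triangles are cut by the curve. -/
inductive Piece
  | center (a : A)
  | corner (c : C) (k : ℕ) (h : k < γ.n c)

/-- Vertices of the triangulation and points of the curve on its edges. -/
inductive Pt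
  | vertex (v : V)
  | point (s : C) (j : ℕ) (h : j < γ.m s) (hs : WellOrderingRel s (S.fl s))

/-- The piece number `k` at a corner. -/
def pc (c : C) (k : ℕ) : γ.Piece :=
  if h : k < γ.n c then .corner c k h else .center (S.tri c)

/-- The point number `j` on a side. -/
noncomputable def pt (s : C) (j : ℕ) (h : j < γ.m s) : γ.Pt :=
  open Classical in
  if hs : WellOrderingRel s (S.fl s) then .point s j h hs
  else .point (S.fl s) (γ.m s - 1 - j) (by rw [γ.m_fl]; omega) (by
    rw [S.fl_fl]
    by_contra h'
    exact S.fl_ne s ((WellOrderingRel.isWellOrder (α := C)).trichotomous _ _ h' hs))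

/-- The next side of the same piece. -/
def nxt : γ.Dart → γ.Dart
  | .seg s j h =>
    if h1 : j < γ.n (S.nx s) then .outer (S.nx s) j h1
    else if h2 : γ.m s - j = 0 then .seg (S.nx s) 0 (Nat.zero_le _)
    else .inner (S.nx (S.nx s)) (γ.m s - j - 1) (by have := γ.m_eq s; omega)
  | .outer c k _ => .seg (S.nx c) (γ.m (S.nx c) - k) (Nat.sub_le _ _)
  | .inner c k h => .seg (S.nx (S.nx c)) (k + 1) (by have := γ.m_nx_nx c; omega)

/-- The previous side of the same piece. -/
def prv : γ.Dart → γ.Dart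
  | .seg s j h =>
    if h1 : j ≤ γ.n (S.nx s) then
      if h2 : j = 0 then .seg (S.nx (S.nx s)) (γ.m (S.nx (S.nx s))) le_rfl
      else .inner (S.nx s) (j - 1) (by omega)
    else .outer (S.nx (S.nx s)) (γ.m s - j) (by have := γ.m_eq s; omega)
  | .outer c k h => .seg (S.nx (S.nx c)) k (by have := γ.m_nx_nx c; omega)
  | .inner c k _ => .seg (S.nx c) (γ.m (S.nx c) - (k + 1)) (Nat.sub_le _ _)

/-- The gluing of the pieces. -/
def flip : γ.Dart → γ.Dart
  | .seg s j h => .seg (S.fl s) (γ.m s - j) (by rw [γ.m_fl]; omega)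
  | .outer c k h => .inner c k h
  | .inner c k h => .outer c k h

/-- The piece to which a side belongs. -/
def face : γ.Dart → γ.Piece
  | .seg s j _ => if j ≤ γ.n (S.nx s) then γ.pc (S.nx s) j else γ.pc (S.nx (S.nx s)) (γ.m s - j)
  | .outer c k _ => γ.pc c k
  | .inner c k _ => γ.pc c (k + 1)

/-- The initial point of a side. -/
noncomputable def tail : γ.Dart → γ.Pt
  | .seg s 0 _ => .vertex (S.lv (S.nx s))
  | .seg s (j + 1) h => γ.pt s j h
  | .outer c k h => γ.pt (S.nx (S.nx c)) k (by have := γ.m_nx_nx c; omega)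
  | .inner c k h => γ.pt (S.nx c) (γ.m (S.nx c) - k - 1) (by have := γ.m_nx c; omega)

/-- The change of height across a side. -/
def jump : γ.Dart → ℤ
  | .seg _ _ _ => 0
  | .outer c k _ => -γ.sg c k
  | .inner c k _ => γ.sg c k

/-- The relative height of the initial point. -/
def tl : γ.Dart → ℤ
  | .seg _ 0 _ => 0
  | .seg s (j + 1) _ => min 0 (γ.cr s j)
  | .outer c k _ => min 0 (-γ.sg c k)
  | .inner c k _ => min 0 (γ.sg c k)

variable {γ}

theorem Dart.seg_congr {s s' : C} {j j' : ℕ} (h : j ≤ γ.m s) (hs : s = s') (hj : j = j') :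
    Dart.seg (γ := γ) s j h = .seg s' j' (hs ▸ hj ▸ h) := by
  subst hs hj; rfl

theorem Dart.outer_congr {s s' : C} {j j' : ℕ} (h : j < γ.n s) (hs : s = s') (hj : j = j') :
    Dart.outer (γ := γ) s j h = .outer s' j' (hs ▸ hj ▸ h) := by
  subst hs hj; rfl

theorem Dart.inner_congr {s s' : C} {j j' : ℕ} (h : j < γ.n s) (hs : s = s') (hj : j = j') :
    Dart.inner (γ := γ) s j h = .inner s' j' (hs ▸ hj ▸ h) := by
  subst hs hj; rfl

theorem pt_congr {s s' : C} {j j' : ℕ} (h : j < γ.m s) (hs : s = s') (hj : j = j') :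
    γ.pt s j h = γ.pt s' j' (hs ▸ hj ▸ h) := by
  subst hs hj; rfl

theorem pt_fl (s : C) (j : ℕ) (h : j < γ.m s) (h' : γ.m s - 1 - j < γ.m (S.fl s)) :
    γ.pt (S.fl s) (γ.m s - 1 - j) h' = γ.pt s j h := by
  have ht := (WellOrderingRel.isWellOrder (α := C)).trichotomous s (S.fl s)
  have ha := fun h => asymm_of WellOrderingRel (a := s) (b := S.fl s) h
  have hne := S.fl_ne s
  unfold pt
  by_cases hs : WellOrderingRel s (S.fl s)
  · have : ¬ WellOrderingRel (S.fl s) (S.fl (S.fl s)) := by rw [S.fl_fl]; exact ha hs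
    rw [dif_neg this, dif_pos hs]
    simp only [Pt.point.injEq, S.fl_fl, γ.m_fl, true_and]
    omega
  · have : WellOrderingRel (S.fl s) (S.fl (S.fl s)) := by
      rw [S.fl_fl]
      by_contra h'
      exact hne (ht hs h').symm
    rw [dif_pos this, dif_neg hs]

theorem pt_eq_iff {s s' : C} {j j' : ℕ} (h : j < γ.m s) (h' : j' < γ.m s') :
    γ.pt s j h = γ.pt s' j' h' → (s' = s ∧ j' = j) ∨ (s' = S.fl s ∧ j' = γ.m s - 1 - j) := by
  unfold pt
  split_ifs <;> simp only [Pt.point.injEq]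
  · rintro ⟨rfl, rfl⟩; simp
  · rintro ⟨rfl, rfl⟩
    rw [γ.m_fl, S.fl_fl]; right; exact ⟨rfl, by omega⟩
  · rintro ⟨rfl, rfl⟩; simp
  · rintro ⟨h1, h2⟩
    have h3 : s = s' := by rw [← S.fl_fl s, h1, S.fl_fl]
    subst h3
    left; exact ⟨rfl, by omega⟩

theorem prv_nxt (d : γ.Dart) : γ.prv (γ.nxt d) = d := by
  cases d with
  | seg s j h =>
    have hm := γ.m_eq s
    simp only [nxt]
    split_ifs with h1 h2
    · exact Dart.seg_congr _ (S.nx_nx_nx s) rfl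
    · simp only [prv, Nat.zero_le, dite_true]
      refine Dart.seg_congr _ (S.nx_nx_nx s) ?_
      rw [S.nx_nx_nx]; omega
    · refine Dart.seg_congr _ (S.nx_nx_nx s) ?_
      rw [S.nx_nx_nx]; omega
  | outer c k h =>
    have hm := γ.m_nx c
    simp only [nxt, prv]
    rw [dif_neg (by omega)]
    exact Dart.outer_congr _ (S.nx_nx_nx c) (by omega)
  | inner c k h =>
    simp only [nxt, prv]
    rw [dif_pos (by rw [S.nx_nx_nx]; omega), dif_neg (by omega)]
    exact Dart.inner_congr _ (S.nx_nx_nx c) (by omega)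

theorem nxt_prv (d : γ.Dart) : γ.nxt (γ.prv d) = d := by
  cases d with
  | seg s j h =>
    have hm := γ.m_eq s
    have hm' := γ.m_nx_nx s
    simp only [prv]
    split_ifs with h1 h2
    · simp only [nxt]
      rw [dif_neg (by rw [S.nx_nx_nx]; omega), dif_pos (by omega)]
      exact Dart.seg_congr _ (S.nx_nx_nx s) h2.symm
    · exact Dart.seg_congr _ (S.nx_nx_nx s) (by omega)
    · refine Dart.seg_congr _ (S.nx_nx_nx s) ?_
      rw [S.nx_nx_nx]; omega
  | outer c k h =>
    simp only [nxt, prv]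
    rw [dif_pos (by rw [S.nx_nx_nx]; omega)]
    exact Dart.outer_congr _ (S.nx_nx_nx c) (by omega)
  | inner c k h =>
    have hm := γ.m_nx c
    simp only [nxt, prv]
    rw [dif_neg (by omega), dif_neg (by omega)]
    exact Dart.inner_congr _ (S.nx_nx_nx c) (by omega)

theorem flip_flip (d : γ.Dart) : γ.flip (γ.flip d) = d := by
  cases d with
  | seg s j h =>
    refine Dart.seg_congr _ (S.fl_fl s) ?_
    rw [γ.m_fl]; omega
  | outer c k h => rfl
  | inner c k h => rfl

theorem flip_ne (d : γ.Dart) : γ.flip d ≠ d := by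
  cases d with
  | seg s j h => simp [flip, S.fl_ne]
  | outer c k h => simp [flip]
  | inner c k h => simp [flip]

theorem tri_nx_nx (c : C) : S.tri (S.nx (S.nx c)) = S.tri c := by rw [S.tri_nx, S.tri_nx]

theorem pc_of_le {c : C} {k : ℕ} (h : γ.n c ≤ k) : γ.pc c k = .center (S.tri c) :=
  dif_neg (by omega)

theorem face_seg_nx {s : C} {j : ℕ} (h : j ≤ γ.m s) (hj : j ≤ γ.n (S.nx s)) :
    γ.face (.seg s j h) = γ.pc (S.nx s) j := if_pos hj

theorem face_seg_nx_nx {s : C} {j : ℕ} (h : j ≤ γ.m s) (hj : γ.n (S.nx s) ≤ j) :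
    γ.face (.seg s j h) = γ.pc (S.nx (S.nx s)) (γ.m s - j) := by
  have hm := γ.m_eq s
  rcases hj.eq_or_lt with hj | hj
  · rw [face_seg_nx h hj.ge, pc_of_le hj.le, pc_of_le (by omega), S.tri_nx, tri_nx_nx]
  · exact if_neg (by omega)

theorem face_nxt (d : γ.Dart) : γ.face (γ.nxt d) = γ.face d := by
  cases d with
  | seg s j h =>
    have hm := γ.m_eq s
    simp only [nxt]
    split_ifs with h1 h2
    · rw [face_seg_nx h h1.le]; rfl
    · rw [face_seg_nx _ (Nat.zero_le _), face_seg_nx_nx h (by omega), h2]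
    · rw [face_seg_nx_nx h (by omega)]
      simp only [face]
      congr 1; omega
  | outer c k h =>
    have hm := γ.m_nx c
    simp only [nxt]
    rw [face_seg_nx_nx _ (by omega), S.nx_nx_nx]
    simp only [face]
    congr 1; omega
  | inner c k h =>
    simp only [nxt]
    rw [face_seg_nx _ (by rw [S.nx_nx_nx]; omega), S.nx_nx_nx]
    rfl

theorem nxt_seg_last (s : C) (h : γ.m s ≤ γ.m s) :
    γ.nxt (.seg s (γ.m s) h) = .seg (S.nx s) 0 (Nat.zero_le _) := by
  have hm := γ.m_eq s
  simp only [nxt]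
  rw [dif_neg (by omega), dif_pos (by omega)]

theorem jump_nxt_seg {s : C} {j : ℕ} (h : j < γ.m s) : γ.jump (γ.nxt (.seg s j h.le)) = -γ.cr s j := by
  have hm := γ.m_eq s
  simp only [nxt, γ.cr_eq]
  split_ifs with h1 h2
  · rfl
  · omega
  · simp only [jump, neg_neg]
    congr 1; omega

theorem jump_prv_seg {s : C} {j : ℕ} (h : j < γ.m s) : γ.jump (γ.prv (.seg s (j + 1) h)) = γ.cr s j := by
  have hm := γ.m_eq s
  simp only [prv, γ.cr_eq]
  by_cases h1 : j + 1 ≤ γ.n (S.nx s)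
  · rw [dif_pos h1, dif_neg (by omega), if_pos (by omega)]
    rfl
  · rw [dif_neg h1, if_neg (by omega)]
    simp only [jump]
    congr 2; omega

theorem tail_seg_succ {s : C} {j j' : ℕ} (h : j' ≤ γ.m s) (hj : j' = j + 1) :
    γ.tail (.seg s j' h) = γ.pt s j (by omega) := by
  subst hj; rfl

theorem tl_seg_succ {s : C} {j j' : ℕ} (h : j' ≤ γ.m s) (hj : j' = j + 1) :
    γ.tl (.seg s j' h) = min 0 (γ.cr s j) := by
  subst hj; rfl

theorem tail_nxt_seg {s : C} {j : ℕ} (h : j < γ.m s) : γ.tail (γ.nxt (.seg s j h.le)) = γ.pt s j h := by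
  have hm := γ.m_eq s
  simp only [nxt]
  split_ifs with h1 h2
  · exact pt_congr _ (S.nx_nx_nx s) rfl
  · omega
  · refine pt_congr _ (S.nx_nx_nx s) ?_
    rw [S.nx_nx_nx]; omega

theorem tl_nxt_seg {s : C} {j : ℕ} (h : j < γ.m s) : γ.tl (γ.nxt (.seg s j h.le)) = min 0 (-γ.cr s j) := by
  have hm := γ.m_eq s
  simp only [nxt, γ.cr_eq]
  split_ifs with h1 h2
  · rfl
  · omega
  · simp only [tl, neg_neg]
    congr 2; omega

theorem nxt_flip_nxt_seg {s : C} {j : ℕ} (h : j < γ.m s) :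
    γ.nxt (γ.flip (γ.nxt (.seg s j h.le))) = .seg s (j + 1) h := by
  have hm := γ.m_eq s
  simp only [nxt]
  split_ifs with h1 h2
  · exact Dart.seg_congr _ (S.nx_nx_nx s) rfl
  · omega
  · refine Dart.seg_congr _ (S.nx_nx_nx s) ?_
    rw [S.nx_nx_nx]; omega

theorem cr_nx {c : C} {k : ℕ} (h : k < γ.n c) : γ.cr (S.nx c) (γ.m (S.nx c) - k - 1) = -γ.sg c k := by
  have hm := γ.m_nx c
  rw [γ.cr_eq, if_neg (by omega), S.nx_nx_nx]
  congr 2; omega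

theorem cr_nx_nx {c : C} {k : ℕ} (h : k < γ.n c) : γ.cr (S.nx (S.nx c)) k = γ.sg c k := by
  rw [γ.cr_eq, S.nx_nx_nx, if_pos h]

theorem tail_flip (d : γ.Dart) : γ.tail (γ.flip d) = γ.tail (γ.nxt d) := by
  cases d with
  | seg s j h =>
    rcases h.eq_or_lt with rfl | hj
    · rw [nxt_seg_last]
      have : γ.flip (.seg s (γ.m s) h) = .seg (S.fl s) 0 (Nat.zero_le _) :=
        Dart.seg_congr _ rfl (Nat.sub_self _)
      rw [this]
      exact congrArg Pt.vertex (S.lv_fl s)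
    · rw [tail_nxt_seg hj]
      simp only [flip]
      have := γ.m_fl s
      rw [tail_seg_succ _ (show γ.m s - j = (γ.m s - 1 - j) + 1 by omega)]
      exact pt_fl s j hj _
  | outer c k h =>
    have hm := γ.m_nx c
    simp only [nxt]
    rw [tail_seg_succ _ (show γ.m (S.nx c) - k = (γ.m (S.nx c) - k - 1) + 1 by omega)]
    rfl
  | inner c k h => rfl

theorem jump_flip (d : γ.Dart) : γ.jump (γ.flip d) = -γ.jump d := by
  cases d with
  | seg s j h => rfl
  | outer c k h => exact (neg_neg _).symm
  | inner c k h => rfl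

theorem tl_flip (d : γ.Dart) : γ.jump d + γ.tl (γ.flip d) = γ.tl (γ.nxt d) := by
  cases d with
  | seg s j h =>
    rcases h.eq_or_lt with rfl | hj
    · rw [nxt_seg_last]
      have : γ.flip (.seg s (γ.m s) h) = .seg (S.fl s) 0 (Nat.zero_le _) :=
        Dart.seg_congr _ rfl (Nat.sub_self _)
      rw [this]
      rfl
    · rw [tl_nxt_seg hj]
      simp only [flip]
      rw [tl_seg_succ _ (show γ.m s - j = (γ.m s - 1 - j) + 1 by omega), γ.cr_fl s j hj]
      exact zero_add _
  | outer c k h =>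
    have hm := γ.m_nx c
    simp only [nxt]
    rw [tl_seg_succ _ (show γ.m (S.nx c) - k = (γ.m (S.nx c) - k - 1) + 1 by omega), cr_nx h]
    simp only [jump, flip, tl]
    omega
  | inner c k h =>
    simp only [nxt, jump, flip, tl, cr_nx_nx h]
    omega

theorem tl_le (d : γ.Dart) : γ.tl d ≤ min 0 (γ.jump d) := by
  cases d with
  | seg s j h =>
    cases j with
    | zero => simp [tl, jump]
    | succ j => simp [tl, jump]
  | outer c k h => exact le_rfl
  | inner c k h => exact le_rfl

theorem nxt_flip_seg_zero (s : C) : γ.nxt (γ.flip (.seg s 0 (Nat.zero_le _))) =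
    .seg (S.nx (S.fl s)) 0 (Nat.zero_le _) := by
  have : γ.flip (.seg s 0 (Nat.zero_le _)) = .seg (S.fl s) (γ.m (S.fl s)) le_rfl :=
    Dart.seg_congr _ rfl (by rw [γ.m_fl]; rfl)
  rw [this, nxt_seg_last]

/-- A dart that starts at a point of the curve can be rotated to a segment of a side, so orbits need
to be compared for segments only. -/
theorem eqvGen_dart (d : γ.Dart) :
    (∃ c, γ.tail d = .vertex (S.lv c) ∧ d = .seg (S.nx (S.nx c)) 0 (Nat.zero_le _)) ∨
    ∃ s j h, γ.tail d = γ.pt s j h ∧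
      Relation.EqvGen (fun a b => b = γ.nxt (γ.flip a)) d (.seg s (j + 1) h) := by
  cases d with
  | seg s j h =>
    cases j with
    | zero => exact Or.inl ⟨S.nx s, rfl, Dart.seg_congr _ (S.nx_nx_nx s).symm rfl⟩
    | succ j => exact Or.inr ⟨s, j, h, rfl, .refl _⟩
  | outer c k h =>
    have hm := γ.m_nx_nx c
    exact Or.inr ⟨S.nx (S.nx c), k, by omega, rfl, .rel _ _ rfl⟩
  | inner c k h =>
    have hm := γ.m_nx c
    refine Or.inr ⟨S.nx c, γ.m (S.nx c) - k - 1, by omega, rfl, .rel _ _ ?_⟩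
    exact (Dart.seg_congr _ rfl (by omega))

theorem tail_orbit (d d' : γ.Dart) (h : γ.tail d = γ.tail d') :
    Relation.EqvGen (fun a b => b = γ.nxt (γ.flip a)) d d' := by
  rcases eqvGen_dart d with ⟨c, h1, rfl⟩ | ⟨s, j, hj, h1, h2⟩
  · rcases eqvGen_dart d' with ⟨c', h1', rfl⟩ | ⟨s', j', hj', h1', h2'⟩
    · rw [h1, h1', Pt.vertex.injEq] at h
      have := S.lv_orbit c c' h
      clear h h1 h1'
      induction this with
      | rel a b h =>
        obtain ⟨s, rfl, rfl⟩ := h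
        refine .rel _ _ ?_
        rw [nxt_flip_seg_zero]
        exact Dart.seg_congr _ (by rw [S.nx_nx_nx, S.nx_nx_nx]) rfl
      | refl x => exact .refl _
      | symm x y _ ih => exact .symm _ _ ih
      | trans x y z _ _ ih1 ih2 => exact .trans _ _ _ ih1 ih2
    · rw [h1, h1'] at h
      unfold pt at h
      split_ifs at h
  · rcases eqvGen_dart d' with ⟨c', h1', rfl⟩ | ⟨s', j', hj', h1', h2'⟩
    · rw [h1, h1'] at h
      unfold pt at h
      split_ifs at h
    · rw [h1, h1'] at h
      refine h2.trans _ _ _ (.trans _ _ _ ?_ (.symm _ _ h2'))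
      rcases pt_eq_iff _ _ h with ⟨rfl, rfl⟩ | ⟨rfl, rfl⟩
      · exact .refl _
      · have hm := γ.m_fl s
        have hj'' : γ.m s - 1 - j < γ.m (S.fl s) := by omega
        refine .trans _ (γ.nxt (.seg (S.fl s) (γ.m s - 1 - j) hj''.le)) _ (.rel _ _ ?_) (.rel _ _ ?_)
        · exact congrArg γ.nxt (Dart.seg_congr _ rfl (by omega))
        · exact (nxt_flip_nxt_seg hj'').symm

variable (γ) in
/-- The surface cut along the curve, whose height increases by one when crossing the curve from its right to its left. -/
noncomputable def heightMap : HeightMap γ.Dart γ.Piece γ.Pt where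
  nxt := γ.nxt
  prv := γ.prv
  fl := γ.flip
  face := γ.face
  tail := γ.tail
  jump := γ.jump
  tl := γ.tl
  prv_nxt := prv_nxt
  nxt_prv := nxt_prv
  fl_fl := flip_flip
  fl_ne := flip_ne
  face_nxt := face_nxt
  tail_fl := tail_flip
  jump_fl := jump_flip
  tl_fl := tl_flip
  tl_le := tl_le
  tail_orbit := tail_orbit
  neg_one_le_jump d := by
    cases d with
    | seg s j h => simp [jump]
    | outer c k h => have := γ.sg_eq c k; simp only [jump]; omega
    | inner c k h => have := γ.sg_eq c k; simp only [jump]; omega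
  jump_nxt d h := by
    cases d with
    | seg s j h' => exact absurd rfl h
    | outer c k h => rfl
    | inner c k h => rfl
  jump_prv d h := by
    cases d with
    | seg s j h' => exact absurd rfl h
    | outer c k h => rfl
    | inner c k h => rfl
  jump_iff d hd := by
    cases d with
    | seg s j h =>
      have hm := γ.m_fl s
      rcases h.eq_or_lt with rfl | hj
      · rw [nxt_seg_last]
        simp [jump, flip, prv]
      · have : γ.flip (.seg s j h) = .seg (S.fl s) ((γ.m s - 1 - j) + 1) (by omega) :=
          Dart.seg_congr _ rfl (by omega)
        rw [jump_nxt_seg hj, this, jump_prv_seg (by omega), γ.cr_fl s j hj]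
    | outer c k h => have := γ.sg_eq c k; simp only [jump] at hd; omega
    | inner c k h => have := γ.sg_eq c k; simp only [jump] at hd; omega

end Curve

end TriSurface

/-! ### The level curves of the cut surface are the components of the curve. -/

namespace TriSurface

variable {C A V : Type*} {S : TriSurface C A V}

namespace Curve

variable {γ : S.Curve}

/-- The arc bounding a piece along a dart. -/
def arcOf : γ.Dart → C × ℕ
  | .seg s _ _ => (s, 0)
  | .outer c k _ => (c, k)
  | .inner c k _ => (c, k)

open Classical in
/-- The side of an arc across which the height decreases. -/
noncomputable def descOf (a : C × ℕ) (h : a.2 < γ.n a.1) : γ.Dart :=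
  if γ.sg a.1 a.2 = 1 then .outer a.1 a.2 h else .inner a.1 a.2 h

theorem arcAt_lt {s : C} {j : ℕ} (h : j < γ.m s) : (γ.arcAt s j).2 < γ.n (γ.arcAt s j).1 := by
  have hm := γ.m_eq s
  rw [γ.arcAt_eq]
  split_ifs
  · assumption
  · simp only; omega

theorem arcOf_nxt_seg {s : C} {j : ℕ} (h : j < γ.m s) : arcOf (γ.nxt (.seg s j h.le)) = γ.arcAt s j := by
  have hm := γ.m_eq s
  simp only [nxt, γ.arcAt_eq]
  split_ifs with h1 h2
  · rfl
  · omega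
  · exact Prod.ext rfl (by simp only [arcOf]; omega)

theorem arcOf_prv_seg {s : C} {j : ℕ} (h : j < γ.m s) : arcOf (γ.prv (.seg s (j + 1) h)) = γ.arcAt s j := by
  have hm := γ.m_eq s
  simp only [prv, γ.arcAt_eq]
  by_cases h1 : j + 1 ≤ γ.n (S.nx s)
  · rw [dif_pos h1, dif_neg (by omega), if_pos (by omega)]
    rfl
  · rw [dif_neg h1, if_neg (by omega)]
    exact Prod.ext rfl (by simp only [arcOf]; omega)

theorem eq_descOf {d : γ.Dart} (h : γ.jump d = -1) (h' : (arcOf d).2 < γ.n (arcOf d).1) :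
    d = descOf (arcOf d) h' := by
  cases d with
  | seg s j h1 => simp [jump] at h
  | outer c k h1 =>
    simp only [jump, neg_inj] at h
    exact (if_pos h).symm
  | inner c k h1 =>
    simp only [jump] at h
    exact (if_neg (by simp only [arcOf]; omega)).symm

theorem cr_eq_or {s : C} {j : ℕ} : γ.cr s j = 1 ∨ γ.cr s j = -1 := by
  rw [γ.cr_eq]
  have h1 := γ.sg_eq (S.nx s) j
  have h2 := γ.sg_eq (S.nx (S.nx s)) (γ.m s - 1 - j)
  split_ifs <;> omega

theorem flip_seg_eq {s : C} {j : ℕ} (h : j < γ.m s) : γ.flip (.seg s j h.le) =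
    .seg (S.fl s) ((γ.m s - 1 - j) + 1) (by rw [γ.m_fl]; omega) :=
  Dart.seg_congr _ rfl (by omega)

theorem joined_of_consecutive {x y : γ.Dart} (h : γ.heightMap.Consecutive x y) :
    γ.Joined (arcOf x) (arcOf y) := by
  obtain ⟨d, hd, rfl, rfl, h1, h2⟩ := h
  cases d with
  | seg s j h =>
    rcases h.eq_or_lt with rfl | hj
    · have : γ.jump (γ.nxt (.seg s (γ.m s) h)) = -1 := h1
      rw [nxt_seg_last] at this
      simp [jump] at this
    · refine ⟨s, j, hj, arcOf_nxt_seg hj, ?_⟩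
      have : γ.heightMap.fl (.seg s j h) = _ := flip_seg_eq hj
      rw [this]
      exact arcOf_prv_seg (by rw [γ.m_fl]; omega)
  | outer c k h =>
    have := γ.sg_eq c k
    have : -γ.sg c k = 0 := hd
    omega
  | inner c k h =>
    have := γ.sg_eq c k
    have : γ.sg c k = 0 := hd
    omega

theorem nxt_seg_eq_descOf {s : C} {j : ℕ} (h : j < γ.m s) (hc : γ.cr s j = 1) :
    γ.nxt (.seg s j h.le) = descOf (γ.arcAt s j) (arcAt_lt h) := by
  have h1 := eq_descOf (d := γ.nxt (.seg s j h.le)) (by rw [jump_nxt_seg h, hc])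
    (by rw [arcOf_nxt_seg h]; exact arcAt_lt h)
  rw [h1]
  simp only [arcOf_nxt_seg h]

theorem prv_seg_eq_descOf {s : C} {j : ℕ} (h : j < γ.m s) (hc : γ.cr s j = -1) :
    γ.prv (.seg s (j + 1) h) = descOf (γ.arcAt s j) (arcAt_lt h) := by
  have h1 := eq_descOf (d := γ.prv (.seg s (j + 1) h)) (by rw [jump_prv_seg h, hc])
    (by rw [arcOf_prv_seg h]; exact arcAt_lt h)
  rw [h1]
  simp only [arcOf_prv_seg h]

theorem consecutive_descOf {s : C} {j : ℕ} (h : j < γ.m s) (hc : γ.cr s j = 1)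
    (h' : γ.m s - 1 - j < γ.m (S.fl s)) :
    γ.heightMap.Consecutive (descOf (γ.arcAt s j) (arcAt_lt h))
      (descOf (γ.arcAt (S.fl s) (γ.m s - 1 - j)) (arcAt_lt h')) := by
  have hc' : γ.cr (S.fl s) (γ.m s - 1 - j) = -1 := by rw [γ.cr_fl s j h, hc]
  refine ⟨.seg s j h.le, rfl, (nxt_seg_eq_descOf h hc).symm, ?_, ?_, ?_⟩
  · have : γ.heightMap.fl (.seg s j h.le) = _ := flip_seg_eq h
    rw [this]
    exact (prv_seg_eq_descOf h' hc').symm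
  · rw [← nxt_seg_eq_descOf h hc]
    exact (jump_nxt_seg h).trans (by rw [hc])
  · rw [← prv_seg_eq_descOf h' hc']
    exact (jump_prv_seg h').trans hc'

/-- At a point where two arcs are joined, their descending sides are consecutive on a level curve,
in the order given by the sign of the crossing. So a component of the curve traces a single level
curve. -/
theorem eqvGen_descOf {a b : C × ℕ} (h : Relation.EqvGen γ.Joined a b) :
    (a.2 < γ.n a.1 ↔ b.2 < γ.n b.1) ∧ ∀ ha hb,
      Relation.EqvGen γ.heightMap.Consecutive (descOf a ha) (descOf b hb) := by
  induction h with
  | rel a b h =>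
    obtain ⟨s, j, h, rfl, rfl⟩ := h
    have h' : γ.m s - 1 - j < γ.m (S.fl s) := by rw [γ.m_fl]; omega
    refine ⟨iff_of_true (arcAt_lt h) (arcAt_lt h'), fun _ _ => ?_⟩
    rcases cr_eq_or (γ := γ) (s := s) (j := j) with hc | hc
    · exact .rel _ _ (consecutive_descOf h hc h')
    · have hc' : γ.cr (S.fl s) (γ.m s - 1 - j) = 1 := by rw [γ.cr_fl s j h, hc]; rfl
      have := consecutive_descOf h' hc' (by rw [S.fl_fl, γ.m_fl]; omega)
      have e : γ.arcAt (S.fl (S.fl s)) (γ.m (S.fl s) - 1 - (γ.m s - 1 - j)) = γ.arcAt s j := by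
        rw [S.fl_fl, γ.m_fl]; congr 1; omega
      simp only [e] at this
      exact .symm _ _ (.rel _ _ this)
  | refl x => exact ⟨Iff.rfl, fun _ _ => .refl _⟩
  | symm x y _ ih => exact ⟨ih.1.symm, fun ha hb => .symm _ _ (ih.2 hb ha)⟩
  | trans x y z _ _ ih1 ih2 =>
    exact ⟨ih1.1.trans ih2.1, fun ha hb => .trans _ _ _ (ih1.2 ha (ih1.1.1 ha)) (ih2.2 _ hb)⟩

-- Suppose a level curve bounds rationally. Summing the relation over the segments of a side
-- telescopes: the total crossing number of the component with the side is the difference of the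
-- values at its two ends. These differences are integers, so rounding the values down gives an
-- integral bounding function, which is excluded.
variable (γ) in
theorem heightMap_essential : γ.heightMap.Essential := by
  classical
  intro b hb
  rintro ⟨h, hh⟩
  have hbl : (arcOf b).2 < γ.n (arcOf b).1 := by
    cases b with
    | seg s j h1 => have : (0 : ℤ) = -1 := hb; omega
    | outer c k h1 => exact h1
    | inner c k h1 => exact h1
  have hjump : ∀ x, Relation.EqvGen γ.heightMap.Consecutive b x → γ.jump x = -1 := by
    have key : ∀ x y, Relation.EqvGen γ.heightMap.Consecutive x y →
        (γ.jump x = -1 ↔ γ.jump y = -1) := by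
      intro x y hxy
      induction hxy with
      | rel a b h => obtain ⟨_, _, _, _, h1, h2⟩ := h; exact iff_of_true h1 h2
      | refl x => rfl
      | symm x y _ ih => exact ih.symm
      | trans x y z _ _ ih1 ih2 => exact ih1.trans ih2
    exact fun x hx => (key b x hx).1 hb
  have hjoin : ∀ x y, Relation.EqvGen γ.heightMap.Consecutive x y →
      Relation.EqvGen γ.Joined (arcOf x) (arcOf y) := by
    intro x y hxy
    induction hxy with
    | rel a b h => exact .rel _ _ (joined_of_consecutive h)
    | refl x => exact .refl _
    | symm x y _ ih => exact .symm _ _ ih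
    | trans x y z _ _ ih1 ih2 => exact .trans _ _ _ ih1 ih2
  have hdesc : ∀ a ha, Relation.EqvGen γ.Joined (arcOf b) a →
      Relation.EqvGen γ.heightMap.Consecutive b (descOf a ha) := by
    intro a ha hab
    have := (eqvGen_descOf hab).2 hbl ha
    rwa [← eq_descOf hb hbl] at this
  have hN : ∀ s j (h : j < γ.m s), Relation.EqvGen γ.heightMap.Consecutive b (γ.nxt (.seg s j h.le)) ↔
      γ.cr s j = 1 ∧ Relation.EqvGen γ.Joined (arcOf b) (γ.arcAt s j) := by
    intro s j h
    constructor
    · intro h1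
      have h2 := hjump _ h1
      rw [jump_nxt_seg h] at h2
      have h3 := hjoin _ _ h1
      rw [arcOf_nxt_seg h] at h3
      exact ⟨by omega, h3⟩
    · rintro ⟨h1, h2⟩
      rw [nxt_seg_eq_descOf h h1]
      exact hdesc _ _ h2
  have hP : ∀ s j (h : j < γ.m s), Relation.EqvGen γ.heightMap.Consecutive b (γ.prv (.seg s (j + 1) h)) ↔
      γ.cr s j = -1 ∧ Relation.EqvGen γ.Joined (arcOf b) (γ.arcAt s j) := by
    intro s j h
    constructor
    · intro h1
      have h2 := hjump _ h1
      rw [jump_prv_seg h] at h2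
      have h3 := hjoin _ _ h1
      rw [arcOf_prv_seg h] at h3
      exact ⟨by omega, h3⟩
    · rintro ⟨h1, h2⟩
      rw [prv_seg_eq_descOf h h1]
      exact hdesc _ _ h2
  set x : C → ℕ → ℤ := fun s j => if Relation.EqvGen γ.Joined (arcOf b) (γ.arcAt s j) then
    γ.cr s j else 0 with hx
  have hNP : ∀ s j (h : j < γ.m s), (x s j : ℚ) =
      (if Relation.EqvGen γ.heightMap.Consecutive b (γ.nxt (.seg s j h.le)) then 1 else 0) -
      (if Relation.EqvGen γ.heightMap.Consecutive b (γ.prv (.seg s (j + 1) h)) then 1 else 0) := by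
    intro s j h
    rw [if_congr (hN s j h) rfl rfl, if_congr (hP s j h) rfl rfl]
    simp only [hx]
    by_cases h1 : Relation.EqvGen γ.Joined (arcOf b) (γ.arcAt s j)
    · rcases cr_eq_or (γ := γ) (s := s) (j := j) with hc | hc <;> simp [h1, hc]
    · simp [h1]
  have hseg : ∀ s j (h' : j ≤ γ.m s), h (γ.tail (γ.nxt (.seg s j h'))) - h (γ.tail (.seg s j h')) =
      (if Relation.EqvGen γ.heightMap.Consecutive b (γ.nxt (.seg s j h')) then 1 else 0) -
      (if Relation.EqvGen γ.heightMap.Consecutive b (γ.prv (.seg s j h')) then 1 else 0) := by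
    intro s j h'
    refine (hh (.seg s j h') rfl).trans ?_
    simp only [HeightMap.pushed, Set.mem_ofPred_eq]
    rfl
  have hsum : ∀ s j (h' : j ≤ γ.m s), ((∑ i ∈ Finset.range j, x s i : ℤ) : ℚ) =
      h (γ.tail (.seg s j h')) -
      (if Relation.EqvGen γ.heightMap.Consecutive b (γ.prv (.seg s j h')) then 1 else 0) -
      h (.vertex (S.lv (S.nx s))) := by
    intro s j
    induction j with
    | zero =>
      intro h'
      rw [if_neg]
      · simp [tail]
      · intro h1
        have := hjump _ h1
        simp [prv, jump] at this
    | succ j ih =>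
      intro h'
      have h1 := hseg s j (Nat.le_of_succ_le h')
      rw [tail_nxt_seg h'] at h1
      rw [Finset.sum_range_succ, Int.cast_add, ih (Nat.le_of_succ_le h'), hNP s j h',
        tail_seg_succ h' rfl]
      linarith
  have htot : ∀ s, ((∑ i ∈ Finset.range (γ.m s), x s i : ℤ) : ℚ) =
      h (.vertex (S.lv (S.nx (S.nx s)))) - h (.vertex (S.lv (S.nx s))) := by
    intro s
    have h1 := hseg s _ le_rfl
    have h2 := hsum s _ le_rfl
    rw [nxt_seg_last] at h1
    rw [if_neg (c := Relation.EqvGen _ b (.seg (S.nx s) 0 _))] at h1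
    · have h3 : γ.tail (.seg (S.nx s) 0 (Nat.zero_le _)) = .vertex (S.lv (S.nx (S.nx s))) := rfl
      rw [h3] at h1
      linarith
    · intro h1
      have := hjump _ h1
      simp [jump] at this
  -- Floors preserve integral differences; the sign comes from the order of the two ends in
  -- `essential`.
  refine γ.essential (arcOf b).1 (arcOf b).2 hbl ⟨fun v => -⌊h (.vertex v)⌋, fun s => ?_⟩
  have h1 : h (.vertex (S.lv (S.nx (S.nx s)))) = h (.vertex (S.lv (S.nx s))) +
      ((∑ i ∈ Finset.range (γ.m s), x s i : ℤ) : ℚ) := by rw [htot]; ring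
  simp only
  rw [h1, Int.floor_add_intCast]
  have h2 : ∑ j ∈ Finset.range (γ.m s), x s j = -⌊h (.vertex (S.lv (S.nx s)))⌋ -
      -(⌊h (.vertex (S.lv (S.nx s)))⌋ + ∑ i ∈ Finset.range (γ.m s), x s i) := by ring
  rw [← h2]
  rfl

/-! ### Levels -/

variable (γ) in
/-- The height of the `k`-th piece at a corner, relative to the central piece of the triangle. -/
def lev (c : C) (k : ℕ) : ℤ := ∑ i ∈ Finset.Ico k (γ.n c), γ.sg c i

theorem lev_of_le {c : C} {k : ℕ} (h : γ.n c ≤ k) : γ.lev c k = 0 := by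
  rw [lev, Finset.Ico_eq_empty_of_le h, Finset.sum_empty]

theorem lev_eq {c : C} {k : ℕ} (h : k < γ.n c) : γ.lev c k = γ.sg c k + γ.lev c (k + 1) := by
  rw [lev, Finset.sum_eq_sum_Ico_succ_bot h, lev]

variable (γ) in
/-- The height of the `j`-th segment of a side. -/
def segLev (s : C) (j : ℕ) : ℤ :=
  if j ≤ γ.n (S.nx s) then γ.lev (S.nx s) j else γ.lev (S.nx (S.nx s)) (γ.m s - j)

theorem segLev_of_le {s : C} {j : ℕ} (h : j ≤ γ.n (S.nx s)) : γ.segLev s j = γ.lev (S.nx s) j := if_pos h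

theorem segLev_of_ge {s : C} {j : ℕ} (h : γ.n (S.nx s) ≤ j) :
    γ.segLev s j = γ.lev (S.nx (S.nx s)) (γ.m s - j) := by
  have hm := γ.m_eq s
  rcases h.eq_or_lt with h | h
  · rw [segLev_of_le h.ge, lev_of_le h.le, lev_of_le (by omega)]
  · exact if_neg (by omega)

theorem segLev_zero (s : C) : γ.segLev s 0 = γ.lev (S.nx s) 0 := segLev_of_le (Nat.zero_le _)

theorem segLev_last (s : C) : γ.segLev s (γ.m s) = γ.lev (S.nx (S.nx s)) 0 := by
  rw [segLev_of_ge (by rw [γ.m_eq]; omega), Nat.sub_self]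

theorem segLev_succ {s : C} {j : ℕ} (h : j < γ.m s) : γ.segLev s j = γ.segLev s (j + 1) + γ.cr s j := by
  have hm := γ.m_eq s
  rw [γ.cr_eq]
  split_ifs with h1
  · rw [segLev_of_le h1.le, segLev_of_le h1, lev_eq h1, add_comm]
  · rw [segLev_of_ge (by omega), segLev_of_ge (by omega), lev_eq (k := γ.m s - (j + 1)) (by omega),
      show γ.m s - (j + 1) + 1 = γ.m s - j by omega, show γ.m s - 1 - j = γ.m s - (j + 1) by omega]
    ring

variable (γ) in
/-- Height functions cutting out a subcomplex of the cyclic cover, given by the heights of its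
centers and vertices. -/
structure Cut where
  H : V → ℤ
  Gs : C → ℤ
  Ga : A → ℤ
  Gs_fl : ∀ s, Gs (S.fl s) - γ.lev (S.nx (S.nx (S.fl s))) 0 = Gs s - γ.lev (S.nx s) 0
  -- If `i` is the height of the centre of a lifted triangle, the triangle is kept for `i + Ga < 0`,
  -- its side for `i + Gs < 0`, and a vertex of height `j` for `j + H < 0`. The two inequalities on
  -- `Gs` say that the kept part is closed.
  le_Gs : ∀ s, γ.lev (S.nx s) 0 + H (S.lv (S.nx s)) ≤ Gs s
  Gs_le : ∀ s, Gs s ≤ Ga (S.tri s)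
  Ga_le : ∀ c k, k ≤ γ.n c → Ga (S.tri c) ≤ γ.lev c k
  -- Every component of the kept part of the 1-skeleton has to reach negative height: there is no
  -- nonempty set of kept vertices closed under moving along kept sides all of whose segments have
  -- nonnegative height.
  good : ∀ R : Set (V × ℤ), (∀ x ∈ R, x.2 + H x.1 < 0) →
    (∀ s i, i + Gs s < 0 → (S.lv (S.nx s), i + γ.lev (S.nx s) 0) ∈ R →
      (∀ j ≤ γ.m s, 0 ≤ i + γ.segLev s j) ∧ (S.lv (S.nx (S.nx s)), i + γ.lev (S.nx (S.nx s)) 0) ∈ R) →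
    R = ∅

theorem le_segLev (X : γ.Cut) {s : C} {j : ℕ} (h : j ≤ γ.m s) : X.Ga (S.tri s) ≤ γ.segLev s j := by
  have hm := γ.m_eq s
  by_cases h1 : j ≤ γ.n (S.nx s)
  · rw [segLev_of_le h1, ← S.tri_nx]
    exact X.Ga_le _ _ h1
  · rw [segLev_of_ge (by omega), ← tri_nx_nx]
    exact X.Ga_le _ _ (by omega)

/-- Both expressions change by the same crossing number from one segment to the next; at the first
segment they agree by `Gs_fl`. -/
theorem segLev_fl (X : γ.Cut) {s : C} {j : ℕ} (h : j ≤ γ.m s) :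
    γ.segLev (S.fl s) (γ.m s - j) - X.Gs (S.fl s) = γ.segLev s j - X.Gs s := by
  induction j with
  | zero =>
    have := X.Gs_fl s
    rw [Nat.sub_zero, segLev_zero, ← γ.m_fl, segLev_last]
    omega
  | succ j ih =>
    have h1 := ih (by omega)
    have h2 := γ.cr_fl s j h
    have h3 := segLev_succ (γ := γ) (s := S.fl s) (j := γ.m s - 1 - j) (by rw [γ.m_fl]; omega)
    have h4 := segLev_succ h
    rw [show γ.m s - 1 - j + 1 = γ.m s - j by omega] at h3
    rw [show γ.m s - (j + 1) = γ.m s - 1 - j by omega]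
    omega

end Curve

end TriSurface

/-! ### The truncation determined by a cut. -/

namespace TriSurface

variable {C A V : Type*} {S : TriSurface C A V}

namespace Curve

variable {γ : S.Curve}

variable (γ) in
/-- The height of a piece relative to the center of its triangle. -/
def pieceLev : γ.Piece → ℤ
  | .center _ => 0
  | .corner c k _ => γ.lev c k

/-- The triangle of a piece. -/
def pieceTri : γ.Piece → A
  | .center a => a
  | .corner c _ _ => S.tri c

theorem pieceLev_pc (c : C) (k : ℕ) : γ.pieceLev (γ.pc c k) = γ.lev c k := by
  unfold pc
  split_ifs with h
  · rfl
  · exact (lev_of_le (by omega)).symm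

theorem pieceTri_pc (c : C) (k : ℕ) : pieceTri (γ.pc c k) = S.tri c := by
  unfold pc
  split_ifs with h <;> rfl

theorem pieceLev_seg {s : C} {j : ℕ} (h : j ≤ γ.m s) :
    γ.pieceLev (γ.face (.seg s j h)) = γ.segLev s j := by
  simp only [face, segLev]
  split_ifs <;> rw [pieceLev_pc]

theorem pieceTri_seg {s : C} {j : ℕ} (h : j ≤ γ.m s) : pieceTri (γ.face (.seg s j h)) = S.tri s := by
  simp only [face]
  split_ifs <;> rw [pieceTri_pc]
  · exact S.tri_nx s
  · exact tri_nx_nx s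

namespace Cut

variable (X : γ.Cut)

/-- Number of levels of the cut above a piece. -/
def rF (f : γ.Piece) : ℕ := (γ.pieceLev f - X.Ga (pieceTri f)).toNat

/-- Number of levels of the cut above a dart. -/
def rD : γ.Dart → ℕ
  | .seg s j _ => (γ.segLev s j - X.Gs s).toNat
  | .outer c k _ => (min (γ.lev c k) (γ.lev c (k + 1)) - X.Ga (S.tri c)).toNat
  | .inner c k _ => (min (γ.lev c k) (γ.lev c (k + 1)) - X.Ga (S.tri c)).toNat

/-- Number of levels of the cut above the `j`-th point of a side. -/
def rPt (s : C) (j : ℕ) : ℤ := min (γ.segLev s j) (γ.segLev s (j + 1)) - X.Gs s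

/-- Number of levels of the cut above a vertex. -/
def rZ : γ.Pt → ℕ
  | .vertex v => (-X.H v).toNat
  | .point s j _ _ => (X.rPt s j).toNat

theorem rPt_fl {s : C} {j : ℕ} (h : j < γ.m s) : X.rPt (S.fl s) (γ.m s - 1 - j) = X.rPt s j := by
  have h1 := segLev_fl X h.le
  have h2 := segLev_fl X (s := s) (j := j + 1) h
  rw [show γ.m s - (j + 1) = γ.m s - 1 - j by omega] at h2
  rw [show γ.m s - j = γ.m s - 1 - j + 1 by omega] at h1
  simp only [rPt]
  omega

theorem rF_pc {c : C} {k : ℕ} (h : k ≤ γ.n c) : (X.rF (γ.pc c k) : ℤ) = γ.lev c k - X.Ga (S.tri c) := by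
  have := X.Ga_le c k h
  rw [rF, pieceLev_pc, pieceTri_pc, Int.toNat_of_nonneg (by omega)]

theorem rF_seg {s : C} {j : ℕ} (h : j ≤ γ.m s) :
    (X.rF (γ.face (.seg s j h)) : ℤ) = γ.segLev s j - X.Ga (S.tri s) := by
  have := le_segLev X h
  rw [rF, pieceLev_seg, pieceTri_seg, Int.toNat_of_nonneg (by omega)]

theorem rD_seg {s : C} {j : ℕ} (h : j ≤ γ.m s) : (X.rD (.seg s j h) : ℤ) = γ.segLev s j - X.Gs s := by
  have := le_segLev X h
  have := X.Gs_le s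
  exact Int.toNat_of_nonneg (by omega)

theorem rPt_nonneg {s : C} {j : ℕ} (h : j < γ.m s) : 0 ≤ X.rPt s j := by
  have h1 := le_segLev X h.le
  have h2 := le_segLev X (s := s) (j := j + 1) h
  have h3 := X.Gs_le s
  simp only [rPt]
  omega

include X in
theorem lev_sub_fl (s : C) : γ.lev (S.nx (S.fl s)) 0 - γ.lev (S.nx (S.nx s)) 0 =
    γ.lev (S.nx (S.nx (S.fl s))) 0 - γ.lev (S.nx s) 0 := by
  have h1 := X.Gs_fl s
  have h2 := X.Gs_fl (S.fl s)
  rw [S.fl_fl] at h2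
  omega

-- Crossing the sides at a lifted vertex does not change the height `i` of that vertex. A property
-- of lifted triangles that is preserved across sides is therefore shared by the whole star of the
-- vertex.
include X in
theorem around_vertex {P : A → ℤ → Prop}
    (hfl : ∀ s i, P (S.tri s) i → P (S.tri (S.fl s)) (i + γ.lev (S.nx s) 0 - γ.lev (S.nx (S.nx (S.fl s))) 0))
    {c d : C} (h : S.lv c = S.lv d) {i : ℤ} :
    P (S.tri c) (i - γ.lev c 0) ↔ P (S.tri d) (i - γ.lev d 0) := by
  have := S.lv_orbit c d h
  clear h
  induction this with
  | rel a b h =>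
    obtain ⟨s, rfl, rfl⟩ := h
    rw [S.tri_nx, tri_nx_nx]
    constructor
    · intro h1
      have := hfl _ _ h1
      rwa [sub_add_cancel] at this
    · intro h1
      have := hfl _ _ h1
      have h2 := X.lev_sub_fl s
      rw [S.fl_fl] at this
      convert this using 1
      omega
  | refl x => rfl
  | symm x y _ ih => exact ih.symm
  | trans x y z _ _ ih1 ih2 => exact ih1.trans ih2

/-- The vertices where `h` is nonzero form a set as in `X.good`: along a kept side the nonzero value
is carried from point to point, and the side cannot reach negative height, where `h` vanishes. Once
`h` is zero at the vertices, it vanishes at the points of the curve on the sides. -/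
theorem vertices_connected (h : γ.Pt → ℤ → ℚ) (h0 : ∀ z (i : ℤ), ¬ (0 ≤ i ∧ i < X.rZ z) → h z i = 0)
    (hd : ∀ d i, 0 ≤ i + min 0 (γ.jump d) → i + min 0 (γ.jump d) < X.rD d →
      h (γ.tail (γ.nxt d)) (i + γ.tl (γ.nxt d)) = h (γ.tail d) (i + γ.tl d)) (z : γ.Pt) (i : ℤ) :
    h z i = 0 := by
  have hneg : ∀ z i, i < 0 → h z i = 0 := fun z i hi => h0 z i (by omega)
  have hseg : ∀ s j (hj : j ≤ γ.m s) i, 0 ≤ i + γ.segLev s j → i + X.Gs s < 0 →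
      h (γ.tail (γ.nxt (.seg s j hj))) (i + γ.segLev s j + γ.tl (γ.nxt (.seg s j hj))) =
        h (γ.tail (.seg s j hj)) (i + γ.segLev s j + γ.tl (.seg s j hj)) := by
    intro s j hj i h1 h2
    have h3 := X.rD_seg hj
    exact hd (.seg s j hj) (i + γ.segLev s j) (by simpa [jump] using h1) (by simp [jump, h3]; omega)
  have hstep : ∀ s j (hj : j < γ.m s) i,
      h (γ.tail (γ.nxt (.seg s j hj.le))) (i + γ.segLev s j + γ.tl (γ.nxt (.seg s j hj.le))) =
        h (γ.tail (.seg s (j + 1) hj)) (i + γ.segLev s (j + 1) + γ.tl (.seg s (j + 1) hj)) := by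
    intro s j hj i
    rw [tail_nxt_seg hj, tl_nxt_seg hj, tail_seg_succ hj rfl, tl_seg_succ hj rfl, segLev_succ hj]
    congr 1
    omega
  have hlast : ∀ s i, h (γ.tail (γ.nxt (.seg s (γ.m s) le_rfl)))
      (i + γ.segLev s (γ.m s) + γ.tl (γ.nxt (.seg s (γ.m s) le_rfl))) =
        h (.vertex (S.lv (S.nx (S.nx s)))) (i + γ.lev (S.nx (S.nx s)) 0) := by
    intro s i
    rw [nxt_seg_last, segLev_last]
    simp [tail, tl]
  have hv : ∀ v i, h (.vertex v) i = 0 := by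
    have := X.good {x | h (.vertex x.1) x.2 ≠ 0} (by
      intro x hx
      by_contra hlt
      refine hx (h0 _ _ fun hi => hlt ?_)
      have : x.2 < (-X.H x.1).toNat := hi.2
      omega) (by
      intro s i hi hR
      have key : ∀ j (hj : j ≤ γ.m s),
          h (γ.tail (.seg s j hj)) (i + γ.segLev s j + γ.tl (.seg s j hj)) ≠ 0 := by
        intro j
        induction j with
        | zero => intro hj; rw [segLev_zero]; simpa [tail, tl] using hR
        | succ j ih =>
          intro hj
          have h1 := ih (Nat.le_of_succ_le hj)
          rw [← hstep, hseg _ _ _ _ ?_ hi]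
          · exact h1
          · by_contra h2
            have h3 : γ.tl _ ≤ _ := tl_le (γ := γ) (.seg s j (Nat.le_of_succ_le hj))
            exact h1 (hneg _ _ (by omega))
      have hpos : ∀ j ≤ γ.m s, 0 ≤ i + γ.segLev s j := by
        intro j hj
        by_contra h2
        have h3 : γ.tl _ ≤ _ := tl_le (γ := γ) (.seg s j hj)
        exact key j hj (hneg _ _ (by omega))
      refine ⟨hpos, ?_⟩
      have h1 := key _ le_rfl
      rw [← hseg _ _ _ _ (hpos _ le_rfl) hi, hlast] at h1
      exact h1)
    intro v i
    by_contra hne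
    exact (Set.mem_empty_iff_false (v, i)).1 (this ▸ hne)
  cases z with
  | vertex v => exact hv v i
  | point s j hj hs =>
    have e : γ.pt s j hj = .point s j hj hs := dif_pos hs
    -- Zero is propagated backwards along the side from its final vertex; `l` counts segments from
    -- that end. A segment of negative height has the value zero anyway.
    have key : ∀ l (hl : l ≤ γ.m s) i, i + X.Gs s < 0 →
        h (γ.tail (.seg s (γ.m s - l) (Nat.sub_le _ _)))
          (i + γ.segLev s (γ.m s - l) + γ.tl (.seg s (γ.m s - l) (Nat.sub_le _ _))) = 0 := by
      intro l
      induction l with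
      | zero =>
        intro hl i hi
        by_cases h1 : 0 ≤ i + γ.segLev s (γ.m s)
        · exact (hseg _ _ le_rfl _ h1 hi).symm.trans ((hlast s i).trans (hv _ _))
        · have h3 := tl_le (γ := γ) (.seg s (γ.m s - 0) (Nat.sub_le _ _))
          simp only [Nat.sub_zero] at h3 ⊢
          exact hneg _ _ (by omega)
      | succ l ih =>
        intro hl i hi
        have hl' : γ.m s - (l + 1) < γ.m s := by omega
        by_cases h1 : 0 ≤ i + γ.segLev s (γ.m s - (l + 1))
        · rw [← hseg _ _ _ _ h1 hi, hstep _ _ hl']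
          have := ih (by omega) i hi
          simp only [show γ.m s - l = γ.m s - (l + 1) + 1 by omega] at this
          exact this
        · have h3 := tl_le (γ := γ) (.seg s (γ.m s - (l + 1)) (Nat.sub_le _ _))
          exact hneg _ _ (by omega)
    by_cases h1 : i - min (γ.segLev s j) (γ.segLev s (j + 1)) + X.Gs s < 0
    · have h2 := key (γ.m s - (j + 1)) (Nat.sub_le _ _) _ h1
      simp only [show γ.m s - (γ.m s - (j + 1)) = j + 1 by omega] at h2
      rw [tail_seg_succ hj rfl, tl_seg_succ hj rfl, e] at h2
      rw [← h2]
      congr 1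
      have := segLev_succ hj
      omega
    · refine h0 _ _ fun hi => h1 ?_
      have : i < (X.rPt s j).toNat := hi.2
      simp only [rPt] at this
      omega

/-- The pieces of a lifted triangle are connected across its arcs, so `R` contains all of them or
none. The vertices of the lifted triangles in `R` then form a set excluded by `X.good`. -/
theorem faces_connected (R : Set (γ.Piece × ℤ)) (hR : ∀ x ∈ R, 0 ≤ x.2 ∧ x.2 < X.rF x.1)
    (hcl : ∀ d i, (γ.face d, i) ∈ R → (γ.face (γ.flip d), i + γ.jump d) ∈ R) : R = ∅ := by
  have hcorner : ∀ c k, k ≤ γ.n c → ∀ i, (γ.pc c k, i + γ.lev c k) ∈ R ↔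
      (Piece.center (S.tri c), i) ∈ R := by
    intro c k hk i
    induction hk using Nat.decreasingInduction with
    | self => rw [pc_of_le le_rfl, lev_of_le le_rfl, add_zero]
    | of_succ k hk ih =>
      rw [← ih]
      have h1 := lev_eq hk
      constructor
      · intro h
        have e : i + γ.lev c (k + 1) = i + γ.lev c k + γ.jump (.outer c k hk) := by
          simp only [jump]; omega
        rw [e]
        exact hcl (.outer c k hk) _ h
      · intro h
        have e : i + γ.lev c k = i + γ.lev c (k + 1) + γ.jump (.inner c k hk) := by
          simp only [jump]; omega
        rw [e]
        exact hcl (.inner c k hk) _ h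
  have hpiece : ∀ s j (hj : j ≤ γ.m s) i, (γ.face (.seg s j hj), i + γ.segLev s j) ∈ R ↔
      (Piece.center (S.tri s), i) ∈ R := by
    intro s j hj i
    have hm := γ.m_eq s
    by_cases h1 : j ≤ γ.n (S.nx s)
    · rw [face_seg_nx hj h1, segLev_of_le h1, hcorner _ _ h1, S.tri_nx]
    · rw [face_seg_nx_nx hj (by omega), segLev_of_ge (by omega), hcorner _ _ (by omega), tri_nx_nx]
  have hfl : ∀ s i, (Piece.center (S.tri s), i) ∈ R →
      (Piece.center (S.tri (S.fl s)), i + γ.lev (S.nx s) 0 - γ.lev (S.nx (S.nx (S.fl s))) 0) ∈ R := by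
    intro s i h
    rw [← hpiece s 0 (Nat.zero_le _)] at h
    have h1 := hcl (.seg s 0 (Nat.zero_le _)) _ h
    have h2 : γ.flip (.seg s 0 (Nat.zero_le _)) = .seg (S.fl s) (γ.m (S.fl s)) le_rfl :=
      Dart.seg_congr _ rfl (by rw [γ.m_fl]; rfl)
    rw [h2] at h1
    rw [← hpiece (S.fl s) _ le_rfl]
    convert h1 using 2
    rw [segLev_last, segLev_zero]
    simp [jump]
  have hgood := X.good {x | ∃ c, S.lv c = x.1 ∧ (Piece.center (S.tri c), x.2 - γ.lev c 0) ∈ R} (by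
    rintro ⟨v, i⟩ ⟨c, rfl, h⟩
    have h1 := (hR _ h).2
    have h2 := X.Ga_le c _ le_rfl
    rw [lev_of_le le_rfl] at h2
    have h3 := X.le_Gs (S.nx (S.nx c))
    have h4 := X.Gs_le (S.nx (S.nx c))
    rw [S.nx_nx_nx] at h3
    rw [tri_nx_nx] at h4
    simp only [rF, pieceLev, pieceTri] at h1 ⊢
    omega) (by
    rintro s i hi ⟨c, hc, h⟩
    have h1 := (X.around_vertex (P := fun a i => (Piece.center a, i) ∈ R) hfl hc).1 h
    simp only [add_sub_cancel_right, S.tri_nx] at h1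
    refine ⟨fun j hj => (hR _ ((hpiece s j hj i).2 h1)).1, S.nx (S.nx s), rfl, ?_⟩
    simp only [add_sub_cancel_right]
    rwa [tri_nx_nx])
  rw [Set.eq_empty_iff_forall_notMem] at hgood ⊢
  have hcenter : ∀ a i, (Piece.center a, i) ∉ R := by
    intro a i h
    obtain ⟨c, rfl⟩ := S.tri_surjective a
    exact hgood (S.lv c, i + γ.lev c 0) ⟨c, rfl, by rwa [add_sub_cancel_right]⟩
  rintro ⟨f, i⟩ h
  cases f with
  | center a => exact hcenter a i h
  | corner c k hk =>
    refine hcenter (S.tri c) (i - γ.lev c k) ((hcorner c k hk.le _).1 ?_)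
    rw [sub_add_cancel]
    convert h using 2
    exact dif_pos hk

/-- The closed subcomplex determined by a cut. -/
noncomputable def truncation : γ.heightMap.Truncation where
  rF := X.rF
  rD := X.rD
  rZ := X.rZ
  rD_fl d := by
    cases d with
    | seg s j h =>
      have h1 := segLev_fl X h
      change (γ.segLev (S.fl s) (γ.m s - j) - X.Gs (S.fl s)).toNat = (γ.segLev s j - X.Gs s).toNat
      rw [h1]
    | outer c k h => rfl
    | inner c k h => rfl
  closed_face d := by
    cases d with
    | seg s j h =>
      change (X.rF (γ.face (.seg s j h)) : ℤ) + min 0 0 ≤ (X.rD (.seg s j h) : ℤ)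
      rw [X.rF_seg, X.rD_seg]
      have := X.Gs_le s
      omega
    | outer c k h =>
      have h1 := X.rF_pc h.le
      have h2 := lev_eq h
      change (X.rF (γ.pc c k) : ℤ) + min 0 (-γ.sg c k) ≤ 
        ((min (γ.lev c k) (γ.lev c (k + 1)) - X.Ga (S.tri c)).toNat : ℤ)
      omega
    | inner c k h =>
      have h1 := X.rF_pc (c := c) (k := k + 1) h
      have h2 := lev_eq h
      change (X.rF (γ.pc c (k + 1)) : ℤ) + min 0 (γ.sg c k) ≤ 
        ((min (γ.lev c k) (γ.lev c (k + 1)) - X.Ga (S.tri c)).toNat : ℤ)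
      omega
  vertices_connected := X.vertices_connected
  faces_connected := X.faces_connected

end Cut

end Curve

end TriSurface

/-! ### Counting the cells of the truncation. -/

namespace TriSurface

variable {C A V : Type*} {S : TriSurface C A V}

theorem sum_nx [Fintype C] (f : C → ℤ) : ∑ c, f (S.nx c) = ∑ c, f c :=
  Fintype.sum_equiv ⟨S.nx, fun c => S.nx (S.nx c), S.nx_nx_nx, S.nx_nx_nx⟩ _ _ fun _ => rfl

namespace Curve

variable {γ : S.Curve}

variable (γ) in
/-- Sides of pieces, by kind. -/
def dartEquiv : γ.Dart ≃ (Σ s, Fin (γ.m s + 1)) ⊕ ((Σ c, Fin (γ.n c)) ⊕ (Σ c, Fin (γ.n c))) where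
  toFun
    | .seg s j h => .inl ⟨s, j, Nat.lt_succ_of_le h⟩
    | .outer c k h => .inr (.inl ⟨c, k, h⟩)
    | .inner c k h => .inr (.inr ⟨c, k, h⟩)
  invFun
    | .inl x => .seg x.1 x.2 (Nat.le_of_lt_succ x.2.2)
    | .inr (.inl x) => .outer x.1 x.2 x.2.2
    | .inr (.inr x) => .inner x.1 x.2 x.2.2
  left_inv d := by cases d <;> rfl
  right_inv x := by rcases x with x | x | x <;> rfl

variable (γ) in
/-- Pieces, by kind. -/
def pieceEquiv : γ.Piece ≃ A ⊕ (Σ c, Fin (γ.n c)) where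
  toFun
    | .center a => .inl a
    | .corner c k h => .inr ⟨c, k, h⟩
  invFun
    | .inl a => .center a
    | .inr x => .corner x.1 x.2 x.2.2
  left_inv d := by cases d <;> rfl
  right_inv x := by rcases x with x | x <;> rfl

variable (γ) in
/-- Vertices, by kind. -/
def ptEquiv : γ.Pt ≃ V ⊕ (Σ s : {s // WellOrderingRel s (S.fl s)}, Fin (γ.m s.1)) where
  toFun
    | .vertex v => .inl v
    | .point s j h hs => .inr ⟨⟨s, hs⟩, j, h⟩
  invFun
    | .inl a => .vertex a
    | .inr x => .point x.1.1 x.2 x.2.2 x.1.2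
  left_inv d := by cases d <;> rfl
  right_inv x := by rcases x with x | x <;> rfl

theorem sum_fin_eq_sub {n : ℕ} {f : Fin n → ℤ} {g : ℕ → ℤ} {a : ℤ} (h : ∀ k, f k = g k - a) :
    ∑ k, f k = ∑ k ∈ Finset.range n, g k - n * a := by
  rw [Finset.sum_congr rfl fun k _ => h k, Finset.sum_sub_distrib, Fin.sum_univ_eq_sum_range,
    Finset.sum_const, Finset.card_univ, Fintype.card_fin, nsmul_eq_mul]

theorem sum_segLev (s : C) : ∑ j ∈ Finset.range (γ.m s + 1), γ.segLev s j =
    ∑ k ∈ Finset.range (γ.n (S.nx s)), γ.lev (S.nx s) k +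
      ∑ k ∈ Finset.range (γ.n (S.nx (S.nx s))), γ.lev (S.nx (S.nx s)) k := by
  have hm := γ.m_eq s
  rw [hm, add_assoc, Finset.sum_range_add]
  congr 1
  · exact Finset.sum_congr rfl fun k hk => segLev_of_le (Finset.mem_range.1 hk).le
  -- There is one more segment than there are arcs; the extra one belongs to the central piece,
  -- whose relative height is zero.
  · have h := Finset.sum_range_reflect (fun k => γ.lev (S.nx (S.nx s)) k) (γ.n (S.nx (S.nx s)) + 1)
    rw [Finset.sum_range_succ (fun k => γ.lev (S.nx (S.nx s)) k), lev_of_le le_rfl, add_zero] at h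
    rw [← h]
    refine Finset.sum_congr rfl fun k hk => ?_
    rw [segLev_of_ge (by omega)]
    congr 1; omega

theorem sum_min_segLev (s : C) :
    ∑ j ∈ Finset.range (γ.m s), min (γ.segLev s j) (γ.segLev s (j + 1)) =
    ∑ k ∈ Finset.range (γ.n (S.nx s)), min (γ.lev (S.nx s) k) (γ.lev (S.nx s) (k + 1)) +
      ∑ k ∈ Finset.range (γ.n (S.nx (S.nx s))),
        min (γ.lev (S.nx (S.nx s)) k) (γ.lev (S.nx (S.nx s)) (k + 1)) := by
  have hm := γ.m_eq s
  rw [hm, Finset.sum_range_add]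
  congr 1
  · refine Finset.sum_congr rfl fun k hk => ?_
    have := Finset.mem_range.1 hk
    rw [segLev_of_le this.le, segLev_of_le this]
  · rw [← Finset.sum_range_reflect]
    refine Finset.sum_congr rfl fun k hk => ?_
    have := Finset.mem_range.1 hk
    rw [segLev_of_ge (by omega), segLev_of_ge (by omega), min_comm]
    congr 2 <;> omega

/-- The regions above the level curves have Euler characteristic at most zero. -/
theorem Cut.sum_le [Fintype C] [Fintype A] [Fintype V] (X : γ.Cut) :
    ∑ s, X.Gs s ≤ 2 * ∑ v, X.H v + 2 * ∑ a, X.Ga a := by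
  classical
  let _ : Fintype γ.Dart := .ofEquiv _ γ.dartEquiv.symm
  let _ : Fintype γ.Piece := .ofEquiv _ γ.pieceEquiv.symm
  let _ : Fintype γ.Pt := .ofEquiv _ γ.ptEquiv.symm
  have key := X.truncation.sum_card_le γ.heightMap_essential
  change 2 * ∑ z, X.rZ z + 2 * ∑ f, X.rF f ≤ ∑ d, X.rD d at key
  rw [← γ.dartEquiv.symm.sum_comp, ← γ.pieceEquiv.symm.sum_comp, ← γ.ptEquiv.symm.sum_comp] at key
  simp only [Fintype.sum_sum_type, Fintype.sum_sigma] at key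
  zify at key
  set μ : C → ℕ → ℤ := fun c k => min (γ.lev c k) (γ.lev c (k + 1)) with hμ
  -- Only an inequality, since `H` may be positive at a vertex none of whose lifts is kept; it
  -- points in the required direction.
  have hV : -∑ v, X.H v ≤ ∑ v, (X.rZ (.vertex v) : ℤ) := by
    rw [← Finset.sum_neg_distrib]
    exact Finset.sum_le_sum fun v _ => Int.self_le_toNat _
  have hP : 2 * ∑ s : {s // WellOrderingRel s (S.fl s)}, ∑ j : Fin (γ.m s.1),
      ((X.rPt s.1 j).toNat : ℤ) = ∑ s, ∑ j ∈ Finset.range (γ.m s), X.rPt s j := by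
    have hpos : ∀ s : C, WellOrderingRel (S.fl s) (S.fl (S.fl s)) ↔ ¬ WellOrderingRel s (S.fl s) := by
      intro s
      have ht := (WellOrderingRel.isWellOrder (α := C)).trichotomous s (S.fl s)
      have ha := fun h => asymm_of WellOrderingRel (a := s) (b := S.fl s) h
      have hne := S.fl_ne s
      rw [S.fl_fl]
      exact ⟨fun h h' => ha h' h, fun h => by by_contra h'; exact hne (ht h h').symm⟩
    rw [← Fintype.sum_subtype_add_sum_subtype (fun s => WellOrderingRel s (S.fl s)), two_mul]
    have e : ∀ s, ∑ j : Fin (γ.m s), ((X.rPt s j).toNat : ℤ) = ∑ j ∈ Finset.range (γ.m s), X.rPt s j := by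
      intro s
      rw [← Fin.sum_univ_eq_sum_range]
      exact Finset.sum_congr rfl fun j _ => Int.toNat_of_nonneg (X.rPt_nonneg j.2)
    rw [Finset.sum_congr rfl fun s _ => e s.1]
    congr 1
    refine Fintype.sum_equiv (⟨fun s => ⟨S.fl s, fun h => ((hpos s).1 h) s.2⟩,
      fun s => ⟨S.fl s, (hpos s).2 s.2⟩, fun s => Subtype.ext (S.fl_fl _),
      fun s => Subtype.ext (S.fl_fl _)⟩ : {s // WellOrderingRel s (S.fl s)} ≃
        {s // ¬ WellOrderingRel s (S.fl s)}) _ _ fun s => ?_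
    change _ = ∑ j ∈ Finset.range (γ.m (S.fl s)), X.rPt (S.fl s) j
    rw [← Finset.sum_range_reflect, γ.m_fl]
    exact Finset.sum_congr rfl fun j hj => by
      have h1 := Finset.mem_range.1 hj
      have h2 := X.rPt_fl (s := s.1) (j := γ.m s.1 - 1 - j) (by omega)
      rw [← h2]
      congr 1; omega
  have hA : ∀ a, (X.rF (.center a) : ℤ) = - X.Ga a := by
    intro a
    obtain ⟨c, rfl⟩ := S.tri_surjective a
    have := X.Ga_le c _ le_rfl
    rw [lev_of_le le_rfl] at this
    simp only [rF, pieceLev, pieceTri]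
    omega
  have hF : ∀ c, ∑ k : Fin (γ.n c), (X.rF (.corner c k k.2) : ℤ) =
      ∑ k ∈ Finset.range (γ.n c), γ.lev c k - γ.n c * X.Ga (S.tri c) := by
    intro c
    refine sum_fin_eq_sub fun k => ?_
    have := X.Ga_le c k k.2.le
    simp only [rF, pieceLev, pieceTri]
    omega
  have hD : ∀ s, ∑ j : Fin (γ.m s + 1), (X.rD (.seg s j (Nat.le_of_lt_succ j.2)) : ℤ) =
      ∑ j ∈ Finset.range (γ.m s + 1), γ.segLev s j - (γ.m s + 1) * X.Gs s := by
    intro s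
    rw [← Nat.cast_succ]
    exact sum_fin_eq_sub fun k => X.rD_seg _
  have hO : ∀ c, ∑ k : Fin (γ.n c), ((μ c k - X.Ga (S.tri c)).toNat : ℤ) =
      ∑ k ∈ Finset.range (γ.n c), μ c k - γ.n c * X.Ga (S.tri c) := by
    intro c
    refine sum_fin_eq_sub fun k => ?_
    have := X.Ga_le c k k.2.le
    have := X.Ga_le c (k + 1) k.2
    simp only [hμ]
    omega
  have hPt : ∀ s, ∑ j ∈ Finset.range (γ.m s), X.rPt s j =
      ∑ j ∈ Finset.range (γ.m s), min (γ.segLev s j) (γ.segLev s (j + 1)) - γ.m s * X.Gs s := by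
    intro s
    simp only [rPt]
    rw [Finset.sum_sub_distrib, Finset.sum_const, Finset.card_range, nsmul_eq_mul]
  change 2 * (∑ v, (X.rZ (.vertex v) : ℤ) + ∑ s : {s // WellOrderingRel s (S.fl s)},
    ∑ j : Fin (γ.m s.1), ((X.rPt s.1 j).toNat : ℤ)) + 2 * (∑ a, (X.rF (.center a) : ℤ) +
      ∑ c, ∑ k : Fin (γ.n c), (X.rF (.corner c k k.2) : ℤ)) ≤
    ∑ s, ∑ j : Fin (γ.m s + 1), (X.rD (.seg s j (Nat.le_of_lt_succ j.2)) : ℤ) +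
    (∑ c, ∑ k : Fin (γ.n c), ((μ c k - X.Ga (S.tri c)).toNat : ℤ) +
      ∑ c, ∑ k : Fin (γ.n c), ((μ c k - X.Ga (S.tri c)).toNat : ℤ)) at key
  simp only [hA, hF, hD, hO, mul_add, hP, hPt, sum_segLev, sum_min_segLev, Finset.sum_sub_distrib,
    Finset.sum_add_distrib, add_mul, one_mul, Finset.sum_neg_distrib] at key
  -- Every corner is adjacent to two sides. The heights of the corner pieces, arcs and points then
  -- cancel, and only the three functions of the cut are left.
  have e1 := S.sum_nx fun c => ∑ k ∈ Finset.range (γ.n c), γ.lev c k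
  have e2 := (S.sum_nx fun c => ∑ k ∈ Finset.range (γ.n (S.nx c)), γ.lev (S.nx c) k).trans e1
  have e3 := S.sum_nx fun c => ∑ k ∈ Finset.range (γ.n c), μ c k
  have e4 := (S.sum_nx fun c => ∑ k ∈ Finset.range (γ.n (S.nx c)), μ (S.nx c) k).trans e3
  simp only [hμ] at e1 e2 e3 e4 key
  linarith

end Curve

end TriSurface

/-! ### Blocks, potentials and the minimum principle. -/

namespace TriSurface

variable {C A V : Type*} (S : TriSurface C A V)

/-- A coarser cell structure: the triangles are merged into blocks. The sides inside a block are not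
`outer`, and the vertices inside a block are not `old`. -/
structure Blocks (Bk : Type*) where
  outer : C → Prop
  old : V → Prop
  bl : A → Bk
  outer_fl : ∀ s, outer (S.fl s) ↔ outer s
  bl_fl : ∀ s, ¬ outer s → bl (S.tri (S.fl s)) = bl (S.tri s)
  adjacent : ∀ a b, bl a = bl b → a = b ∨ ∃ s, ¬ outer s ∧ S.tri s = a ∧ S.tri (S.fl s) = b
  old_nx : ∀ s, outer s → old (S.lv (S.nx s))
  exists_outer : ∀ v, old v → ∃ s, outer s ∧ S.lv (S.nx s) = v
  old_or : ∀ s, old (S.lv (S.nx s)) ∨ old (S.lv (S.nx (S.nx s)))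
  outer_or : ∀ c, old (S.lv (S.nx c)) → old (S.lv (S.nx (S.nx c))) →
    outer c ∨ (old (S.lv c) ∧ outer (S.nx c) ∧ outer (S.nx (S.nx c)))

/-- The connected components of a surface of Euler characteristic zero. -/
structure Components (Q : Type*) [Fintype A] [Fintype V] where
  cA : A → Q
  cV : V → Q
  cV_lv : ∀ c, cV (S.lv c) = cA (S.tri c)
  connected : ∀ a b, cA a = cA b → Relation.EqvGen (fun a b => ∃ s, S.tri s = a ∧ S.tri (S.fl s) = b) a b
  euler : ∀ t : Q → ℤ, ∑ a, t (cA a) = 2 * ∑ v, t (cV v)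

variable {S}

theorem Blocks.old_nx_nx {Bk : Type*} (B : S.Blocks Bk) (s : C) (h : B.outer s) :
    B.old (S.lv (S.nx (S.nx s))) := by
  rw [← S.lv_fl]
  exact B.old_nx _ ((B.outer_fl s).2 h)

theorem Components.cA_fl {Q : Type*} [Fintype A] [Fintype V] (Q : S.Components Q) (s : C) :
    Q.cA (S.tri (S.fl s)) = Q.cA (S.tri s) := by
  rw [← S.tri_nx (S.fl s), ← Q.cV_lv, S.lv_fl, Q.cV_lv, S.tri_nx, S.tri_nx]

theorem lv_fl' (s : C) : S.lv (S.nx (S.nx (S.fl s))) = S.lv (S.nx s) := by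
  rw [← S.lv_fl, S.fl_fl]

/-- A real function of the vertices on the cyclic cover given by `K`, with the minimum principle, and
an integral approximation. -/
structure Blocks.Potential {Bk : Type*} (B : S.Blocks Bk) (K : C → ℤ) where
  val : V → ℝ
  min_principle : ∀ v, B.old v →
    (∀ s, B.outer s → S.lv (S.nx s) = v → K (S.nx s) + val v ≤ K (S.nx (S.nx s)) + val (S.lv (S.nx (S.nx s)))) →
    ∀ s, B.outer s → S.lv (S.nx s) = v → K (S.nx s) + val v = K (S.nx (S.nx s)) + val (S.lv (S.nx (S.nx s)))
  g : V → ℤ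
  -- `g` rounds `val`: shifts that make the rounded value negative have strictly smaller real value
  -- than shifts that leave it nonnegative.
  lt_of_neg : ∀ v w, B.old v → B.old w → ∀ j k : ℤ, j + g v < 0 → 0 ≤ k + g w → j + val v < k + val w
  M : Bk → ℤ
  le_M : ∀ c, K c + g (S.lv c) ≤ M (B.bl (S.tri c))
  exists_M : ∀ a, ∃ d, B.old (S.lv d) ∧ B.bl (S.tri d) = B.bl a ∧ M (B.bl a) ≤ K d + g (S.lv d)
  -- Together with `le_M`, a vertex inside a block takes the maximal value `M` of the block.
  M_le : ∀ c, ¬ B.old (S.lv c) → M (B.bl (S.tri c)) ≤ K c + g (S.lv c)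

namespace Curve

variable {γ : S.Curve}

section

variable {Bk Q : Type*} {B : S.Blocks Bk} {K : C → ℤ} (P : B.Potential K)

open Classical in
/-- The height of a side. -/
noncomputable def Gside (s : C) : ℤ :=
  if B.outer s then max (K (S.nx s) + P.g (S.lv (S.nx s))) (K (S.nx (S.nx s)) + P.g (S.lv (S.nx (S.nx s))))
  else P.M (B.bl (S.tri s))

theorem Gside_le (s : C) : Gside P s ≤ P.M (B.bl (S.tri s)) := by
  have h1 := P.le_M (S.nx s)
  have h2 := P.le_M (S.nx (S.nx s))
  rw [S.tri_nx] at h1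
  rw [tri_nx_nx] at h2
  unfold Gside
  split_ifs
  · exact max_le h1 h2
  · exact le_rfl

theorem le_Gside (s : C) : K (S.nx s) + P.g (S.lv (S.nx s)) ≤ Gside P s := by
  have h1 := P.le_M (S.nx s)
  rw [S.tri_nx] at h1
  unfold Gside
  split_ifs
  · exact le_max_left _ _
  · exact h1

theorem Gside_neg_iff {s : C} (hs : B.outer s) {i : ℤ} : i + Gside P s < 0 ↔
    i + (K (S.nx s) + P.g (S.lv (S.nx s))) < 0 ∧
      i + (K (S.nx (S.nx s)) + P.g (S.lv (S.nx (S.nx s)))) < 0 := by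
  rw [Gside, if_pos hs]
  omega

variable [Fintype A] [Fintype V] (Qs : S.Components Q) {e : A → ℤ} {h : V → ℤ}

/-- The maximum principle: the level sets of a potential form a good cut. -/
theorem good_of_potential [Finite V] (hlv : Function.Surjective S.lv)
    (hκ : ∀ c, γ.lev c 0 = K c + e (S.tri c) + h (S.lv c))
    (hK : ∀ s, ¬ B.outer s → K (S.nx s) = K (S.nx (S.nx (S.fl s))))
    (hlev : ∀ s, γ.lev (S.nx (S.fl s)) 0 - γ.lev (S.nx (S.nx s)) 0 =
      γ.lev (S.nx (S.nx (S.fl s))) 0 - γ.lev (S.nx s) 0)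
    (t : Q → ℤ)
    (ht : ∀ a, ∃ c k, Qs.cA (S.tri c) = Qs.cA a ∧ k ≤ γ.n c ∧
      γ.lev c k = e (S.tri c) + t (Qs.cA (S.tri c)) + P.M (B.bl (S.tri c)))
    (R : Set (V × ℤ)) (hR : ∀ x ∈ R, x.2 + (P.g x.1 + t (Qs.cV x.1) - h x.1) < 0)
    (hcl : ∀ s i, i + (e (S.tri s) + t (Qs.cA (S.tri s)) + Gside P s) < 0 →
      (S.lv (S.nx s), i + γ.lev (S.nx s) 0) ∈ R →
      (∀ j ≤ γ.m s, 0 ≤ i + γ.segLev s j) ∧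
        (S.lv (S.nx (S.nx s)), i + γ.lev (S.nx (S.nx s)) 0) ∈ R) : R = ∅ := by
  rw [Set.eq_empty_iff_forall_notMem]
  intro x₀ hx₀
  have hcV : ∀ s, Qs.cV (S.lv (S.nx s)) = Qs.cA (S.tri s) := fun s => by rw [Qs.cV_lv, S.tri_nx]
  have hcV' : ∀ s, Qs.cV (S.lv (S.nx (S.nx s))) = Qs.cA (S.tri s) := fun s => by
    rw [Qs.cV_lv, tri_nx_nx]
  have hκ1 : ∀ s, γ.lev (S.nx s) 0 = K (S.nx s) + e (S.tri s) + h (S.lv (S.nx s)) := fun s => by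
    rw [hκ, S.tri_nx]
  have hκ2 : ∀ s, γ.lev (S.nx (S.nx s)) 0 =
      K (S.nx (S.nx s)) + e (S.tri s) + h (S.lv (S.nx (S.nx s))) := fun s => by
    rw [hκ, tri_nx_nx]
  -- vertices inside blocks
  have hnew : ∀ s i, ¬ B.old (S.lv (S.nx s)) → (S.lv (S.nx s), i + γ.lev (S.nx s) 0) ∈ R →
      0 ≤ i + γ.lev (S.nx s) 0 ∧ (S.lv (S.nx (S.nx s)), i + γ.lev (S.nx (S.nx s)) 0) ∈ R := by
    intro s i hs hi
    have h1 := hR _ hi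
    have h2 := P.M_le _ hs
    rw [S.tri_nx] at h2
    have h3 := Gside_le P s
    have h4 := hκ1 s
    simp only [hcV] at h1
    have h5 := hcl s i (by omega) hi
    have h6 := h5.1 0 (Nat.zero_le _)
    rw [segLev_zero] at h6
    exact ⟨h6, h5.2⟩
  let val (x : V × ℤ) : ℝ := x.2 - h x.1 + t (Qs.cV x.1) + P.val x.1
  -- comparison across a side which is not in the cut
  have hcmp : ∀ s i, B.outer s → (S.lv (S.nx s), i + γ.lev (S.nx s) 0) ∈ R →
      ¬ i + (e (S.tri s) + t (Qs.cA (S.tri s)) + Gside P s) < 0 →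
      (K (S.nx s) + P.val (S.lv (S.nx s)) : ℝ) <
        K (S.nx (S.nx s)) + P.val (S.lv (S.nx (S.nx s))) := by
    intro s i hs hi hX
    have h1 := hR _ hi
    simp only [hcV] at h1
    rw [← add_assoc, Gside_neg_iff P hs] at hX
    have h2 := hκ1 s
    have h3 := P.lt_of_neg _ _ (B.old_nx s hs) (B.old_nx_nx s hs)
      (i + (e (S.tri s) + t (Qs.cA (S.tri s))) + K (S.nx s))
      (i + (e (S.tri s) + t (Qs.cA (S.tri s))) + K (S.nx (S.nx s))) (by omega) (by omega)
    push_cast at h3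
    linarith
  -- At an old vertex of negative height no kept outer side can start. All neighbours would then
  -- have strictly larger values, contradicting the minimum principle.
  have hnonneg : ∀ x ∈ R, 0 ≤ x.2 := by
    rintro ⟨v, i⟩ hx
    by_cases hv : B.old v
    · by_contra hi
      have hno : ∀ s, B.outer s → S.lv (S.nx s) = v → (K (S.nx s) + P.val v : ℝ) <
          K (S.nx (S.nx s)) + P.val (S.lv (S.nx (S.nx s))) := by
        rintro s hs rfl
        have e1 : i = i - γ.lev (S.nx s) 0 + γ.lev (S.nx s) 0 := by ring
        rw [e1] at hx
        refine hcmp s _ hs hx fun hX => hi ?_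
        have := (hcl s _ hX hx).1 0 (Nat.zero_le _)
        rw [segLev_zero] at this
        simp only
        omega
      obtain ⟨s, hs, hsv⟩ := B.exists_outer v hv
      have := P.min_principle v hv (fun s hs hsv => (hno s hs hsv).le) s hs hsv
      exact (hno s hs hsv).ne this
    · obtain ⟨c, rfl⟩ := hlv v
      obtain ⟨s, rfl⟩ : ∃ s, S.nx s = c := ⟨_, S.nx_nx_nx c⟩
      have e1 : i = i - γ.lev (S.nx s) 0 + γ.lev (S.nx s) 0 := by ring
      rw [e1] at hx ⊢
      exact (hnew s _ hv hx).1
  have hold : ∃ x ∈ R, B.old x.1 := by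
    obtain ⟨v, i⟩ := x₀
    by_cases hv : B.old v
    · exact ⟨_, hx₀, hv⟩
    · obtain ⟨c, rfl⟩ := hlv v
      obtain ⟨s, rfl⟩ : ∃ s, S.nx s = c := ⟨_, S.nx_nx_nx c⟩
      have e1 : i = i - γ.lev (S.nx s) 0 + γ.lev (S.nx s) 0 := by ring
      rw [e1] at hx₀
      exact ⟨_, (hnew s _ hv hx₀).2, (B.old_or s).resolve_left hv⟩
  have hfin : {x | x ∈ R ∧ B.old x.1}.Finite := by
    refine Set.Finite.subset (s := ⋃ v : V, (fun i => (v, i)) ''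
      Set.Ico (0 : ℤ) (-(P.g v + t (Qs.cV v) - h v))) (Set.finite_iUnion fun v => (Set.finite_Ico _ _).image _) ?_
    rintro ⟨v, i⟩ ⟨hx, -⟩
    have h1 := hR _ hx
    have h2 := hnonneg _ hx
    exact Set.mem_iUnion.2 ⟨v, i, ⟨h2, by simp only at h1; omega⟩, rfl⟩
  -- The set where the minimum of `val` on the old vertices of `R` is attained is closed under
  -- passing to neighbours: at a minimum all neighbours have the same value, hence the sides to them
  -- are kept.
  obtain ⟨x₁, hx₁, hmin⟩ := Set.exists_min_image _ val hfin hold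
  set 𝓜 : Set (V × ℤ) := {x | (x ∈ R ∧ B.old x.1) ∧ val x = val x₁} with h𝓜
  have hval : ∀ s i, val (S.lv (S.nx s), i + γ.lev (S.nx s) 0) =
      (i + e (S.tri s) + t (Qs.cA (S.tri s)) : ℝ) + (K (S.nx s) + P.val (S.lv (S.nx s))) := by
    intro s i
    simp only [val, hκ1, hcV]; push_cast; ring
  have hval' : ∀ s i, val (S.lv (S.nx (S.nx s)), i + γ.lev (S.nx (S.nx s)) 0) =
      (i + e (S.tri s) + t (Qs.cA (S.tri s)) : ℝ) + (K (S.nx (S.nx s)) + P.val (S.lv (S.nx (S.nx s)))) := by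
    intro s i
    simp only [val, hκ2, hcV']; push_cast; ring
  have h𝓜cl : ∀ s i, B.outer s → (S.lv (S.nx s), i + γ.lev (S.nx s) 0) ∈ 𝓜 →
      (S.lv (S.nx (S.nx s)), i + γ.lev (S.nx (S.nx s)) 0) ∈ 𝓜 := by
    intro s₀ i₀ hs₀ hx
    have hle : ∀ s, B.outer s → S.lv (S.nx s) = S.lv (S.nx s₀) → (K (S.nx s) + P.val (S.lv (S.nx s₀)) : ℝ) ≤
        K (S.nx (S.nx s)) + P.val (S.lv (S.nx (S.nx s))) := by
      intro s hs hsv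
      rw [← hsv] at hx ⊢
      have e1 : i₀ + γ.lev (S.nx s₀) 0 = i₀ + γ.lev (S.nx s₀) 0 - γ.lev (S.nx s) 0 + γ.lev (S.nx s) 0 := by ring
      rw [e1] at hx
      by_cases hX : i₀ + γ.lev (S.nx s₀) 0 - γ.lev (S.nx s) 0 +
          (e (S.tri s) + t (Qs.cA (S.tri s)) + Gside P s) < 0
      · have h1 := hmin _ ⟨(hcl s _ hX hx.1.1).2, B.old_nx_nx s hs⟩
        rw [← hx.2, hval s, hval' s] at h1
        linarith
      · exact (hcmp s _ hs hx.1.1 hX).le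
    have heq := P.min_principle _ (B.old_nx s₀ hs₀) hle s₀ hs₀ rfl
    by_cases hX : i₀ + (e (S.tri s₀) + t (Qs.cA (S.tri s₀)) + Gside P s₀) < 0
    · refine ⟨⟨(hcl s₀ _ hX hx.1.1).2, B.old_nx_nx s₀ hs₀⟩, ?_⟩
      rw [← hx.2, hval s₀, hval' s₀, heq]
    · exact absurd heq (hcmp s₀ _ hs₀ hx.1.1 hX).ne
  have h𝓜cl' : ∀ s i, B.outer s → (S.lv (S.nx (S.nx s)), i + γ.lev (S.nx (S.nx s)) 0) ∈ 𝓜 →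
      (S.lv (S.nx s), i + γ.lev (S.nx s) 0) ∈ 𝓜 := by
    intro s i hs hx
    have h1 := hlev s
    rw [← S.lv_fl] at hx
    have e1 : i + γ.lev (S.nx (S.nx s)) 0 =
        i + γ.lev (S.nx (S.nx s)) 0 - γ.lev (S.nx (S.fl s)) 0 + γ.lev (S.nx (S.fl s)) 0 := by ring
    rw [e1] at hx
    have h2 := h𝓜cl _ _ ((B.outer_fl s).2 hs) hx
    rw [lv_fl'] at h2
    convert h2 using 2
    omega
  -- triangles with a corner on the minimal set
  have hpair : ∀ s i, B.old (S.lv (S.nx s)) → B.old (S.lv (S.nx (S.nx s))) →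
      ((S.lv (S.nx s), i + γ.lev (S.nx s) 0) ∈ 𝓜 ↔
        (S.lv (S.nx (S.nx s)), i + γ.lev (S.nx (S.nx s)) 0) ∈ 𝓜) := by
    intro s i h1 h2
    rcases B.outer_or s h1 h2 with h3 | ⟨h3, h4, h5⟩
    · exact ⟨h𝓜cl s i h3, h𝓜cl' s i h3⟩
    · have h6 : _ ↔ _ := ⟨h𝓜cl _ i h4, h𝓜cl' _ i h4⟩
      have h7 : _ ↔ _ := ⟨h𝓜cl _ i h5, h𝓜cl' _ i h5⟩
      rw [S.nx_nx_nx] at h6 h7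
      rw [h6, h7]
  have htri : ∀ c d i, S.tri c = S.tri d → (S.lv c, i + γ.lev c 0) ∈ 𝓜 → B.old (S.lv d) →
      (S.lv d, i + γ.lev d 0) ∈ 𝓜 := by
    intro c d i hcd hc hd
    rcases S.tri_eq c d hcd with rfl | rfl | rfl
    · exact hc
    · have := hpair (S.nx (S.nx c)) i
      rw [S.nx_nx_nx] at this
      exact (this hc.1.2 hd).1 hc
    · have := hpair (S.nx c) i
      rw [S.nx_nx_nx] at this
      exact (this hd hc.1.2).2 hc
  -- Lifts of triangles all of whose old corners are minimal, `i` being the height of the centre.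
  -- One old minimal corner is enough, and the property is passed to adjacent triangles, so it
  -- spreads over a whole component.
  let G (a : A) (i : ℤ) : Prop := ∀ d, S.tri d = a → B.old (S.lv d) → (S.lv d, i + γ.lev d 0) ∈ 𝓜
  have hGfl : ∀ s i, G (S.tri s) i → G (S.tri (S.fl s)) (i + γ.lev (S.nx s) 0 - γ.lev (S.nx (S.nx (S.fl s))) 0) := by
    intro s i hG d hd hd'
    rcases B.old_or s with h1 | h1
    · have h2 := hG _ (S.tri_nx s) h1
      refine htri (S.nx (S.nx (S.fl s))) d _ (by rw [tri_nx_nx, hd]) ?_ hd'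
      rw [lv_fl']
      convert h2 using 2
      ring
    · have h2 := hG _ (tri_nx_nx s) h1
      refine htri (S.nx (S.fl s)) d _ (by rw [S.tri_nx, hd]) ?_ hd'
      rw [S.lv_fl]
      convert h2 using 2
      have := hlev s
      omega
  have hGM : ∀ d i, B.old (S.lv d) → G (S.tri d) i →
      i + e (S.tri d) + t (Qs.cA (S.tri d)) + (K d + P.g (S.lv d)) < 0 := by
    intro d i hd hG
    have h1 := hR _ (hG d rfl hd).1.1
    have h2 := hκ d
    simp only [Qs.cV_lv] at h1
    omega
  -- The maximum `M` is attained at an old corner of the block, either of this triangle or of one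
  -- adjacent across an inner side; that corner is minimal, hence kept.
  have hGX : ∀ a i, G a i → i + (e a + t (Qs.cA a) + P.M (B.bl a)) < 0 := by
    intro a i hG
    obtain ⟨d, hd, hda, hM⟩ := P.exists_M a
    rcases B.adjacent a (S.tri d) hda.symm with rfl | ⟨s, hs, rfl, hsd⟩
    · have := hGM d i hd hG
      omega
    · have h1 := hGfl s i hG
      rw [hsd] at h1
      have h2 := hGM d _ hd h1
      have h3 := hK s hs
      have h4 := hκ1 s
      have h5 := hκ2 (S.fl s)
      have h6 := Qs.cA_fl s
      rw [lv_fl'] at h5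
      rw [hsd] at h5 h6
      rw [h6] at h2
      omega
  have hGseg : ∀ s i, G (S.tri s) i → ∀ j ≤ γ.m s, 0 ≤ i + γ.segLev s j := by
    have key : ∀ s i, G (S.tri s) i → i + (e (S.tri s) + t (Qs.cA (S.tri s)) + Gside P s) < 0 := by
      intro s i hG
      have h1 := hGX _ i hG
      have h2 := Gside_le P s
      omega
    intro s i hG
    refine (hcl s i (key s i hG) ?_).1
    rcases B.old_or s with h1 | h1
    · exact (hG _ (S.tri_nx s) h1).1.1
    · have h2 := hGfl s i hG
      rw [← S.lv_fl] at h1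
      have h3 := (hcl (S.fl s) _ (key _ _ h2) (h2 _ (S.tri_nx _) h1).1.1).2
      rw [lv_fl'] at h3
      convert h3 using 2
      ring
  have hGconn : ∀ a b, Relation.EqvGen (fun a b => ∃ s, S.tri s = a ∧ S.tri (S.fl s) = b) a b →
      ((∃ i, G a i) ↔ ∃ i, G b i) := by
    intro a b hab
    induction hab with
    | rel a b hab =>
      obtain ⟨s, rfl, rfl⟩ := hab
      constructor
      · exact fun ⟨i, hi⟩ => ⟨_, hGfl s i hi⟩
      · rintro ⟨i, hi⟩
        have := hGfl _ i hi
        rw [S.fl_fl] at this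
        exact ⟨_, this⟩
    | refl x => rfl
    | symm x y _ ih => exact ih.symm
    | trans x y z _ _ ih1 ih2 => exact ih1.trans ih2
  obtain ⟨c₁, hc₁⟩ := hlv x₁.1
  have hG₁ : G (S.tri c₁) (x₁.2 - γ.lev c₁ 0) := by
    intro d hd hd'
    refine htri c₁ d _ hd.symm ?_ hd'
    rw [hc₁, sub_add_cancel]
    exact ⟨hx₁, rfl⟩
  -- The contradiction comes from the place where `t` makes the cut touch a piece: the lift of that
  -- triangle in `G` is kept, so the piece has negative height, yet all segments at lifts in `G`
  -- have nonnegative height.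
  obtain ⟨c, k, hc, hk, hmin'⟩ := ht (S.tri c₁)
  obtain ⟨i, hi⟩ := (hGconn _ _ (Qs.connected _ _ hc.symm)).1 ⟨_, hG₁⟩
  have h1 := hGX _ _ hi
  have h2 := hGseg (S.nx (S.nx c)) i (by rwa [tri_nx_nx]) k (by rw [γ.m_eq, S.nx_nx_nx]; omega)
  rw [segLev_of_le (by rwa [S.nx_nx_nx]), S.nx_nx_nx] at h2
  omega

end

end Curve

end TriSurface

/-! ### The rotation inequality for a potential. -/

namespace TriSurface

variable {C A V : Type*} {S : TriSurface C A V}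

theorem sum_tri [Fintype C] [Fintype A] (f : A → ℤ) : ∑ s, f (S.tri s) = 3 * ∑ a, f a := by
  classical
  rw [← Finset.sum_fiberwise Finset.univ S.tri, Finset.mul_sum]
  refine Finset.sum_congr rfl fun a _ => ?_
  obtain ⟨c, rfl⟩ := S.tri_surjective a
  have h1 := S.nx_ne c
  have h2 : S.nx (S.nx c) ≠ c := fun h => h1 (by rw [← h, S.nx_nx_nx, h])
  have h3 : S.nx (S.nx c) ≠ S.nx c := S.nx_ne _
  have h4 : Finset.univ.filter (fun s => S.tri s = S.tri c) = {c, S.nx c, S.nx (S.nx c)} := by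
    ext d
    simp only [Finset.mem_filter, Finset.mem_univ, true_and, Finset.mem_insert, Finset.mem_singleton]
    constructor
    · exact fun h => S.tri_eq c d h.symm
    · rintro (rfl | rfl | rfl)
      · rfl
      · exact S.tri_nx _
      · rw [S.tri_nx, S.tri_nx]
  rw [h4, Finset.sum_insert (by simp [h1.symm, h2.symm]), Finset.sum_insert (by simp [h3.symm]),
    Finset.sum_singleton, S.tri_nx (S.nx c), S.tri_nx]
  ring

namespace Curve

variable {γ : S.Curve}

theorem lev_sub_lev (s : C) : γ.lev (S.nx s) 0 - γ.lev (S.nx (S.nx s)) 0 =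
    ∑ j ∈ Finset.range (γ.m s), γ.cr s j := by
  have h : ∀ j ≤ γ.m s, γ.segLev s 0 - γ.segLev s j = ∑ i ∈ Finset.range j, γ.cr s i := by
    intro j
    induction j with
    | zero => simp
    | succ j ih =>
      intro hj
      have h1 := ih (by omega)
      have h2 := segLev_succ (γ := γ) hj
      rw [Finset.sum_range_succ]
      omega
  rw [← h _ le_rfl, segLev_zero, segLev_last]

/-- The crossing numbers of the two sides of an edge are opposite, and their sums are the
differences of turning numbers at the ends. -/
theorem lev_fl (s : C) : γ.lev (S.nx (S.fl s)) 0 - γ.lev (S.nx (S.nx s)) 0 =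
    γ.lev (S.nx (S.nx (S.fl s))) 0 - γ.lev (S.nx s) 0 := by
  have h1 := lev_sub_lev (γ := γ) s
  have h2 := lev_sub_lev (γ := γ) (S.fl s)
  rw [← Finset.sum_range_reflect, γ.m_fl,
    Finset.sum_congr rfl fun j hj => γ.cr_fl s j (Finset.mem_range.1 hj), Finset.sum_neg_distrib] at h2
  omega

variable {Bk Q : Type*} {B : S.Blocks Bk} {K : C → ℤ}

/-- The level sets of the potential, corrected by `e` and `h`, form a cut, and `Cut.sum_le` for this
cut is the assertion. On each component the potential may be shifted by an integer `t`, which drops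
out because the Euler characteristic is zero. -/
theorem rotation_le [Fintype C] [Fintype A] [Fintype V] (P : B.Potential K) (Qs : S.Components Q)
    {e : A → ℤ} {h : V → ℤ} (hlv : Function.Surjective S.lv)
    (hκ : ∀ c, γ.lev c 0 = K c + e (S.tri c) + h (S.lv c))
    (hK : ∀ s, ¬ B.outer s → K (S.nx s) = K (S.nx (S.nx (S.fl s)))) :
    ∑ a, e a + 2 * ∑ v, h v + ∑ s, Gside P s ≤ 2 * ∑ v, P.g v + 2 * ∑ a, P.M (B.bl a) := by
  have hlev := lev_fl (γ := γ)
  -- `t` is the largest shift compatible with `Ga_le`. That equality occurs somewhere is what makes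
  -- the cut good.
  have ht : ∀ q, ∃ t : ℤ, (∀ c k, Qs.cA (S.tri c) = q → k ≤ γ.n c →
      e (S.tri c) + t + P.M (B.bl (S.tri c)) ≤ γ.lev c k) ∧
      ((∃ c, Qs.cA (S.tri c) = q) → ∃ c k, Qs.cA (S.tri c) = q ∧ k ≤ γ.n c ∧
        γ.lev c k = e (S.tri c) + t + P.M (B.bl (S.tri c))) := by
    intro q
    by_cases hq : ∃ c, Qs.cA (S.tri c) = q
    · obtain ⟨c, hc⟩ := hq
      have hfin : {x : C × ℕ | Qs.cA (S.tri x.1) = q ∧ x.2 ≤ γ.n x.1}.Finite := by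
        refine (Set.finite_iUnion fun c : C => (Set.finite_Iic (γ.n c)).image fun k => (c, k)).subset ?_
        rintro ⟨c, k⟩ ⟨-, hk⟩
        exact Set.mem_iUnion.2 ⟨c, k, hk, rfl⟩
      obtain ⟨x, hx, hmin⟩ := Set.exists_min_image _
        (fun x : C × ℕ => γ.lev x.1 x.2 - e (S.tri x.1) - P.M (B.bl (S.tri x.1))) hfin ⟨(c, 0), hc, Nat.zero_le _⟩
      refine ⟨γ.lev x.1 x.2 - e (S.tri x.1) - P.M (B.bl (S.tri x.1)), fun c k h1 h2 => ?_,
        fun _ => ⟨x.1, x.2, hx.1, hx.2, ?_⟩⟩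
      · have := hmin (c, k) ⟨h1, h2⟩
        simp only at this
        omega
      · ring
    · exact ⟨0, fun c k hc => absurd ⟨c, hc⟩ hq, fun h => absurd h hq⟩
  choose t ht1 ht2 using ht
  have hκ1 : ∀ s, γ.lev (S.nx s) 0 = K (S.nx s) + e (S.tri s) + h (S.lv (S.nx s)) := fun s => by
    rw [hκ, S.tri_nx]
  have hκ2 : ∀ s, γ.lev (S.nx (S.nx s)) 0 =
      K (S.nx (S.nx s)) + e (S.tri s) + h (S.lv (S.nx (S.nx s))) := fun s => by
    rw [hκ, tri_nx_nx]
  let X : γ.Cut :=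
    { H := fun v => P.g v + t (Qs.cV v) - h v
      Gs := fun s => e (S.tri s) + t (Qs.cA (S.tri s)) + Gside P s
      Ga := fun a => e a + t (Qs.cA a) + P.M (B.bl a)
      Gs_fl := fun s => by
        have h1 := hκ1 s
        have h2 := hκ2 s
        have h3 := hκ1 (S.fl s)
        have h4 := hκ2 (S.fl s)
        have h5 := hlev s
        rw [S.lv_fl] at h3
        rw [lv_fl'] at h4
        rw [Qs.cA_fl]
        unfold Gside
        by_cases hs : B.outer s
        · rw [if_pos hs, if_pos ((B.outer_fl s).2 hs), S.lv_fl, lv_fl']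
          omega
        · rw [if_neg hs, if_neg fun h => hs ((B.outer_fl s).1 h), B.bl_fl s hs]
          have h6 := hK s hs
          omega
      le_Gs := fun s => by
        have h1 := hκ1 s
        have h2 := le_Gside P s
        rw [Qs.cV_lv, S.tri_nx]
        omega
      Gs_le := fun s => by
        have h2 := Gside_le P s
        omega
      Ga_le := fun c k hk => ht1 _ c k rfl hk
      good := good_of_potential P Qs hlv hκ hK hlev t fun a => by
        obtain ⟨c, rfl⟩ := S.tri_surjective a
        obtain ⟨c', k, h1, h2, h3⟩ := ht2 _ ⟨c, rfl⟩
        exact ⟨c', k, h1, h2, by rw [h3, h1]⟩ }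
  have key := X.sum_le
  change ∑ s, (e (S.tri s) + t (Qs.cA (S.tri s)) + Gside P s) ≤
    2 * ∑ v, (P.g v + t (Qs.cV v) - h v) + 2 * ∑ a, (e a + t (Qs.cA a) + P.M (B.bl a)) at key
  simp only [Finset.sum_add_distrib, Finset.sum_sub_distrib] at key
  -- A triangle has three sides and the sum of `t` over triangles is twice the sum over vertices, so
  -- `t` contributes equally to both sides of the inequality.
  rw [S.sum_tri, S.sum_tri fun a => t (Qs.cA a), Qs.euler] at key
  linarith

end Curve

end TriSurface

/-! ## The boundary surface of an ideal triangulation -/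

theorem ccw_ccw_ccw : ∀ v w : Fin 4, v ≠ w → ccw v (ccw v (ccw v w)) = w := by decide

theorem ccw_ne : ∀ v w : Fin 4, v ≠ w → ccw v w ≠ w := by decide

theorem eq_ccw_or : ∀ v w x : Fin 4, v ≠ w → v ≠ x → x = w ∨ x = ccw v w ∨ x = ccw v (ccw v w) := by
  decide

theorem ccw_perm_odd : ∀ (p : Equiv.Perm (Fin 4)), Equiv.Perm.sign p = -1 → ∀ v w : Fin 4, v ≠ w →
    p (ccw v (ccw v w)) = ccw (p v) (p w) := by
  decide

theorem ccw_perm_even : ∀ (p : Equiv.Perm (Fin 4)), Equiv.Perm.sign p = 1 → ∀ v w : Fin 4, v ≠ w →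
    p (ccw v w) = ccw (p v) (p w) := by
  decide

theorem ccw_ccw_perm_odd (p : Equiv.Perm (Fin 4)) (hp : Equiv.Perm.sign p = -1) {v w : Fin 4} (h : v ≠ w) :
    p (ccw v w) = ccw (p v) (ccw (p v) (p w)) := by
  rw [← ccw_perm_odd p hp v w h, ← ccw_perm_odd p hp _ _ (ne_ccw _ _ (ne_ccw _ _ h)), ccw_ccw_ccw v w h]

theorem Corner.next_next_next {τ : Type*} (c : Corner τ) : c.next.next.next = c :=
  Subtype.ext (Prod.ext rfl (Prod.ext rfl (ccw_ccw_ccw _ _ c.2)))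

namespace FacePairing

variable {τ : Type*} (T : FacePairing τ)

/-- Gluing of sides. -/
def flipSide (s : Corner τ) : Corner τ := ⟨T.flip s.1, fun h => s.2 ((T.glue _ _).injective h)⟩

theorem flip_flip (s : τ × Fin 4 × Fin 4) : T.flip (T.flip s) = s := by
  obtain ⟨t, v, f⟩ := s
  simp only [flip, T.adj_adj, T.glue_glue, Equiv.Perm.inv_def, Equiv.symm_apply_apply]

theorem cornerRel_nextNext (s : Corner τ) : T.CornerRel s.next.next (T.flipSide s).next := by
  obtain ⟨⟨t, v, f⟩, h⟩ := s
  refine ⟨f, h.symm, ?_, ?_⟩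
  · have := ccw_ne v _ (ne_ccw v _ (ne_ccw v f h))
    rw [ccw_ccw_ccw v f h] at this
    exact this
  · simp only [flipSide, flip, Corner.next, ccw_perm_odd _ (T.odd t f) v f h]

theorem cornerRel_iff {c d : Corner τ} (h : T.CornerRel c d) :
    ∃ s, (c = s.next ∧ d = (T.flipSide s).next.next) ∨ (c = s.next.next ∧ d = (T.flipSide s).next) := by
  obtain ⟨f, h1, h2, h3⟩ := h
  obtain ⟨⟨t, v, w⟩, h⟩ := c
  simp only at h1 h2 h3 h
  refine ⟨⟨(t, v, f), h1.symm⟩, ?_⟩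
  rcases eq_ccw_or v f w h1.symm h with rfl | rfl | rfl
  · exact absurd rfl h2
  · refine Or.inl ⟨rfl, Subtype.ext (h3.trans ?_)⟩
    simp only [flipSide, flip, Corner.next, ccw_ccw_perm_odd _ (T.odd t f) h1.symm]
  · refine Or.inr ⟨rfl, Subtype.ext (h3.trans ?_)⟩
    simp only [flipSide, flip, Corner.next, ccw_perm_odd _ (T.odd t f) v f h1.symm]

/-- The triangulated boundary. -/
def surface : TriSurface (Corner τ) (τ × Fin 4) T.LinkVertex where
  nx := Corner.next
  fl := T.flipSide
  tri c := (c.1.1, c.1.2.1)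
  lv := linkVertex
  nx_nx_nx := Corner.next_next_next
  nx_ne c h := ccw_ne _ _ c.2 (congrArg (fun c => c.1.2.2) h)
  tri_nx _ := rfl
  tri_eq := by
    rintro ⟨⟨t, v, w⟩, h⟩ ⟨⟨t', v', w'⟩, h'⟩ e
    simp only [Prod.mk.injEq] at e
    obtain ⟨rfl, rfl⟩ := e
    simp only [Corner.next, Subtype.mk.injEq, Prod.mk.injEq, true_and]
    exact eq_ccw_or v w w' h h'
  tri_surjective a := by
    obtain ⟨w, hw⟩ := exists_ne a.2
    exact ⟨⟨(a.1, a.2, w), hw.symm⟩, rfl⟩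
  fl_fl s := Subtype.ext (T.flip_flip s.1)
  fl_ne s h := T.not_self s.1.1 s.1.2.2 (by
    have := congrArg Subtype.val h
    exact Prod.ext (congrArg (fun c => c.1) this) (congrArg (fun c => c.2.2) this))
  lv_fl s := (Quot.sound (T.cornerRel_nextNext s)).symm
  lv_orbit c d h := by
    have := Quot.eqvGen_exact h
    clear h
    induction this with
    | rel a b h =>
      obtain ⟨s, ⟨rfl, rfl⟩ | ⟨rfl, rfl⟩⟩ := T.cornerRel_iff h
      · exact .rel _ _ ⟨s, rfl, rfl⟩
      · refine .symm _ _ (.rel _ _ ⟨T.flipSide s, rfl, ?_⟩)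
        rw [show T.flipSide (T.flipSide s) = s from Subtype.ext (T.flip_flip s.1)]
    | refl x => exact .refl _
    | symm x y _ ih => exact .symm _ _ ih
    | trans x y z _ _ ih1 ih2 => exact .trans _ _ _ ih1 ih2

theorem flipSide_flipSide (s : Corner τ) : T.flipSide (T.flipSide s) = s := Subtype.ext (T.flip_flip s.1)

theorem linkVertex_surjective : Function.Surjective T.surface.lv := Quot.mk_surjective

instance [Finite τ] : Finite T.LinkVertex := Finite.of_surjective _ T.linkVertex_surjective

instance [Finite τ] : Finite T.LinkEdge := Finite.of_surjective _ Quot.mk_surjective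

instance [Finite τ] : Finite T.Edge := Finite.of_surjective _ Quot.mk_surjective

instance [Finite τ] : Finite T.Cusp := Finite.of_surjective _ Quot.mk_surjective

/-- The cusp at a boundary vertex. -/
def cuspOfVertex : T.LinkVertex → T.Cusp :=
  Quot.lift (fun c => cusp (c.1.1, c.1.2.1)) (by
    rintro c d ⟨f, h1, h2, h3⟩
    refine Quot.sound ⟨f, h1, ?_⟩
    rw [h3])

theorem cusp_flipSide (s : Corner τ) :
    cusp (T := T) ((T.flipSide s).1.1, (T.flipSide s).1.2.1) = cusp (s.1.1, s.1.2.1) :=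
  (Quot.sound ⟨s.1.2.2, s.2.symm, rfl⟩).symm

theorem linkEdge_eq_iff {s s' : Corner τ} : (linkEdge s : T.LinkEdge) = linkEdge s' ↔
    s' = s ∨ s' = T.flipSide s := by
  constructor
  · intro h
    have := Quot.eqvGen_exact h
    clear h
    induction this with
    | rel a b h => exact Or.inr (Subtype.ext h)
    | refl x => exact Or.inl rfl
    | symm x y _ ih =>
      rcases ih with rfl | rfl
      · exact Or.inl rfl
      · exact Or.inr (T.flipSide_flipSide x).symm
    | trans x y z _ _ ih1 ih2 =>
      rcases ih1 with rfl | rfl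
      · exact ih2
      · rcases ih2 with rfl | rfl
        · exact Or.inr rfl
        · exact Or.inl (T.flipSide_flipSide x)
  · rintro (rfl | rfl)
    · rfl
    · exact Quot.sound rfl

end FacePairing

/-! ### Euler characteristic zero of the boundary components. -/

namespace IdealTriangulation

variable {τ : Type*} [Fintype τ] (T : IdealTriangulation τ)

/-- Triangles have three sides and sides are glued in pairs, so 2E = 3F; together with V - E + F = 0
this gives 2V = F. -/
theorem two_mul_card_linkVertex (q : T.Cusp) [Fintype T.LinkVertex] [DecidableEq T.Cusp] :
    2 * (Finset.univ.filter fun v => T.cuspOfVertex v = q).card =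
      (Finset.univ.filter fun a => FacePairing.cusp (T := T.toFacePairing) a = q).card := by
  classical
  let _ : Fintype T.LinkEdge := Fintype.ofFinite _
  have h := T.torus q
  unfold FacePairing.linkEuler at h
  have h1 : {x : T.LinkVertex | ∃ c : Corner τ, FacePairing.linkVertex c = x ∧
      FacePairing.cusp (c.1.1, c.1.2.1) = q} = (Finset.univ.filter fun v => T.cuspOfVertex v = q : Finset _) := by
    ext x
    simp only [Set.mem_ofPred_eq, Finset.coe_filter, Finset.mem_univ, true_and]
    constructor
    · rintro ⟨c, rfl, h⟩; exact h
    · intro h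
      obtain ⟨c, rfl⟩ := T.linkVertex_surjective x
      exact ⟨c, rfl, h⟩
  have h2 : {x : T.LinkEdge | ∃ c : Corner τ, FacePairing.linkEdge c = x ∧
      FacePairing.cusp (c.1.1, c.1.2.1) = q} = ((Finset.univ.filter fun c : Corner τ =>
        FacePairing.cusp (T := T.toFacePairing) (c.1.1, c.1.2.1) = q).image (FacePairing.linkEdge : _ → T.LinkEdge) : Finset T.LinkEdge) := by
    ext x
    simp only [Set.mem_ofPred_eq, Finset.coe_image, Finset.coe_filter, Finset.mem_univ, true_and,
      Set.mem_image]
    exact exists_congr fun c => and_comm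
  have h3 : {a : τ × Fin 4 | FacePairing.cusp (T := T.toFacePairing) a = q} =
      (Finset.univ.filter fun a => FacePairing.cusp (T := T.toFacePairing) a = q : Finset _) := by
    ext; simp
  rw [h1, h2, h3, Set.ncard_coe_finset, Set.ncard_coe_finset, Set.ncard_coe_finset] at h
  have h4 : ((Finset.univ.filter fun c : Corner τ =>
      FacePairing.cusp (T := T.toFacePairing) (c.1.1, c.1.2.1) = q).card : ℤ) =
      3 * (Finset.univ.filter fun a => FacePairing.cusp (T := T.toFacePairing) a = q).card := by
    have := T.surface.sum_tri fun a => if FacePairing.cusp (T := T.toFacePairing) a = q then 1 else 0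
    rw [Finset.card_filter, Finset.card_filter]
    push_cast
    exact this
  have h5 : (Finset.univ.filter fun c : Corner τ =>
      FacePairing.cusp (T := T.toFacePairing) (c.1.1, c.1.2.1) = q).card =
      2 * ((Finset.univ.filter fun c : Corner τ =>
        FacePairing.cusp (T := T.toFacePairing) (c.1.1, c.1.2.1) = q).image
          (FacePairing.linkEdge : _ → T.LinkEdge)).card := by
    rw [Finset.card_eq_sum_card_image (FacePairing.linkEdge : _ → T.LinkEdge), mul_comm]
    refine Finset.sum_const_nat fun b hb => ?_
    obtain ⟨c, hc, rfl⟩ := Finset.mem_image.1 hb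
    have hc' := (Finset.mem_filter.1 hc).2
    have h6 : T.flipSide c ≠ c := T.surface.fl_ne c
    rw [← Finset.card_pair h6.symm]
    congr 1
    ext d
    rw [Finset.mem_filter, Finset.mem_filter, eq_comm (b := FacePairing.linkEdge c),
      T.linkEdge_eq_iff, Finset.mem_insert, Finset.mem_singleton]
    simp only [Finset.mem_univ, true_and, and_iff_right_iff_imp]
    rintro (rfl | rfl)
    · exact hc'
    · rw [T.cusp_flipSide, hc']
  omega

/-- The connected components of the boundary. -/
noncomputable def components [Fintype T.LinkVertex] : T.surface.Components T.Cusp where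
  cA := FacePairing.cusp
  cV := T.cuspOfVertex
  cV_lv _ := rfl
  connected a b h := by
    have := Quot.eqvGen_exact h
    clear h
    induction this with
    | rel a b h =>
      obtain ⟨f, hf, rfl⟩ := h
      exact .rel _ _ ⟨⟨(a.1, a.2, f), hf.symm⟩, rfl, rfl⟩
    | refl x => exact .refl _
    | symm x y _ ih => exact .symm _ _ ih
    | trans x y z _ _ ih1 ih2 => exact .trans _ _ _ ih1 ih2
  euler t := by
    classical
    let _ : Fintype T.Cusp := Fintype.ofFinite _
    rw [← Finset.sum_fiberwise Finset.univ (FacePairing.cusp (T := T.toFacePairing)),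
      ← Finset.sum_fiberwise Finset.univ T.cuspOfVertex, Finset.mul_sum]
    refine Finset.sum_congr rfl fun q _ => ?_
    have h1 : ∀ a ∈ Finset.univ.filter (fun a => FacePairing.cusp (T := T.toFacePairing) a = q),
        t (FacePairing.cusp a) = t q := fun a ha => by rw [(Finset.mem_filter.1 ha).2]
    have h2 : ∀ v ∈ Finset.univ.filter (fun v => T.cuspOfVertex v = q),
        t (T.cuspOfVertex v) = t q := fun v hv => by rw [(Finset.mem_filter.1 hv).2]
    rw [Finset.sum_congr rfl h1, Finset.sum_congr rfl h2,
      Finset.sum_const, Finset.sum_const, ← T.two_mul_card_linkVertex q]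
    simp only [nsmul_eq_mul]
    push_cast
    ring

end IdealTriangulation

/-! ### Multi-curves as normal curves on the triangulated boundary. -/

namespace FacePairing

variable {τ : Type*} {T : FacePairing τ}

namespace NormalCurve

variable (γ : T.NormalCurve)

/-- Number of arcs at a corner. -/
def num (c : Corner τ) : ℕ := γ.count c.1.1 c.1.2.1 c.1.2.2

/-- Number of points on a side. -/
def pts (s : Corner τ) : ℕ := γ.num s.next + γ.num s.next.next

/-- Corner and index of the arc at the `j`-th point of a side. -/
def arcAt (s : Corner τ) (j : ℕ) : Corner τ × ℕ :=
  if j < γ.num s.next then (s.next, j) else (s.next.next, γ.pts s - 1 - j)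

theorem filter_ne_ne {v f : Fin 4} (h : v ≠ f) :
    Finset.univ.filter (fun w => w ≠ v ∧ w ≠ f) = {ccw v f, ccw v (ccw v f)} := by
  revert v f; decide

theorem pts_flipSide (s : Corner τ) : γ.pts (T.flipSide s) = γ.pts s := by
  obtain ⟨⟨t, v, f⟩, h⟩ := s
  have h1 : v ≠ f := h
  have := γ.matching t v f h1
  rw [filter_ne_ne h1, Finset.sum_pair (ccw_ne _ _ (ne_ccw _ _ h1)).symm,
    Finset.sum_pair (ccw_ne _ _ (ne_ccw _ _ h1)).symm, ccw_perm_odd _ (T.odd t f) v f h1,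
    ccw_ccw_perm_odd _ (T.odd t f) h1, add_comm (γ.count _ _ (ccw _ (ccw _ _)))] at this
  exact this.symm

theorem arcAt_lt {s : Corner τ} {j : ℕ} (h : j < γ.pts s) : (γ.arcAt s j).2 < γ.num (γ.arcAt s j).1 := by
  unfold arcAt
  unfold pts at h ⊢
  split_ifs
  · assumption
  · simp only; omega

variable {γ}

theorem Arc.vert_ne_corner (a : γ.Arc) : a.1.2.1 ≠ a.1.2.2 := by
  intro h
  have h1 := a.2.2
  have h2 := γ.count_diag a.1.1 a.1.2.1
  nth_rw 2 [h] at h2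
  omega

/-- The arc with given corner and index. -/
def mkArc (x : Corner τ × ℕ) (h : x.2 < γ.num x.1) : γ.Arc := ⟨x.1.1, x.2, h⟩

/-- Corner and index of an arc. -/
def Arc.data (a : γ.Arc) : Corner τ × ℕ := (⟨a.1, a.vert_ne_corner⟩, a.2)

theorem data_mkArc (x : Corner τ × ℕ) (h : x.2 < γ.num x.1) : (mkArc x h).data = x := rfl

theorem Arc.data_lt (a : γ.Arc) : a.data.2 < γ.num a.data.1 := a.2.2

theorem Arc.data_eq (a : γ.Arc) (s : Corner τ) (h1 : a.tet = s.1.1) (h2 : a.vert = s.1.2.1)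
    (h3 : a.corner ≠ s.1.2.2) : a.pos s.next.1.2.2 < γ.pts s ∧ a.data = γ.arcAt s (a.pos s.next.1.2.2) ∧
      a.pos s.next.next.1.2.2 = γ.pts s - 1 - a.pos s.next.1.2.2 := by
  obtain ⟨⟨t, v, w⟩, k⟩ := a
  obtain ⟨⟨t', v', f⟩, h⟩ := s
  have hvw : v ≠ w := Arc.vert_ne_corner ⟨(t, v, w), k⟩
  simp only [tet, vert, corner] at h1 h2 h3
  subst h1 h2
  simp only at h
  have e1 := (ccw_ne v _ (ne_ccw v f h)).symm
  have hk := k.2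
  rcases eq_ccw_or v f w h hvw with rfl | rfl | rfl
  · exact absurd rfl h3
  · have p1 : pos ⟨(t, v, ccw v f), k⟩ (ccw v f) = k := if_pos rfl
    have p2 : pos ⟨(t, v, ccw v f), k⟩ (ccw v (ccw v f)) =
        γ.count t v (ccw v (ccw v f)) + γ.count t v (ccw v f) - 1 - k := if_neg e1
    simp only [Arc.data, Corner.next, arcAt, pts, num, p1, p2]
    simp only at hk
    refine ⟨by omega, ?_, by omega⟩
    rw [if_pos hk]
  · have p1 : pos ⟨(t, v, ccw v (ccw v f)), k⟩ (ccw v (ccw v f)) = k := if_pos rfl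
    have p2 : pos ⟨(t, v, ccw v (ccw v f)), k⟩ (ccw v f) =
        γ.count t v (ccw v f) + γ.count t v (ccw v (ccw v f)) - 1 - k := if_neg e1.symm
    simp only [Arc.data, Corner.next, arcAt, pts, num, p1, p2]
    simp only at hk
    refine ⟨by omega, ?_, by omega⟩
    rw [if_neg (by omega)]
    exact Prod.ext rfl (by simp only; omega)

theorem arcAt_injective {s : Corner τ} {j j' : ℕ} (h : j < γ.pts s) (h' : j' < γ.pts s)
    (e : γ.arcAt s j = γ.arcAt s j') : j = j' := by
  have hne : s.next ≠ s.next.next := fun h => T.surface.nx_ne s.next h.symm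
  unfold arcAt at e
  split_ifs at e <;> simp only [Prod.mk.injEq, true_and, hne, hne.symm, false_and] at e <;> omega

theorem arcAt_side (s : Corner τ) (j : ℕ) : (γ.arcAt s j).1.1.1 = s.1.1 ∧ (γ.arcAt s j).1.1.2.1 = s.1.2.1 ∧
    (γ.arcAt s j).1.1.2.2 ≠ s.1.2.2 := by
  have h1 := ccw_ne _ _ s.2
  have h2 := ccw_ne _ _ (ne_ccw _ _ (ne_ccw _ _ s.2))
  rw [ccw_ccw_ccw _ _ s.2] at h2
  unfold arcAt
  split_ifs
  · exact ⟨rfl, rfl, h1⟩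
  · exact ⟨rfl, rfl, h2.symm⟩

theorem pos_arcAt {s : Corner τ} {j : ℕ} (h : j < γ.pts s) :
    (mkArc _ (γ.arcAt_lt h)).pos s.next.1.2.2 = j ∧
      (mkArc _ (γ.arcAt_lt h)).pos s.next.next.1.2.2 = γ.pts s - 1 - j := by
  obtain ⟨e1, e2, e3⟩ := arcAt_side (γ := γ) s j
  obtain ⟨h1, h2, h3⟩ := Arc.data_eq (mkArc _ (γ.arcAt_lt h)) s e1 e2 e3
  rw [data_mkArc] at h2
  have := arcAt_injective h h1 h2
  rw [h3, ← this]
  exact ⟨rfl, rfl⟩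

theorem joined_arcAt {s : Corner τ} {j : ℕ} (h : j < γ.pts s) (h' : γ.pts s - 1 - j < γ.pts (T.flipSide s)) :
    Joined (mkArc _ (γ.arcAt_lt h)) s.1.2.2 (mkArc _ (γ.arcAt_lt h')) := by
  obtain ⟨e1, e2, e3⟩ := arcAt_side (γ := γ) s j
  obtain ⟨e1', e2', e3'⟩ := arcAt_side (γ := γ) (T.flipSide s) (γ.pts s - 1 - j)
  obtain ⟨p1, p2⟩ := pos_arcAt h
  obtain ⟨p1', p2'⟩ := pos_arcAt h'
  have g1 : (mkArc _ (γ.arcAt_lt h)).tet = s.1.1 := e1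
  have g2 : (mkArc _ (γ.arcAt_lt h)).vert = s.1.2.1 := e2
  refine ⟨?_, e3.symm, ?_, ?_, ?_, ?_⟩
  · rw [g2]; exact s.2.symm
  · rw [g1]; exact e1'
  · rw [g1, g2]; exact e2'
  · rw [g1]; exact e3'
  · intro w hw1 hw2
    rw [g1]
    rw [g2] at hw1
    rcases eq_ccw_or _ _ w s.2 hw1.symm with rfl | rfl | rfl
    · exact absurd rfl hw2
    · refine p1.trans ?_
      rw [ccw_ccw_perm_odd _ (T.odd _ _) s.2]
      refine (p2'.trans ?_).symm
      rw [γ.pts_flipSide]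
      omega
    · refine p2.trans ?_
      rw [ccw_perm_odd _ (T.odd _ _) _ _ s.2]
      exact p1'.symm

theorem Joined.exists {a b : γ.Arc} {f : Fin 4} (h : Joined a f b) : ∃ s j, j < γ.pts s ∧
    a.data = γ.arcAt s j ∧ b.data = γ.arcAt (T.flipSide s) (γ.pts s - 1 - j) := by
  obtain ⟨h1, h2, h3, h4, h5, h6⟩ := h
  let s : Corner τ := ⟨(a.tet, a.vert, f), h1.symm⟩
  have g := ne_ccw a.vert f h1.symm
  obtain ⟨i1, i2, i3⟩ := a.data_eq s rfl rfl h2.symm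
  obtain ⟨j1, j2, j3⟩ := b.data_eq (T.flipSide s) h3 h4 h5
  refine ⟨s, _, i1, i2, ?_⟩
  rw [← i3, j2]
  congr 1
  have := h6 (ccw a.vert (ccw a.vert f)) (ne_ccw _ _ g).symm (by
    have h2 := ccw_ne _ _ (ne_ccw _ _ g)
    rw [ccw_ccw_ccw _ _ h1.symm] at h2
    exact h2.symm)
  rw [ccw_perm_odd _ (T.odd _ _) _ _ h1.symm] at this
  exact this.symm

theorem sameComponent_iff (a b : γ.Arc) : SameComponent a b ↔
    Relation.EqvGen (fun x y => ∃ s j, j < γ.pts s ∧ x = γ.arcAt s j ∧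
      y = γ.arcAt (T.flipSide s) (γ.pts s - 1 - j)) a.data b.data := by
  constructor
  · intro h
    induction h with
    | rel a b h => obtain ⟨f, h⟩ := h; exact .rel _ _ h.exists
    | refl x => exact .refl _
    | symm x y _ ih => exact .symm _ _ ih
    | trans x y z _ _ ih1 ih2 => exact .trans _ _ _ ih1 ih2
  · have key : ∀ x y, Relation.EqvGen (fun x y => ∃ s j, j < γ.pts s ∧ x = γ.arcAt s j ∧
        y = γ.arcAt (T.flipSide s) (γ.pts s - 1 - j)) x y →
        (x.2 < γ.num x.1 ↔ y.2 < γ.num y.1) ∧ ∀ hx hy, SameComponent (γ := γ) (mkArc x hx) (mkArc y hy) := by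
      intro x y h
      induction h with
      | rel x y h =>
        obtain ⟨s, j, h, rfl, rfl⟩ := h
        have h' : γ.pts s - 1 - j < γ.pts (T.flipSide s) := by rw [γ.pts_flipSide]; omega
        exact ⟨iff_of_true (γ.arcAt_lt h) (γ.arcAt_lt h'), fun _ _ => .rel _ _ ⟨_, joined_arcAt h h'⟩⟩
      | refl x => exact ⟨Iff.rfl, fun _ _ => .refl _⟩
      | symm x y _ ih => exact ⟨ih.1.symm, fun hx hy => .symm _ _ (ih.2 hy hx)⟩
      | trans x y z _ _ ih1 ih2 =>
        exact ⟨ih1.1.trans ih2.1, fun hx hz => .trans _ _ _ (ih1.2 hx (ih1.1.1 hx)) (ih2.2 _ hz)⟩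
    exact fun h => (key _ _ h).2 a.data_lt b.data_lt

variable (sgn : γ.Arc → ℤˣ)

/-- Signs of the arcs at a corner. -/
def sign (c : Corner τ) (k : ℕ) : ℤ := if h : k < γ.num c then (sgn (mkArc (c, k) h) : ℤ) else 1

theorem sign_eq (c : Corner τ) (k : ℕ) : sign sgn c k = 1 ∨ sign sgn c k = -1 := by
  unfold sign
  split_ifs with h
  · rcases Int.units_eq_one_or (sgn (mkArc (c, k) h)) with h | h <;> simp [h]
  · exact Or.inl rfl

/-- Crossing number at the `j`-th point of a side. -/
def crossing (s : Corner τ) (j : ℕ) : ℤ :=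
  if j < γ.num s.next then sign sgn s.next j else -sign sgn s.next.next (γ.pts s - 1 - j)

theorem enters_next (s : Corner τ) (a : γ.Arc) (h1 : a.vert = s.1.2.1) (h2 : a.corner = s.next.1.2.2) :
    a.enters s.1.2.2 = 1 := by
  unfold Arc.enters
  rw [h1, h2, if_pos]
  exact (ccw_ccw_ccw _ _ s.2).symm

theorem enters_nextNext (s : Corner τ) (a : γ.Arc) (h1 : a.vert = s.1.2.1)
    (h2 : a.corner = s.next.next.1.2.2) : a.enters s.1.2.2 = -1 := by
  unfold Arc.enters
  rw [h1, h2, if_neg]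
  have := ccw_ccw_ccw _ _ s.2
  simp only [Corner.next]
  rw [this]
  exact (ccw_ne _ _ s.2).symm

theorem crossing_eq {s : Corner τ} {j : ℕ} (h : j < γ.pts s) : crossing sgn s j =
    (sgn (mkArc _ (γ.arcAt_lt h)) : ℤ) * (mkArc _ (γ.arcAt_lt h)).enters s.1.2.2 := by
  unfold crossing
  have hlt := γ.arcAt_lt h
  by_cases h1 : j < γ.num s.next
  · have e : γ.arcAt s j = (s.next, j) := if_pos h1
    simp only [e] at hlt ⊢
    rw [if_pos h1, enters_next s _ rfl rfl, sign, dif_pos h1, mul_one]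
  · have e : γ.arcAt s j = (s.next.next, γ.pts s - 1 - j) := if_neg h1
    simp only [e] at hlt ⊢
    rw [if_neg h1, enters_nextNext s _ rfl rfl, sign, dif_pos hlt]
    ring

open Classical in
/-- The chain of a set of arcs, as a sum over the points of a side. -/
theorem chain_eq [Fintype τ] (R : Set γ.Arc) (s : Corner τ) : chain sgn R s.1 =
    ∑ j ∈ Finset.range (γ.pts s), if ∃ h, mkArc (γ.arcAt s j) h ∈ R then crossing sgn s j else 0 := by
  have hne : s.next.1 ≠ s.next.next.1 := fun h => T.surface.nx_ne s.next (Subtype.ext h).symm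
  let F (c : Corner τ) (k : ℕ) : ℤ := if ∃ h, mkArc (c, k) h ∈ R then sign sgn c k else 0
  have h1 : ∑ i, (if (⟨s.next.1, i⟩ : γ.Arc) ∈ R ∧ Arc.tet (⟨s.next.1, i⟩ : γ.Arc) = s.1.1 ∧
      Arc.vert (⟨s.next.1, i⟩ : γ.Arc) = s.1.2.1 ∧ Arc.corner (⟨s.next.1, i⟩ : γ.Arc) ≠ s.1.2.2 then
      (sgn (⟨s.next.1, i⟩ : γ.Arc) : ℤ) * Arc.enters (⟨s.next.1, i⟩ : γ.Arc) s.1.2.2 else 0) =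
      ∑ k ∈ Finset.range (γ.num s.next), F s.next k := by
    rw [← Fin.sum_univ_eq_sum_range]
    refine Finset.sum_congr rfl fun i _ => ?_
    rw [enters_next s _ rfl rfl, mul_one]
    have e : sign sgn s.next i = sgn (⟨s.next.1, i⟩ : γ.Arc) := dif_pos i.2
    simp only [F, e]
    refine if_congr ?_ rfl rfl
    exact ⟨fun h => ⟨i.2, h.1⟩, fun ⟨_, h⟩ => ⟨h, rfl, rfl, ccw_ne _ _ s.2⟩⟩
  have h2 : ∑ i, (if (⟨s.next.next.1, i⟩ : γ.Arc) ∈ R ∧ Arc.tet (⟨s.next.next.1, i⟩ : γ.Arc) = s.1.1 ∧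
      Arc.vert (⟨s.next.next.1, i⟩ : γ.Arc) = s.1.2.1 ∧
      Arc.corner (⟨s.next.next.1, i⟩ : γ.Arc) ≠ s.1.2.2 then
      (sgn (⟨s.next.next.1, i⟩ : γ.Arc) : ℤ) * Arc.enters (⟨s.next.next.1, i⟩ : γ.Arc) s.1.2.2 else 0) =
      ∑ k ∈ Finset.range (γ.num s.next.next), -F s.next.next k := by
    rw [← Fin.sum_univ_eq_sum_range]
    refine Finset.sum_congr rfl fun i _ => ?_
    rw [enters_nextNext s _ rfl rfl]
    have e : sign sgn s.next.next i = sgn (⟨s.next.next.1, i⟩ : γ.Arc) := dif_pos i.2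
    simp only [F, e]
    have h3 : s.next.next.1.2.2 ≠ s.1.2.2 := by
      have := ccw_ne _ _ (ne_ccw _ _ (ne_ccw _ _ s.2))
      rw [ccw_ccw_ccw _ _ s.2] at this
      exact this.symm
    rw [mul_neg_one, ← neg_zero, ← apply_ite Neg.neg, neg_zero]
    refine congrArg _ (if_congr ?_ rfl rfl)
    exact ⟨fun h => ⟨i.2, h.1⟩, fun ⟨_, h⟩ => ⟨h, rfl, rfl, h3⟩⟩
  rw [chain, Fintype.sum_sigma, ← Finset.sum_subset (Finset.subset_univ {s.next.1, s.next.next.1}),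
    Finset.sum_pair hne, h1, h2, pts, Finset.sum_range_add]
  · congr 1
    · refine Finset.sum_congr rfl fun k hk => ?_
      have hk' := Finset.mem_range.1 hk
      simp only [arcAt, crossing, if_pos hk', F]
    · rw [← Finset.sum_range_reflect]
      refine Finset.sum_congr rfl fun k hk => ?_
      have hk' := Finset.mem_range.1 hk
      have e1 : ¬ γ.num s.next + k < γ.num s.next := by omega
      have e2 : γ.num s.next.next - 1 - k = γ.pts s - 1 - (γ.num s.next + k) := by unfold pts; omega
      simp only [arcAt, crossing, if_neg e1, F, e2]
      split_ifs <;> simp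
  · rintro ⟨t, v, w⟩ - hc
    refine Finset.sum_eq_zero fun i _ => if_neg ?_
    rintro ⟨-, h3, h4, h5⟩
    have h6 := Arc.vert_ne_corner (⟨(t, v, w), i⟩ : γ.Arc)
    simp only [Arc.tet, Arc.vert, Arc.corner] at h3 h4 h5 h6
    subst h3 h4
    refine hc ?_
    rcases eq_ccw_or _ _ w s.2 h6 with rfl | rfl | rfl
    · exact absurd rfl h5
    · exact Finset.mem_insert_self _ _
    · exact Finset.mem_insert_of_mem (Finset.mem_singleton_self _)

end NormalCurve

namespace MultiCurve

open NormalCurve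

variable [Fintype τ] (ϖ : T.MultiCurve)

/-- A multi-curve as a normal curve on the triangulated boundary. -/
def toCurve : T.surface.Curve where
  n := ϖ.num
  sg := sign ϖ.sgn
  sg_eq := sign_eq ϖ.sgn
  m := ϖ.pts
  m_eq _ := rfl
  m_fl := ϖ.pts_flipSide
  cr := crossing ϖ.sgn
  cr_eq _ _ := rfl
  cr_fl s j h := by
    have h' : ϖ.pts s - 1 - j < ϖ.pts (T.flipSide s) := by rw [ϖ.pts_flipSide]; omega
    have := ϖ.coherent _ _ _ (joined_arcAt h h')
    have e1 := crossing_eq ϖ.sgn h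
    have e2 := crossing_eq ϖ.sgn h'
    rw [← e1] at this
    refine e2.trans ?_
    rw [this, neg_neg]
    congr 2
    rw [show (mkArc _ (ϖ.arcAt_lt h)).tet = s.1.1 from (arcAt_side s j).1]
    rfl
  arcAt := ϖ.arcAt
  arcAt_eq _ _ := rfl
  essential c k h := by
    classical
    rintro ⟨f, hf⟩
    refine ϖ.essential (mkArc (c, k) h) ⟨f, fun s => ?_⟩
    rw [chain_eq]
    refine Eq.trans (Finset.sum_congr rfl fun j hj => ?_) (hf s)
    have hj' := ϖ.arcAt_lt (Finset.mem_range.1 hj)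
    refine if_congr ?_ rfl rfl
    have := sameComponent_iff (mkArc (c, k) h) (mkArc _ hj')
    rw [data_mkArc, data_mkArc] at this
    exact Iff.trans ⟨fun ⟨_, h⟩ => h, fun h => ⟨hj', h⟩⟩ this

/-- The sum of the signs of the arcs at a corner. -/
def kappa (c : Corner τ) : ℤ := ϖ.toCurve.lev c 0

/-- The arcs meeting a side are those at its two ends, crossing in opposite senses. Hence the
1-cycle determines `kappa` up to a constant on every triangle; these constants are the rotation that
homology does not see. -/
theorem cycle_eq (s : Corner τ) : ϖ.cycle s.1 = ϖ.kappa s.next - ϖ.kappa s.next.next := by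
  classical
  rw [cycle, chain_eq]
  refine Eq.trans (Finset.sum_congr rfl fun j hj => ?_) (TriSurface.Curve.lev_sub_lev (γ := ϖ.toCurve) s).symm
  exact if_pos ⟨ϖ.arcAt_lt (Finset.mem_range.1 hj), Set.mem_univ _⟩

theorem kappa_eq (c : Corner τ) : ϖ.kappa c = ∑ i, (ϖ.sgn ⟨c.1, i⟩ : ℤ) := by
  rw [kappa, TriSurface.Curve.lev, ← Finset.range_eq_Ico, ← Fin.sum_univ_eq_sum_range]
  exact Finset.sum_congr rfl fun i _ => dif_pos i.2

end MultiCurve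

end FacePairing

/-! ## Harmonic functions on a cell decomposition -/

/-- A cell decomposition of a closed oriented surface. The pairs of a cell and one of its sides are
indexed by `O`; `rot` is the next side of the cell, `fl` the side of the neighbouring cell. -/
structure Cells (O Bk : Type*) where
  rot : O → O
  fl : O → O
  bk : O → Bk
  fl_fl : ∀ x, fl (fl x) = x
  bk_rot : ∀ x, bk (rot x) = bk x
  rot_trans : ∀ x y, bk x = bk y → ∃ n, rot^[n] x = y
  bk_surjective : Function.Surjective bk

namespace Cells

variable {O Bk : Type*} (Z : Cells O Bk)

/-- Vertices of a cell decomposition. -/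
def Vertex := Quot fun x y => y = Z.rot (Z.fl x)

/-- The initial vertex of a side. -/
def vertex (x : O) : Z.Vertex := Quot.mk _ x

theorem vertex_rot (x : O) : Z.vertex (Z.rot x) = Z.vertex (Z.fl x) := by
  refine (Quot.sound ?_).symm
  rw [Z.fl_fl]

instance [Finite O] : Finite Z.Vertex := Finite.of_surjective _ Quot.mk_surjective

theorem vertex_surjective : Function.Surjective Z.vertex := Quot.mk_surjective

theorem rot_bijective [Finite O] : Function.Bijective Z.rot := by
  refine Finite.injective_iff_bijective.1 (Finite.injective_iff_surjective.2 fun y => ?_)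
  obtain ⟨n, hn⟩ := Z.rot_trans (Z.rot y) y (Z.bk_rot y)
  exact ⟨Z.rot^[n] y, by rw [← Function.iterate_succ_apply' Z.rot, Function.iterate_succ_apply, hn]⟩

/-- Harmonic functions on the vertices of the cyclic cover given by the cocycle `k (rot x) - k x`. -/
def Harmonic [Fintype O] (k : O → ℤ) (a : Z.Vertex → ℝ) : Prop :=
  ∀ b : Z.Vertex → ℝ,
    ∑ x, (k (Z.rot x) + a (Z.vertex (Z.rot x)) - (k x + a (Z.vertex x))) * b (Z.vertex x) = 0

theorem Harmonic.neg [Fintype O] {k : O → ℤ} {a : Z.Vertex → ℝ} (h : Z.Harmonic k a) :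
    Z.Harmonic (-k) (-a) := by
  intro b
  rw [← neg_zero, ← h b, ← Finset.sum_neg_distrib]
  refine Finset.sum_congr rfl fun x _ => ?_
  simp only [Pi.neg_apply]
  push_cast
  ring

/-- The 1-cochain defined by `k` is projected orthogonally onto the coboundaries. The remainder is
orthogonal to all coboundaries; as it is antisymmetric under `fl`, this says that its divergence
vanishes at every vertex. -/
theorem exists_harmonic [Fintype O] (k : O → ℤ)
    (hk : ∀ x, k (Z.rot (Z.fl x)) - k (Z.fl x) = k x - k (Z.rot x)) : ∃ a, Z.Harmonic k a := by
  classical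
  let L : (Z.Vertex → ℝ) →ₗ[ℝ] EuclideanSpace ℝ O :=
    { toFun := fun a => WithLp.toLp 2 fun x => a (Z.vertex (Z.rot x)) - a (Z.vertex x)
      map_add' := fun a b => by ext x; simp; ring
      map_smul' := fun c a => by ext x; simp; ring }
  obtain ⟨y, ⟨a, rfl⟩, z, hz, h⟩ := Submodule.exists_add_mem_mem_orthogonal (K := LinearMap.range L)
    (WithLp.toLp 2 fun x => (k (Z.rot x) - k x : ℝ))
  have hz1 : ∀ x, z x = k (Z.rot x) - k x - (a (Z.vertex (Z.rot x)) - a (Z.vertex x)) := fun x => by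
    have := congrArg (fun w : EuclideanSpace ℝ O => w x) h
    simp only [PiLp.add_apply, L, LinearMap.coe_mk, AddHom.coe_mk] at this
    linarith
  have hz2 : ∀ x, z (Z.fl x) = -z x := fun x => by
    have h1 : ((k (Z.rot (Z.fl x)) - k (Z.fl x) : ℤ) : ℝ) = (k x - k (Z.rot x) : ℤ) := congrArg _ (hk x)
    push_cast at h1
    rw [hz1, hz1, Z.vertex_rot, Z.vertex_rot, Z.fl_fl]
    linarith
  refine ⟨-a, fun b => ?_⟩
  have h1 : ∑ x, z x * (b (Z.vertex (Z.rot x)) - b (Z.vertex x)) = 0 := by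
    have := (Submodule.mem_orthogonal _ _).1 hz (L b) ⟨b, rfl⟩
    simpa [L, PiLp.inner_apply, mul_comm] using this
  have h2 : ∑ x, z x * b (Z.vertex (Z.rot x)) = -∑ x, z x * b (Z.vertex x) := by
    rw [← Equiv.sum_comp (Function.Involutive.toPerm Z.fl Z.fl_fl), ← Finset.sum_neg_distrib]
    refine Finset.sum_congr rfl fun x _ => ?_
    rw [show (Function.Involutive.toPerm Z.fl Z.fl_fl) x = Z.fl x from rfl, Z.vertex_rot, Z.fl_fl, hz2]
    ring
  simp only [mul_sub, Finset.sum_sub_distrib] at h1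
  rw [h2] at h1
  have h3 : ∑ x, z x * b (Z.vertex x) = 0 := by linarith
  rw [← h3]
  refine Finset.sum_congr rfl fun x _ => ?_
  rw [hz1, Pi.neg_apply, Pi.neg_apply]
  ring

section

variable [Fintype O] (y : O → ℤ)

theorem exists_top (b : Bk) : ∃ x, Z.bk x = b ∧ ∀ x', Z.bk x' = b → y x' ≤ y x := by
  obtain ⟨x, hx⟩ := Z.bk_surjective b
  exact Set.exists_max_image {x | Z.bk x = b} y (Set.toFinite _) ⟨x, hx⟩

/-- The maximum of a function on the vertices of a cell. -/
noncomputable def top (b : Bk) : ℤ := y (Z.exists_top y b).choose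

theorem le_top (x : O) : y x ≤ Z.top y (Z.bk x) := (Z.exists_top y _).choose_spec.2 x rfl

theorem exists_eq_top (b : Bk) : ∃ x, Z.bk x = b ∧ y x = Z.top y b :=
  ⟨_, (Z.exists_top y b).choose_spec.1, rfl⟩

/-- The rise between two corners of a cell is at most the sum of all rises along its sides. The
strong induction removes repetitions from the walk, so that no side is used twice. -/
theorem sub_le_sum_posPart [DecidableEq Bk] (x : O) (n : ℕ) : y (Z.rot^[n] x) - y x ≤
    ∑ x' with Z.bk x' = Z.bk x, max (y (Z.rot x') - y x') 0 := by
  classical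
  have hbk : ∀ i, Z.bk (Z.rot^[i] x) = Z.bk x := fun i => by
    induction i with
    | zero => rfl
    | succ i ih => rw [Function.iterate_succ_apply', Z.bk_rot, ih]
  induction n using Nat.strong_induction_on with
  | _ n ih =>
  by_cases hinj : ∃ i j, i < j ∧ j ≤ n ∧ Z.rot^[i] x = Z.rot^[j] x
  · obtain ⟨i, j, h1, h2, h3⟩ := hinj
    have : Z.rot^[n] x = Z.rot^[n - j + i] x := by
      rw [Function.iterate_add_apply, h3, ← Function.iterate_add_apply]
      congr 2
      omega
    rw [this]
    exact ih _ (by omega)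
  · have h1 : ∑ i ∈ Finset.range n, (y (Z.rot^[i + 1] x) - y (Z.rot^[i] x)) = y (Z.rot^[n] x) - y x :=
      Finset.sum_range_sub (fun i => y (Z.rot^[i] x)) n
    have hi : Set.InjOn (fun i => Z.rot^[i] x) (Finset.range n : Set ℕ) := by
      intro i h2 j h3 h4
      have h2 := Finset.mem_range.1 h2
      have h3 := Finset.mem_range.1 h3
      by_contra hne
      rcases lt_or_gt_of_ne hne with h | h
      · exact hinj ⟨i, j, h, h3.le, h4⟩
      · exact hinj ⟨j, i, h, h2.le, h4.symm⟩
    rw [← h1]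
    calc _ ≤ ∑ i ∈ Finset.range n, max (y (Z.rot (Z.rot^[i] x)) - y (Z.rot^[i] x)) 0 :=
          Finset.sum_le_sum fun i _ => by rw [Function.iterate_succ_apply']; exact le_max_left _ _
      _ = ∑ x' ∈ (Finset.range n).image fun i => Z.rot^[i] x, max (y (Z.rot x') - y x') 0 :=
          (Finset.sum_image (f := fun x' => max (y (Z.rot x') - y x') 0) hi).symm
      _ ≤ _ := Finset.sum_le_sum_of_subset_of_nonneg (fun x' h => by
          obtain ⟨i, -, rfl⟩ := Finset.mem_image.1 h
          exact Finset.mem_filter.2 ⟨Finset.mem_univ _, hbk i⟩) fun _ _ _ => le_max_right _ _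

/-- The total variation around each cell is at least twice the oscillation. -/
theorem two_mul_sum_le [Fintype Bk] : 2 * ∑ b, (Z.top y b + Z.top (-y) b) ≤
    ∑ x, (max (y x) (y (Z.rot x)) + max (-y x) (-y (Z.rot x))) := by
  classical
  have h0 : ∑ x, y (Z.rot x) = ∑ x, y x := Z.rot_bijective.sum_comp y
  have h1 : ∀ x, max (y x) (y (Z.rot x)) + max (-y x) (-y (Z.rot x)) =
      2 * max (y (Z.rot x) - y x) 0 - (y (Z.rot x) - y x) := fun x => by omega
  rw [Finset.sum_congr rfl fun x _ => h1 x, Finset.sum_sub_distrib, Finset.sum_sub_distrib, h0, sub_self,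
    sub_zero, ← Finset.mul_sum, ← Finset.sum_fiberwise Finset.univ Z.bk]
  refine mul_le_mul_of_nonneg_left (Finset.sum_le_sum fun b _ => ?_) zero_le_two
  obtain ⟨p, rfl, h2⟩ := Z.exists_eq_top (-y) b
  obtain ⟨q, h3, h4⟩ := Z.exists_eq_top y (Z.bk p)
  obtain ⟨n, rfl⟩ := Z.rot_trans p q h3.symm
  refine le_trans (le_of_eq ?_) (Z.sub_le_sum_posPart y p n)
  rw [← h2, ← h4, Pi.neg_apply]
  ring

/-- The value of the total rotation number computed from heights `y` of the corners of the cells and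
`f` of the vertices. -/
noncomputable def rotation [Fintype Bk] [Fintype Z.Vertex] (f : Z.Vertex → ℤ) : ℤ :=
  2 * ∑ v, f v - ∑ x, max (y x) (y (Z.rot x)) + 2 * ∑ b, Z.top y b

/-- The vertex terms cancel, and what is left is the oscillation of the cells against their total
variation. This turns one-sided bounds for a curve and its reverse into equality. -/
theorem rotation_add_rotation_neg_le [Fintype Bk] [Fintype Z.Vertex] (f : Z.Vertex → ℤ) :
    Z.rotation y f + Z.rotation (-y) (-f) ≤ 0 := by
  have := Z.two_mul_sum_le y
  simp only [rotation, Pi.neg_apply, Finset.sum_neg_distrib]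
  rw [Finset.sum_add_distrib, Finset.sum_add_distrib] at this
  linarith

end

end Cells

/-! ### Rotation numbers computed on a coarser cell decomposition. -/

namespace TriSurface

variable {C A V O Bk : Type*} {S : TriSurface C A V}

/-- The reversed curve. -/
def Curve.neg (γ : S.Curve) : S.Curve where
  n := γ.n
  sg c k := -γ.sg c k
  sg_eq c k := by rcases γ.sg_eq c k with h | h <;> simp [h]
  m := γ.m
  m_eq := γ.m_eq
  m_fl := γ.m_fl
  cr s j := -γ.cr s j
  cr_eq s j := by rw [γ.cr_eq]; split_ifs <;> rfl
  cr_fl s j h := by rw [γ.cr_fl s j h]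
  arcAt := γ.arcAt
  arcAt_eq := γ.arcAt_eq
  essential c k h := by
    classical
    rintro ⟨f, hf⟩
    refine γ.essential c k h ⟨-f, fun s => ?_⟩
    have := hf s
    rw [Pi.neg_apply, Pi.neg_apply, neg_sub_neg, ← neg_sub, ← this, ← Finset.sum_neg_distrib]
    refine Finset.sum_congr rfl fun j _ => ?_
    split_ifs <;> simp

theorem Curve.lev_neg (γ : S.Curve) (c : C) (k : ℕ) : γ.neg.lev c k = -γ.lev c k :=
  Finset.sum_neg_distrib _

/-- The blocks of a triangulated surface are the cells of a cell decomposition. -/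
structure Frame (Z : Cells O Bk) (S : TriSurface C A V) [Fintype C] [Fintype A] [Fintype V] [Fintype Bk]
    extends S.Blocks Bk where
  o : O → C
  o_injective : Function.Injective o
  outer_o : ∀ x, outer (o x)
  exists_o : ∀ s, outer s → ∃ x, o x = s
  o_rot : ∀ x, outer (S.nx (o x)) → o (Z.rot x) = S.nx (o x)
  o_rot' : ∀ x, ¬ outer (S.nx (o x)) → o (Z.rot x) = S.nx (S.fl (S.nx (o x)))
  o_fl : ∀ x, o (Z.fl x) = S.fl (o x)
  bl_o : ∀ x, bl (S.tri (o x)) = Z.bk x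
  outer_nx_fl : ∀ s, ¬ outer s → old (S.lv (S.nx s)) → outer (S.nx (S.fl s))
  bn : V → Bk
  bl_eq_bn : ∀ c, ¬ old (S.lv c) → bl (S.tri c) = bn (S.lv c)
  weight : open Classical in ∀ F : Bk → ℤ, 2 * ∑ a, F (bl a) + 2 * ∑ v with ¬ old v, F (bn v) =
    ∑ s with ¬ outer s, F (bl (S.tri s)) + 2 * ∑ b, F b

namespace Frame

variable {Z : Cells O Bk} [Fintype C] [Fintype A] [Fintype V] [Fintype Bk] (F : Frame Z S)

theorem lv_rot (x : O) : S.lv (S.nx (F.o (Z.rot x))) = S.lv (S.nx (S.nx (F.o x))) := by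
  by_cases h : F.outer (S.nx (F.o x))
  · rw [F.o_rot x h]
  · rw [F.o_rot' x h, lv_fl']

/-- A vertex of the cell decomposition as a vertex of the triangulation. -/
def vtx : Z.Vertex → V := Quot.lift (fun x => S.lv (S.nx (F.o x))) (by
  rintro x y rfl
  rw [F.lv_rot, F.o_fl, lv_fl'])

theorem vtx_vertex (x : O) : F.vtx (Z.vertex x) = S.lv (S.nx (F.o x)) := rfl

theorem vtx_vertex_rot (x : O) : F.vtx (Z.vertex (Z.rot x)) = S.lv (S.nx (S.nx (F.o x))) := F.lv_rot x

/-- The side of the block that begins at a corner. -/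
theorem exists_start (c : C) (h : F.old (S.lv c)) : ∃ x, (F.outer (S.nx (S.nx c)) ∧ F.o x = S.nx (S.nx c)) ∨
    (¬ F.outer (S.nx (S.nx c)) ∧ F.o x = S.nx (S.fl (S.nx (S.nx c)))) := by
  by_cases h1 : F.outer (S.nx (S.nx c))
  · obtain ⟨x, hx⟩ := F.exists_o _ h1
    exact ⟨x, Or.inl ⟨h1, hx⟩⟩
  · obtain ⟨x, hx⟩ := F.exists_o _ (F.outer_nx_fl _ h1 (by rwa [S.nx_nx_nx]))
    exact ⟨x, Or.inr ⟨h1, hx⟩⟩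

/-- Walking around an old vertex of the triangulation, crossing an inner side stays in the same
block and does not change the starting side of the block; crossing an outer side is one step around
the vertex of the cell decomposition. -/
theorem vtx_injective : Function.Injective F.vtx := by
  intro p q h
  obtain ⟨x, rfl⟩ := Z.vertex_surjective p
  obtain ⟨y, rfl⟩ := Z.vertex_surjective q
  have key : ∀ c d, Relation.EqvGen (fun a b => ∃ s, a = S.nx s ∧ b = S.nx (S.nx (S.fl s))) c d →
      S.lv c = S.lv d ∧ (F.old (S.lv c) → ∀ x y,
        ((F.outer (S.nx (S.nx c)) ∧ F.o x = S.nx (S.nx c)) ∨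
          (¬ F.outer (S.nx (S.nx c)) ∧ F.o x = S.nx (S.fl (S.nx (S.nx c))))) →
        ((F.outer (S.nx (S.nx d)) ∧ F.o y = S.nx (S.nx d)) ∨
          (¬ F.outer (S.nx (S.nx d)) ∧ F.o y = S.nx (S.fl (S.nx (S.nx d))))) →
        Z.vertex x = Z.vertex y) := by
    intro c d h
    induction h with
    | rel c d h =>
      obtain ⟨s, rfl, rfl⟩ := h
      refine ⟨(S.lv_fl' s).symm, fun hold x y => ?_⟩
      simp only [S.nx_nx_nx]
      rintro (⟨h1, h2⟩ | ⟨h1, h2⟩) h3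
      · have h4 : F.o y = F.o (Z.rot (Z.fl x)) := by
          rcases h3 with ⟨h3, h4⟩ | ⟨h3, h4⟩
          · rw [F.o_rot, h4, F.o_fl, h2]
            rwa [F.o_fl, h2]
          · rw [F.o_rot', h4, F.o_fl, h2]
            rwa [F.o_fl, h2]
        rw [F.o_injective h4, Z.vertex_rot, Z.fl_fl]
      · have h5 := F.outer_nx_fl s h1 hold
        rcases h3 with ⟨h3, h4⟩ | ⟨h3, h4⟩
        · rw [F.o_injective (h2.trans h4.symm)]
        · exact absurd h5 h3
    | refl c =>
      refine ⟨rfl, fun _ x y h1 h2 => ?_⟩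
      rw [F.o_injective (a₁ := x) (a₂ := y)]
      rcases h1 with ⟨h1, h3⟩ | ⟨h1, h3⟩ <;> rcases h2 with ⟨h2, h4⟩ | ⟨h2, h4⟩
      · exact h3.trans h4.symm
      · exact absurd h1 h2
      · exact absurd h2 h1
      · exact h3.trans h4.symm
    | symm c d _ ih => exact ⟨ih.1.symm, fun hold x y h1 h2 => (ih.2 (ih.1 ▸ hold) y x h2 h1).symm⟩
    | trans a b c _ _ ih1 ih2 =>
      refine ⟨ih1.1.trans ih2.1, fun hold x y h1 h2 => ?_⟩
      obtain ⟨z, hz⟩ := F.exists_start b (ih1.1 ▸ hold)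
      exact (ih1.2 hold x z h1 hz).trans (ih2.2 (ih1.1 ▸ hold) z y hz h2)
  refine (key _ _ (S.lv_orbit _ _ h)).2 (F.old_nx _ (F.outer_o x)) x y ?_ ?_
  · rw [S.nx_nx_nx]; exact Or.inl ⟨F.outer_o x, rfl⟩
  · rw [S.nx_nx_nx]; exact Or.inl ⟨F.outer_o y, rfl⟩

theorem old_vtx (p : Z.Vertex) : F.old (F.vtx p) := by
  obtain ⟨x, rfl⟩ := Z.vertex_surjective p
  exact F.old_nx _ (F.outer_o x)

theorem exists_vtx {v : V} (h : F.old v) : ∃ p, F.vtx p = v := by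
  obtain ⟨s, hs, rfl⟩ := F.exists_outer v h
  obtain ⟨x, rfl⟩ := F.exists_o s hs
  exact ⟨Z.vertex x, rfl⟩

/-- Extension of a function on the vertices of the cell decomposition. -/
noncomputable def ext {X : Type*} (f : Z.Vertex → X) (d : V → X) : V → X := Function.extend F.vtx f d

theorem ext_vtx {X : Type*} (f : Z.Vertex → X) (d : V → X) (p : Z.Vertex) : F.ext f d (F.vtx p) = f p :=
  F.vtx_injective.extend_apply _ _ _

theorem ext_of_not {X : Type*} (f : Z.Vertex → X) (d : V → X) {v : V} (h : ¬ F.old v) : F.ext f d v = d v :=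
  Function.extend_apply' _ _ _ fun ⟨p, hp⟩ => h (hp ▸ F.old_vtx p)

variable {K : C → ℤ} {k : O → ℤ} (hKk : ∀ x, K (S.nx (F.o x)) = k x)
  (hK : ∀ s, ¬ F.outer s → K (S.nx s) = K (S.nx (S.nx (S.fl s))))
  (hnew : ∀ c, ¬ F.old (S.lv c) → K c = 0)

include hKk hK

theorem K_rot (x : O) : K (S.nx (S.nx (F.o x))) = k (Z.rot x) := by
  by_cases h : F.outer (S.nx (F.o x))
  · rw [← hKk, F.o_rot x h]
  · rw [← hKk, F.o_rot' x h, hK _ h]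

theorem exists_corner (c : C) (h : F.old (S.lv c)) :
    ∃ x, K c = k x ∧ S.lv c = F.vtx (Z.vertex x) ∧ F.bl (S.tri c) = Z.bk x := by
  obtain ⟨x, ⟨h1, h2⟩ | ⟨h1, h2⟩⟩ := F.exists_start c h
  · refine ⟨x, ?_, ?_, ?_⟩
    · rw [← hKk, h2, S.nx_nx_nx]
    · rw [F.vtx_vertex, h2, S.nx_nx_nx]
    · rw [← F.bl_o, h2, S.tri_nx, S.tri_nx]
  · refine ⟨x, ?_, ?_, ?_⟩
    · rw [← hKk, h2, ← hK _ h1, S.nx_nx_nx]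
    · rw [F.vtx_vertex, h2, lv_fl', S.nx_nx_nx]
    · rw [← F.bl_o, h2, S.tri_nx, F.bl_fl _ h1, S.tri_nx, S.tri_nx]

include hnew

/-- A harmonic function and an integral approximation of it define a potential. -/
noncomputable def potential [Fintype O] {a : Z.Vertex → ℝ} (ha : Z.Harmonic k a) (f : Z.Vertex → ℤ)
    (hf : ∀ p q, ∀ i j : ℤ, i + f p < 0 → 0 ≤ j + f q → i + a p < j + a q) : F.toBlocks.Potential K where
  val := F.ext a 0
  min_principle v hv h := by
    classical
    obtain ⟨p, rfl⟩ := F.exists_vtx hv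
    have h1 : ∀ x, Z.vertex x = p → k x + a p ≤ k (Z.rot x) + a (Z.vertex (Z.rot x)) := by
      rintro x rfl
      have := h (F.o x) (F.outer_o x) rfl
      rwa [hKk, F.K_rot hKk hK, F.ext_vtx, ← F.vtx_vertex_rot, F.ext_vtx] at this
    -- Harmonicity tested against the indicator of `p` is a vanishing sum of nonnegative terms.
    have h2 := ha fun q => if q = p then 1 else 0
    rw [Finset.sum_eq_zero_iff_of_nonneg] at h2
    · intro s hs hv
      obtain ⟨x, rfl⟩ := F.exists_o s hs
      have hp := F.vtx_injective (a₁ := Z.vertex x) hv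
      have := h2 x (Finset.mem_univ _)
      have hx : Z.vertex x = p := hp
      rw [if_pos hx, hx] at this
      rw [hKk, F.K_rot hKk hK, F.ext_vtx, ← F.vtx_vertex_rot, F.ext_vtx]
      linarith
    · intro x _
      split_ifs with hx
      · have := h1 x hx
        rw [hx]
        linarith
      · simp
  -- A vertex inside a block receives the maximum of the block; since `K` is zero there, both
  -- conditions comparing it with `M` hold with equality.
  g := F.ext f fun v => Z.top (fun x => k x + f (Z.vertex x)) (F.bn v)
  lt_of_neg v w hv hw i j hi hj := by
    obtain ⟨p, rfl⟩ := F.exists_vtx hv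
    obtain ⟨q, rfl⟩ := F.exists_vtx hw
    rw [F.ext_vtx] at *
    rw [F.ext_vtx]
    exact hf p q i j hi hj
  M := Z.top fun x => k x + f (Z.vertex x)
  le_M c := by
    by_cases h : F.old (S.lv c)
    · obtain ⟨x, h1, h2, h3⟩ := F.exists_corner hKk hK c h
      rw [h1, h2, h3, F.ext_vtx]
      exact Z.le_top (fun x => k x + f (Z.vertex x)) x
    · rw [F.ext_of_not _ _ h, hnew c h, F.bl_eq_bn c h, zero_add]
  exists_M a := by
    obtain ⟨x, h1, h2⟩ := Z.exists_eq_top (fun x => k x + f (Z.vertex x)) (F.bl a)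
    refine ⟨S.nx (F.o x), F.old_nx _ (F.outer_o x), ?_, ?_⟩
    · rw [S.tri_nx, F.bl_o, h1]
    · rw [← h2, hKk, ← F.vtx_vertex, F.ext_vtx]
  M_le c h := by
    rw [F.ext_of_not _ _ h, hnew c h, F.bl_eq_bn c h, zero_add]

/-- Triangles, interior vertices and inner sides of a block all carry the value `M`, and by `weight`
they contribute together as much as a single cell. So the bound depends only on the cell
decomposition. -/
theorem rotation_le [Fintype O] [Fintype Z.Vertex] {γ : S.Curve} {a : Z.Vertex → ℝ} (ha : Z.Harmonic k a)
    (f : Z.Vertex → ℤ) (hf : ∀ p q, ∀ i j : ℤ, i + f p < 0 → 0 ≤ j + f q → i + a p < j + a q)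
    {Q : Type*} (Qs : S.Components Q) {e : A → ℤ} {h : V → ℤ} (hlv : Function.Surjective S.lv)
    (hκ : ∀ c, γ.lev c 0 = K c + e (S.tri c) + h (S.lv c)) :
    ∑ a, e a + 2 * ∑ v, h v ≤ Z.rotation (fun x => k x + f (Z.vertex x)) f := by
  classical
  have h0 := Curve.rotation_le (F.potential hKk hK hnew ha f hf) Qs hlv hκ hK
  set P := F.potential hKk hK hnew ha f hf
  have hg : P.g = F.ext f fun v => P.M (F.bn v) := rfl
  have h1 : ∑ v, P.g v = ∑ p, f p + ∑ v with ¬ F.old v, P.M (F.bn v) := by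
    rw [← Finset.sum_filter_add_sum_filter_not _ F.old]
    congr 1
    · refine (Finset.sum_bij (fun p _ => F.vtx p) (fun p _ => ?_) (fun p _ q _ h => F.vtx_injective h)
        (fun v hv => ?_) fun p _ => ?_).symm
      · exact Finset.mem_filter.2 ⟨Finset.mem_univ _, F.old_vtx p⟩
      · obtain ⟨p, hp⟩ := F.exists_vtx (Finset.mem_filter.1 hv).2
        exact ⟨p, Finset.mem_univ _, hp⟩
      · rw [hg, F.ext_vtx]
    · exact Finset.sum_congr rfl fun v hv => by rw [hg, F.ext_of_not _ _ (Finset.mem_filter.1 hv).2]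
  have h2 : ∑ s, Curve.Gside P s = ∑ x, max (k x + f (Z.vertex x)) (k (Z.rot x) + f (Z.vertex (Z.rot x))) +
      ∑ s with ¬ F.outer s, P.M (F.bl (S.tri s)) := by
    rw [← Finset.sum_filter_add_sum_filter_not _ F.outer]
    congr 1
    · refine (Finset.sum_bij (fun x _ => F.o x) (fun x _ => ?_) (fun x _ y _ h => F.o_injective h)
        (fun s hs => ?_) fun x _ => ?_).symm
      · exact Finset.mem_filter.2 ⟨Finset.mem_univ _, F.outer_o x⟩
      · obtain ⟨x, hx⟩ := F.exists_o s (Finset.mem_filter.1 hs).2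
        exact ⟨x, Finset.mem_univ _, hx⟩
      · rw [Curve.Gside, if_pos (F.outer_o x), hKk, F.K_rot hKk hK, ← F.vtx_vertex, ← F.vtx_vertex_rot]
        simp only [P, potential, F.ext_vtx]
    · exact Finset.sum_congr rfl fun s hs => if_neg (Finset.mem_filter.1 hs).2
  have h3 := F.weight P.M
  rw [h1, h2] at h0
  have h4 : Z.rotation (fun x => k x + f (Z.vertex x)) f = 2 * ∑ p, f p -
    ∑ x, max (k x + f (Z.vertex x)) (k (Z.rot x) + f (Z.vertex (Z.rot x))) + 2 * ∑ b, P.M b := rfl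
  rw [h4]
  linarith

/-- The total rotation number of a curve only depends on its class in the cell decomposition. -/
theorem rotation_eq [Fintype O] [Fintype Z.Vertex] {γ : S.Curve} {a : Z.Vertex → ℝ} (ha : Z.Harmonic k a)
    {Q : Type*} (Qs : S.Components Q) {e : A → ℤ} {h : V → ℤ} (hlv : Function.Surjective S.lv)
    (hκ : ∀ c, γ.lev c 0 = K c + e (S.tri c) + h (S.lv c)) :
    ∑ a, e a + 2 * ∑ v, h v = Z.rotation (fun x => k x + ⌊a (Z.vertex x)⌋) (fun p => ⌊a p⌋) := by
  -- The same bound is applied to the reversed curve with `-a`, rounded up as `-⌊a⌋`. The two upper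
  -- bounds add up to at most zero by `rotation_add_rotation_neg_le`, so both are attained.
  refine le_antisymm (F.rotation_le hKk hK hnew ha (fun p => ⌊a p⌋) (fun p q i j hi hj => ?_) Qs hlv hκ) ?_
  · have h1 : (i : ℝ) + a p < 0 := by
      have := Int.floor_lt.1 (show ⌊a p⌋ < -i by omega)
      push_cast at this
      linarith
    have h2 : 0 ≤ (j : ℝ) + a q := by
      have := Int.le_floor.1 (show -j ≤ ⌊a q⌋ by omega)
      push_cast at this
      linarith
    linarith
  · have h1 := F.rotation_le (K := -K) (k := -k) (γ := γ.neg) (e := -e) (h := -h)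
      (fun x => by rw [Pi.neg_apply, hKk]; rfl) (fun s hs => by rw [Pi.neg_apply, hK s hs]; rfl)
      (fun c hc => by rw [Pi.neg_apply, hnew c hc]; rfl) ha.neg (fun p => -⌊a p⌋) (fun p q i j hi hj => ?_) Qs hlv
      (fun c => by rw [γ.lev_neg, hκ]; simp only [Pi.neg_apply]; ring)
    · have h2 := Z.rotation_add_rotation_neg_le (fun x => k x + ⌊a (Z.vertex x)⌋) (fun p => ⌊a p⌋)
      have h3 : Z.rotation (fun x => (-k) x + -⌊a (Z.vertex x)⌋) (fun p => -⌊a p⌋) =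
          Z.rotation (-fun x => k x + ⌊a (Z.vertex x)⌋) (-fun p => ⌊a p⌋) := by
        congr 1
        funext x
        simp only [Pi.neg_apply]
        ring
      rw [h3] at h1
      simp only [Pi.neg_apply, Finset.sum_neg_distrib] at h1
      linarith
    · have h1 : (i : ℝ) + 1 ≤ ⌊a p⌋ := by exact_mod_cast (by omega : i + 1 ≤ ⌊a p⌋)
      have h2 : (⌊a q⌋ : ℝ) ≤ j := by exact_mod_cast (by omega : ⌊a q⌋ ≤ j)
      have h3 := Int.floor_le (a p)
      have h4 := Int.lt_floor_add_one (a q)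
      simp only [Pi.neg_apply]
      linarith

end Frame

end TriSurface

/-! ## Replacing a part of a triangulation -/

section Emb

variable {ι τ : Type*} (e : ι → τ) (l : ι → Equiv.Perm (Fin 4))

/-- Relabelling of corners. -/
def Corner.emb (c : Corner ι) : Corner τ :=
  ⟨(e c.1.1, l c.1.1 c.1.2.1, l c.1.1 c.1.2.2), fun h => c.2 ((l _).injective h)⟩

/-- Relabelling of triangles. -/
def triEmb (a : ι × Fin 4) : τ × Fin 4 := (e a.1, l a.1 a.2)

variable {e l}

theorem Corner.emb_next (hl : ∀ i, Equiv.Perm.sign (l i) = 1) (c : Corner ι) :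
    (c.emb e l).next = c.next.emb e l := by
  obtain ⟨⟨t, v, w⟩, h⟩ := c
  simp only [Corner.emb, Corner.next, ccw_perm_even _ (hl t) v w h]

theorem triEmb_injective (he : Function.Injective e) : Function.Injective (triEmb e l) := by
  rintro ⟨t, v⟩ ⟨t', v'⟩ h
  simp only [triEmb, Prod.mk.injEq] at h
  obtain ⟨h1, h2⟩ := h
  obtain rfl := he h1
  rw [(l t).injective h2]

theorem Corner.emb_injective (he : Function.Injective e) : Function.Injective (Corner.emb e l) := by
  rintro ⟨⟨t, v, w⟩, h⟩ ⟨⟨t', v', w'⟩, h'⟩ h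
  simp only [Corner.emb, Subtype.mk.injEq, Prod.mk.injEq] at h
  obtain ⟨h1, h2, h3⟩ := h
  obtain rfl := he h1
  simp only [(l t).injective h2, (l t).injective h3]

/-- The triangle containing a corner. -/
def Corner.tri (c : Corner ι) : ι × Fin 4 := (c.1.1, c.1.2.1)

theorem Corner.exists_emb (t : τ) (i : ι) (h : e i = t) (v w : Fin 4) (hvw : v ≠ w) :
    ∃ c : Corner ι, (c.emb e l).1 = (t, v, w) ∧ c.1.1 = i := by
  subst h
  exact ⟨⟨(i, (l i).symm v, (l i).symm w), fun h => hvw ((l i).symm.injective h)⟩, by simp [Corner.emb], rfl⟩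

end Emb

/-- Sides of the boundary of a bipyramid: `(p, i, r)` lies in the face of the pole `0` (for
`p = false`) or `4` not containing the equatorial vertex number `i`; it is the `r`-th of the three
sides there, beginning at the pole. -/
abbrev BSide := Bool × Fin 3 × Fin 3

/-- The next side of the same truncated end of the bipyramid. -/
def BSide.rot : BSide → BSide
  | (false, i, 0) => (false, i + 1, 0)
  | (false, i, 1) => (false, i + 2, 2)
  | (false, i, 2) => (true, i, 2)
  | (true, i, 0) => (true, i + 2, 0)
  | (true, i, 1) => (false, i, 1)
  | (true, i, 2) => (true, i + 1, 1)

/-- Truncated ends of the bipyramid. -/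
abbrev BEnd := Bool ⊕ Fin 3

/-- The truncated end containing a side. -/
def BSide.bend : BSide → BEnd
  | (p, _, 0) => .inl p
  | (_, i, 1) => .inr (i + 1)
  | (_, i, 2) => .inr (i + 2)

theorem BSide.bend_rot : ∀ x : BSide, x.rot.bend = x.bend := by decide

theorem BSide.rot_trans : ∀ x y : BSide, x.bend = y.bend →
    x = y ∨ x.rot = y ∨ x.rot.rot = y ∨ x.rot.rot.rot = y := by decide

theorem BSide.bend_surjective : ∀ b : BEnd, ∃ x : BSide, x.bend = b := by decide

/-- A triangulation of the bipyramid without interior vertices: `β` indexes the tetrahedra, `I` the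
sides of boundary triangles in inner faces and `N` the ends of inner edges. -/
structure Patch (β I N : Type) [Fintype β] [DecidableEq β] [Fintype I] [Fintype N] where
  o : BSide → Corner β
  inn : I → Corner β
  fl : I → I
  new : Corner β → Prop
  bl : β × Fin 4 → BEnd
  nv : N → Corner β
  o_injective : Function.Injective o
  cases : ∀ c, (∃ x, o x = c) ∨ ∃ y, inn y = c
  o_ne_inn : ∀ x y, o x ≠ inn y
  inn_injective : Function.Injective inn
  bl_inn : ∀ y, bl (inn (fl y)).tri = bl (inn y).tri
  bl_o : ∀ x, bl (o x).tri = x.bend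
  adjacent : ∀ a b, bl a = bl b → a = b ∨ ∃ y, (inn y).tri = a ∧ (inn (fl y)).tri = b
  not_new_o : ∀ x, ¬ new (o x).next
  not_new_o' : ∀ x, ¬ new (o x).next.next
  new_inn : ∀ y, new (inn y).next ↔ new (inn (fl y)).next.next
  exists_start : ∀ c, ¬ new c → (∃ x, (o x).next = c) ∨
    ∃ y x, (inn y).next = c ∧ o x = (inn (fl y)).next
  old_or : ∀ c : Corner β, ¬ new c.next ∨ ¬ new c.next.next
  outer_or : ∀ c : Corner β, ¬ new c.next → ¬ new c.next.next →
    (∃ x, o x = c) ∨ (¬ new c ∧ (∃ x, o x = c.next) ∧ ∃ x, o x = c.next.next)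
  o_rot : ∀ x z, o z = (o x).next → o x.rot = (o x).next
  o_rot' : ∀ x y, inn y = (o x).next → o x.rot = (inn (fl y)).next
  outer_next_fl : ∀ y, ¬ new (inn y).next → ∃ x, o x = (inn (fl y)).next
  new_nv : ∀ n, new (nv n)
  bl_nv_injective : Function.Injective fun n => bl (nv n).tri
  -- Every truncated end of the bipyramid is a disc: triangles plus interior vertices minus inner
  -- edges is one, where `I` lists each inner edge twice.
  weight : ∀ F : BEnd → ℤ, 2 * ∑ a, F (bl a) + 2 * ∑ n, F (bl (nv n).tri) =
    ∑ y, F (bl (inn y).tri) + 2 * ∑ b, F b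

namespace Patch

/-- A side of the boundary of the tetrahedron with pole `0` or `4`. -/
def side₂ : BSide → Corner Bool
  | (false, i, 0) => ⟨(false, 0, i.succ), by revert i; decide⟩
  | (false, i, 1) => ⟨(false, (i + 1).succ, i.succ), by revert i; decide⟩
  | (false, i, 2) => ⟨(false, (i + 2).succ, i.succ), by revert i; decide⟩
  | (true, i, 0) => ⟨(true, 3, i.castSucc), by revert i; decide⟩
  | (true, i, 1) => ⟨(true, (i + 1).castSucc, i.castSucc), by revert i; decide⟩
  | (true, i, 2) => ⟨(true, (i + 2).castSucc, i.castSucc), by revert i; decide⟩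

/-- A side in the face separating the two tetrahedra. -/
def inner₂ : Bool × Fin 3 → Corner Bool
  | (false, i) => ⟨(false, i.succ, 0), by revert i; decide⟩
  | (true, i) => ⟨(true, i.castSucc, 3), by revert i; decide⟩

/-- The end of the bipyramid containing an end of one of the two tetrahedra. -/
def end₂ : Bool × Fin 4 → BEnd
  | (false, v) => ![.inl false, .inr 0, .inr 1, .inr 2] v
  | (true, v) => ![.inr 0, .inr 1, .inr 2, .inl true] v

set_option maxRecDepth 20000 in
set_option maxHeartbeats 1000000 in
/-- The bipyramid as the union of two tetrahedra. -/
def two : Patch Bool (Bool × Fin 3) Empty where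
  o := side₂
  inn := inner₂
  fl y := (!y.1, y.2)
  new _ := False
  bl := end₂
  nv := Empty.elim
  o_injective := by unfold Function.Injective; decide
  cases := by decide
  o_ne_inn := by decide
  inn_injective := by unfold Function.Injective; decide
  bl_inn := by decide
  bl_o := by decide
  adjacent := by decide
  not_new_o := by decide
  not_new_o' := by decide
  new_inn := by decide
  exists_start := by decide
  old_or := by decide
  outer_or := by decide
  o_rot := by decide
  o_rot' := by decide
  outer_next_fl := by decide
  new_nv := by decide
  bl_nv_injective := by unfold Function.Injective; decide
  weight F := by
    simp [Fintype.sum_prod_type, Fin.sum_univ_three, Fin.sum_univ_four, end₂, inner₂, Corner.tri]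
    ring

/-- A side of the boundary of one of the tetrahedra around the axis. -/
def side₃ : BSide → Corner (Fin 3)
  | (false, i, 0) => ⟨(i, 0, 3), by simp⟩
  | (false, i, 1) => ⟨(i, 1, 3), by simp⟩
  | (false, i, 2) => ⟨(i, 2, 3), by simp⟩
  | (true, i, 0) => ⟨(i, 3, 0), by simp⟩
  | (true, i, 1) => ⟨(i, 1, 0), by simp⟩
  | (true, i, 2) => ⟨(i, 2, 0), by simp⟩

/-- A side in a face containing the axis. -/
def inner₃ : Bool × Fin 3 × Fin 3 → Corner (Fin 3)
  | (false, i, 0) => ⟨(i, 0, 1), by simp⟩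
  | (false, i, 1) => ⟨(i, 2, 1), by simp⟩
  | (false, i, 2) => ⟨(i, 3, 1), by simp⟩
  | (true, i, 0) => ⟨(i, 0, 2), by simp⟩
  | (true, i, 1) => ⟨(i, 1, 2), by simp⟩
  | (true, i, 2) => ⟨(i, 3, 2), by simp⟩

/-- The gluing of the inner faces. -/
def flip₃ : Bool × Fin 3 × Fin 3 → Bool × Fin 3 × Fin 3
  | (false, i, r) => (true, i + 1, r)
  | (true, i, r) => (false, i + 2, r)

/-- The end of the bipyramid containing an end of one of the three tetrahedra. -/
def end₃ : Fin 3 × Fin 4 → BEnd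
  | (_, 0) => .inl false
  | (i, 1) => .inr (i + 1)
  | (i, 2) => .inr (i + 2)
  | (_, 3) => .inl true

/-- The ends of the axis. -/
def axis₃ : Bool → Corner (Fin 3)
  | false => ⟨(0, 0, 3), by simp⟩
  | true => ⟨(0, 3, 0), by simp⟩

set_option maxRecDepth 20000 in
set_option maxHeartbeats 1000000 in
/-- The bipyramid as the union of three tetrahedra. -/
def three : Patch (Fin 3) (Bool × Fin 3 × Fin 3) Bool where
  o := side₃
  inn := inner₃
  fl := flip₃
  new c := c.1.2 = (0, 3) ∨ c.1.2 = (3, 0)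
  bl := end₃
  nv := axis₃
  o_injective := by unfold Function.Injective; decide
  cases := by decide
  o_ne_inn := by decide
  inn_injective := by unfold Function.Injective; decide
  bl_inn := by decide
  bl_o := by decide
  adjacent := by decide
  not_new_o := by decide
  not_new_o' := by decide
  new_inn := by decide
  exists_start := by decide
  old_or := by decide
  outer_or := by decide
  o_rot := by decide
  o_rot' := by decide
  outer_next_fl := by decide
  new_nv := by decide
  bl_nv_injective := by unfold Function.Injective; decide
  weight F := by
    simp [Fintype.sum_prod_type, Fin.sum_univ_three, Fin.sum_univ_four, end₃, axis₃, inner₃, Corner.tri]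
    ring

end Patch

/-- The cell decomposition of the boundary given by the triangles outside a bipyramid and the
truncated ends of the bipyramid. -/
def bipyramidCells {R : Type*} (fl : Corner R ⊕ BSide → Corner R ⊕ BSide) (hfl : ∀ x, fl (fl x) = x) :
    Cells (Corner R ⊕ BSide) (R × Fin 4 ⊕ BEnd) where
  rot := Sum.map Corner.next BSide.rot
  fl := fl
  bk := Sum.map Corner.tri BSide.bend
  fl_fl := hfl
  bk_rot x := by
    rcases x with x | x
    · rfl
    · exact congrArg Sum.inr x.bend_rot
  rot_trans x y h := by
    rcases x with x | x <;> rcases y with y | y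
    · obtain ⟨⟨t, v, w⟩, hx⟩ := x
      obtain ⟨⟨t', v', w'⟩, hy⟩ := y
      simp only [Sum.map_inl, Sum.inl.injEq, Corner.tri, Prod.mk.injEq] at h
      obtain ⟨rfl, rfl⟩ := h
      rcases eq_ccw_or v w w' hx hy with rfl | rfl | rfl
      · exact ⟨0, rfl⟩
      · exact ⟨1, rfl⟩
      · exact ⟨2, rfl⟩
    · cases h
    · cases h
    · rcases BSide.rot_trans x y (Sum.inr_injective h) with h | h | h | h
      · exact ⟨0, congrArg Sum.inr h⟩
      · exact ⟨1, congrArg Sum.inr h⟩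
      · exact ⟨2, congrArg Sum.inr h⟩
      · exact ⟨3, congrArg Sum.inr h⟩
  bk_surjective b := by
    rcases b with ⟨t, v⟩ | b
    · obtain ⟨w, hw⟩ := exists_ne v
      exact ⟨.inl ⟨(t, v, w), hw.symm⟩, rfl⟩
    · obtain ⟨x, rfl⟩ := BSide.bend_surjective b
      exact ⟨.inr x, rfl⟩

/-! ### A triangulated bipyramid inside an ideal triangulation. -/

namespace Patch

variable {β I N : Type} [Fintype β] [DecidableEq β] [Fintype I] [Fintype N]

/-- An occurrence of a triangulated bipyramid in an ideal triangulation; the other tetrahedra are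
indexed by `R`. -/
structure Realization (P : Patch β I N) {τ R : Type*} (T : FacePairing τ)
    (fl : Corner R ⊕ BSide → Corner R ⊕ BSide) where
  e : R → τ
  l : R → Equiv.Perm (Fin 4)
  e' : β → τ
  l' : β → Equiv.Perm (Fin 4)
  even : ∀ i, Equiv.Perm.sign (l i) = 1
  even' : ∀ i, Equiv.Perm.sign (l' i) = 1
  bijective : Function.Bijective (Sum.elim e e')
  flip_o : ∀ x, T.flipSide (Sum.elim (Corner.emb e l) (fun x => (P.o x).emb e' l') x) =
    Sum.elim (Corner.emb e l) (fun x => (P.o x).emb e' l') (fl x)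
  flip_inn : ∀ y, T.flipSide ((P.inn y).emb e' l') = (P.inn (P.fl y)).emb e' l'
  exists_nv : ∀ c, P.new c → ∃ n, FacePairing.linkVertex (T := T) (c.emb e' l') =
    FacePairing.linkVertex ((P.nv n).emb e' l')

namespace Realization

variable {P : Patch β I N} {τ R : Type*} {T : FacePairing τ}
  {fl : Corner R ⊕ BSide → Corner R ⊕ BSide} (ρ : P.Realization T fl)

theorem e_injective : Function.Injective ρ.e := fun _ _ h =>
  Sum.inl_injective (ρ.bijective.1 (a₁ := .inl _) (a₂ := .inl _) h)

theorem e'_injective : Function.Injective ρ.e' := fun _ _ h =>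
  Sum.inr_injective (ρ.bijective.1 (a₁ := .inr _) (a₂ := .inr _) h)

theorem e_ne (r : R) (b : β) : ρ.e r ≠ ρ.e' b := fun h =>
  Sum.inl_ne_inr (ρ.bijective.1 (a₁ := .inl r) (a₂ := .inr b) h)

/-- A corner outside the bipyramid. -/
def outC (c : Corner R) : Corner τ := c.emb ρ.e ρ.l

/-- A corner in the bipyramid. -/
def inC (c : Corner β) : Corner τ := c.emb ρ.e' ρ.l'

/-- A side of the boundary of a block. -/
def o : Corner R ⊕ BSide → Corner τ := Sum.elim ρ.outC fun x => ρ.inC (P.o x)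

theorem next_outC (c : Corner R) : (ρ.outC c).next = ρ.outC c.next := Corner.emb_next ρ.even c

theorem next_inC (c : Corner β) : (ρ.inC c).next = ρ.inC c.next := Corner.emb_next ρ.even' c

theorem outC_injective : Function.Injective ρ.outC := Corner.emb_injective ρ.e_injective

theorem inC_injective : Function.Injective ρ.inC := Corner.emb_injective ρ.e'_injective

theorem outC_ne_inC (c : Corner R) (d : Corner β) : ρ.outC c ≠ ρ.inC d := fun h =>
  ρ.e_ne c.1.1 d.1.1 (congrArg (fun c => c.1.1) h)

theorem flip_outer (x : Corner R ⊕ BSide) : T.flipSide (ρ.o x) = ρ.o (fl x) := ρ.flip_o x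

theorem flip_inner (y : I) : T.flipSide (ρ.inC (P.inn y)) = ρ.inC (P.inn (P.fl y)) := ρ.flip_inn y

theorem cases (c : Corner τ) : (∃ d, ρ.outC d = c) ∨ ∃ d, ρ.inC d = c := by
  obtain ⟨⟨t, v, w⟩, h⟩ := c
  obtain ⟨r | b, hr⟩ := ρ.bijective.2 t
  · obtain ⟨d, hd, -⟩ := Corner.exists_emb (e := ρ.e) (l := ρ.l) t r hr v w h
    exact Or.inl ⟨d, Subtype.ext hd⟩
  · obtain ⟨d, hd, -⟩ := Corner.exists_emb (e := ρ.e') (l := ρ.l') t b hr v w h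
    exact Or.inr ⟨d, Subtype.ext hd⟩

theorem o_injective : Function.Injective ρ.o := by
  rintro (x | x) (y | y) h
  · rw [ρ.outC_injective h]
  · exact absurd h (ρ.outC_ne_inC _ _)
  · exact absurd h.symm (ρ.outC_ne_inC _ _)
  · rw [P.o_injective (ρ.inC_injective h)]

theorem o_ne (x : Corner R ⊕ BSide) (y : I) : ρ.o x ≠ ρ.inC (P.inn y) := by
  rcases x with x | x
  · exact ρ.outC_ne_inC _ _
  · exact fun h => P.o_ne_inn _ _ (ρ.inC_injective h)

theorem outer_or_inner (s : Corner τ) : (∃ x, ρ.o x = s) ∨ ∃ y, ρ.inC (P.inn y) = s := by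
  rcases ρ.cases s with ⟨d, rfl⟩ | ⟨d, rfl⟩
  · exact Or.inl ⟨.inl d, rfl⟩
  · rcases P.cases d with ⟨x, rfl⟩ | ⟨y, rfl⟩
    · exact Or.inl ⟨.inr x, rfl⟩
    · exact Or.inr ⟨y, rfl⟩

theorem not_outer_iff (s : Corner τ) : (¬ ∃ x, ρ.o x = s) ↔ ∃ y, ρ.inC (P.inn y) = s := by
  constructor
  · exact (ρ.outer_or_inner s).resolve_left
  · rintro ⟨y, rfl⟩ ⟨x, hx⟩
    exact ρ.o_ne x y hx

/-- The block containing a triangle. -/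
noncomputable def bl (a : τ × Fin 4) : R × Fin 4 ⊕ BEnd :=
  match (Equiv.ofBijective _ ρ.bijective).symm a.1 with
  | .inl r => .inl (r, (ρ.l r).symm a.2)
  | .inr b => .inr (P.bl (b, (ρ.l' b).symm a.2))

theorem bl_out (a : R × Fin 4) : ρ.bl (triEmb ρ.e ρ.l a) = .inl a := by
  have : (Equiv.ofBijective _ ρ.bijective).symm (ρ.e a.1) = .inl a.1 := by
    rw [Equiv.symm_apply_eq]; rfl
  simp only [bl, triEmb, this, Equiv.symm_apply_apply]

theorem bl_in (a : β × Fin 4) : ρ.bl (triEmb ρ.e' ρ.l' a) = .inr (P.bl a) := by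
  have : (Equiv.ofBijective _ ρ.bijective).symm (ρ.e' a.1) = .inr a.1 := by
    rw [Equiv.symm_apply_eq]; rfl
  simp only [bl, triEmb, this, Equiv.symm_apply_apply]

theorem bl_outC (c : Corner R) : ρ.bl (ρ.outC c).tri = .inl c.tri := ρ.bl_out c.tri

theorem bl_inC (c : Corner β) : ρ.bl (ρ.inC c).tri = .inr (P.bl c.tri) := ρ.bl_in c.tri

theorem bl_flip (y : I) : ρ.bl (T.flipSide (ρ.inC (P.inn y))).tri = ρ.bl (ρ.inC (P.inn y)).tri := by
  rw [ρ.flip_inner, ρ.bl_inC, ρ.bl_inC, P.bl_inn]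

theorem tri_bijective : Function.Bijective (Sum.elim (triEmb ρ.e ρ.l) (triEmb ρ.e' ρ.l')) := by
  constructor
  · rintro (a | a) (b | b) h
    · rw [triEmb_injective ρ.e_injective h]
    · exact absurd (congrArg Prod.fst h) (ρ.e_ne _ _)
    · exact absurd (congrArg Prod.fst h).symm (ρ.e_ne _ _)
    · rw [triEmb_injective ρ.e'_injective h]
  · rintro ⟨t, v⟩
    obtain ⟨r | b, rfl⟩ := ρ.bijective.2 t
    · exact ⟨.inl (r, (ρ.l r).symm v), by simp [triEmb]⟩
    · exact ⟨.inr (b, (ρ.l' b).symm v), by simp [triEmb]⟩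

/-- A corner at an interior vertex of a block. -/
def New (c : Corner τ) : Prop := ∃ d, P.new d ∧ ρ.inC d = c

theorem new_inC (d : Corner β) : ρ.New (ρ.inC d) ↔ P.new d :=
  ⟨fun ⟨_, h, h'⟩ => ρ.inC_injective h' ▸ h, fun h => ⟨d, h, rfl⟩⟩

theorem not_new_outC (d : Corner R) : ¬ ρ.New (ρ.outC d) := fun ⟨_, _, h⟩ => ρ.outC_ne_inC _ _ h.symm

theorem not_new_next_o (x : Corner R ⊕ BSide) : ¬ ρ.New (ρ.o x).next := by
  rcases x with x | x
  · exact ρ.next_outC x ▸ ρ.not_new_outC _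
  · exact fun h => P.not_new_o x ((ρ.new_inC _).1 (ρ.next_inC _ ▸ h))

theorem not_new_next_next_o (x : Corner R ⊕ BSide) : ¬ ρ.New (ρ.o x).next.next := by
  rcases x with x | x
  · have : (ρ.outC x).next.next = ρ.outC x.next.next := by rw [ρ.next_outC, ρ.next_outC]
    exact this ▸ ρ.not_new_outC _
  · have : (ρ.inC (P.o x)).next.next = ρ.inC (P.o x).next.next := by rw [ρ.next_inC, ρ.next_inC]
    exact fun h => P.not_new_o' x ((ρ.new_inC _).1 (this ▸ h))

/-- Corners at the same vertex are connected by crossing sides. At an outer side neither corner is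
interior, and an inner side has the same block on both sides. -/
theorem new_of_eq {c d : Corner τ} (h : (FacePairing.linkVertex c : T.LinkVertex) = FacePairing.linkVertex d) :
    (ρ.New c ↔ ρ.New d) ∧ (ρ.New c → ρ.bl c.tri = ρ.bl d.tri) := by
  have := T.surface.lv_orbit c d h
  clear h
  induction this with
  | rel c d h =>
    obtain ⟨s, rfl, rfl⟩ := h
    change (ρ.New s.next ↔ ρ.New (T.flipSide s).next.next) ∧
      (ρ.New s.next → ρ.bl s.tri = ρ.bl (T.flipSide s).tri)
    rcases ρ.outer_or_inner s with ⟨x, rfl⟩ | ⟨y, rfl⟩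
    · rw [ρ.flip_outer]
      exact ⟨iff_of_false (ρ.not_new_next_o x) (ρ.not_new_next_next_o _), fun h => absurd h (ρ.not_new_next_o x)⟩
    · refine ⟨?_, fun _ => (ρ.bl_flip y).symm⟩
      rw [ρ.flip_inner, ρ.next_inC, ρ.next_inC, ρ.next_inC, ρ.new_inC, ρ.new_inC]
      exact P.new_inn y
  | refl c => exact ⟨Iff.rfl, fun _ => rfl⟩
  | symm c d _ ih => exact ⟨ih.1.symm, fun h => (ih.2 (ih.1.2 h)).symm⟩
  | trans c d e _ _ ih1 ih2 =>
    exact ⟨ih1.1.trans ih2.1, fun h => (ih1.2 h).trans (ih2.2 (ih1.1.1 h))⟩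

/-- A vertex on the boundary of a block. -/
def Old (v : T.LinkVertex) : Prop := ∀ c, FacePairing.linkVertex c = v → ¬ ρ.New c

theorem not_old_iff (c : Corner τ) : ¬ ρ.Old (FacePairing.linkVertex c) ↔ ρ.New c := by
  constructor
  · intro h
    simp only [Old, not_forall, not_not] at h
    obtain ⟨d, h1, h2⟩ := h
    exact (ρ.new_of_eq h1).1.1 h2
  · exact fun h h' => h' c rfl h

theorem old_iff (c : Corner τ) : ρ.Old (FacePairing.linkVertex c) ↔ ¬ ρ.New c := by
  rw [← ρ.not_old_iff, not_not]

theorem old_inC (c : Corner β) : ρ.Old (FacePairing.linkVertex (ρ.inC c)) ↔ ¬ P.new c := by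
  rw [old_iff, new_inC]

theorem old_outC (c : Corner R) : ρ.Old (FacePairing.linkVertex (ρ.outC c)) :=
  (ρ.old_iff _).2 (ρ.not_new_outC _)

/-- A side of the boundary of a block. -/
def Outer (s : Corner τ) : Prop := ∃ x, ρ.o x = s

-- Outside the bipyramid every block is a single triangle without inner sides or interior vertices
-- and contributes equally to both sides; the rest is the count for the patch.
open Classical in
theorem weight_eq [Fintype τ] [Fintype R] [Fintype T.LinkVertex] (F : R × Fin 4 ⊕ BEnd → ℤ) :
    2 * ∑ a, F (ρ.bl a) + 2 * ∑ v with ¬ ρ.Old v, F (ρ.bl (Quot.out v).tri) =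
      ∑ s with ¬ ρ.Outer s, F (ρ.bl s.tri) + 2 * ∑ b, F b := by
  have h1 : ∑ a, F (ρ.bl a) = ∑ a, F (.inl a) + ∑ a, F (.inr (P.bl a)) := by
    rw [← ρ.tri_bijective.sum_comp, Fintype.sum_sum_type]
    simp only [Sum.elim_inl, Sum.elim_inr, ρ.bl_out, ρ.bl_in]
  have h2 : ∑ v with ¬ ρ.Old v, F (ρ.bl (Quot.out v).tri) = ∑ n, F (.inr (P.bl (P.nv n).tri)) := by
    have h3 : ∀ n, ρ.bl (Quot.out (FacePairing.linkVertex (ρ.inC (P.nv n)) : T.LinkVertex)).tri =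
        .inr (P.bl (P.nv n).tri) := fun n => by
      rw [← ρ.bl_inC]
      exact ((ρ.new_of_eq (Quot.out_eq (FacePairing.linkVertex (ρ.inC (P.nv n)) : T.LinkVertex)).symm).2
        ((ρ.new_inC _).2 (P.new_nv n))).symm
    refine (Finset.sum_bij (fun n _ => FacePairing.linkVertex (ρ.inC (P.nv n))) (fun n _ => ?_)
      (fun n _ n' _ h => ?_) (fun v hv => ?_) fun n _ => by rw [h3]).symm
    · exact Finset.mem_filter.2 ⟨Finset.mem_univ _, (ρ.not_old_iff _).2 ((ρ.new_inC _).2 (P.new_nv n))⟩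
    · have := h3 n
      rw [h, h3 n'] at this
      exact (P.bl_nv_injective (Sum.inr_injective this)).symm
    · obtain ⟨c, rfl⟩ := T.linkVertex_surjective v
      obtain ⟨d, hd, rfl⟩ := (ρ.not_old_iff c).1 (Finset.mem_filter.1 hv).2
      obtain ⟨n, hn⟩ := ρ.exists_nv d hd
      exact ⟨n, Finset.mem_univ _, hn.symm⟩
  have h4 : ∑ s with ¬ ρ.Outer s, F (ρ.bl s.tri) = ∑ y, F (.inr (P.bl (P.inn y).tri)) := by
    refine (Finset.sum_bij (fun y _ => ρ.inC (P.inn y)) (fun y _ => ?_)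
      (fun y _ y' _ h => P.inn_injective (ρ.inC_injective h)) (fun s hs => ?_) fun y _ => by rw [ρ.bl_inC]).symm
    · exact Finset.mem_filter.2 ⟨Finset.mem_univ _, (ρ.not_outer_iff _).2 ⟨y, rfl⟩⟩
    · obtain ⟨y, hy⟩ := (ρ.not_outer_iff s).1 (Finset.mem_filter.1 hs).2
      exact ⟨y, Finset.mem_univ _, hy⟩
  have h5 := P.weight fun b => F (.inr b)
  rw [h1, h2, h4, Fintype.sum_sum_type F]
  linarith

variable [Fintype τ] [Fintype R] [Fintype T.LinkVertex] (hfl : ∀ x, fl (fl x) = x)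

/-- The decomposition of the boundary triangulation into blocks. -/
noncomputable def frame : TriSurface.Frame (bipyramidCells fl hfl) T.surface where
  outer := ρ.Outer
  old := ρ.Old
  bl := ρ.bl
  outer_fl s := by
    constructor
    · rintro ⟨x, hx⟩
      refine ⟨fl x, ?_⟩
      rw [← ρ.flip_outer, hx]
      exact T.flipSide_flipSide s
    · rintro ⟨x, rfl⟩
      exact ⟨fl x, (ρ.flip_outer x).symm⟩
  bl_fl s hs := by
    obtain ⟨y, rfl⟩ := (ρ.not_outer_iff s).1 hs
    exact ρ.bl_flip y
  adjacent a b h := by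
    obtain ⟨a | a, rfl⟩ := ρ.tri_bijective.2 a <;> obtain ⟨b | b, rfl⟩ := ρ.tri_bijective.2 b
    · rw [Sum.elim_inl, Sum.elim_inl, ρ.bl_out, ρ.bl_out] at h
      rw [Sum.inl_injective h]
      exact Or.inl rfl
    · rw [Sum.elim_inl, Sum.elim_inr, ρ.bl_out, ρ.bl_in] at h
      cases h
    · rw [Sum.elim_inl, Sum.elim_inr, ρ.bl_out, ρ.bl_in] at h
      cases h
    · rw [Sum.elim_inr, Sum.elim_inr, ρ.bl_in, ρ.bl_in] at h
      rcases P.adjacent a b (Sum.inr_injective h) with rfl | ⟨y, rfl, rfl⟩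
      · exact Or.inl rfl
      · exact Or.inr ⟨ρ.inC (P.inn y), (ρ.not_outer_iff _).2 ⟨y, rfl⟩, rfl,
          congrArg Corner.tri (ρ.flip_inner y)⟩
  old_nx := by
    rintro _ ⟨x, rfl⟩
    exact (ρ.old_iff _).2 (ρ.not_new_next_o x)
  exists_outer v hv := by
    obtain ⟨c, rfl⟩ := T.linkVertex_surjective v
    have hv := (ρ.old_iff c).1 hv
    rcases ρ.cases c with ⟨d, rfl⟩ | ⟨d, rfl⟩
    · refine ⟨ρ.o (.inl d.next.next), ⟨_, rfl⟩, congrArg T.surface.lv ?_⟩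
      change (ρ.outC d.next.next).next = _
      rw [ρ.next_outC, Corner.next_next_next]
    · rcases P.exists_start d ((ρ.new_inC d).not.1 hv) with ⟨x, rfl⟩ | ⟨y, x, rfl, h⟩
      · exact ⟨ρ.o (.inr x), ⟨_, rfl⟩, congrArg T.surface.lv (ρ.next_inC _)⟩
      · refine ⟨ρ.o (.inr x), ⟨_, rfl⟩, ?_⟩
        have e : (ρ.inC (P.o x)).next = (T.flipSide (ρ.inC (P.inn y))).next.next := by
          rw [h, ρ.flip_inner, ρ.next_inC, ρ.next_inC, ρ.next_inC]
        exact (congrArg T.surface.lv e).trans ((T.surface.lv_fl' (ρ.inC (P.inn y))).trans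
          (congrArg T.surface.lv (ρ.next_inC _)))
  old_or s := by
    change ρ.Old (FacePairing.linkVertex s.next) ∨ ρ.Old (FacePairing.linkVertex s.next.next)
    rcases ρ.cases s with ⟨d, rfl⟩ | ⟨d, rfl⟩
    · rw [ρ.next_outC]
      exact Or.inl (ρ.old_outC _)
    · rw [ρ.next_inC, ρ.next_inC, ρ.old_inC, ρ.old_inC]
      exact P.old_or d
  outer_or c h1 h2 := by
    change ρ.Old (FacePairing.linkVertex c.next) at h1
    change ρ.Old (FacePairing.linkVertex c.next.next) at h2
    change (∃ x, ρ.o x = c) ∨ (ρ.Old (FacePairing.linkVertex c) ∧ (∃ x, ρ.o x = c.next) ∧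
      ∃ x, ρ.o x = c.next.next)
    rcases ρ.cases c with ⟨d, rfl⟩ | ⟨d, rfl⟩
    · exact Or.inl ⟨.inl d, rfl⟩
    · rw [ρ.next_inC, ρ.old_inC] at h1
      rw [ρ.next_inC, ρ.next_inC, ρ.old_inC] at h2
      rw [ρ.old_inC, ρ.next_inC, ρ.next_inC]
      rcases P.outer_or d h1 h2 with ⟨x, rfl⟩ | ⟨h3, ⟨x, h4⟩, ⟨x', h5⟩⟩
      · exact Or.inl ⟨.inr x, rfl⟩
      · exact Or.inr ⟨h3, ⟨.inr x, congrArg ρ.inC h4⟩, ⟨.inr x', congrArg ρ.inC h5⟩⟩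
  o := ρ.o
  o_injective := ρ.o_injective
  outer_o x := ⟨x, rfl⟩
  exists_o _ h := h
  o_rot x h := by
    change ∃ z, ρ.o z = (ρ.o x).next at h
    change _ = (ρ.o x).next
    rcases x with x | x
    · exact (ρ.next_outC x).symm
    · obtain ⟨z | z, hz⟩ := h
      · exact absurd (hz.trans (ρ.next_inC _)) (ρ.outC_ne_inC _ _)
      · exact (congrArg ρ.inC (P.o_rot x z (ρ.inC_injective (hz.trans (ρ.next_inC _))))).trans
          (ρ.next_inC _).symm
  o_rot' x h := by
    obtain ⟨y, hy⟩ := (ρ.not_outer_iff _).1 h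
    change ρ.inC (P.inn y) = (ρ.o x).next at hy
    change _ = (T.flipSide (ρ.o x).next).next
    rcases x with x | x
    · exact absurd (hy.trans (ρ.next_outC x)).symm (ρ.outC_ne_inC _ _)
    · rw [← hy, ρ.flip_inner, ρ.next_inC]
      exact congrArg ρ.inC (P.o_rot' x y (ρ.inC_injective (hy.trans (ρ.next_inC _))))
  o_fl x := (ρ.flip_outer x).symm
  bl_o x := by
    rcases x with x | x
    · exact ρ.bl_outC x
    · exact (ρ.bl_inC _).trans (congrArg Sum.inr (P.bl_o x))
  outer_nx_fl s hs h := by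
    obtain ⟨y, rfl⟩ := (ρ.not_outer_iff s).1 hs
    change ρ.Old (FacePairing.linkVertex (ρ.inC (P.inn y)).next) at h
    rw [ρ.next_inC, ρ.old_inC] at h
    obtain ⟨x, hx⟩ := P.outer_next_fl y h
    refine ⟨.inr x, ?_⟩
    change _ = (T.flipSide (ρ.inC (P.inn y))).next
    rw [ρ.flip_inner, ρ.next_inC, ← hx]
    rfl
  bn v := ρ.bl (Quot.out v).tri
  bl_eq_bn c hc := (ρ.new_of_eq (Quot.out_eq (FacePairing.linkVertex c : T.LinkVertex)).symm).2
    ((ρ.not_old_iff c).1 hc)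
  weight F := ρ.weight_eq F

end Realization

end Patch

/-! ### The two triangulations of the bipyramid in a 2–3 move. -/

namespace TwoThreeMove

variable {τ τ' : Type*} {T : FacePairing τ} {T' : FacePairing τ'} (m : TwoThreeMove T T')

/-- The tetrahedra outside the bipyramid. -/
abbrev Rest : Type _ := {t : τ // t ≠ m.north ∧ t ≠ m.south}

/-- The two tetrahedra of `T` in the bipyramid. -/
def two : Bool → τ
  | false => m.north
  | true => m.south

/-- The labels of the two tetrahedra of `T` in the bipyramid. -/
def twoLabel : Bool → Equiv.Perm (Fin 4)
  | false => m.northLabel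
  | true => m.southLabel

/-- The side of a boundary triangle of `T` with a given index. -/
def side : Corner m.Rest ⊕ BSide → Corner τ :=
  Sum.elim (Corner.emb Subtype.val fun _ => 1) fun x => (Patch.two.o x).emb m.two m.twoLabel

/-- The side of a boundary triangle of `T'` with a given index. -/
def side' : Corner m.Rest ⊕ BSide → Corner τ' :=
  Sum.elim (Corner.emb (fun t => (m.rest t).1) m.restLabel) fun x => (Patch.three.o x).emb m.mid m.midLabel

theorem corr_side (x : Corner m.Rest ⊕ BSide) : m.Corr (m.side x).1 (m.side' x).1 := by
  rcases x with ⟨⟨t, v, w⟩, h⟩ | ⟨p, i, r⟩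
  · exact .rest t v w h
  · match p, r with
    | false, 0 => exact .north_pole i
    | false, 1 => exact .north_one i
    | false, 2 => exact .north_two i
    | true, 0 => exact .south_pole i
    | true, 1 => exact .south_one i
    | true, 2 => exact .south_two i

theorem exists_side {s : τ × Fin 4 × Fin 4} {s' : τ' × Fin 4 × Fin 4} (h : m.Corr s s') :
    ∃ x, (m.side x).1 = s ∧ (m.side' x).1 = s' := by
  cases h with
  | rest t v f h => exact ⟨.inl ⟨(t, v, f), h⟩, rfl, rfl⟩
  | north_pole i => exact ⟨.inr (false, i, 0), rfl, rfl⟩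
  | north_one i => exact ⟨.inr (false, i, 1), rfl, rfl⟩
  | north_two i => exact ⟨.inr (false, i, 2), rfl, rfl⟩
  | south_pole i => exact ⟨.inr (true, i, 0), rfl, rfl⟩
  | south_one i => exact ⟨.inr (true, i, 1), rfl, rfl⟩
  | south_two i => exact ⟨.inr (true, i, 2), rfl, rfl⟩

theorem exists_flip (x : Corner m.Rest ⊕ BSide) :
    ∃ y, m.side y = T.flipSide (m.side x) ∧ m.side' y = T'.flipSide (m.side' x) := by
  obtain ⟨y, h1, h2⟩ := m.exists_side (m.outer _ _ (m.corr_side x))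
  exact ⟨y, Subtype.ext h1, Subtype.ext h2⟩

/-- The gluing of the sides of the boundary triangles outside the bipyramid. -/
noncomputable def fl (x : Corner m.Rest ⊕ BSide) : Corner m.Rest ⊕ BSide := (m.exists_flip x).choose

/-- The bipyramid in `T`. -/
noncomputable def realization : Patch.two.Realization T m.fl where
  e := Subtype.val
  l _ := 1
  e' := m.two
  l' := m.twoLabel
  even _ := map_one _
  even' b := by
    cases b
    · exact m.north_even
    · exact m.south_even
  bijective := by
    constructor
    · rintro (t | a) (t' | b) h
      · rw [Subtype.ext h]
      · cases b
        · exact absurd h t.2.1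
        · exact absurd h t.2.2
      · cases a
        · exact absurd h.symm t'.2.1
        · exact absurd h.symm t'.2.2
      · cases a <;> cases b
        · rfl
        · exact absurd h m.north_ne_south
        · exact absurd h.symm m.north_ne_south
        · rfl
    · intro t
      by_cases h1 : t = m.north
      · exact ⟨.inr false, h1.symm⟩
      · by_cases h2 : t = m.south
        · exact ⟨.inr true, h2.symm⟩
        · exact ⟨.inl ⟨t, h1, h2⟩, rfl⟩
  flip_o x := (m.exists_flip x).choose_spec.1.symm
  flip_inn := by
    have h : ∀ i, T.flipSide ((Patch.inner₂ (false, i)).emb m.two m.twoLabel) =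
      (Patch.inner₂ (true, i)).emb m.two m.twoLabel := fun i => Subtype.ext (m.shared i)
    rintro ⟨_ | _, i⟩
    · exact h i
    · change T.flipSide ((Patch.inner₂ (true, i)).emb m.two m.twoLabel) = _
      rw [← h, T.flipSide_flipSide]
      rfl
  exists_nv _ := False.elim

/-- The bipyramid in `T'`. -/
noncomputable def realization' : Patch.three.Realization T' m.fl where
  e t := (m.rest t).1
  l := m.restLabel
  e' := m.mid
  l' := m.midLabel
  even := m.rest_even
  even' := m.mid_even
  bijective := by
    constructor
    · rintro (t | a) (t' | b) h
      · rw [m.rest.injective (Subtype.ext h)]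
      · exact absurd h ((m.rest t).2 b)
      · exact absurd h.symm ((m.rest t').2 a)
      · rw [m.mid_injective h]
    · intro t
      by_cases h1 : ∃ i, t = m.mid i
      · obtain ⟨i, rfl⟩ := h1
        exact ⟨.inr i, rfl⟩
      · exact ⟨.inl (m.rest.symm ⟨t, not_exists.1 h1⟩), by simp⟩
  flip_o x := (m.exists_flip x).choose_spec.2.symm
  flip_inn := by
    have h : ∀ i r, T'.flipSide ((Patch.inner₃ (false, i, r)).emb m.mid m.midLabel) =
        (Patch.inner₃ (true, i + 1, r)).emb m.mid m.midLabel := by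
      intro i r
      match r with
      | 0 => exact Subtype.ext (m.inner_zero i)
      | 1 => exact Subtype.ext (m.inner_equator i)
      | 2 => exact Subtype.ext (m.inner_four i)
    rintro ⟨_ | _, i, r⟩
    · exact h i r
    · have := h (i + 2) r
      rw [add_assoc, show (2 + 1 : Fin 3) = 0 from rfl, add_zero] at this
      change T'.flipSide ((Patch.inner₃ (true, i, r)).emb m.mid m.midLabel) = _
      rw [← this, T'.flipSide_flipSide]
      rfl
  exists_nv := by
    -- The corners on the axis of consecutive tetrahedra are glued across the common inner face, so
    -- all three lie at one vertex for each pole.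
    have h0 : ∀ i, (FacePairing.linkVertex (Corner.emb m.mid m.midLabel ⟨(i + 1, 0, 3), by simp⟩) : T'.LinkVertex) =
        FacePairing.linkVertex (Corner.emb m.mid m.midLabel ⟨(i, 0, 3), by simp⟩) := fun i => by
      have h1 := T'.surface.lv_fl ((Patch.inner₃ (false, i, 0)).emb m.mid m.midLabel)
      have h2 : T'.flipSide ((Patch.inner₃ (false, i, 0)).emb m.mid m.midLabel) =
        (Patch.inner₃ (true, i + 1, 0)).emb m.mid m.midLabel := Subtype.ext (m.inner_zero i)
      change FacePairing.linkVertex (T'.flipSide _).next = FacePairing.linkVertex (Corner.next (Corner.next _)) at h1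
      rw [h2, Corner.emb_next m.mid_even, Corner.emb_next m.mid_even, Corner.emb_next m.mid_even] at h1
      exact h1
    have h3 : ∀ i, (FacePairing.linkVertex (Corner.emb m.mid m.midLabel ⟨(i + 1, 3, 0), by simp⟩) : T'.LinkVertex) =
        FacePairing.linkVertex (Corner.emb m.mid m.midLabel ⟨(i, 3, 0), by simp⟩) := fun i => by
      have h1 := T'.surface.lv_fl' ((Patch.inner₃ (false, i, 2)).emb m.mid m.midLabel)
      have h2 : T'.flipSide ((Patch.inner₃ (false, i, 2)).emb m.mid m.midLabel) =
        (Patch.inner₃ (true, i + 1, 2)).emb m.mid m.midLabel := Subtype.ext (m.inner_four i)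
      change FacePairing.linkVertex (Corner.next (Corner.next (T'.flipSide _))) = FacePairing.linkVertex (Corner.next _) at h1
      rw [h2, Corner.emb_next m.mid_even, Corner.emb_next m.mid_even, Corner.emb_next m.mid_even] at h1
      exact h1
    rintro ⟨⟨i, v, w⟩, hvw⟩ h
    simp only [Patch.three, Prod.mk.injEq] at h
    rcases h with ⟨rfl, rfl⟩ | ⟨rfl, rfl⟩
    · refine ⟨false, ?_⟩
      match i with
      | 0 => rfl
      | 1 => exact h0 0
      | 2 => exact (h0 1).trans (h0 0)
    · refine ⟨true, ?_⟩
      match i with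
      | 0 => rfl
      | 1 => exact h3 0
      | 2 => exact (h3 1).trans (h3 0)

theorem fl_fl (x : Corner m.Rest ⊕ BSide) : m.fl (m.fl x) = x :=
  m.realization.o_injective (by
    rw [← m.realization.flip_outer, ← m.realization.flip_outer, T.flipSide_flipSide])

/-- The cells of the boundary decomposition common to `T` and `T'`. -/
noncomputable abbrev cells : Cells (Corner m.Rest ⊕ BSide) (m.Rest × Fin 4 ⊕ BEnd) :=
  bipyramidCells m.fl m.fl_fl

end TwoThreeMove

/-! ### Extending functions from the sides of blocks when there are no interior vertices. -/

namespace TriSurface.Frame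

variable {C A V O Bk : Type*} {S : TriSurface C A V} {Z : Cells O Bk} [Fintype C] [Fintype A] [Fintype V]
  [Fintype Bk] (F : Frame Z S)

/-- Extension of a function from the sides of the blocks to all corners. -/
noncomputable def extK (hold : ∀ v, F.old v) (k : O → ℤ) (c : C) : ℤ := k (F.exists_start c (hold _)).choose

variable (hold : ∀ v, F.old v) (k : O → ℤ)

theorem extK_spec (c : C) : ∃ x, F.extK hold k c = k x ∧
    ((F.outer (S.nx (S.nx c)) ∧ F.o x = S.nx (S.nx c)) ∨
      (¬ F.outer (S.nx (S.nx c)) ∧ F.o x = S.nx (S.fl (S.nx (S.nx c))))) :=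
  ⟨_, rfl, (F.exists_start c (hold _)).choose_spec⟩

theorem extK_o (x : O) : F.extK hold k (S.nx (F.o x)) = k x := by
  obtain ⟨z, hz, h⟩ := F.extK_spec hold k (S.nx (F.o x))
  rw [S.nx_nx_nx] at h
  rw [hz]
  rcases h with ⟨-, h⟩ | ⟨h, -⟩
  · exact congrArg k (F.o_injective h)
  · exact absurd (F.outer_o x) h

theorem extK_inner (s : C) (hs : ¬ F.outer s) :
    F.extK hold k (S.nx s) = F.extK hold k (S.nx (S.nx (S.fl s))) := by
  obtain ⟨z, hz, h1⟩ := F.extK_spec hold k (S.nx s)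
  obtain ⟨z', hz', h2⟩ := F.extK_spec hold k (S.nx (S.nx (S.fl s)))
  rw [S.nx_nx_nx] at h1 h2
  rw [hz, hz']
  refine congrArg k (F.o_injective ?_)
  rcases h1 with ⟨h, -⟩ | ⟨-, h1⟩
  · exact absurd h hs
  · rcases h2 with ⟨-, h2⟩ | ⟨h, -⟩
    · exact h1.trans h2.symm
    · exact absurd (F.outer_nx_fl s hs (hold _)) h

include hold in
theorem outer_or' (c : C) : F.outer c ∨ (F.outer (S.nx c) ∧ F.outer (S.nx (S.nx c))) :=
  (F.outer_or c (hold _) (hold _)).imp_right And.right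

include hold in
/-- A function on the corners that agrees at both ends of each outer side is constant on triangles. -/
theorem eq_of_tri_eq {D : C → ℤ} (hD : ∀ x, D (S.nx (F.o x)) = D (S.nx (S.nx (F.o x)))) {c d : C}
    (h : S.tri c = S.tri d) : D c = D d := by
  have hD : ∀ s, F.outer s → D (S.nx s) = D (S.nx (S.nx s)) := fun s hs => by
    obtain ⟨x, rfl⟩ := F.exists_o s hs
    exact hD x
  have h1 : ∀ s, D (S.nx s) = D (S.nx (S.nx s)) := fun s => by
    rcases F.outer_or' hold s with hs | ⟨h1, h2⟩
    · exact hD s hs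
    · have e1 := hD _ h1
      have e2 := hD _ h2
      rw [S.nx_nx_nx] at e1 e2
      rw [e1, e2]
  have h2 : ∀ c, D c = D (S.nx c) := fun c => by
    have := h1 (S.nx (S.nx c))
    rwa [S.nx_nx_nx] at this
  rcases S.tri_eq c d h with rfl | rfl | rfl
  · rfl
  · exact h2 c
  · rw [← h2, ← h2]

end TriSurface.Frame

namespace FacePairing.MultiCurve

variable {τ : Type*} {T : FacePairing τ} [Fintype τ] (ϖ : T.MultiCurve)

theorem kappa_flip (s : Corner τ) : ϖ.kappa (T.flipSide s).next - ϖ.kappa s.next.next =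
    ϖ.kappa (T.flipSide s).next.next - ϖ.kappa s.next :=
  TriSurface.Curve.lev_fl (γ := ϖ.toCurve) s

end FacePairing.MultiCurve

namespace Patch.Realization

variable {β I N : Type} [Fintype β] [DecidableEq β] [Fintype I] [Fintype N] {P : Patch β I N}
  {τ R : Type*} {T : FacePairing τ} {fl : Corner R ⊕ BSide → Corner R ⊕ BSide} (ρ : P.Realization T fl)

/-- A function on the triangles, given outside and inside the bipyramid. -/
noncomputable def triFun {X : Type*} (f : R × Fin 4 → X) (g : β × Fin 4 → X) (a : τ × Fin 4) : X :=
  Sum.elim f g ((Equiv.ofBijective _ ρ.tri_bijective).symm a)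

theorem triFun_in {X : Type*} (f : R × Fin 4 → X) (g : β × Fin 4 → X) (c : Corner β) :
    ρ.triFun f g (ρ.inC c).tri = g c.tri := by
  have : (Equiv.ofBijective _ ρ.tri_bijective).symm (ρ.inC c).tri = .inr c.tri := by
    rw [Equiv.symm_apply_eq]; rfl
  rw [triFun, this, Sum.elim_inr]

end Patch.Realization

/-- The values subtracted from a function on the corners of the tetrahedra around the axis of a
bipyramid to make it compatible with the truncated ends of the bipyramid. -/
def axisShift (κ : Corner (Fin 3) → ℤ) : Fin 3 × Fin 4 → ℤ
  | (i, 0) => κ ⟨(i, 0, 3), by simp⟩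
  | (i, 1) => κ ⟨(i, 1, 0), by simp⟩ - κ ⟨(i + 2, 2, 0), by simp⟩
  | (_, 2) => 0
  | (i, 3) => κ ⟨(i, 3, 0), by simp⟩

theorem axisShift_new (κ : Corner (Fin 3) → ℤ) (c : Corner (Fin 3)) (h : Patch.three.new c) :
    κ c - axisShift κ c.tri = 0 := by
  obtain ⟨⟨i, v, w⟩, hc⟩ := c
  simp only [Patch.three, Prod.mk.injEq] at h
  rcases h with ⟨rfl, rfl⟩ | ⟨rfl, rfl⟩ <;> simp [axisShift, Corner.tri]

/-- At a pole the value on the axis is subtracted; at an equatorial end, only one of the two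
triangles is shifted so that the values match across the inner side. The flip relation in the
hypothesis makes the match at one end of an inner side equivalent to that at the other. -/
theorem axisShift_inn (κ : Corner (Fin 3) → ℤ)
    (h : ∀ y, κ (Patch.three.inn (Patch.three.fl y)).next - κ (Patch.three.inn y).next.next =
      κ (Patch.three.inn (Patch.three.fl y)).next.next - κ (Patch.three.inn y).next) (y) :
    κ (Patch.three.inn y).next - axisShift κ (Patch.three.inn y).tri =
      κ (Patch.three.inn (Patch.three.fl y)).next.next - axisShift κ (Patch.three.inn (Patch.three.fl y)).tri := by
  have h3 : ∀ i : Fin 3, i + 2 + 1 = i := by decide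
  have h3' : ∀ i : Fin 3, i + 1 + 2 = i := by decide
  obtain ⟨p, i, r⟩ := y
  have := h (p, i, r)
  match p, r with
  | false, 0 | false, 2 | true, 0 | true, 2 | false, 1 | true, 1 =>
    simp [Patch.three, Patch.inner₃, Patch.flip₃, Corner.next, Corner.tri, axisShift, ccw, h3, h3'] at this ⊢
    try omega

/-! ### Homologous curves have the same rotation number. -/

namespace TwoThreeMove

variable {τ τ' : Type*} [Fintype τ] [Fintype τ'] {T : IdealTriangulation τ} {T' : IdealTriangulation τ'}
  (m : TwoThreeMove T.toFacePairing T'.toFacePairing) {ϖ : T.MultiCurve} {ϖ' : T'.MultiCurve}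

/-- The turning numbers of two homologous curves, up to vertex and triangle terms, agree on the common
cell decomposition, and these terms have the same total. -/
theorem exists_rotation [Fintype T.LinkVertex] (hϖ : m.SameClass ϖ ϖ') :
    ∃ (K : Corner τ → ℤ) (e : τ × Fin 4 → ℤ) (h : T.LinkVertex → ℤ) (K' : Corner τ' → ℤ) (e' : τ' × Fin 4 → ℤ),
      (∀ c, ϖ.kappa c = K c + e c.tri + h (FacePairing.linkVertex c)) ∧
      (∀ c, ϖ'.kappa c = K' c + e' c.tri) ∧
      (∀ x, K (m.side x).next = K' (m.side' x).next ∧ K (m.side x).next.next = K' (m.side' x).next.next) ∧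
      (∀ c, Patch.three.new c → K' (m.realization'.inC c) = 0) ∧
      ∑ a, e a + 2 * ∑ v, h v = ∑ a, e' a := by
  classical
  let _ : Fintype T'.LinkVertex := Fintype.ofFinite _
  let _ : Fintype m.cells.Vertex := Fintype.ofFinite _
  let ρ' := m.realization'
  let F' := ρ'.frame m.fl_fl
  let F := m.realization.frame m.fl_fl
  obtain ⟨h, hh⟩ := hϖ
  -- Subtracting these constants inside the bipyramid makes the turning function of `ϖ'` a function
  -- on the common cells that vanishes at the axis.
  let e' := ρ'.triFun (fun _ => 0) (axisShift fun c => ϖ'.kappa (ρ'.inC c))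
  let K' (c : Corner τ') : ℤ := ϖ'.kappa c - e' c.tri
  let k (x : Corner m.Rest ⊕ BSide) : ℤ := K' (m.side' x).next
  have hK' : ∀ s, ¬ F'.outer s → K' s.next = K' (T'.flipSide s).next.next := fun s hs => by
    obtain ⟨y, rfl⟩ := (ρ'.not_outer_iff s).1 hs
    have h1 := axisShift_inn (fun c => ϖ'.kappa (ρ'.inC c)) (fun y => by
      have := ϖ'.kappa_flip (ρ'.inC (Patch.three.inn y))
      rwa [ρ'.flip_inner, ρ'.next_inC, ρ'.next_inC, ρ'.next_inC, ρ'.next_inC] at this) y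
    simp only [K', e']
    rw [ρ'.flip_inner, ρ'.next_inC, ρ'.next_inC, ρ'.next_inC, ρ'.triFun_in, ρ'.triFun_in]
    exact h1
  have hnew' : ∀ c, Patch.three.new c → K' (ρ'.inC c) = 0 := fun c hc => by
    simp only [K', e']
    rw [ρ'.triFun_in]
    exact axisShift_new (fun c => ϖ'.kappa (ρ'.inC c)) c hc
  have hrot' : ∀ x, K' (m.side' x).next.next = k (m.cells.rot x) := F'.K_rot (fun _ => rfl) hK'
  -- The values `k` define an antisymmetric cochain on the common cell decomposition, so a harmonic
  -- representative exists.
  have hcoc : ∀ x, k (m.cells.rot (m.cells.fl x)) - k (m.cells.fl x) = k x - k (m.cells.rot x) := fun x => by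
    have h1 := ϖ'.kappa_flip (m.side' x)
    rw [show T'.flipSide (m.side' x) = m.side' (m.fl x) from ρ'.flip_outer x] at h1
    rw [← hrot', ← hrot']
    simp only [k, K']
    have h2 : ∀ s : Corner τ', s.next.tri = s.tri := fun _ => rfl
    have h3 : m.cells.fl x = m.fl x := rfl
    simp only [h2, h3]
    omega
  obtain ⟨a, ha⟩ := m.cells.exists_harmonic k hcoc
  -- The two tetrahedra of `T` create no interior vertices, so `k` extends to all corners of `T`.
  have hold : ∀ v, F.old v := fun v c _ ⟨d, hd, _⟩ => hd
  let K := F.extK hold k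
  have hKk : ∀ x, K (m.side x).next = k x := F.extK_o hold k
  have hK := F.extK_inner hold k
  have hrot : ∀ x, K (m.side x).next.next = k (m.cells.rot x) := F.K_rot hKk hK
  -- The homology between the curves says that `D` agrees at the two ends of every outer side; hence
  -- it is constant on triangles and provides `e`.
  let D (c : Corner τ) : ℤ := ϖ.kappa c - K c - h (FacePairing.linkVertex c)
  have hD : ∀ c d : Corner τ, c.tri = d.tri → D c = D d := fun c d hcd => by
    refine F.eq_of_tri_eq hold (fun x => ?_) hcd
    change D (m.side x).next = D (m.side x).next.next
    have h1 := hh (m.side x) _ (m.corr_side x)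
    rw [ϖ.cycle_eq, ϖ'.cycle_eq, FacePairing.loops] at h1
    have h2 := hrot' x
    have h3 : K' (m.side' x).next = k x := rfl
    have h4 : ∀ s : Corner τ', s.next.tri = s.tri := fun _ => rfl
    simp only [K', h4] at h2 h3
    simp only [D, hKk, hrot]
    omega
  let e (b : τ × Fin 4) : ℤ := D (T.surface.tri_surjective b).choose
  have hκ : ∀ c, ϖ.kappa c = K c + e c.tri + h (FacePairing.linkVertex c) := fun c => by
    have h1 : e c.tri = D c := hD _ _ (T.surface.tri_surjective c.tri).choose_spec
    rw [h1]
    simp only [D]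
    ring
  have hκ' : ∀ c, ϖ'.kappa c = K' c + e' c.tri := fun c => (sub_add_cancel _ _).symm
  refine ⟨K, e, h, K', e', hκ, hκ', fun x => ⟨hKk x, (hrot x).trans (hrot' x).symm⟩, hnew', ?_⟩
  -- Both rotation numbers equal the one computed on the common cells from the same harmonic
  -- function `a`.
  have r1 := F.rotation_eq (γ := ϖ.toCurve) hKk hK (fun c hc => absurd (hold _) hc) ha T.components
    T.linkVertex_surjective hκ
  have r2 := F'.rotation_eq (γ := ϖ'.toCurve) (h := fun _ => 0) (fun _ => rfl) hK' (fun c hc => by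
      obtain ⟨d, hd, rfl⟩ := (ρ'.not_old_iff c).1 hc
      exact hnew' d hd) ha T'.components
    T'.linkVertex_surjective (fun c => (hκ' c).trans (add_zero _).symm)
  rw [Finset.sum_const_zero, mul_zero, add_zero] at r2
  exact r1.trans r2.symm

end TwoThreeMove

/-! ## The lattice sum -/

/-- The corner on the same edge at the other end. -/
def Corner.swap {τ : Type*} (c : Corner τ) : Corner τ := ⟨(c.1.1, c.1.2.2, c.1.2.1), c.2.symm⟩

/-- Sums over the pairs of opposite edges of a tetrahedron. -/
def quadSum {τ M : Type*} [Add M] (f : Corner τ → M) (t : τ) : Fin 3 → M :=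
  ![f ⟨(t, 0, 1), by simp⟩ + f ⟨(t, 2, 3), by simp⟩, f ⟨(t, 0, 2), by simp⟩ + f ⟨(t, 1, 3), by simp⟩,
    f ⟨(t, 0, 3), by simp⟩ + f ⟨(t, 1, 2), by simp⟩]

/-- The tetrahedron index as a function of three angle variables. -/
noncomputable def tetJ₃ (y : Fin 3 → ℤ) : LaurentSeries ℤ := tetJ (y 0) (y 1) (y 2)

theorem quadSum_add {τ : Type*} (f g : Corner τ → ℤ) (t : τ) :
    quadSum (fun c => f c + g c) t = quadSum f t + quadSum g t := by
  funext x
  fin_cases x <;> simp [quadSum] <;> ring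

theorem tetJ₃_add_const (y : Fin 3 → ℤ) (s : ℤ) :
    tetJ₃ (fun x => y x + s) = negSqrtQPow (-s) * tetJ₃ y := tetJ_add _ _ _ s

theorem tetJ₃_cyclic (y : Fin 3 → ℤ) (x : Fin 3) : tetJ (y (x + 2)) (y x) (y (x + 1)) = tetJ₃ y := by
  unfold tetJ₃
  fin_cases x
  · change tetJ (y 2) (y 0) (y 1) = _
    rw [tetJ_swap_left, tetJ_swap_right]
  · change tetJ (y 0) (y 1) (y 2) = _
    rfl
  · change tetJ (y 1) (y 2) (y 0) = _
    rw [tetJ_swap_right, tetJ_swap_left]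

theorem sum_quadType (F : Fin 4 → Fin 4 → ℤ) (x : Fin 3) :
    ∑ v, ∑ w with w ≠ v ∧ quadType v w = x, F v w =
      (![F 0 1 + F 1 0 + (F 2 3 + F 3 2), F 0 2 + F 2 0 + (F 1 3 + F 3 1),
        F 0 3 + F 3 0 + (F 1 2 + F 2 1)] : Fin 3 → ℤ) x := by
  simp only [Finset.sum_filter, Fin.sum_univ_four]
  fin_cases x <;> simp [quadType] <;> ring

namespace FacePairing

variable {τ : Type*} (T : FacePairing τ)

noncomputable instance [Finite τ] : Fintype T.Edge := Fintype.ofFinite _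

noncomputable instance [Finite τ] : Fintype T.LinkVertex := Fintype.ofFinite _

theorem MultiCurve.turn_eq [Fintype τ] (ϖ : T.MultiCurve) (t : τ) :
    ϖ.turn t = quadSum (fun c => ϖ.kappa c + ϖ.kappa c.swap) t := by
  funext x
  refine (sum_quadType (fun v w => ∑ i, (ϖ.sgn ⟨(t, v, w), i⟩ : ℤ)) x).trans ?_
  simp only [quadSum, ϖ.kappa_eq, Corner.swap]

/-- The coefficients of a combination of angle equations. -/
noncomputable def vec (u : T.Edge → ℤ) : τ → Fin 3 → ℤ := quadSum fun c => u (edge c)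

theorem sum_mul_edgeVec [Finite τ] (u : T.Edge → ℤ) (t : τ) (x : Fin 3) :
    ∑ E, u E * T.edgeVec E t x = T.vec u t x := by
  classical
  let _ : Fintype τ := Fintype.ofFinite _
  have h1 : ∀ E, (T.edgeVec E t x : ℤ) = ∑ c : Corner τ with c.1.1 = t ∧ c.1.2.1 < c.1.2.2 ∧
      quadType c.1.2.1 c.1.2.2 = x, if edge c = E then 1 else 0 := fun E => by
    rw [edgeVec, edgeCoeff, Nat.card_eq_fintype_card, Fintype.card_subtype, Finset.sum_boole,
      Finset.filter_filter]
    simp only [and_assoc]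
  have h2 : ∑ E, u E * T.edgeVec E t x = ∑ c : Corner τ with c.1.1 = t ∧ c.1.2.1 < c.1.2.2 ∧
      quadType c.1.2.1 c.1.2.2 = x, u (edge c) := by
    simp only [h1, Finset.mul_sum]
    rw [Finset.sum_comm]
    refine Finset.sum_congr rfl fun c _ => ?_
    simp
  have h3 : ∀ (v w v' w' : Fin 4) (h : v ≠ w) (h' : v' ≠ w') (f : Corner τ → ℤ), v ≠ v' →
      (∀ a b : Fin 4, a ≠ b → (a < b ∧ quadType a b = x ↔ (a = v ∧ b = w) ∨ (a = v' ∧ b = w'))) →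
      ∑ c : Corner τ with c.1.1 = t ∧ c.1.2.1 < c.1.2.2 ∧ quadType c.1.2.1 c.1.2.2 = x, f c =
        f ⟨(t, v, w), h⟩ + f ⟨(t, v', w'), h'⟩ := by
    intro v w v' w' h h' f hne H
    rw [← Finset.sum_pair (fun e => hne (congrArg (fun c => c.1.2.1) e))]
    refine Finset.sum_congr ?_ fun _ _ => rfl
    ext ⟨⟨t', a, b⟩, hab⟩
    simp only [Finset.mem_filter, Finset.mem_univ, true_and, H a b hab, Finset.mem_insert,
      Finset.mem_singleton, Subtype.mk.injEq, Prod.mk.injEq]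
    tauto
  rw [h2, vec]
  fin_cases x
  · exact h3 0 1 2 3 _ _ _ (by decide) (by decide)
  · exact h3 0 2 1 3 _ _ _ (by decide) (by decide)
  · exact h3 0 3 1 2 _ _ _ (by decide) (by decide)

theorem vec_add (u v : T.Edge → ℤ) (t : τ) (x : Fin 3) : T.vec (u + v) t x = T.vec u t x + T.vec v t x :=
  congrFun (quadSum_add (fun c => u (edge c)) (fun c => v (edge c)) t) x

theorem vec_neg (u : T.Edge → ℤ) (t : τ) (x : Fin 3) : T.vec (-u) t x = -T.vec u t x := by
  have h0 : T.vec 0 t x = 0 := by fin_cases x <;> rfl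
  have := T.vec_add u (-u) t x
  rw [add_neg_cancel, h0] at this
  omega

variable [Fintype τ]

/-- The coefficients of all angle variables in a term of the index. -/
noncomputable def coeffs (ϖ : T.MultiCurve) (u : T.Edge → ℤ) (t : τ) (x : Fin 3) : ℤ :=
  ϖ.turn t x + T.vec u t x

/-- The terms of the index, as functions of an integer for every edge. -/
noncomputable def term (ϖ : T.MultiCurve) (u : T.Edge → ℤ) : LaurentSeries ℤ :=
  sqrtQPow (2 * ∑ E, u E) * ∏ t, tetJ₃ (T.coeffs ϖ u t)

/-- Extension by zero of a function on a set of edges. -/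
noncomputable def extend (B : Finset T.Edge) (k : B → ℤ) (E : T.Edge) : ℤ :=
  open Classical in if h : E ∈ B then k ⟨E, h⟩ else 0

theorem sum_extend_mul (B : Finset T.Edge) (k : B → ℤ) (f : T.Edge → ℤ) :
    ∑ E, T.extend B k E * f E = ∑ E : B, k E * f E := by
  classical
  rw [← Finset.sum_subset (Finset.subset_univ B), ← Finset.sum_attach B]
  · refine Finset.sum_congr rfl fun E _ => ?_
    rw [extend, dif_pos E.2]
  · intro E _ h
    rw [extend, dif_neg h, zero_mul]

/-- Rewriting each tetrahedron index by J_Δ produces a power of `-q^{1/2}` given by the coefficient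
of the eliminated angle. These powers cancel the dependence of the constants ν on `Q`. -/
theorem indexTerm_eq (Q : τ → Fin 3) (B : Finset T.Edge) (ϖ : T.MultiCurve) (k : B → ℤ) :
    T.indexTerm Q B ϖ k = T.term ϖ (T.extend B k) := by
  have h1 : ∀ t x, ∑ E : B, k E * T.edgeVec E t x = T.vec (T.extend B k) t x := fun t x => by
    rw [← T.sum_mul_edgeVec, T.sum_extend_mul B k fun E => T.edgeVec E t x]
  have h2 : ∀ t, tetIndex (-(elimB Q ϖ.turn t) - ∑ E : B, k E * elimB Q (T.edgeVec E) t)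
      (elimA Q ϖ.turn t + ∑ E : B, k E * elimA Q (T.edgeVec E) t) =
      negSqrtQPow (T.coeffs ϖ (T.extend B k) t (Q t)) * tetJ₃ (T.coeffs ϖ (T.extend B k) t) := fun t => by
    rw [← tetJ₃_cyclic _ (Q t), ← tetIndex_eq_tetJ]
    simp only [elimA, elimB, mul_sub, Finset.sum_sub_distrib, h1, coeffs]
    congr 1 <;> ring
  have h3 : ∑ E : B, k E * T.nu Q E + ϖ.nu Q =
      2 * ∑ E, T.extend B k E - ∑ t, T.coeffs ϖ (T.extend B k) t (Q t) := by
    have h4 := T.sum_extend_mul B k fun _ => 1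
    simp only [mul_one] at h4
    simp only [nu, MultiCurve.nu, coeffs, ← h1, Finset.sum_add_distrib, mul_sub, Finset.sum_sub_distrib,
      Finset.mul_sum, h4]
    rw [Finset.sum_comm]
    simp only [mul_comm (k _) 2]
    ring
  rw [indexTerm, Finset.prod_congr rfl fun t _ => h2 t, Finset.prod_mul_distrib, ← negSqrtQPow_sum,
    ← mul_assoc, ← negSqrtQPow_add, h3, sub_add_cancel, negSqrtQPow_two_mul, term]

/-- The combinations of angle equations in which only the sums of the three angles of a tetrahedron
occur. -/
def IsFlat (u : T.Edge → ℤ) : Prop := ∀ t x, T.vec u t x = T.vec u t 0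

theorem IsFlat.add {u v : T.Edge → ℤ} (hu : T.IsFlat u) (hv : T.IsFlat v) : T.IsFlat (u + v) :=
  fun t x => by rw [vec_add, vec_add, hu, hv]

theorem IsFlat.neg {u : T.Edge → ℤ} (hu : T.IsFlat u) : T.IsFlat (-u) :=
  fun t x => by rw [vec_neg, vec_neg, hu]

theorem sum_smul_row (Q : τ → Fin 3) (u : T.Edge → ℤ) :
    ∑ E, u E • T.row Q E = fun t => (elimA Q (T.vec u) t, elimB Q (T.vec u) t) := by
  funext t
  rw [Finset.sum_apply]
  refine Prod.ext ?_ ?_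
  · rw [Prod.fst_sum]
    simp only [Pi.smul_apply, row, Prod.smul_fst, smul_eq_mul, elimA, mul_sub, Finset.sum_sub_distrib,
      sum_mul_edgeVec]
  · rw [Prod.snd_sum]
    simp only [Pi.smul_apply, row, Prod.smul_snd, smul_eq_mul, elimB, mul_sub, Finset.sum_sub_distrib,
      sum_mul_edgeVec]

theorem isFlat_iff (Q : τ → Fin 3) (u : T.Edge → ℤ) : T.IsFlat u ↔ ∑ E, u E • T.row Q E = 0 := by
  rw [sum_smul_row]
  constructor
  · intro h
    funext t
    simp only [elimA, elimB, h t (Q t), h t (Q t + 1), h t (Q t + 2), sub_self]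
    rfl
  · intro h t
    have h1 := congrFun h t
    simp only [Pi.zero_apply, Prod.mk_eq_zero, elimA, elimB] at h1
    have h2 : ∀ y x : Fin 3, x = y ∨ x = y + 1 ∨ x = y + 2 := by decide
    have h3 : ∀ x, T.vec u t x = T.vec u t (Q t) := fun x => by
      rcases h2 (Q t) x with rfl | rfl | rfl <;> omega
    intro x
    rw [h3, h3 0]

theorem sum_extend_smul {M : Type*} [AddCommGroup M] (B : Finset T.Edge) (k : B → ℤ) (f : T.Edge → M) :
    ∑ E, T.extend B k E • f E = ∑ E : B, k E • f E := by
  classical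
  rw [← Finset.sum_subset (Finset.subset_univ B), ← Finset.sum_attach B]
  · refine Finset.sum_congr rfl fun E _ => ?_
    rw [extend, dif_pos E.2]
  · intro E _ h
    rw [extend, dif_neg h, zero_smul]

variable {T}

/-- Flat vectors are the relations between the rows. With the next lemma, the vectors supported on a
basic set represent each class modulo flat vectors exactly once. -/
theorem IsBasic.eq_zero {Q : τ → Fin 3} {B : Finset T.Edge} (h : T.IsBasic Q B) {k : B → ℤ}
    (hk : T.IsFlat (T.extend B k)) : k = 0 := by
  rw [T.isFlat_iff Q, sum_extend_smul] at hk
  exact funext (Fintype.linearIndependent_iff.1 h.1 k hk)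

theorem IsBasic.exists {Q : τ → Fin 3} {B : Finset T.Edge} (h : T.IsBasic Q B) (u : T.Edge → ℤ) :
    ∃ k : B → ℤ, T.IsFlat (u - T.extend B k) := by
  have h1 : ∑ E, u E • T.row Q E ∈ Submodule.span ℤ (Set.range fun E : B => T.row Q E) := by
    have h2 : Set.range (fun E : B => T.row Q E) = T.row Q '' B := by
      ext; simp
    rw [h2, h.2]
    exact Submodule.sum_mem _ fun E _ => Submodule.smul_mem _ _ (Submodule.subset_span ⟨E, rfl⟩)
  obtain ⟨k, hk⟩ := (Submodule.mem_span_range_iff_exists_fun ℤ).1 h1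
  refine ⟨k, (T.isFlat_iff Q _).2 ?_⟩
  simp only [Pi.sub_apply, sub_smul, Finset.sum_sub_distrib, sum_extend_smul]
  rw [hk, sub_self]

theorem IsGeneralisedAngleStructure.sum_mul_vec {α : τ → Fin 3 → ℝ} (h : T.IsGeneralisedAngleStructure α)
    (u : T.Edge → ℤ) : ∑ t, ∑ x, α t x * T.vec u t x = 2 * Real.pi * ∑ E, (u E : ℝ) := by
  have h1 : ∀ t x, (T.vec u t x : ℝ) = ∑ E, (u E : ℝ) * T.edgeCoeff E t x := fun t x => by
    rw [← sum_mul_edgeVec]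
    simp [edgeVec]
  simp only [h1, Finset.mul_sum]
  rw [Finset.sum_congr rfl fun t _ => Finset.sum_comm, Finset.sum_comm]
  refine Finset.sum_congr rfl fun E _ => ?_
  rw [← h.edge E, Finset.sum_mul]
  refine Finset.sum_congr rfl fun t _ => ?_
  rw [Finset.sum_mul]
  exact Finset.sum_congr rfl fun x _ => by ring

/-- Pairing `u` with the angles in two ways: an edge contributes 2π, and a tetrahedron with equal
coefficients contributes π times the common coefficient. -/
theorem IsGeneralisedAngleStructure.two_mul_sum {α : τ → Fin 3 → ℝ} (h : T.IsGeneralisedAngleStructure α)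
    {u : T.Edge → ℤ} (hu : T.IsFlat u) : 2 * ∑ E, u E = ∑ t, T.vec u t 0 := by
  have h1 := h.sum_mul_vec u
  simp only [hu _ _, ← Finset.sum_mul, h.tet] at h1
  rw [← Finset.mul_sum] at h1
  have h2 : (2 * ∑ E, (u E : ℝ)) = ∑ t, (T.vec u t 0 : ℝ) :=
    mul_left_cancel₀ Real.pi_ne_zero (by rw [h1]; ring)
  exact_mod_cast h2

/-- A flat vector adds a constant to the three entries of each J_Δ. The resulting power of
`-q^{1/2}` is cancelled by the prefactor, by `two_mul_sum`. -/
theorem term_add_of_isFlat (hT : T.HasIndexStructure) (ϖ : T.MultiCurve) (u : T.Edge → ℤ) {v : T.Edge → ℤ}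
    (hv : T.IsFlat v) : T.term ϖ (u + v) = T.term ϖ u := by
  obtain ⟨α, h, -⟩ := hT fun _ => 0
  have h1 : ∀ t, tetJ₃ (T.coeffs ϖ (u + v) t) = negSqrtQPow (-T.vec v t 0) * tetJ₃ (T.coeffs ϖ u t) :=
    fun t => by
      rw [← tetJ₃_add_const]
      congr 1
      funext x
      rw [coeffs, vec_add, hv t x, coeffs, add_assoc]
  simp only [term, h1, Pi.add_apply, Finset.sum_add_distrib, Finset.prod_mul_distrib]
  rw [← negSqrtQPow_sum, Finset.sum_neg_distrib, ← h.two_mul_sum hv, mul_add, sqrtQPow_add,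
    ← negSqrtQPow_two_mul (∑ E, v E), ← mul_assoc, mul_assoc (sqrtQPow _), ← negSqrtQPow_add, add_neg_cancel,
    negSqrtQPow_zero, mul_one]

end FacePairing

/-! ### Degree bounds from angle structures, and convergence. -/

theorem mul_add_mul_ge {p M b A : ℝ} (h0 : 0 ≤ p) (h1 : p ≤ M) (h2 : -A ≤ b) : -A ^ 2 ≤ b * p + p * M := by
  nlinarith [mul_nonneg h0 (sub_nonneg.2 h1), mul_nonneg h0 (show 0 ≤ b + A by linarith),
    sq_nonneg (p - A), sq_nonneg (p + A), sq_nonneg p]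

/-- The lower bound for the degree of the tetrahedron index in the presence of an angle structure. -/
theorem degJ_ge (β : Fin 3 → ℝ) (hβ : ∑ x, β x = 1) (i : Fin 3) (hi : 0 ≤ β i) (y : Fin 3 → ℤ)
    (hy : ∀ x, y x ≤ y i) (j : Fin 3) :
    β i * (y i - y j) - (|β 0| + |β 1| + |β 2|) ^ 2 ≤ ∑ x, β x * y x + degJ (y 0) (y 1) (y 2) := by
  set s := min (y 0) (min (y 1) (y 2)) with hs
  set A := |β 0| + |β 1| + |β 2|
  have hb : ∀ x, -A ≤ β x := fun x => by
    have h0 := abs_nonneg (β 0)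
    have h1 := abs_nonneg (β 1)
    have h2 := abs_nonneg (β 2)
    have h3 := neg_abs_le (β x)
    fin_cases x <;> simp only [A] <;> simp at h3 ⊢ <;> linarith
  have hsy : ∀ x, s ≤ y x := fun x => by fin_cases x <;> simp <;> omega
  have hsx : ∃ x, s = y x := by
    rcases min_choice (y 0) (min (y 1) (y 2)) with h | h
    · exact ⟨0, h⟩
    · rcases min_choice (y 1) (y 2) with h' | h'
      · exact ⟨1, h.trans h'⟩
      · exact ⟨2, h.trans h'⟩
  -- As the angles sum to one, the linear part and the degree change oppositely under translation,
  -- so the minimum of `y` may be moved to zero.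
  have hD : (∑ x, β x * y x + degJ (y 0) (y 1) (y 2) : ℝ) = ∑ x, β x * (y x - s) +
      ((y 0 - s) * (y 1 - s) + (y 1 - s) * (y 2 - s) + (y 2 - s) * (y 0 - s)) := by
    simp only [degJ, ← hs]
    rw [Fin.sum_univ_three] at hβ ⊢
    rw [Fin.sum_univ_three]
    push_cast
    linear_combination s * hβ
  have hle : β i * (y i - y j) ≤ β i * (y i - s) := by
    have : (s : ℝ) ≤ y j := by exact_mod_cast hsy j
    exact mul_le_mul_of_nonneg_left (by linarith) hi
  rw [hD]
  set z : Fin 3 → ℝ := fun x => y x - s with hz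
  have hz0 : ∀ x, 0 ≤ z x := fun x => by
    have : (s : ℝ) ≤ y x := by exact_mod_cast hsy x
    simp only [hz]; linarith
  have hzi : ∀ x, z x ≤ z i := fun x => by
    have : (y x : ℝ) ≤ y i := by exact_mod_cast hy x
    simp only [hz]; linarith
  obtain ⟨k, hk⟩ := hsx
  have hzk : z k = 0 := by simp only [hz, hk, sub_self]
  have key : β i * z i - A ^ 2 ≤ ∑ x, β x * z x + (z 0 * z 1 + z 1 * z 2 + z 2 * z 0) := by
    have hA := sq_nonneg A
    -- A possibly negative angle is absorbed by the product with the largest entry, up to a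
    -- constant. One entry being zero, at most one such product is needed.
    have m : ∀ x, -A ^ 2 ≤ β x * z x + z x * z i := fun x => mul_add_mul_ge (hz0 x) (hzi x) (hb x)
    have m0 := m 0
    have m1 := m 1
    have m2 := m 2
    have e0 := hz0 0
    have e1 := hz0 1
    have e2 := hz0 2
    have f0 := hzi 0
    have f1 := hzi 1
    have f2 := hzi 2
    rw [Fin.sum_univ_three]
    clear_value z
    have c : ∀ x : Fin 3, x = 0 ∨ x = 1 ∨ x = 2 := by decide
    rcases c i with rfl | rfl | rfl <;> rcases c k with rfl | rfl | rfl <;>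
      first
      | (have g0 : z 0 = 0 := by linarith
         have g1 : z 1 = 0 := by linarith
         have g2 : z 2 = 0 := by linarith
         rw [g0, g1, g2]
         linarith)
      | (rw [hzk]
         linarith)
  exact (sub_le_sub_right hle _).trans key

namespace FacePairing

variable {τ : Type*} [Fintype τ] {T : FacePairing τ}

theorem coeff_term_eq_zero (ϖ : T.MultiCurve) (u : T.Edge → ℤ) {d : ℤ}
    (hd : d < 2 * ∑ E, u E + ∑ t, degJ (T.coeffs ϖ u t 0) (T.coeffs ϖ u t 1) (T.coeffs ϖ u t 2)) :
    (T.term ϖ u).coeff d = 0 := by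
  rw [term, coeff_sqrtQPow_mul]
  exact coeff_prod_eq_zero_of_lt _ _ _ (fun t d h => coeff_tetJ_eq_zero _ _ _ _ h) _ (by linarith)

/-- The angle structure expresses 2∑u through the coefficients up to a constant, so the degree of
the term is a sum over tetrahedra to which `degJ_ge` applies. Where the largest coefficients sit at
types of positive angle, each spread is bounded by the degree. -/
theorem exists_bound_of_argmax (ϖ : T.MultiCurve) {Q : τ → Fin 3} {α : τ → Fin 3 → ℝ}
    (hα : T.IsGeneralisedAngleStructure α) (hQ : ∀ t, 0 < α t (Q t)) (d : ℤ) :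
    ∃ N : ℤ, 0 ≤ N ∧ ∀ u, (∀ t x, T.coeffs ϖ u t x ≤ T.coeffs ϖ u t (Q t)) →
      (∃ e ≤ d, (T.term ϖ u).coeff e ≠ 0) →
      ∀ t x, T.coeffs ϖ u t (Q t) - T.coeffs ϖ u t x ≤ N := by
  have hπ := Real.pi_pos
  let β (t : τ) (x : Fin 3) : ℝ := α t x / Real.pi
  have hβ : ∀ t, ∑ x, β t x = 1 := fun t => by
    simp only [β]
    rw [← Finset.sum_div, hα.tet, div_self hπ.ne']
  have hβQ : ∀ t, 0 < β t (Q t) := fun t => div_pos (hQ t) hπ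
  let c : ℝ := ∑ t, ∑ x, β t x * ϖ.turn t x
  let A (t : τ) : ℝ := (|β t 0| + |β t 1| + |β t 2|) ^ 2
  let S : ℝ := d + c + ∑ t, A t
  obtain ⟨N, hN⟩ := exists_int_gt (∑ t, |S| / β t (Q t))
  have hpos : ∀ t, 0 ≤ |S| / β t (Q t) := fun t => div_nonneg (abs_nonneg _) (hβQ t).le
  refine ⟨N, ?_, fun u hu ⟨e, hed, he⟩ t x => ?_⟩
  · have := (Finset.sum_nonneg fun t _ => hpos t).trans hN.le
    exact_mod_cast this
  have h1 : 2 * ∑ E, u E + ∑ t, degJ (T.coeffs ϖ u t 0) (T.coeffs ϖ u t 1) (T.coeffs ϖ u t 2) ≤ d := by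
    by_contra h
    exact he (coeff_term_eq_zero ϖ u (by omega))
  have h2 : (2 * ∑ E, (u E : ℝ)) = ∑ t, ∑ x, β t x * T.coeffs ϖ u t x - c := by
    have h3 : ∑ t, ∑ x, β t x * (T.vec u t x : ℝ) = 2 * ∑ E, (u E : ℝ) := by
      have h4 : ∑ t, ∑ x, β t x * (T.vec u t x : ℝ) = (∑ t, ∑ x, α t x * T.vec u t x) / Real.pi := by
        rw [Finset.sum_div]
        refine Finset.sum_congr rfl fun t _ => ?_
        rw [Finset.sum_div]
        exact Finset.sum_congr rfl fun x _ => by simp only [β]; ring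
      rw [h4, hα.sum_mul_vec]
      field_simp
    rw [← h3]
    simp only [c, coeffs, ← Finset.sum_sub_distrib]
    refine Finset.sum_congr rfl fun t _ => Finset.sum_congr rfl fun x _ => ?_
    push_cast
    ring
  have h3 : ∑ t', (∑ x, β t' x * (T.coeffs ϖ u t' x : ℝ) +
      degJ (T.coeffs ϖ u t' 0) (T.coeffs ϖ u t' 1) (T.coeffs ϖ u t' 2)) ≤ d + c := by
    have h4 : ((2 * ∑ E, u E + ∑ t, degJ (T.coeffs ϖ u t 0) (T.coeffs ϖ u t 1) (T.coeffs ϖ u t 2) : ℤ) : ℝ) ≤ d := by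
      exact_mod_cast h1
    push_cast at h4
    rw [Finset.sum_add_distrib]
    linarith
  have h4 : ∀ t', 0 ≤ ∑ x, β t' x * (T.coeffs ϖ u t' x : ℝ) +
      degJ (T.coeffs ϖ u t' 0) (T.coeffs ϖ u t' 1) (T.coeffs ϖ u t' 2) + A t' := fun t' => by
    have := degJ_ge (β t') (hβ t') (Q t') (hβQ t').le (T.coeffs ϖ u t') (hu t') (Q t')
    rw [sub_self, mul_zero] at this
    simp only [A]
    linarith
  have h5 : β t (Q t) * (T.coeffs ϖ u t (Q t) - T.coeffs ϖ u t x) ≤ S := by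
    have h6 := degJ_ge (β t) (hβ t) (Q t) (hβQ t).le (T.coeffs ϖ u t) (hu t) x
    have h7 := Finset.single_le_sum (fun t' _ => h4 t') (Finset.mem_univ t)
    rw [Finset.sum_add_distrib] at h7
    simp only [S]
    simp only [A] at h7 ⊢
    linarith
  have h6 : (T.coeffs ϖ u t (Q t) - T.coeffs ϖ u t x : ℝ) ≤ |S| / β t (Q t) := by
    rw [le_div_iff₀ (hβQ t), mul_comm]
    exact h5.trans (le_abs_self S)
  have h7 := Finset.single_le_sum (fun t' _ => hpos t') (Finset.mem_univ t)
  have h8 : (T.coeffs ϖ u t (Q t) - T.coeffs ϖ u t x : ℝ) ≤ N := (h6.trans h7).trans hN.le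
  exact_mod_cast h8

/-- For each `u` the quad choice is taken where the coefficients are largest. There are finitely
many choices, so the sum of their bounds serves for all `u`. -/
theorem exists_bound (hT : T.HasIndexStructure) (ϖ : T.MultiCurve) (d : ℤ) :
    ∃ N : ℤ, ∀ u, (∃ e ≤ d, (T.term ϖ u).coeff e ≠ 0) →
      ∀ t x x', |T.coeffs ϖ u t x - T.coeffs ϖ u t x'| ≤ N := by
  classical
  choose α hα hQ using hT
  choose N hN0 hN using fun Q => exists_bound_of_argmax ϖ (hα Q) (hQ Q) d
  refine ⟨∑ Q, N Q, fun u hu t x x' => ?_⟩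
  choose Q hQ' using fun t => Finite.exists_max (T.coeffs ϖ u t)
  have h1 := hN Q u hQ' hu t
  have h2 := Finset.single_le_sum (fun Q _ => hN0 Q) (Finset.mem_univ Q)
  have h3 := h1 x
  have h4 := h1 x'
  have h5 := hQ' t x
  have h6 := hQ' t x'
  rw [abs_le]
  constructor <;> omega

/-- Bounded spreads leave finitely many values for the combination of rows given by `k`, and for a
basic set this combination determines `k`. -/
theorem formallySummable_indexTerm (hT : T.HasIndexStructure) (ϖ : T.MultiCurve) {Q : τ → Fin 3}
    {B : Finset T.Edge} (hB : T.IsBasic Q B) : FormallySummable (T.indexTerm Q B ϖ) := by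
  classical
  refine formallySummable_of_finite fun d => ?_
  obtain ⟨N, hN⟩ := exists_bound hT ϖ d
  let L (k : B → ℤ) (t : τ) : ℤ × ℤ := (elimA Q (T.vec (T.extend B k)) t, elimB Q (T.vec (T.extend B k)) t)
  have hL : ∀ k, L k = ∑ E : B, k E • T.row Q E := fun k => by
    rw [← sum_extend_smul, sum_smul_row]
  have hinj : Function.Injective L := fun k k' h => by
    rw [hL, hL] at h
    have : ∑ E : B, (k - k') E • T.row Q E = 0 := by
      simp only [Pi.sub_apply, sub_smul, Finset.sum_sub_distrib, h, sub_self]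
    have := Fintype.linearIndependent_iff.1 hB.1 _ this
    exact funext fun E => sub_eq_zero.1 (this E)
  let lo (t : τ) : ℤ × ℤ := (-N - elimA Q ϖ.turn t, -N - elimB Q ϖ.turn t)
  let hi (t : τ) : ℤ × ℤ := (N - elimA Q ϖ.turn t, N - elimB Q ϖ.turn t)
  refine ((Set.finite_Icc lo hi).preimage hinj.injOn).subset ?_
  rintro k ⟨e, hed, he⟩
  rw [indexTerm_eq] at he
  have h := hN _ ⟨e, hed, he⟩
  refine ⟨fun t => ?_, fun t => ?_⟩
  · have h1 := (abs_le.1 (h t (Q t + 2) (Q t))).1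
    have h2 := (abs_le.1 (h t (Q t + 1) (Q t))).1
    simp only [coeffs] at h1 h2
    refine ⟨?_, ?_⟩ <;> simp only [lo, L, elimA, elimB] <;> omega
  · have h1 := (abs_le.1 (h t (Q t + 2) (Q t))).2
    have h2 := (abs_le.1 (h t (Q t + 1) (Q t))).2
    simp only [coeffs] at h1 h2
    refine ⟨?_, ?_⟩ <;> simp only [hi, L, elimA, elimB] <;> omega

end FacePairing

/-! ## Edges and their ends -/

theorem ccw_swap : ∀ v w : Fin 4, v ≠ w → ccw w v = ccw v (ccw v w) := by decide

theorem perm_odd_fix : ∀ p : Equiv.Perm (Fin 4), Equiv.Perm.sign p = -1 → ∀ v w : Fin 4, v ≠ w →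
    p v = w → p w = v → p (ccw v (ccw v w)) = ccw v (ccw v w) := by decide

theorem Corner.swap_swap {τ : Type*} (c : Corner τ) : c.swap.swap = c := rfl

theorem Corner.swap_ne {τ : Type*} (c : Corner τ) : c.swap ≠ c := fun h =>
  c.2 (congrArg (fun c => c.1.2.2) h)

namespace FacePairing

variable {τ : Type*} (T : FacePairing τ)

/-- The other end of an edge. -/
def swapV : T.LinkVertex → T.LinkVertex :=
  Quot.map Corner.swap fun _ _ ⟨f, h1, h2, h3⟩ => ⟨f, h2, h1, by
    simp only [Corner.swap, h3]⟩

theorem swapV_linkVertex (c : Corner τ) : T.swapV (linkVertex c) = linkVertex c.swap := rfl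

theorem swapV_swapV (v : T.LinkVertex) : T.swapV (T.swapV v) = v := by
  obtain ⟨c, rfl⟩ := T.linkVertex_surjective v
  rfl

/-- The edge with a given end. -/
def edgeOf : T.LinkVertex → T.Edge := Quot.lift edge fun _ _ h => Quot.sound (Or.inl h)

theorem edgeOf_linkVertex (c : Corner τ) : T.edgeOf (linkVertex c) = edge c := rfl

theorem edge_swap (c : Corner τ) : edge (T := T) c.swap = edge c := by
  refine (Quot.sound ?_).symm
  exact Or.inr rfl

theorem edgeOf_swapV (v : T.LinkVertex) : T.edgeOf (T.swapV v) = T.edgeOf v := by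
  obtain ⟨c, rfl⟩ := T.linkVertex_surjective v
  exact T.edge_swap c

theorem edgeOf_eq_iff {v w : T.LinkVertex} : T.edgeOf v = T.edgeOf w ↔ v = w ∨ v = T.swapV w := by
  constructor
  · intro h
    obtain ⟨c, rfl⟩ := T.linkVertex_surjective v
    obtain ⟨d, rfl⟩ := T.linkVertex_surjective w
    have := Quot.eqvGen_exact h
    clear h
    change linkVertex c = linkVertex d ∨ linkVertex c = T.swapV (linkVertex d)
    induction this with
    | rel c d h =>
      rcases h with h | h
      · exact Or.inl (Quot.sound h)
      · refine Or.inr ?_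
        rw [swapV_linkVertex]
        refine congrArg linkVertex (Subtype.ext ?_)
        change c.1 = (d.1.1, d.1.2.2, d.1.2.1)
        rw [h]
    | refl c => exact Or.inl rfl
    | symm c d _ ih =>
      rcases ih with h | h
      · exact Or.inl h.symm
      · exact Or.inr (by rw [h, swapV_swapV])
    | trans a b c _ _ h1 h2 =>
      rcases h1 with h1 | h1 <;> rcases h2 with h2 | h2 <;> rw [h1, h2]
      · exact Or.inl rfl
      · exact Or.inr rfl
      · exact Or.inr rfl
      · exact Or.inl (T.swapV_swapV _)
  · rintro (rfl | rfl)
    · rfl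
    · exact T.edgeOf_swapV _

theorem edgeOf_surjective : Function.Surjective T.edgeOf := fun E => by
  obtain ⟨c, rfl⟩ := Quot.exists_rep E
  exact ⟨linkVertex c, rfl⟩

/-- The next corner around a vertex. -/
def step : Equiv.Perm (Corner τ) where
  toFun c := (T.flipSide c.next.next).next.next
  invFun c := (T.flipSide c.next).next
  left_inv c := by
    change (T.flipSide (T.flipSide c.next.next).next.next.next).next = c
    rw [Corner.next_next_next, flipSide_flipSide, Corner.next_next_next]
  right_inv c := by
    change (T.flipSide (T.flipSide c.next).next.next.next).next.next = c
    rw [Corner.next_next_next, flipSide_flipSide, Corner.next_next_next]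

theorem step_val (c : Corner τ) : (T.step c).1 =
    (T.adj c.1.1 (ccw c.1.2.1 (ccw c.1.2.1 c.1.2.2)),
      T.glue c.1.1 (ccw c.1.2.1 (ccw c.1.2.1 c.1.2.2)) c.1.2.1,
      T.glue c.1.1 (ccw c.1.2.1 (ccw c.1.2.1 c.1.2.2)) c.1.2.2) := by
  obtain ⟨⟨t, v, w⟩, h⟩ := c
  have h1 := ne_ccw _ _ (ne_ccw _ _ h)
  simp only [step, Equiv.coe_fn_mk, flipSide, flip, Corner.next]
  rw [← ccw_ccw_perm_odd _ (T.odd _ _) h1, ccw_ccw_ccw _ _ h]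

/-- The tetrahedra around an edge are passed in the opposite order when seen from the other end;
this uses orientability. -/
theorem swap_step (c : Corner τ) : (T.step c).swap = T.step.symm c.swap := by
  obtain ⟨⟨t, v, w⟩, h⟩ := c
  refine Subtype.ext ?_
  have h1 : ((T.step ⟨(t, v, w), h⟩).swap).1 =
    (T.adj t (ccw v (ccw v w)), T.glue t (ccw v (ccw v w)) w, T.glue t (ccw v (ccw v w)) v) := by
    simp only [Corner.swap, T.step_val]
  have h2 := ne_ccw _ _ h.symm
  rw [h1]
  simp only [step, Equiv.coe_fn_symm_mk, flipSide, flip, Corner.next, Corner.swap]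
  rw [← ccw_perm_odd _ (T.odd _ _) _ _ h2, ccw_ccw_ccw _ _ h.symm, ccw_swap _ _ h]

theorem swap_step_zpow (c : Corner τ) (n : ℤ) : ((T.step ^ n) c).swap = (T.step ^ (-n)) c.swap := by
  let s : Equiv.Perm (Corner τ) := Function.Involutive.toPerm Corner.swap Corner.swap_swap
  have h : s * T.step * s⁻¹ = T.step⁻¹ := by
    ext1 c
    have := T.swap_step c.swap
    rw [Corner.swap_swap] at this
    exact this
  have h1 : s * T.step ^ n * s⁻¹ = T.step ^ (-n) := by
    rw [← conj_zpow, h, inv_zpow, zpow_neg]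
  have h2 := Equiv.Perm.ext_iff.1 h1 c.swap
  exact h2

/-- Otherwise a gluing map would exchange the ends of an edge. Being odd, it would map the vertex
opposite the face to itself, so the face would be glued to itself. -/
theorem swap_ne_step (c : Corner τ) : c.swap ≠ T.step c := by
  obtain ⟨⟨t, v, w⟩, h⟩ := c
  intro e
  have := congrArg Subtype.val e
  rw [T.step_val] at this
  simp only [Corner.swap, Prod.mk.injEq] at this
  obtain ⟨h1, h2, h3⟩ := this
  have h4 := perm_odd_fix _ (T.odd t (ccw v (ccw v w))) v w h h2.symm h3.symm
  exact T.not_self _ _ (Prod.ext h1.symm h4)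

/-- The two ends of an edge are distinct. -/
theorem swapV_ne (v : T.LinkVertex) : T.swapV v ≠ v := by
  obtain ⟨c, rfl⟩ := T.linkVertex_surjective v
  intro h
  have h1 : T.step.SameCycle c c.swap := by
    have := T.surface.lv_orbit _ _ h.symm
    change Relation.EqvGen _ c c.swap at this
    generalize c.swap = d at this
    clear h
    induction this with
    | rel a b h =>
      obtain ⟨s, rfl, rfl⟩ := h
      refine ⟨1, ?_⟩
      change (T.flipSide s.next.next.next).next.next = (T.flipSide s).next.next
      rw [Corner.next_next_next]
    | refl a => exact .refl _ _
    | symm a b _ ih => exact ih.symm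
    | trans a b c _ _ h1 h2 => exact h1.trans h2
  obtain ⟨n, hn⟩ := h1
  -- If the swapped corner is `n` steps away, then going half way round yields a corner equal to its
  -- own swap for even `n`, and one whose swap is its next step for odd `n`; both are impossible.
  rcases Int.even_or_odd' n with ⟨j, rfl | rfl⟩
  · have := T.swap_step_zpow c j
    rw [← hn, ← Equiv.Perm.mul_apply, ← zpow_add, show -j + 2 * j = j by ring] at this
    exact Corner.swap_ne _ this
  · have := T.swap_step_zpow c j
    rw [← hn, ← Equiv.Perm.mul_apply, ← zpow_add, show -j + (2 * j + 1) = 1 + j by ring, zpow_add,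
      zpow_one] at this
    exact T.swap_ne_step _ this

/-- A function on the ends of the edges induces a function on the edges. -/
theorem exists_edge_sum [Finite τ] (h : T.LinkVertex → ℤ) : ∃ H : T.Edge → ℤ,
    (∀ c, H (edge c) = h (linkVertex c) + h (linkVertex c.swap)) ∧ ∑ E, H E = ∑ v, h v := by
  classical
  refine ⟨fun E => ∑ v with T.edgeOf v = E, h v, fun c => ?_, Finset.sum_fiberwise _ _ _⟩
  rw [← T.swapV_linkVertex, ← Finset.sum_pair (f := h) (T.swapV_ne (linkVertex c)).symm]
  refine Finset.sum_congr ?_ fun _ _ => rfl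
  ext v
  rw [Finset.mem_filter, ← edgeOf_linkVertex, edgeOf_eq_iff]
  simp

end FacePairing

/-- The side of the boundary of a tetrahedron in the same face at the next vertex. -/
def Corner.faceNext {τ : Type*} (s : Corner τ) : Corner τ :=
  ⟨(s.1.1, ccw s.1.2.1 s.1.2.2, s.1.2.2), ccw_ne _ _ s.2⟩

theorem Corner.swap_next {τ : Type*} (s : Corner τ) : s.next.swap = s.faceNext.next.next := by
  have : ∀ v w : Fin 4, v ≠ w → ccw (ccw v w) (ccw (ccw v w) w) = v := by decide
  obtain ⟨⟨t, v, w⟩, h⟩ := s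
  exact Subtype.ext (Prod.ext rfl (Prod.ext rfl (this v w h).symm))

theorem Corner.emb_faceNext {ι τ : Type*} {e : ι → τ} {l : ι → Equiv.Perm (Fin 4)}
    (hl : ∀ i, Equiv.Perm.sign (l i) = 1) (c : Corner ι) : (c.emb e l).faceNext = c.faceNext.emb e l := by
  obtain ⟨⟨t, v, w⟩, h⟩ := c
  simp only [Corner.emb, Corner.faceNext, ccw_perm_even _ (hl t) v w h]

/-- The next side in the same face of the bipyramid. -/
def BSide.faceNext : BSide → BSide
  | (false, i, r) => (false, i, r + 1)
  | (true, i, r) => (true, i, r + 2)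

theorem Patch.two_faceNext : ∀ x, two.o (BSide.faceNext x) = (two.o x).faceNext := by decide

theorem Patch.three_faceNext : ∀ x, three.o (BSide.faceNext x) = (three.o x).faceNext := by decide

namespace TwoThreeMove

variable {τ τ' : Type*} [Fintype τ] [Fintype τ'] {T : FacePairing τ} {T' : FacePairing τ'}
  (m : TwoThreeMove T T')

/-- The next side in the same face. -/
def faceNext : Corner m.Rest ⊕ BSide → Corner m.Rest ⊕ BSide := Sum.map Corner.faceNext BSide.faceNext

theorem side_faceNext (x : Corner m.Rest ⊕ BSide) : m.side (m.faceNext x) = (m.side x).faceNext := by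
  rcases x with x | x
  · exact (Corner.emb_faceNext m.realization.even x).symm
  · exact (congrArg _ (Patch.two_faceNext x)).trans (Corner.emb_faceNext m.realization.even' _).symm

theorem side'_faceNext (x : Corner m.Rest ⊕ BSide) : m.side' (m.faceNext x) = (m.side' x).faceNext := by
  rcases x with x | x
  · exact (Corner.emb_faceNext (e := fun t => (m.rest t).1) m.realization'.even x).symm
  · exact (congrArg _ (Patch.three_faceNext x)).trans (Corner.emb_faceNext m.realization'.even' _).symm

theorem swap_side_next (x : Corner m.Rest ⊕ BSide) :
    (m.side x).next.swap = (m.side (m.faceNext x)).next.next := by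
  rw [side_faceNext, Corner.swap_next]

theorem swap_side'_next (x : Corner m.Rest ⊕ BSide) :
    (m.side' x).next.swap = (m.side' (m.faceNext x)).next.next := by
  rw [side'_faceNext, Corner.swap_next]

/-- An edge inside the bipyramid. -/
theorem edge_new (c : Corner (Fin 3)) (h : Patch.three.new c) :
    (FacePairing.edge (m.realization'.inC c) : T'.Edge) =
      FacePairing.edge (m.realization'.inC (Patch.axis₃ false)) := by
  have h1 : (FacePairing.edge (m.realization'.inC (Patch.axis₃ true)) : T'.Edge) =
    FacePairing.edge (m.realization'.inC (Patch.axis₃ false)) :=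
      T'.edge_swap (m.realization'.inC (Patch.axis₃ false))
  obtain ⟨n, hn⟩ := m.realization'.exists_nv c h
  have h2 := congrArg T'.edgeOf hn
  rw [FacePairing.edgeOf_linkVertex, FacePairing.edgeOf_linkVertex] at h2
  refine h2.trans ?_
  cases n
  · rfl
  · exact h1

/-- The edges of `T'` are those of `T` and the axis of the bipyramid. -/
theorem exists_edgeEquiv : ∃ η : Option T.Edge ≃ T'.Edge,
    (∀ x, η (some (FacePairing.edge (m.side x).next)) = FacePairing.edge (m.side' x).next) ∧
    (∀ x, η (some (FacePairing.edge (m.side x).next.next)) = FacePairing.edge (m.side' x).next.next) ∧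
    ∀ c, Patch.three.new c → η none = FacePairing.edge (m.realization'.inC c) := by
  classical
  let F := m.realization.frame m.fl_fl
  let F' := m.realization'.frame m.fl_fl
  have hold : ∀ v, F.old v := fun v c _ ⟨d, hd, _⟩ => hd
  -- The passage to the other end of an edge, expressed in the common cell decomposition. It
  -- describes `swapV` in both triangulations, so they identify the same pairs of old vertices.
  let σ (p : m.cells.Vertex) : m.cells.Vertex :=
    m.cells.vertex (m.cells.rot (m.faceNext (Quot.out p)))
  have hσ : ∀ p, T.swapV (F.vtx p) = F.vtx (σ p) := fun p => by
    have h1 : F.vtx p = FacePairing.linkVertex (m.side (Quot.out p)).next :=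
      congrArg F.vtx (Quot.out_eq p).symm
    rw [h1, T.swapV_linkVertex, swap_side_next, F.vtx_vertex_rot]
    rfl
  have hσ' : ∀ p, T'.swapV (F'.vtx p) = F'.vtx (σ p) := fun p => by
    have h1 : F'.vtx p = FacePairing.linkVertex (m.side' (Quot.out p)).next :=
      congrArg F'.vtx (Quot.out_eq p).symm
    rw [h1, T'.swapV_linkVertex, swap_side'_next, F'.vtx_vertex_rot]
    rfl
  have hsurj : ∀ E : T.Edge, ∃ p, T.edgeOf (F.vtx p) = E := fun E => by
    obtain ⟨v, rfl⟩ := T.edgeOf_surjective E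
    obtain ⟨p, rfl⟩ := F.exists_vtx (hold v)
    exact ⟨p, rfl⟩
  choose g hg using hsurj
  have key : ∀ p q, T.edgeOf (F.vtx p) = T.edgeOf (F.vtx q) ↔ T'.edgeOf (F'.vtx p) = T'.edgeOf (F'.vtx q) := by
    intro p q
    rw [T.edgeOf_eq_iff, T'.edgeOf_eq_iff, hσ, hσ', F.vtx_injective.eq_iff, F.vtx_injective.eq_iff,
      F'.vtx_injective.eq_iff, F'.vtx_injective.eq_iff]
  let f (E : Option T.Edge) : T'.Edge :=
    E.elim (FacePairing.edge (m.realization'.inC (Patch.axis₃ false))) fun E => T'.edgeOf (F'.vtx (g E))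
  have hf : ∀ p, f (some (T.edgeOf (F.vtx p))) = T'.edgeOf (F'.vtx p) := fun p => (key _ _).1 (hg _)
  have hnone : ∀ p, f none ≠ T'.edgeOf (F'.vtx p) := fun p h => by
    have h1 : ∀ q, F'.vtx q ≠ FacePairing.linkVertex (m.realization'.inC (Patch.axis₃ false)) := fun q hq =>
      (m.realization'.not_old_iff _).2 ((m.realization'.new_inC _).2 (Patch.three.new_nv false)) (hq ▸ F'.old_vtx q)
    rcases T'.edgeOf_eq_iff (v := FacePairing.linkVertex (m.realization'.inC (Patch.axis₃ false))).1 h with h | h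
    · exact h1 _ h.symm
    · exact h1 _ ((hσ' p).symm.trans h.symm)
  have hinj : Function.Injective f := by
    rintro (_ | E) (_ | E') h
    · rfl
    · exact absurd h (hnone _)
    · exact absurd h.symm (hnone _)
    · have := (key _ _).2 h
      rw [hg, hg] at this
      rw [this]
  have hsur : Function.Surjective f := fun E => by
    obtain ⟨v, rfl⟩ := T'.edgeOf_surjective E
    obtain ⟨c, rfl⟩ := T'.linkVertex_surjective v
    by_cases hv : m.realization'.New c
    · obtain ⟨d, hd, rfl⟩ := hv
      exact ⟨none, (m.edge_new d hd).symm⟩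
    · obtain ⟨p, hp⟩ := F'.exists_vtx ((m.realization'.old_iff c).2 hv)
      exact ⟨some (T.edgeOf (F.vtx p)), (hf p).trans (congrArg T'.edgeOf hp)⟩
  refine ⟨Equiv.ofBijective f ⟨hinj, hsur⟩, fun x => ?_, fun x => ?_, fun c hc => (m.edge_new c hc).symm⟩
  · exact hf (m.cells.vertex x)
  · have h1 : FacePairing.edge (m.side x).next.next = T.edgeOf (F.vtx (m.cells.vertex (m.cells.rot x))) := by
      rw [F.vtx_vertex_rot]; rfl
    have h2 : FacePairing.edge (m.side' x).next.next = T'.edgeOf (F'.vtx (m.cells.vertex (m.cells.rot x))) := by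
      rw [F'.vtx_vertex_rot]; rfl
    rw [h1, h2]
    exact hf _

end TwoThreeMove

/-! ## Tetrahedra up to renumbering -/

/-- Two triples agree up to a permutation. -/
def PermEq (y z : Fin 3 → ℤ) : Prop := ∃ σ : Equiv.Perm (Fin 3), y = fun x => z (σ x)

theorem PermEq.symm {y z : Fin 3 → ℤ} (h : PermEq y z) : PermEq z y := by
  obtain ⟨σ, rfl⟩ := h
  exact ⟨σ.symm, by simp⟩

theorem PermEq.trans {y z w : Fin 3 → ℤ} (h : PermEq y z) (h' : PermEq z w) : PermEq y w := by
  obtain ⟨σ, rfl⟩ := h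
  obtain ⟨σ', rfl⟩ := h'
  exact ⟨σ.trans σ', rfl⟩

theorem PermEq.tetJ₃_eq {y z : Fin 3 → ℤ} (h : PermEq y z) : tetJ₃ y = tetJ₃ z := by
  obtain ⟨σ, rfl⟩ := h
  have : ∀ σ : Equiv.Perm (Fin 3), (σ 0 = 0 ∧ σ 1 = 1 ∧ σ 2 = 2) ∨ (σ 0 = 0 ∧ σ 1 = 2 ∧ σ 2 = 1) ∨
    (σ 0 = 1 ∧ σ 1 = 0 ∧ σ 2 = 2) ∨ (σ 0 = 1 ∧ σ 1 = 2 ∧ σ 2 = 0) ∨ (σ 0 = 2 ∧ σ 1 = 0 ∧ σ 2 = 1) ∨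
    (σ 0 = 2 ∧ σ 1 = 1 ∧ σ 2 = 0) := by decide
  unfold tetJ₃
  rcases this σ with ⟨h0, h1, h2⟩ | ⟨h0, h1, h2⟩ | ⟨h0, h1, h2⟩ | ⟨h0, h1, h2⟩ | ⟨h0, h1, h2⟩ | ⟨h0, h1, h2⟩ <;>
    simp only [h0, h1, h2]
  · exact tetJ_swap_right _ _ _
  · exact tetJ_swap_left _ _ _
  · rw [tetJ_swap_right, tetJ_swap_left]
  · rw [tetJ_swap_left, tetJ_swap_right]
  · exact tetJ_swap_outer _ _ _

theorem PermEq.const_iff {y z : Fin 3 → ℤ} (h : PermEq y z) : (∀ x, y x = y 0) ↔ ∀ x, z x = z 0 := by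
  have : ∀ {y z : Fin 3 → ℤ}, PermEq y z → (∀ x, z x = z 0) → ∀ x, y x = y 0 := by
    rintro _ z ⟨σ, rfl⟩ h x
    exact (h _).trans (h _).symm
  exact ⟨this h.symm, this h⟩

/-- An orientation-preserving renumbering permutes the three pairs of opposite edges cyclically, and
`quadType (p 0) (p 1)` is the amount of the rotation. -/
theorem quad_perm : ∀ p : Equiv.Perm (Fin 4), Equiv.Perm.sign p = 1 → ∀ x : Fin 3,
    (s(p 0, p x.succ) = s(0, (x + quadType (p 0) (p 1)).succ) ∧ s(p (x + 1).succ, p (x + 2).succ) =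
      s((x + quadType (p 0) (p 1) + 1).succ, (x + quadType (p 0) (p 1) + 2).succ)) ∨
    (s(p 0, p x.succ) = s((x + quadType (p 0) (p 1) + 1).succ, (x + quadType (p 0) (p 1) + 2).succ) ∧
      s(p (x + 1).succ, p (x + 2).succ) = s(0, (x + quadType (p 0) (p 1)).succ)) := by
  decide

theorem quadSum_apply {τ : Type*} {W : Corner τ → ℤ} (hW : ∀ c, W c.swap = W c) (t : τ) (x : Fin 3) :
    quadSum W t x = W ⟨(t, 0, x.succ), (Fin.succ_ne_zero x).symm⟩ +
      W ⟨(t, (x + 1).succ, (x + 2).succ), (by decide : ∀ x : Fin 3, (x + 1).succ ≠ (x + 2).succ) x⟩ := by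
  fin_cases x
  · rfl
  · exact congrArg₂ (· + ·) rfl (hW ⟨(t, 3, 1), by simp⟩)
  · rfl

/-- The effect of a renumbering of the vertices on the sums over opposite edges. -/
theorem quadSum_emb {ι τ : Type*} {e : ι → τ} {l : ι → Equiv.Perm (Fin 4)}
    (hl : ∀ i, Equiv.Perm.sign (l i) = 1) {W : Corner τ → ℤ} (hW : ∀ c, W c.swap = W c) (i : ι) :
    PermEq (quadSum (fun c : Corner ι => W (c.emb e l)) i) (quadSum W (e i)) := by
  refine ⟨Equiv.addRight (quadType (l i 0) (l i 1)), funext fun x => ?_⟩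
  rw [quadSum_apply (fun c => hW (c.emb e l)), quadSum_apply hW]
  have key : ∀ {v w v' w' : Fin 4} (h : v ≠ w) (h' : v' ≠ w'), s(v, w) = s(v', w') →
      W ⟨(e i, v, w), h⟩ = W ⟨(e i, v', w'), h'⟩ := by
    intro v w v' w' h h' e
    rcases Sym2.eq_iff.1 e with ⟨rfl, rfl⟩ | ⟨rfl, rfl⟩
    · rfl
    · exact hW ⟨(_, _, _), h'⟩
  rcases quad_perm (l i) (hl i) x with ⟨h1, h2⟩ | ⟨h1, h2⟩
  · exact congrArg₂ _ (key _ _ h1) (key _ _ h2)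
  · exact (congrArg₂ _ (key _ _ h1) (key _ _ h2)).trans (add_comm _ _)

/-- The linear algebra of a 2–3 move: the three tetrahedra around the axis are flat exactly when the
two original ones are and the axis has one particular value. -/
theorem bipyramid_flat_iff (n s e : Fin 3 → ℤ) (k : ℤ) :
    (∀ i x, (![k + e i, n (i + 1) + s (i + 2), n (i + 2) + s (i + 1)] : Fin 3 → ℤ) x =
      (![k + e i, n (i + 1) + s (i + 2), n (i + 2) + s (i + 1)] : Fin 3 → ℤ) 0) ↔
    (∀ i, n i + e i = n 0 + e 0) ∧ (∀ i, s i + e i = s 0 + e 0) ∧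
      k + ∑ i, e i = n 0 + e 0 + (s 0 + e 0) := by
  have h3 : (3 : Fin 3) = 0 := rfl
  have h4 : (4 : Fin 3) = 1 := rfl
  simp [Fin.forall_fin_succ, Fin.sum_univ_three, h3, h4]
  omega

/-! ### Edge weights of the two triangulations that agree on the bipyramid boundary. -/

namespace TwoThreeMove

variable {τ τ' : Type*} {T : FacePairing τ} {T' : FacePairing τ'} (m : TwoThreeMove T T')

/-- Symmetric functions on the corners of `T` and of `T'` that agree outside the bipyramid and on its
boundary; the latter has the value `k` on the axis. -/
structure Matching (W : Corner τ → ℤ) (W' : Corner τ' → ℤ) (k : ℤ) : Prop where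
  swap : ∀ c, W c.swap = W c
  swap' : ∀ c, W' c.swap = W' c
  next : ∀ x, W (m.side x).next = W' (m.side' x).next
  next_next : ∀ x, W (m.side x).next.next = W' (m.side' x).next.next
  axis : ∀ c, Patch.three.new c → W' (m.realization'.inC c) = k

/-- The values on the edges at the pole `0`. -/
noncomputable def northValue (W : Corner τ → ℤ) (i : Fin 3) : ℤ :=
  W (m.realization.inC ⟨(false, 0, i.succ), (Fin.succ_ne_zero i).symm⟩)

/-- The values on the edges at the pole `4`. -/
noncomputable def southValue (W : Corner τ → ℤ) (i : Fin 3) : ℤ :=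
  W (m.realization.inC ⟨(true, 3, i.castSucc), by revert i; decide⟩)

/-- The values on the equatorial edges. -/
noncomputable def equatorValue (W : Corner τ → ℤ) (i : Fin 3) : ℤ :=
  W (m.realization.inC ⟨(false, (i + 1).succ, (i + 2).succ), by revert i; decide⟩)

variable {m}

theorem permEq_north {W : Corner τ → ℤ} (hW : ∀ c, W c.swap = W c) :
    PermEq (fun i => m.northValue W i + m.equatorValue W i) (quadSum W m.north) := by
  refine PermEq.trans ⟨1, funext fun x => ?_⟩
    (quadSum_emb (e := m.two) (l := m.twoLabel) m.realization.even' hW false)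
  rw [quadSum_apply fun c : Corner Bool => hW (c.emb m.two m.twoLabel)]
  rfl

variable {W : Corner τ → ℤ} {W' : Corner τ' → ℤ} {k : ℤ} (M : m.Matching W W' k)
include M

theorem Matching.next_inC (x : BSide) :
    W (m.realization.inC (Patch.two.o x).next) = W' (m.realization'.inC (Patch.three.o x).next) := by
  rw [← Patch.Realization.next_inC, ← Patch.Realization.next_inC]
  exact M.next (.inr x)

theorem Matching.next_next_inC (x : BSide) :
    W (m.realization.inC (Patch.two.o x).next.next) = W' (m.realization'.inC (Patch.three.o x).next.next) := by
  rw [← Patch.Realization.next_inC, ← Patch.Realization.next_inC, ← Patch.Realization.next_inC,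
    ← Patch.Realization.next_inC]
  exact M.next_next (.inr x)

theorem Matching.northValue_one (i : Fin 3) :
    W' (m.realization'.inC ⟨(i, 0, 1), by simp⟩) = m.northValue W (i + 1) := by
  have := M.next_inC (false, i, 0)
  fin_cases i <;> exact this.symm

theorem Matching.northValue_two (i : Fin 3) :
    W' (m.realization'.inC ⟨(i, 0, 2), by simp⟩) = m.northValue W (i + 2) := by
  have := M.next_next_inC (false, i, 0)
  fin_cases i <;> exact this.symm

theorem Matching.southValue_two (i : Fin 3) :
    W' (m.realization'.inC ⟨(i, 3, 2), by simp⟩) = m.southValue W (i + 2) := by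
  have := M.next_inC (true, i, 0)
  fin_cases i <;> exact this.symm

theorem Matching.southValue_one (i : Fin 3) :
    W' (m.realization'.inC ⟨(i, 3, 1), by simp⟩) = m.southValue W (i + 1) := by
  have := M.next_next_inC (true, i, 0)
  fin_cases i <;> exact this.symm

theorem Matching.equatorValue (i : Fin 3) :
    W' (m.realization'.inC ⟨(i, 1, 2), by simp⟩) = m.equatorValue W i := by
  have := M.next_inC (false, i, 1)
  fin_cases i <;> exact this.symm

theorem Matching.equatorValue_south (i : Fin 3) :
    W (m.realization.inC ⟨(true, (i + 1).castSucc, (i + 2).castSucc), by revert i; decide⟩) =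
      m.equatorValue W i := by
  rw [← M.equatorValue]
  have := M.next_next_inC (true, i, 1)
  fin_cases i <;> exact this

theorem Matching.permEq_south :
    PermEq (fun i => m.southValue W i + m.equatorValue W i) (quadSum W m.south) := by
  refine PermEq.trans ⟨Equiv.swap 0 2, funext fun x => ?_⟩
    (quadSum_emb (e := m.two) (l := m.twoLabel) m.realization.even' M.swap true)
  rw [← M.equatorValue_south]
  have hs := fun c : Corner Bool => M.swap (m.realization.inC c)
  fin_cases x
  · exact congrArg₂ (· + ·) (hs ⟨(true, 0, 3), by simp⟩) rfl
  · exact (congrArg₂ (· + ·) (hs ⟨(true, 1, 3), by simp⟩) (hs ⟨(true, 0, 2), by simp⟩)).trans (add_comm _ _)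
  · exact (congrArg₂ (· + ·) (hs ⟨(true, 2, 3), by simp⟩) rfl).trans (add_comm _ _)

theorem Matching.permEq_mid (i : Fin 3) :
    PermEq ![k + m.equatorValue W i, m.northValue W (i + 1) + m.southValue W (i + 2),
      m.northValue W (i + 2) + m.southValue W (i + 1)] (quadSum W' (m.mid i)) := by
  refine PermEq.trans ⟨Equiv.addRight 2, funext fun x => ?_⟩
    (quadSum_emb (e := m.mid) (l := m.midLabel) m.realization'.even' M.swap' i)
  have hs := fun c : Corner (Fin 3) => M.swap' (m.realization'.inC c)
  rw [← M.axis ⟨(i, 0, 3), by simp⟩ (Or.inl rfl), ← M.equatorValue, ← M.northValue_one, ← M.northValue_two,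
    ← M.southValue_one, ← M.southValue_two]
  fin_cases x
  · rfl
  · exact congrArg₂ (· + ·) rfl (hs ⟨(i, 2, 3), by simp⟩)
  · exact congrArg₂ (· + ·) rfl (hs ⟨(i, 1, 3), by simp⟩)

theorem Matching.permEq_rest (r : m.Rest) : PermEq (quadSum W r.1) (quadSum W' (m.rest r).1) := by
  refine (quadSum_emb (e := Subtype.val) (l := fun _ => 1) m.realization.even M.swap r).symm.trans
    (PermEq.trans ?_ (quadSum_emb (e := fun t => (m.rest t).1) (l := m.restLabel) m.rest_even M.swap' r))
  have h : ∀ c : Corner m.Rest, W (c.emb Subtype.val fun _ => 1) =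
      W' (c.emb (fun t => (m.rest t).1) m.restLabel) := fun c => by
    have h1 := M.next (.inl c.next.next)
    have h2 : (m.side (.inl c.next.next)).next = c.emb Subtype.val fun _ => 1 :=
      (m.realization.next_outC _).trans (by rw [Corner.next_next_next]; rfl)
    have h3 : (m.side' (.inl c.next.next)).next = c.emb (fun t => (m.rest t).1) m.restLabel :=
      (m.realization'.next_outC _).trans (by rw [Corner.next_next_next]; rfl)
    rwa [h2, h3] at h1
  rw [show (fun c : Corner m.Rest => W (c.emb Subtype.val fun _ => 1)) = fun c => _ from funext h]
  exact ⟨1, rfl⟩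

/-- The condition on the axis for the sums over opposite edges of every tetrahedron to be equal. -/
theorem Matching.flat_iff : (∀ t x, quadSum W' t x = quadSum W' t 0) ↔
    (∀ t x, quadSum W t x = quadSum W t 0) ∧
      k + ∑ i, m.equatorValue W i = m.northValue W 0 + m.equatorValue W 0 + (m.southValue W 0 + m.equatorValue W 0) := by
  have hT : (∀ t x, quadSum W t x = quadSum W t 0) ↔ (∀ r : m.Rest, ∀ x, quadSum W r.1 x = quadSum W r.1 0) ∧
      (∀ x, quadSum W m.north x = quadSum W m.north 0) ∧ ∀ x, quadSum W m.south x = quadSum W m.south 0 := by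
    refine ⟨fun h => ⟨fun r => h _, h _, h _⟩, fun ⟨h1, h2, h3⟩ t => ?_⟩
    obtain ⟨r | b | b, rfl⟩ := m.realization.bijective.2 t
    exacts [h1 r, h2, h3]
  have hT' : (∀ t x, quadSum W' t x = quadSum W' t 0) ↔
      (∀ r : m.Rest, ∀ x, quadSum W' (m.rest r).1 x = quadSum W' (m.rest r).1 0) ∧
      (∀ i x, quadSum W' (m.mid i) x = quadSum W' (m.mid i) 0) := by
    refine ⟨fun h => ⟨fun r => h _, fun i => h _⟩, fun ⟨h1, h2⟩ t => ?_⟩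
    obtain ⟨r | b, rfl⟩ := m.realization'.bijective.2 t
    exacts [h1 r, h2 b]
  rw [hT, hT', ← (permEq_north M.swap).const_iff, ← M.permEq_south.const_iff]
  simp only [(M.permEq_rest _).const_iff, ← (M.permEq_mid _).const_iff, bipyramid_flat_iff, and_assoc]

end TwoThreeMove

/-! ### Separating rotations of triangles and loops around vertices from the terms. -/

namespace FacePairing

variable {τ : Type*} (T : FacePairing τ)

/-- The contribution of a turning function `K` and of a combination of edges to the coefficients. -/
def weight (K : Corner τ → ℤ) (u : T.Edge → ℤ) (c : Corner τ) : ℤ := K c + K c.swap + u (edge c)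

theorem quadSum_tri (e : τ × Fin 4 → ℤ) (t : τ) (x : Fin 3) :
    quadSum (fun c => e c.tri + e c.swap.tri) t x = ∑ v, e (t, v) := by
  fin_cases x <;> simp [quadSum, Corner.tri, Corner.swap, Fin.sum_univ_four] <;> ring

/-- Splitting the turning numbers into a function `K` on corners, a rotation of the triangles and loops
around the vertices. -/
theorem term_sub [Fintype τ] {ϖ : T.MultiCurve} {K : Corner τ → ℤ} {e : τ × Fin 4 → ℤ} {h : T.LinkVertex → ℤ}
    {H : T.Edge → ℤ} (hK : ∀ c, ϖ.kappa c = K c + e c.tri + h (linkVertex c))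
    (hH : ∀ c, H (edge c) = h (linkVertex c) + h (linkVertex c.swap)) (u : T.Edge → ℤ) :
    T.term ϖ (u - H) = negSqrtQPow (2 * ∑ E, u E - (∑ a, e a + 2 * ∑ E, H E)) *
      ∏ t, tetJ₃ (quadSum (T.weight K u) t) := by
  have h1 : ∀ t, T.coeffs ϖ (u - H) t = fun x => quadSum (T.weight K u) t x + ∑ v, e (t, v) := fun t => by
    funext x
    rw [← quadSum_tri e t x, coeffs, vec, MultiCurve.turn_eq]
    rw [← Pi.add_apply (f := quadSum _ t), ← quadSum_add, ← Pi.add_apply (f := quadSum _ t), ← quadSum_add]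
    congr 2
    funext c
    rw [hK, hK, weight, Pi.sub_apply, hH]
    ring
  simp only [term, h1, tetJ₃_add_const, Finset.prod_mul_distrib]
  rw [← negSqrtQPow_sum, ← negSqrtQPow_two_mul, ← mul_assoc, ← negSqrtQPow_add, Finset.sum_neg_distrib,
    Fintype.sum_prod_type]
  simp only [Pi.sub_apply, Finset.sum_sub_distrib]
  congr 2
  ring

end FacePairing

/-! ### Summation over the value on the axis. -/

namespace TwoThreeMove

variable {τ τ' : Type*} [Fintype τ] [Fintype τ']

section

variable {T : FacePairing τ} {T' : FacePairing τ'} {m : TwoThreeMove T T'}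
  {W : Corner τ → ℤ} {W' : ℤ → Corner τ' → ℤ} (M : ∀ k, m.Matching W (W' k) k)
include M

/-- `tetJ_pentagon` with the equatorial values added to both polar triples. Translating the entries
of each middle tetrahedron and shifting `k` by the sum of the equatorial values brings the axis
terms to that form. -/
theorem hasFormalSum_mid : HasFormalSum
    (fun k => negSqrtQPow (2 * k) * ∏ i, tetJ₃ (quadSum (W' k) (m.mid i)))
    (tetJ₃ (quadSum W m.north) * tetJ₃ (quadSum W m.south)) := by
  rw [← (permEq_north (M 0).swap).tetJ₃_eq, ← (M 0).permEq_south.tetJ₃_eq]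
  simp only [← ((M _).permEq_mid _).tetJ₃_eq]
  generalize m.northValue W = n
  generalize m.southValue W = s
  generalize m.equatorValue W = e
  refine (tetJ_pentagon (fun i => n i + e i) fun i => s i + e i).equiv (Equiv.addRight (∑ i, e i)) fun k => ?_
  have h3 : (3 : Fin 3) = 0 := rfl
  have h4 : (4 : Fin 3) = 1 := rfl
  have h : ∀ a b c d : ℤ, tetJ (k + ∑ i, e i) (a + (∑ i, e i - d)) (b + (∑ i, e i - d)) =
      negSqrtQPow (-(∑ i, e i - d)) * tetJ (k + d) a b := fun a b c d => by
    rw [← tetJ_add]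
    congr 1
    ring
  have h0 := h (n 1 + s 2) (n 2 + s 1) 0 (e 0)
  have h1 := h (n 2 + s 0) (n 0 + s 2) 0 (e 1)
  have h2 := h (n 0 + s 1) (n 1 + s 0) 0 (e 2)
  have h5 : negSqrtQPow (2 * k) = negSqrtQPow (2 * (k + ∑ i, e i)) * (negSqrtQPow (-(∑ i, e i - e 0)) *
      negSqrtQPow (-(∑ i, e i - e 1)) * negSqrtQPow (-(∑ i, e i - e 2))) := by
    simp only [← negSqrtQPow_add, Fin.sum_univ_three]
    congr 1
    ring
  simp only [pentagonJ, Equiv.coe_addRight, tetJ₃, Fin.prod_univ_three, ← negSqrtQPow_two_mul, h5]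
  simp only [Fin.sum_univ_three] at h0 h1 h2 ⊢
  rw [show n 1 + e 1 + (s 2 + e 2) = n 1 + s 2 + (e 0 + e 1 + e 2 - e 0) by ring,
    show n 2 + e 2 + (s 1 + e 1) = n 2 + s 1 + (e 0 + e 1 + e 2 - e 0) by ring,
    show n 2 + e 2 + (s 0 + e 0) = n 2 + s 0 + (e 0 + e 1 + e 2 - e 1) by ring,
    show n 0 + e 0 + (s 2 + e 2) = n 0 + s 2 + (e 0 + e 1 + e 2 - e 1) by ring,
    show n 0 + e 0 + (s 1 + e 1) = n 0 + s 1 + (e 0 + e 1 + e 2 - e 2) by ring,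
    show n 1 + e 1 + (s 0 + e 0) = n 1 + s 0 + (e 0 + e 1 + e 2 - e 2) by ring, h0, h1, h2]
  simp [h3, h4]
  ring

theorem hasFormalSum_prod : HasFormalSum
    (fun k => negSqrtQPow (2 * k) * ∏ t, tetJ₃ (quadSum (W' k) t)) (∏ t, tetJ₃ (quadSum W t)) := by
  classical
  let _ : Fintype m.Rest := Fintype.ofFinite _
  have h1 : ∏ t, tetJ₃ (quadSum W t) = (∏ r : m.Rest, tetJ₃ (quadSum W r.1)) *
      (tetJ₃ (quadSum W m.north) * tetJ₃ (quadSum W m.south)) := by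
    rw [← m.realization.bijective.prod_comp, Fintype.prod_sum_type, Fintype.prod_bool, mul_comm (tetJ₃ _)]
    rfl
  have h2 : ∀ k, ∏ t, tetJ₃ (quadSum (W' k) t) = (∏ r : m.Rest, tetJ₃ (quadSum W r.1)) *
      ∏ i, tetJ₃ (quadSum (W' k) (m.mid i)) := fun k => by
    rw [← m.realization'.bijective.prod_comp, Fintype.prod_sum_type]
    refine congrArg₂ _ (Finset.prod_congr rfl fun r _ => ?_) rfl
    exact ((M k).permEq_rest r).tetJ₃_eq.symm
  rw [h1]
  refine ((hasFormalSum_mid M).mul_left _).congr fun k => ?_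
  rw [h2, mul_left_comm]

end

/-- A function on the edges of `T'`, given by a function on the edges of `T` and the value on the axis. -/
def insertAxis {T : FacePairing τ} {T' : FacePairing τ'} (η : Option T.Edge ≃ T'.Edge) (u : T.Edge → ℤ) (k : ℤ)
    (E : T'.Edge) : ℤ := (η.symm E).elim k u

section

variable {T : FacePairing τ} {T' : FacePairing τ'} {η : Option T.Edge ≃ T'.Edge}

theorem insertAxis_none (u : T.Edge → ℤ) (k : ℤ) : insertAxis η u k (η none) = k := by
  simp [insertAxis]

theorem insertAxis_some (u : T.Edge → ℤ) (k : ℤ) (E : T.Edge) : insertAxis η u k (η (some E)) = u E := by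
  simp [insertAxis]

theorem insertAxis_sub (u v : T.Edge → ℤ) (j k : ℤ) :
    insertAxis η (u - v) (j - k) = insertAxis η u j - insertAxis η v k := by
  funext E
  simp only [insertAxis, Pi.sub_apply]
  cases η.symm E <;> rfl

theorem sum_insertAxis (u : T.Edge → ℤ) (k : ℤ) : ∑ E, insertAxis η u k E = k + ∑ E, u E := by
  rw [← η.sum_comp, Fintype.sum_option, insertAxis_none]
  simp only [insertAxis_some]

theorem exists_insertAxis (v : T'.Edge → ℤ) : ∃ u k, insertAxis η u k = v := by
  refine ⟨fun E => v (η (some E)), v (η none), funext fun E => ?_⟩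
  obtain ⟨E | E, rfl⟩ := η.surjective E
  · exact insertAxis_none _ _
  · exact insertAxis_some _ _ _

end

theorem faceNext_faceNext_faceNext {T : FacePairing τ} {T' : FacePairing τ'} (m : TwoThreeMove T T')
    (x : Corner m.Rest ⊕ BSide) : m.faceNext (m.faceNext (m.faceNext x)) = x := by
  rcases x with ⟨⟨t, v, w⟩, h⟩ | x
  · have : ∀ v w : Fin 4, v ≠ w → ccw (ccw (ccw v w) w) w = v := by decide
    exact congrArg Sum.inl (Subtype.ext (Prod.ext rfl (Prod.ext (this v w h) rfl)))
  · have : ∀ x : BSide, x.faceNext.faceNext.faceNext = x := by decide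
    exact congrArg Sum.inr (this x)

/-- The effect of a 2-3 move on the terms of the index. -/
theorem exists_pentagon {T : IdealTriangulation τ} {T' : IdealTriangulation τ'}
    (m : TwoThreeMove T.toFacePairing T'.toFacePairing) {ϖ : T.MultiCurve} {ϖ' : T'.MultiCurve}
    (hϖ : m.SameClass ϖ ϖ') : ∃ (H : T.Edge → ℤ) (η : Option T.Edge ≃ T'.Edge) (c : (T.Edge → ℤ) → ℤ),
      (∀ u, HasFormalSum (fun k => T'.term ϖ' (insertAxis η u k)) (T.term ϖ (u - H))) ∧
      ∀ u k, T'.IsFlat (insertAxis η u k) ↔ T.IsFlat u ∧ k = c u := by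
  obtain ⟨K, e, h, K', e', hK, hK', hKK', hnew, hsum⟩ := m.exists_rotation hϖ
  obtain ⟨H, hH, hHh⟩ := T.exists_edge_sum h
  obtain ⟨η, hη1, hη2, hη3⟩ := m.exists_edgeEquiv
  -- Needed twice: with the turning functions `K`, `K'` for the summation formula, and with zero
  -- functions for flatness.
  have M : ∀ (J : Corner τ → ℤ) (J' : Corner τ' → ℤ), (∀ x, J (m.side x).next = J' (m.side' x).next ∧
      J (m.side x).next.next = J' (m.side' x).next.next) →
      (∀ c, Patch.three.new c → J' (m.realization'.inC c) = 0) → ∀ u k,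
      m.Matching (T.weight J u) (T'.weight J' (insertAxis η u k)) k := fun J J' h1 h2 u k => by
    have hs : ∀ x, J (m.side x).next.swap = J' (m.side' x).next.swap := fun x => by
      rw [swap_side_next, swap_side'_next]
      exact (h1 _).2
    have hs' : ∀ x, J (m.side x).next.next.swap = J' (m.side' x).next.next.swap := fun x => by
      rw [← m.faceNext_faceNext_faceNext x, ← swap_side_next, ← swap_side'_next]
      exact (h1 _).1
    refine ⟨fun c => ?_, fun c => ?_, fun x => ?_, fun x => ?_, fun c hc => ?_⟩
    · rw [FacePairing.weight, FacePairing.weight, T.edge_swap, Corner.swap_swap, add_comm (J _)]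
    · rw [FacePairing.weight, FacePairing.weight, T'.edge_swap, Corner.swap_swap, add_comm (J' _)]
    · rw [FacePairing.weight, FacePairing.weight, (h1 x).1, hs, ← hη1, insertAxis_some]
    · rw [FacePairing.weight, FacePairing.weight, (h1 x).2, hs', ← hη2, insertAxis_some]
    · have hc' : Patch.three.new c.swap := Or.symm (by
        obtain ⟨⟨t, v, w⟩, h⟩ := c
        simpa [Patch.three, Corner.swap, and_comm] using hc)
      have := h2 c.swap hc'
      rw [FacePairing.weight, h2 c hc, ← hη3 c hc, insertAxis_none]
      change 0 + J' (m.realization'.inC c.swap) + k = k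
      omega
  -- The third witness is the value on the axis singled out by `Matching.flat_iff`.
  refine ⟨H, η, fun u => m.northValue (T.weight 0 u) 0 + m.equatorValue (T.weight 0 u) 0 +
    (m.southValue (T.weight 0 u) 0 + m.equatorValue (T.weight 0 u) 0) - ∑ i, m.equatorValue (T.weight 0 u) i,
    fun u => ?_, fun u k => ?_⟩
  · rw [T.term_sub hK hH]
    refine ((hasFormalSum_prod (M K K' hKK' hnew u)).mul_left _).congr fun k => ?_
    have h1 := T'.term_sub (ϖ := ϖ') (K := K') (e := e') (h := 0) (H := 0) (fun c => by simp [hK' c])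
      (fun c => by simp) (insertAxis η u k)
    rw [sub_zero] at h1
    -- The powers of `-q^{1/2}` on the two sides match precisely because the rotation numbers agree.
    rw [h1, ← mul_assoc, ← negSqrtQPow_add, sum_insertAxis, hHh, hsum]
    congr 2
    simp
    ring
  · have h0 := (M 0 0 (fun _ => ⟨rfl, rfl⟩) (fun _ _ => rfl) u k).flat_iff
    have h1 : T.weight 0 u = fun c => u (FacePairing.edge c) := funext fun c => by simp [FacePairing.weight]
    have h2 : T'.weight 0 (insertAxis η u k) = fun c => insertAxis η u k (FacePairing.edge c) :=
      funext fun c => by simp [FacePairing.weight]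
    rw [eq_sub_iff_add_eq, h1]
    rw [h1, h2] at h0
    exact h0

end TwoThreeMove

/-! ### Comparison of the two lattice sums. -/

theorem FacePairing.extend_sub {τ : Type*} [Fintype τ] (T : FacePairing τ) (B : Finset T.Edge) (k l : B → ℤ) :
    T.extend B (k - l) = T.extend B k - T.extend B l := by
  funext E
  simp only [FacePairing.extend, Pi.sub_apply]
  split_ifs <;> simp

theorem FacePairing.IsFlat.sub {τ : Type*} [Fintype τ] {T : FacePairing τ} {u v : T.Edge → ℤ} (hu : T.IsFlat u)
    (hv : T.IsFlat v) : T.IsFlat (u - v) := by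
  rw [sub_eq_add_neg]
  exact hu.add (T := T) (hv.neg (T := T))

theorem mainTheorem10 {τ τ' : Type*} [Fintype τ] [Fintype τ']
    (T : IdealTriangulation τ) (T' : IdealTriangulation τ')
    (m : TwoThreeMove T.toFacePairing T'.toFacePairing)
    (hT : T.HasIndexStructure) (hT' : T'.HasIndexStructure)
    (ϖ : T.MultiCurve) (ϖ' : T'.MultiCurve) (hϖ : m.SameClass ϖ ϖ')
    (Q : τ → Fin 3) (B : Finset T.Edge) (hB : T.IsBasic Q B)
    (Q' : τ' → Fin 3) (B' : Finset T'.Edge) (hB' : T'.IsBasic Q' B') :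
    FormallySummable (T.indexTerm Q B ϖ) ∧ FormallySummable (T'.indexTerm Q' B' ϖ') ∧
      T.index Q B ϖ = T'.index Q' B' ϖ' := by
  have hS := FacePairing.formallySummable_indexTerm hT ϖ hB
  have hS' := FacePairing.formallySummable_indexTerm hT' ϖ' hB'
  refine ⟨hS, hS', ?_⟩
  obtain ⟨H, η, c, hsum, hflat⟩ := m.exists_pentagon hϖ
  -- A point of ℤ^B × ℤ gives a vector on the edges of `T'`, and `Φ` picks its representative
  -- supported on `B'`. The translation by `H` compensates the loops around vertices between the two
  -- curves.
  choose Φ hΦ using fun p : (B → ℤ) × ℤ => hB'.exists (TwoThreeMove.insertAxis η (T.extend B p.1 + H) p.2)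
  have hinj : Function.Injective Φ := by
    rintro ⟨k, j⟩ ⟨l, i⟩ h
    have h1 := (hΦ (k, j)).sub (hΦ (l, i))
    rw [h, sub_sub_sub_cancel_right, ← TwoThreeMove.insertAxis_sub, add_sub_add_right_eq_sub, hflat] at h1
    rw [← T.extend_sub] at h1
    have h2 := hB.eq_zero h1.1
    have h3 := h1.2
    rw [h2] at h3
    have h4 : T.extend B 0 = 0 := by
      rw [← sub_self (0 : B → ℤ), T.extend_sub, sub_self]
    -- The zero vector is flat, so `c 0 = 0`; this makes the axis coordinate injective.
    have h5 : T'.IsFlat (TwoThreeMove.insertAxis η (0 : T.Edge → ℤ) 0) := by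
      have := ((hΦ (k, j)).sub (hΦ (k, j)))
      rwa [sub_self, ← sub_self (TwoThreeMove.insertAxis η (0 : T.Edge → ℤ) 0), ← TwoThreeMove.insertAxis_sub, sub_self,
        sub_self] at this
    have h6 := ((hflat _ _).1 h5).2
    rw [h4, ← h6] at h3
    exact Prod.ext (sub_eq_zero.1 h2) (sub_eq_zero.1 h3)
  have hsur : Function.Surjective Φ := fun k' => by
    obtain ⟨v, i, hv⟩ := TwoThreeMove.exists_insertAxis (η := η) (T'.extend B' k')
    obtain ⟨k, hk⟩ := hB.exists (v - H)
    -- Changing the vector on `T` by the flat vector `w` must be accompanied by the change `c w` on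
    -- the axis to be flat on `T'`; hence the preimage `(k, i - c w)`.
    set w := v - H - T.extend B k with hw
    refine ⟨(k, i - c w), sub_eq_zero.1 (hB'.eq_zero ?_)⟩
    have h1 := hΦ (k, i - c w)
    have h2 : T.extend B k + H = v - w := by rw [hw]; abel
    rw [h2, TwoThreeMove.insertAxis_sub, hv] at h1
    have h3 := h1.add (T := T'.toFacePairing) ((hflat w (c w)).2 ⟨hk, rfl⟩)
    have h4 := h3.neg (T := T'.toFacePairing)
    rw [T'.extend_sub]
    convert h4 using 1
    abel
  have h1 := (hS'.hasFormalSum.equiv (Equiv.ofBijective Φ ⟨hinj, hsur⟩)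
    (g := fun p => T'.term ϖ' (TwoThreeMove.insertAxis η (T.extend B p.1 + H) p.2)) fun p => by
      change _ = T'.indexTerm Q' B' ϖ' (Φ p)
      rw [FacePairing.indexTerm_eq,
        ← FacePairing.term_add_of_isFlat hT' ϖ' (T'.extend B' (Φ p)) (hΦ p), add_sub_cancel])
  -- Over each `k`, the sum over the axis coordinate is the pentagon identity and returns the term
  -- of `T`; the translation by `H` cancels.
  have h2 := h1.prod_fiberwise (g := T.indexTerm Q B ϖ) fun k => by
    rw [FacePairing.indexTerm_eq]
    have := hsum (T.extend B k + H)
    rwa [add_sub_cancel_right] at this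
  exact h2.formalSum_eq
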